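/- **Conventions.** All spaces $X,Y$ below are topological spaces having the homotopy type of a CW complex. Line bundles are complex, $L^{\otimes 2}=L\otimes L$, $\Delta_X:X\to X\times X$ is the diagonal, and $\pi_i,\pi_{ij}$ are projections of products of copies of $X$. We write $H^j(X;\mathbb Z_2)=\mathrm{Hom}(H_j(X;\mathbb Z_2),\mathbb Z_2)$. *Square roots.* A square root of a line bundle $K\to X$ is an isomorphism class $[J,\jmath]$ of pairs of a line bundle $J\to X$ and an isomorphism $\jmath:J\otimes J\to K$, where an isomorphism $(J,\jmath)\to(J',\jmath')$ is a bundle isomorphism $\iota:J\to J'$ with $\jmath=\jmath'\circ(\iota\otimes\iota)$. Let $S_K$ be the set of square roots. The group $H^1(X;\mathbb Z_2)$ acts on $S_K$ by tensoring with real line bundles: $\alpha$ sends $[J,\jmath]$ to the class $[J',\jmath']$ for which the principal $\mathbb Z_2$-bundle of local isomorphisms $\iota:J_x\to J'_x$ with $\jmath=\jmath'\circ(\iota\otimes\iota)$ has first Stiefel–Whitney class $\alpha$. Let $\mathrm o_K\in H^2(X;\mathbb Z_2)$ be the mod $2$ reduction of $c_1(K)$. *H-spaces.* An H-space $(X,e_X,\mu_X)$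 is a space with a point $e_X$ and a continuous map $\mu_X:X\times X\to X$ such that $\mu_X(e_X,\cdot)\simeq\mathrm{id}\simeq\mu_X(\cdot,e_X)$ and $\mu_X$ is associative and commutative up to homotopy. An H-map $f:X\to Y$ is a continuous map such that $f(e_X)$ and $e_Y$ are joined by a path and $f\circ\mu_X\simeq\mu_Y\circ(f\times f)$. For a field $k$, $R=H_*(X;k)$ is a ring under the Pontryagin product $rs=(\mu_X)_*(r\times s)$, and $\epsilon:R\to k$ is the projection to $H_0(X;k)=\bigoplus_{\pi_0(X)}k$ followed by summation. The space $X$ is grouplike if the monoid $\pi_0(X)$ is a group. *Hochschild–Pontryagin cohomology.* $HP^{i,j}(X,k)$ is the cohomology in degree $i$ of the cochains $c\in \mathrm{Hom}_k(R^{\otimes i},k)$ that vanish on homogeneous tensors of total degree $\ne j$, with differential $$(\mathrm dc)(r_0,\dots,r_i)=\epsilon(r_0)c(r_1,\dots,r_i)+\sum_{a=1}^{i}(-1)^a c(\dots,r_{a-1}r_a,\dots)+(-1)^{i+1}c(r_0,\dots,r_{i-1})\epsilon(r_i).$$ An H-map $f$ induces $f^*:HP^{i,j}(Y,k)\to HP^{i,j}(X,k)$.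 We have $HP^{1,1}(X,\mathbb Z_2)\subset H^1(X;\mathbb Z_2)$. *Compatibility.* Let $X$ be an H-space, $L\to X\times X$ a line bundle, $K=\Delta_X^*L$, and $\phi:\pi_1^*K\otimes\pi_2^*K\otimes L^{\otimes2}\to\mu_X^*K$ an isomorphism. A square root $[J,\jmath]$ of $K$ is compatible if there is an isomorphism $\xi:\pi_1^*J\otimes\pi_2^*J\otimes L\to\mu_X^*J$ with $\mu_X^*(\jmath)\circ(\xi\otimes\xi)=\phi\circ(\pi_1^*\jmath\otimes\pi_2^*\jmath\otimes\mathrm{id})$. Let $S^\phi_{K,L}\subset S_K$ be the set of compatible square roots; the subgroup $HP^{1,1}(X,\mathbb Z_2)$ of $H^1(X;\mathbb Z_2)$ preserves it. We say that $(L,\phi)$ *admits an associativity structure* if there are isomorphisms $\chi:\pi_{13}^*L\otimes\pi_{23}^*L\to(\mu_X\times\mathrm{id})^*L$ and $\psi:\pi_{12}^*L\otimes\pi_{13}^*L\to(\mathrm{id}\times\mu_X)^*L$, a homotopy $h:\mu_X\circ(\mu_X\times\mathrm{id})\simeq\mu_X\circ(\mathrm{id}\times\mu_X)$, and an isomorphism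 $$\zeta:\pi_1^*K\otimes\pi_2^*K\otimes\pi_3^*K\otimes\pi_{12}^*L^{\otimes2}\otimes\pi_{13}^*L^{\otimes2}\otimes\pi_{23}^*L^{\otimes2}\to h^*K$$ over $X^3\times[0,1]$ that restricts to $(\mu_X\times\mathrm{id})^*\phi\circ(\pi_{12}^*\phi\otimes\mathrm{id}_{\pi_3^*K}\otimes\chi^{\otimes2})$ over $X^3\times\{0\}$ and to $(\mathrm{id}\times\mu_X)^*\phi\circ(\mathrm{id}_{\pi_1^*K}\otimes\pi_{23}^*\phi\otimes\psi^{\otimes2})$ over $X^3\times\{1\}$. If moreover $\mathrm o_K=0$, the obstruction class $\mathrm o^\phi_{K,L}\in HP^{2,1}(X,\mathbb Z_2)$ is the class of the cocycle $a\otimes b\mapsto\langle w_1(Q_J),a\times b\rangle$, where $[J,\jmath]$ is any square root of $K$ and $Q_J\to X\times X$ is the principal $\mathbb Z_2$-bundle whose fibre at $(x,y)$ consists of all isomorphisms $\xi:J_x\otimes J_y\otimes L_{(x,y)}\to J_{\mu_X(x,y)}$ with $\jmath\circ(\xi\otimes\xi)=\phi\circ(\jmath\otimes\jmath\otimes\mathrm{id})$.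 *Group completions.* An H-map $f:X\to Y$ is a homotopy-theoretic group completion if $Y$ is grouplike, $\pi_0(f)$ is the group completion of the abelian monoid $\pi_0(X)$, and $f_*:H_*(X;k)\to H_*(Y;k)$ is the localization at the central multiplicative set $\pi_0(X)\subset H_*(X;k)$ for all fields $k$. **Proposition.** **(a)** Let $K_X\to X$, $K_Y\to Y$ be line bundles, $f:X\to Y$ continuous, and $\kappa:f^*K_Y\to K_X$ an isomorphism. The actions of $H^1(X;\mathbb Z_2)$ on $S_{K_X}$ and of $H^1(Y;\mathbb Z_2)$ on $S_{K_Y}$ are well defined, and the map $$S_{K_Y}\to S_{K_X},\qquad[J,\jmath]\mapsto[f^*J,\kappa\circ f^*\jmath]\tag{1}$$ is equivariant over $f^*:H^1(Y;\mathbb Z_2)\to H^1(X;\mathbb Z_2)$. **(b)** Let $X,Y$ be H-spaces, $L_X\to X\times X$ and $L_Y\to Y\times Y$ line bundles, $K_X=\Delta_X^*L_X$, $K_Y=\Delta_Y^*L_Y$, and $\phi_X:\pi_1^*K_X\otimes\pi_2^*K_X\otimes L_X^{\otimes2}\to\mu_X^*K_X$, $\phi_Y:\pi_1^*K_Y\otimes\pi_2^*K_Y\otimes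 L_Y^{\otimes2}\to\mu_Y^*K_Y$ isomorphisms. Let $f:X\to Y$ be an H-map, $\lambda:(f\times f)^*L_Y\to L_X$ an isomorphism, $\kappa=\Delta_X^*\lambda:f^*K_Y\to K_X$, $h:\mu_Y\circ(f\times f)\simeq f\circ\mu_X$ a homotopy, and $\theta$ an isomorphism over $X\times X\times[0,1]$ from (the pullback of) $\pi_1^*f^*K_Y\otimes\pi_2^*f^*K_Y\otimes(f\times f)^*L_Y^{\otimes2}$ to $h^*K_Y$ that restricts to $(f\times f)^*\phi_Y$ at $0$ and to $\mu_X^*(\kappa^{-1})\circ\phi_X\circ(\pi_1^*\kappa\otimes\pi_2^*\kappa\otimes\lambda^{\otimes2})$ at $1$. Then the map (1) for $(f,\kappa)$ restricts to a map $$S^{\phi_Y}_{K_Y,L_Y}\to S^{\phi_X}_{K_X,L_X},\tag{2}$$ the actions of $HP^{1,1}(X,\mathbb Z_2)$ and $HP^{1,1}(Y,\mathbb Z_2)$ on these sets are well defined, and (2) is equivariant over $f^*:HP^{1,1}(Y,\mathbb Z_2)\to HP^{1,1}(X,\mathbb Z_2)$. **(c)** In the situation of (b), suppose that $(L_X,\phi_X)$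 and $(L_Y,\phi_Y)$ admit associativity structures and that $\mathrm o_{K_Y}=0$. Then $\mathrm o_{K_X}=0$, both obstruction classes $\mathrm o^{\phi_X}_{K_X,L_X}$ and $\mathrm o^{\phi_Y}_{K_Y,L_Y}$ are well defined, and $f^*:HP^{2,1}(Y,\mathbb Z_2)\to HP^{2,1}(X,\mathbb Z_2)$ maps $\mathrm o^{\phi_Y}_{K_Y,L_Y}$ to $\mathrm o^{\phi_X}_{K_X,L_X}$. **(d)** In the situation of (b), suppose that $(L_X,\phi_X)$ and $(L_Y,\phi_Y)$ admit associativity structures and that $f$ is a homotopy-theoretic group completion. Then $S^{\phi_X}_{K_X,L_X}\neq\emptyset$ if and only if $S^{\phi_Y}_{K_Y,L_Y}\neq\emptyset$, and (2) is a bijection. -/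

import Mathlib

open scoped TensorProduct unitInterval Topology
open Bundle CategoryTheory Topology

universe u v w

noncomputable section

namespace HochPont

/-- A complex line bundle over a topological space `B`: a topological complex vector bundle with
model fibre `ℂ`. -/
structure LineBundle (B : Type u) [TopologicalSpace B] where
  Fib : B → Type v
  [addCommGroup : ∀ b, AddCommGroup (Fib b)]
  [module : ∀ b, Module ℂ (Fib b)]
  [topologicalSpace : ∀ b, TopologicalSpace (Fib b)]
  [topTotal : TopologicalSpace (TotalSpace ℂ Fib)]
  [fiberBundle : FiberBundle ℂ Fib]
  [vectorBundle : VectorBundle ℂ ℂ Fib]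

namespace LineBundle

attribute [instance] addCommGroup module topologicalSpace topTotal fiberBundle vectorBundle

section

variable {B : Type u} [TopologicalSpace B] {B' : Type w} [TopologicalSpace B']

/-- The total space of a line bundle. -/
abbrev Tot (E : LineBundle.{u, v} B) : Type (max u v) := TotalSpace ℂ E.Fib

/-- The point of the total space given by a vector in the fibre over `b`. -/
abbrev pt (E : LineBundle.{u, v} B) (b : B) (x : E.Fib b) : E.Tot := ⟨b, x⟩

/-- Pullback `f^* E` of a line bundle along a continuous map `f`. -/
def pullback (E : LineBundle.{u, v} B) (f : C(B', B)) : LineBundle.{w, v} B' where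
  Fib b := E.Fib (f b)
  addCommGroup b := E.addCommGroup (f b)
  module b := E.module (f b)
  topologicalSpace b := E.topologicalSpace (f b)
  topTotal := Pullback.TotalSpace.topologicalSpace ℂ E.Fib f
  fiberBundle := FiberBundle.pullback (F := ℂ) (E := E.Fib) f
  vectorBundle := VectorBundle.pullback (𝕜 := ℂ) (F := ℂ) (E := E.Fib) f

theorem continuous_pullback_proj (E : LineBundle.{u, v} B) (f : C(B', B)) :
    Continuous fun p : (E.pullback f).Tot => p.1 :=
  Pullback.continuous_proj ℂ E.Fib f

theorem continuous_pullback_lift (E : LineBundle.{u, v} B) (f : C(B', B)) :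
    Continuous fun p : (E.pullback f).Tot => E.pt (f p.1) p.2 :=
  Pullback.continuous_lift ℂ E.Fib f

/-- A map to the total space of a pullback is continuous if and only if both its components are. -/
theorem continuous_pullback_iff {E : LineBundle.{u, v} B} {f : C(B', B)} {Z : Type*}
    [TopologicalSpace Z] {g : Z → (E.pullback f).Tot} :
    Continuous g ↔
      (Continuous fun z => (g z).1) ∧ Continuous fun z => E.pt (f (g z).1) (g z).2 := by
  refine (inducing_pullbackTotalSpaceEmbedding ℂ E.Fib f).continuous_iff.trans ?_
  exact ⟨fun h => ⟨continuous_fst.comp h, continuous_snd.comp h⟩, fun h => h.1.prodMk h.2⟩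

/-- An isomorphism of line bundles over `B`. -/
structure Iso (E F : LineBundle.{u, v} B) where
  map : ∀ b, E.Fib b ≃ₗ[ℂ] F.Fib b
  continuous_map : Continuous fun p : E.Tot => F.pt p.1 (map p.1 p.2)
  continuous_symm : Continuous fun p : F.Tot => E.pt p.1 ((map p.1).symm p.2)

namespace Iso

variable {E F G : LineBundle.{u, v} B}

def refl (E : LineBundle.{u, v} B) : E.Iso E := ⟨fun _ => .refl _ _, continuous_id, continuous_id⟩

def symm (φ : E.Iso F) : F.Iso E := ⟨fun b => (φ.map b).symm, φ.continuous_symm, φ.continuous_map⟩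

def trans (φ : E.Iso F) (ψ : F.Iso G) : E.Iso G :=
  ⟨fun b => (φ.map b).trans (ψ.map b), ψ.continuous_map.comp φ.continuous_map,
    φ.continuous_symm.comp ψ.continuous_symm⟩

theorem continuous_pullback_aux (φ : E.Iso F) (f : C(B', B)) :
    Continuous fun p : (E.pullback f).Tot => (F.pullback f).pt p.1 (φ.map (f p.1) p.2) :=
  continuous_pullback_iff.2 ⟨continuous_pullback_proj E f,
    φ.continuous_map.comp (continuous_pullback_lift E f)⟩

/-- The pullback of an isomorphism. -/
def pullback (φ : E.Iso F) (f : C(B', B)) : (E.pullback f).Iso (F.pullback f) :=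
  ⟨fun b => φ.map (f b), φ.continuous_pullback_aux f, φ.symm.continuous_pullback_aux f⟩

end Iso

/-! ### Tensor products of line bundles -/

section Tensor

variable (E F : LineBundle.{u, v} B)

/-- The local trivialization of `E ⊗ F` induced by local trivializations of `E` and `F`, on a
fibre: `x ⊗ y ↦ e₁(x) e₂(y)`. -/
def tensorLin (e₁ : Trivialization ℂ (π ℂ E.Fib)) (e₂ : Trivialization ℂ (π ℂ F.Fib))
    [e₁.IsLinear ℂ] [e₂.IsLinear ℂ] (b : B) : E.Fib b ⊗[ℂ] F.Fib b →ₗ[ℂ] ℂ :=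
  (TensorProduct.lid ℂ ℂ).toLinearMap ∘ₗ
    TensorProduct.map (e₁.linearMapAt ℂ b) (e₂.linearMapAt ℂ b)

/-- The inverse of the local trivialization of `E ⊗ F`. -/
def tensorInv (e₁ : Trivialization ℂ (π ℂ E.Fib)) (e₂ : Trivialization ℂ (π ℂ F.Fib))
    [e₁.IsLinear ℂ] [e₂.IsLinear ℂ] (b : B) : ℂ →ₗ[ℂ] E.Fib b ⊗[ℂ] F.Fib b :=
  TensorProduct.map (e₁.symmₗ ℂ b) (e₂.symmₗ ℂ b) ∘ₗ (TensorProduct.lid ℂ ℂ).symm.toLinearMap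

variable {E F}

theorem tensorInv_tensorLin (e₁ : Trivialization ℂ (π ℂ E.Fib))
    (e₂ : Trivialization ℂ (π ℂ F.Fib)) [e₁.IsLinear ℂ] [e₂.IsLinear ℂ] {b : B}
    (h₁ : b ∈ e₁.baseSet) (h₂ : b ∈ e₂.baseSet) (t : E.Fib b ⊗[ℂ] F.Fib b) :
    tensorInv E F e₁ e₂ b (tensorLin E F e₁ e₂ b t) = t := by
  simp only [tensorInv, tensorLin, LinearMap.comp_apply, LinearEquiv.coe_coe,
    LinearEquiv.symm_apply_apply]
  rw [← LinearMap.comp_apply, ← TensorProduct.map_comp]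
  have a₁ : e₁.symmₗ ℂ b ∘ₗ e₁.linearMapAt ℂ b = LinearMap.id := by
    ext y; simp [e₁.symmₗ_linearMapAt h₁]
  have a₂ : e₂.symmₗ ℂ b ∘ₗ e₂.linearMapAt ℂ b = LinearMap.id := by
    ext y; simp [e₂.symmₗ_linearMapAt h₂]
  rw [a₁, a₂]; simp

theorem tensorLin_tensorInv (e₁ : Trivialization ℂ (π ℂ E.Fib))
    (e₂ : Trivialization ℂ (π ℂ F.Fib)) [e₁.IsLinear ℂ] [e₂.IsLinear ℂ] {b : B}
    (h₁ : b ∈ e₁.baseSet) (h₂ : b ∈ e₂.baseSet) (z : ℂ) :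
    tensorLin E F e₁ e₂ b (tensorInv E F e₁ e₂ b z) = z := by
  simp only [tensorInv, tensorLin, LinearMap.comp_apply, LinearEquiv.coe_coe]
  rw [← LinearMap.comp_apply (TensorProduct.map _ _), ← TensorProduct.map_comp]
  have a₁ : e₁.linearMapAt ℂ b ∘ₗ e₁.symmₗ ℂ b = LinearMap.id := by
    ext; simp [e₁.linearMapAt_symmₗ h₁]
  have a₂ : e₂.linearMapAt ℂ b ∘ₗ e₂.symmₗ ℂ b = LinearMap.id := by
    ext; simp [e₂.linearMapAt_symmₗ h₂]
  rw [a₁, a₂]; simp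

/-- The local trivializations of `E ⊗ F`. -/
def tensorPre (e₁ : Trivialization ℂ (π ℂ E.Fib)) (e₂ : Trivialization ℂ (π ℂ F.Fib))
    [e₁.IsLinear ℂ] [e₂.IsLinear ℂ] :
    Pretrivialization ℂ (π ℂ fun b => E.Fib b ⊗[ℂ] F.Fib b) where
  toFun p := (p.1, tensorLin E F e₁ e₂ p.1 p.2)
  invFun p := ⟨p.1, tensorInv E F e₁ e₂ p.1 p.2⟩
  source := TotalSpace.proj ⁻¹' (e₁.baseSet ∩ e₂.baseSet)
  target := (e₁.baseSet ∩ e₂.baseSet) ×ˢ Set.univ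
  map_source' := fun ⟨_, _⟩ h ↦ ⟨h, Set.mem_univ _⟩
  map_target' := fun ⟨_, _⟩ h ↦ h.1
  left_inv' := fun ⟨x, t⟩ ⟨h₁, h₂⟩ ↦ by
    simp only [TotalSpace.mk_inj]
    exact tensorInv_tensorLin e₁ e₂ h₁ h₂ t
  right_inv' := fun ⟨x, z⟩ ⟨⟨h₁, h₂⟩, _⟩ ↦ by
    simp only [Prod.mk_right_inj]
    exact tensorLin_tensorInv e₁ e₂ h₁ h₂ z
  open_target := (e₁.open_baseSet.inter e₂.open_baseSet).prod isOpen_univ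
  baseSet := e₁.baseSet ∩ e₂.baseSet
  open_baseSet := e₁.open_baseSet.inter e₂.open_baseSet
  source_eq := rfl
  target_eq := rfl
  proj_toFun _ _ := rfl

theorem tensorPre_symm (e₁ : Trivialization ℂ (π ℂ E.Fib)) (e₂ : Trivialization ℂ (π ℂ F.Fib))
    [e₁.IsLinear ℂ] [e₂.IsLinear ℂ] {b : B} (h : b ∈ e₁.baseSet ∩ e₂.baseSet) (z : ℂ) :
    (tensorPre e₁ e₂).symm b z = tensorInv E F e₁ e₂ b z := by
  rw [Pretrivialization.symm_apply _ h]; rfl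

variable (E F) in
/-- The topology of the fibres of `E ⊗ F`. -/
@[reducible] def tensorFibTop (b : B) : TopologicalSpace (E.Fib b ⊗[ℂ] F.Fib b) :=
  TopologicalSpace.induced
    (tensorLin E F (trivializationAt ℂ E.Fib b) (trivializationAt ℂ F.Fib b) b) inferInstance

variable (E F) in
/-- The local trivializations of `E ⊗ F` form a vector prebundle. -/
@[reducible] def tensorPrebundle : letI := tensorFibTop E F
    VectorPrebundle ℂ ℂ fun b => E.Fib b ⊗[ℂ] F.Fib b :=
  letI := tensorFibTop E F
  { pretrivializationAtlas :=
      {e | ∃ (e₁ : Trivialization ℂ (π ℂ E.Fib)) (e₂ : Trivialization ℂ (π ℂ F.Fib))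
        (_ : MemTrivializationAtlas e₁) (_ : MemTrivializationAtlas e₂), e = tensorPre e₁ e₂}
    pretrivialization_linear' := by
      rintro _ ⟨e₁, e₂, _, _, rfl⟩
      exact ⟨fun b _ => (tensorLin E F e₁ e₂ b).isLinear⟩
    pretrivializationAt := fun b =>
      tensorPre (trivializationAt ℂ E.Fib b) (trivializationAt ℂ F.Fib b)
    mem_base_pretrivializationAt := fun b =>
      ⟨mem_baseSet_trivializationAt ℂ E.Fib b, mem_baseSet_trivializationAt ℂ F.Fib b⟩
    pretrivialization_mem_atlas := fun b => ⟨_, _, inferInstance, inferInstance, rfl⟩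
    exists_coordChange := by
      rintro _ ⟨e₁, e₂, he₁, he₂, rfl⟩ _ ⟨e₁', e₂', he₁', he₂', rfl⟩
      refine ⟨fun b => ((e₁.coordChangeL ℂ e₁' b 1) * (e₂.coordChangeL ℂ e₂' b 1)) •
        ContinuousLinearMap.id ℂ ℂ, ?_, ?_⟩
      · have h₁ := continuousOn_coordChange ℂ e₁ e₁'
        have h₂ := continuousOn_coordChange ℂ e₂ e₂'
        refine ContinuousOn.smul (M := ℂ) (ContinuousOn.mul ?_ ?_) continuousOn_const
        · exact (h₁.clm_apply continuousOn_const).mono fun b hb => ⟨hb.1.1, hb.2.1⟩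
        · exact (h₂.clm_apply continuousOn_const).mono fun b hb => ⟨hb.1.2, hb.2.2⟩
      · rintro b ⟨hb, hb'⟩ z
        rw [tensorPre_symm e₁ e₂ hb]
        change _ = tensorLin E F e₁' e₂' b (tensorInv E F e₁ e₂ b z)
        simp only [_root_.smul_apply, ContinuousLinearMap.id_apply]
        rw [e₁.coordChangeL_apply e₁' ⟨hb.1, hb'.1⟩, e₂.coordChangeL_apply e₂' ⟨hb.2, hb'.2⟩]
        have : tensorInv E F e₁ e₂ b z = z • tensorInv E F e₁ e₂ b 1 := by
          rw [← map_smul]; simp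
        rw [this, map_smul]
        simp [tensorInv, tensorLin, e₁'.linearMapAt_def_of_mem hb'.1,
          e₂'.linearMapAt_def_of_mem hb'.2, mul_comm]
        left
        rw [e₁.symmₗ_apply hb.1, e₂.symmₗ_apply hb.2]
    totalSpaceMk_isInducing := fun b => by
      have : IsInducing fun t : E.Fib b ⊗[ℂ] F.Fib b => (b, tensorLin E F
        (trivializationAt ℂ E.Fib b) (trivializationAt ℂ F.Fib b) b t) :=
        isInducing_const_prod.mpr ⟨rfl⟩
      exact this }

/-- The tensor product `E ⊗ F` of line bundles. -/
def tensor (E F : LineBundle.{u, v} B) : LineBundle.{u, v} B where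
  Fib b := E.Fib b ⊗[ℂ] F.Fib b
  topologicalSpace := tensorFibTop E F
  topTotal := letI := tensorFibTop E F; (tensorPrebundle E F).totalSpaceTopology
  fiberBundle := letI := tensorFibTop E F; (tensorPrebundle E F).toFiberBundle
  vectorBundle := letI := tensorFibTop E F; (tensorPrebundle E F).toVectorBundle

theorem trivializationAt_tensor_apply (E F : LineBundle.{u, v} B) (b : B) (p : (E.tensor F).Tot) :
    trivializationAt ℂ (E.tensor F).Fib b p = (p.1, tensorLin E F (trivializationAt ℂ E.Fib b)
      (trivializationAt ℂ F.Fib b) p.1 p.2) := rfl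

theorem tensorLin_tmul (e₁ : Trivialization ℂ (π ℂ E.Fib)) (e₂ : Trivialization ℂ (π ℂ F.Fib))
    [e₁.IsLinear ℂ] [e₂.IsLinear ℂ] {b : B} (h₁ : b ∈ e₁.baseSet) (h₂ : b ∈ e₂.baseSet)
    (x : E.Fib b) (y : F.Fib b) :
    tensorLin E F e₁ e₂ b (x ⊗ₜ y) = (e₁ (E.pt b x)).2 * (e₂ (F.pt b y)).2 := by
  simp [tensorLin, e₁.linearMapAt_def_of_mem h₁, e₂.linearMapAt_def_of_mem h₂]

/-- Continuity of maps to the total space of `E ⊗ F`, in local trivializations. -/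
theorem continuousAt_tensor_iff {Z : Type*} [TopologicalSpace Z] {g : Z → (E.tensor F).Tot}
    {z : Z} : ContinuousAt g z ↔ ContinuousAt (fun z => (g z).1) z ∧
      ContinuousAt (fun z' => tensorLin E F (trivializationAt ℂ E.Fib (g z).1)
        (trivializationAt ℂ F.Fib (g z).1) (g z').1 (g z').2) z :=
  FiberBundle.continuousAt_totalSpace (F := ℂ) (E := (E.tensor F).Fib) g

theorem tensorLin_pullback (E F : LineBundle.{u, v} B) (f : C(B', B)) (b b' : B')
    (h : b' ∈ f ⁻¹' ((trivializationAt ℂ E.Fib (f b)).baseSet ∩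
      (trivializationAt ℂ F.Fib (f b)).baseSet))
    (t : E.Fib (f b') ⊗[ℂ] F.Fib (f b')) :
    tensorLin (E.pullback f) (F.pullback f) (trivializationAt ℂ (E.pullback f).Fib b)
      (trivializationAt ℂ (F.pullback f).Fib b) b' t =
    tensorLin E F (trivializationAt ℂ E.Fib (f b)) (trivializationAt ℂ F.Fib (f b)) (f b') t := by
  induction t using TensorProduct.induction_on with
  | zero => exact (map_zero _).trans (map_zero _).symm
  | add x y hx hy => exact (map_add _ _ _).trans ((congrArg₂ _ hx hy).trans (map_add _ _ _).symm)
  | tmul x y =>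
    exact (tensorLin_tmul (E := E.pullback f) (F := F.pullback f) _ _ h.1 h.2 x y).trans
      (tensorLin_tmul _ _ h.1 h.2 x y).symm

theorem eventually_mem_base (E F : LineBundle.{u, v} B) (b : B) :
    ∀ᶠ b' in 𝓝 b, b' ∈ (trivializationAt ℂ E.Fib b).baseSet ∩
      (trivializationAt ℂ F.Fib b).baseSet :=
  ((trivializationAt ℂ E.Fib b).open_baseSet.inter
    (trivializationAt ℂ F.Fib b).open_baseSet).mem_nhds
      ⟨mem_baseSet_trivializationAt ℂ E.Fib b, mem_baseSet_trivializationAt ℂ F.Fib b⟩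

theorem continuous_proj (E : LineBundle.{u, v} B) : Continuous fun p : E.Tot => p.1 :=
  FiberBundle.continuous_proj ℂ E.Fib

/-- The identification `f^* E ⊗ f^* F = f^* (E ⊗ F)`. -/
def tensorPullback (E F : LineBundle.{u, v} B) (f : C(B', B)) :
    ((E.pullback f).tensor (F.pullback f)).Iso ((E.tensor F).pullback f) where
  map b := .refl ℂ (E.Fib (f b) ⊗[ℂ] F.Fib (f b))
  continuous_map := by
    refine continuous_pullback_iff.2 ⟨continuous_proj _, ?_⟩
    refine continuous_iff_continuousAt.2 fun p => continuousAt_tensor_iff.2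
      ⟨(f.continuous.comp (continuous_proj _)).continuousAt, ?_⟩
    have h := (continuousAt_tensor_iff.1 (continuousAt_id (x := p))).2
    refine h.congr ?_
    filter_upwards [(f.continuous.comp (continuous_proj ((E.pullback f).tensor
      (F.pullback f)))).continuousAt (eventually_mem_base E F (f p.1))] with q hq
    exact tensorLin_pullback E F f p.1 q.1 hq q.2
  continuous_symm := by
    refine continuous_iff_continuousAt.2 fun p => continuousAt_tensor_iff.2
      ⟨(continuous_proj _).continuousAt, ?_⟩
    have h := (continuousAt_tensor_iff.1
      ((continuous_pullback_lift (E.tensor F) f).continuousAt (x := p))).2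
    refine h.congr ?_
    filter_upwards [(f.continuous.comp (continuous_proj ((E.tensor F).pullback f))).continuousAt
      (eventually_mem_base E F (f p.1))] with q hq
    exact (tensorLin_pullback E F f p.1 q.1 hq q.2).symm

end Tensor

/-- The identification `f^* g^* E = (g ∘ f)^* E`. -/
def pullbackComp {B'' : Type*} [TopologicalSpace B''] (E : LineBundle.{u, v} B) (g : C(B', B))
    (f : C(B'', B')) : ((E.pullback g).pullback f).Iso (E.pullback (g.comp f)) where
  map b := .refl ℂ (E.Fib (g (f b)))
  continuous_map := continuous_pullback_iff.2 ⟨continuous_pullback_proj _ _,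
    (continuous_pullback_lift E g).comp (continuous_pullback_lift (E.pullback g) f)⟩
  continuous_symm := continuous_pullback_iff.2 ⟨continuous_pullback_proj _ _,
    continuous_pullback_iff.2 ⟨f.continuous.comp (continuous_pullback_proj _ _),
      continuous_pullback_lift E (g.comp f)⟩⟩

end

end LineBundle

/-! ### H-spaces -/

/-- An H-space: a space with a base point and a multiplication that is unital (up to free
homotopy), associative and commutative up to homotopy.  (Mathlib's `HSpace` instead has a strict
product `e * e = e`, based unit homotopies, and neither associativity nor commutativity.) -/
structure HSpaceStr (X : Type u) [TopologicalSpace X] where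
  e : X
  mul : C(X × X, X)
  e_mul : (mul.comp ((ContinuousMap.const X e).prodMk (.id X))).Homotopic (.id X)
  mul_e : (mul.comp ((ContinuousMap.id X).prodMk (.const X e))).Homotopic (.id X)
  assoc : (mul.comp (mul.prodMap (.id X))).Homotopic
    ((mul.comp ((ContinuousMap.id X).prodMap mul)).comp
      (ContinuousMap.mk fun p : (X × X) × X => (p.1.1, (p.1.2, p.2))))
  comm : mul.Homotopic (mul.comp (ContinuousMap.mk fun p : X × X => (p.2, p.1)))

section

variable {X : Type u} [TopologicalSpace X] {Y : Type u} [TopologicalSpace Y]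

/-- `f` is an H-map: `f(e) ≃ e` and `f ∘ μ ≃ μ ∘ (f × f)`. -/
structure IsHMap (mX : HSpaceStr X) (mY : HSpaceStr Y) (f : C(X, Y)) : Prop where
  map_e : Joined (f mX.e) mY.e
  map_mul : (f.comp mX.mul).Homotopic (mY.mul.comp (f.prodMap f))

end

/-! ### Square roots -/

section

variable {B : Type u} [TopologicalSpace B]

/-- A pair `(J, j)` of a line bundle `J` and an isomorphism `j : J ⊗ J → K`. -/
structure SquareRoot (K : LineBundle.{u, v} B) where
  J : LineBundle.{u, v} B
  j : (J.tensor J).Iso K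

/-- Isomorphism of pairs `(J, j)`. -/
def SquareRoot.setoid (K : LineBundle.{u, v} B) : Setoid (SquareRoot K) where
  r s t := ∃ ι : s.J.Iso t.J, ∀ b (x y : s.J.Fib b),
    s.j.map b (x ⊗ₜ[ℂ] y) = t.j.map b (ι.map b x ⊗ₜ[ℂ] ι.map b y)
  iseqv := by
    refine ⟨fun r => ⟨.refl _, fun _ _ _ => rfl⟩, ?_, ?_⟩
    · rintro r s ⟨ι, h⟩
      refine ⟨ι.symm, fun b x y => ?_⟩
      have := h b ((ι.map b).symm x) ((ι.map b).symm y)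
      rw [LinearEquiv.apply_symm_apply, LinearEquiv.apply_symm_apply] at this
      exact this.symm
    · rintro r s t ⟨ι, h⟩ ⟨ι', h'⟩
      exact ⟨ι.trans ι', fun b x y => (h b x y).trans (h' b _ _)⟩

/-- The set `S_K` of square roots of `K`, that is, of isomorphism classes `[J, j]`. -/
def SqRoots (K : LineBundle.{u, v} B) : Type _ := Quotient (SquareRoot.setoid K)

/-- The class `[J, j]`. -/
def SquareRoot.cls {K : LineBundle.{u, v} B} (r : SquareRoot K) : SqRoots K :=
  Quotient.mk (SquareRoot.setoid K) r

end

section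

variable {X : Type u} [TopologicalSpace X] {Y : Type u} [TopologicalSpace Y]

/-- The pullback `(f^* J, κ ∘ f^* j)` of a square root. -/
def SquareRoot.pull {KX : LineBundle.{u, v} X} {KY : LineBundle.{u, v} Y} (f : C(X, Y))
    (κ : (KY.pullback f).Iso KX) (r : SquareRoot KY) : SquareRoot KX where
  J := r.J.pullback f
  j := (LineBundle.tensorPullback r.J r.J f).trans ((r.j.pullback f).trans κ)

/-- The map `S_{K_Y} → S_{K_X}, [J, j] ↦ [f^* J, κ ∘ f^* j]`. -/
def SqRoots.pull {KX : LineBundle.{u, v} X} {KY : LineBundle.{u, v} Y} (f : C(X, Y))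
    (κ : (KY.pullback f).Iso KX) : SqRoots KY → SqRoots KX :=
  Quotient.map (SquareRoot.pull f κ) fun _ _ ⟨ι, h⟩ =>
    ⟨ι.pullback f, fun b x y => congrArg (κ.map b) (h (f b) x y)⟩

/-- The diagonal map. -/
def diag (X : Type u) [TopologicalSpace X] : C(X, X × X) := (ContinuousMap.id X).prodMk (.id X)

/-- The line bundle `K = Δ^* L`. -/
def diagBundle (L : LineBundle.{u, v} (X × X)) : LineBundle.{u, v} X := L.pullback (diag X)

/-- The isomorphism `κ = Δ^* λ : f^* K_Y → K_X` induced by `λ : (f × f)^* L_Y → L_X`. -/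
def diagIso {LX : LineBundle.{u, v} (X × X)} {LY : LineBundle.{u, v} (Y × Y)} (f : C(X, Y))
    (lam : (LY.pullback (f.prodMap f)).Iso LX) :
    ((diagBundle LY).pullback f).Iso (diagBundle LX) :=
  (LY.pullbackComp (diag Y) f).trans
    ((LY.pullbackComp (f.prodMap f) (diag X)).symm.trans (lam.pullback (diag X)))

theorem diagIso_map {LX : LineBundle.{u, v} (X × X)} {LY : LineBundle.{u, v} (Y × Y)} (f : C(X, Y))
    (lam : (LY.pullback (f.prodMap f)).Iso LX) (x : X) (l : LY.Fib (f x, f x)) :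
    (diagIso f lam).map x l = lam.map (x, x) l := rfl

/-- An isomorphism `φ : π₁^* K ⊗ π₂^* K ⊗ L² → μ^* K`, where `K = Δ^* L`. -/
abbrev PhiIso (m : HSpaceStr X) (L : LineBundle.{u, v} (X × X)) : Type _ :=
  ((((diagBundle L).pullback .fst).tensor ((diagBundle L).pullback .snd)).tensor
    (L.tensor L)).Iso ((diagBundle L).pullback m.mul)

/-- The condition `μ^*(j) ∘ (ξ ⊗ ξ) = φ ∘ (π₁^*(j) ⊗ π₂^*(j) ⊗ id)` in the fibre over `p`, for a
linear isomorphism `ξ` from the fibre of `π₁^* J ⊗ π₂^* J ⊗ L` to that of `μ^* J`. -/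
def SquaresTo {m : HSpaceStr X} {L : LineBundle.{u, v} (X × X)} (φ : PhiIso m L)
    (r : SquareRoot (diagBundle L)) (p : X × X)
    (ξ : (((r.J.pullback .fst).tensor (r.J.pullback .snd)).tensor L).Fib p ≃ₗ[ℂ]
      (r.J.pullback m.mul).Fib p) : Prop :=
  ∀ (x x' : r.J.Fib p.1) (y y' : r.J.Fib p.2) (l l' : L.Fib p),
    r.j.map (m.mul p) (ξ ((x ⊗ₜ[ℂ] y) ⊗ₜ[ℂ] l) ⊗ₜ[ℂ] ξ ((x' ⊗ₜ[ℂ] y') ⊗ₜ[ℂ] l')) =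
      φ.map p ((r.j.map p.1 (x ⊗ₜ[ℂ] x') ⊗ₜ[ℂ] r.j.map p.2 (y ⊗ₜ[ℂ] y')) ⊗ₜ[ℂ] (l ⊗ₜ[ℂ] l'))

/-- The set of compatible square roots. -/
def CompatRoots {m : HSpaceStr X} {L : LineBundle.{u, v} (X × X)} (φ : PhiIso m L) :
    Set (SqRoots (diagBundle L)) :=
  {s | ∃ r : SquareRoot (diagBundle L), r.cls = s ∧
    ∃ ξ : (((r.J.pullback .fst).tensor (r.J.pullback .snd)).tensor L).Iso (r.J.pullback m.mul),
      ∀ p, SquaresTo φ r p (ξ.map p)}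

/-! ### Associativity structure -/

/-- The projection of `X × X × X` to its factors `(1,2)`. -/
def p12 (X : Type u) [TopologicalSpace X] : C((X × X) × X, X × X) := ⟨fun p => p.1, by fun_prop⟩

/-- The projection of `X × X × X` to its factors `(1,3)`. -/
def p13 (X : Type u) [TopologicalSpace X] : C((X × X) × X, X × X) :=
  ⟨fun p => (p.1.1, p.2), by fun_prop⟩

/-- The projection of `X × X × X` to its factors `(2,3)`. -/
def p23 (X : Type u) [TopologicalSpace X] : C((X × X) × X, X × X) :=
  ⟨fun p => (p.1.2, p.2), by fun_prop⟩

/-- The map `μ × id`. -/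
def HSpaceStr.mulId (m : HSpaceStr X) : C((X × X) × X, X × X) :=
  ⟨fun p => (m.mul p.1, p.2), by fun_prop⟩

/-- The map `id × μ`. -/
def HSpaceStr.idMul (m : HSpaceStr X) : C((X × X) × X, X × X) :=
  ⟨fun p => (p.1.1, m.mul (p.1.2, p.2)), by fun_prop⟩

/-- The line bundle `π₁^* K ⊗ π₂^* K ⊗ π₃^* K ⊗ π₁₂^* L² ⊗ π₁₃^* L² ⊗ π₂₃^* L²` over
`X × X × X`, where `K = Δ^* L`. -/
def assocBundle (L : LineBundle.{u, v} (X × X)) : LineBundle.{u, v} ((X × X) × X) :=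
  ((((((diagBundle L).pullback ⟨fun p => p.1.1, by fun_prop⟩).tensor
    ((diagBundle L).pullback ⟨fun p => p.1.2, by fun_prop⟩)).tensor
    ((diagBundle L).pullback .snd)).tensor
    ((L.pullback (p12 X)).tensor (L.pullback (p12 X)))).tensor
    ((L.pullback (p13 X)).tensor (L.pullback (p13 X)))).tensor
    ((L.pullback (p23 X)).tensor (L.pullback (p23 X)))

/-- Isomorphisms `χ`, `ψ`, an associativity homotopy `h` for `μ`, and an isomorphism `ζ` of line
bundles over `[0,1] × X × X × X` to `h^* K` interpolating between the two ways of forming the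
triple product with `φ`, `χ` and `φ`, `ψ`. -/
structure AssocData {m : HSpaceStr X} {L : LineBundle.{u, v} (X × X)} (φ : PhiIso m L) where
  χ : ((L.pullback (p13 X)).tensor (L.pullback (p23 X))).Iso (L.pullback m.mulId)
  ψ : ((L.pullback (p12 X)).tensor (L.pullback (p13 X))).Iso (L.pullback m.idMul)
  h : (m.mul.comp m.mulId).Homotopy (m.mul.comp m.idMul)
  ζ : ((assocBundle L).pullback .snd).Iso ((diagBundle L).pullback h.toContinuousMap)
  ζ_zero : ∀ (p : (X × X) × X) (a : (diagBundle L).Fib p.1.1) (b : (diagBundle L).Fib p.1.2)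
    (c : (diagBundle L).Fib p.2) (l₁₂ l₁₂' : L.Fib (p12 X p)) (l₁₃ l₁₃' : L.Fib (p13 X p))
    (l₂₃ l₂₃' : L.Fib (p23 X p)),
    (diagBundle L).pt (h (0, p)) (ζ.map (0, p) (((((a ⊗ₜ[ℂ] b) ⊗ₜ[ℂ] c) ⊗ₜ[ℂ]
      (l₁₂ ⊗ₜ[ℂ] l₁₂')) ⊗ₜ[ℂ] (l₁₃ ⊗ₜ[ℂ] l₁₃')) ⊗ₜ[ℂ] (l₂₃ ⊗ₜ[ℂ] l₂₃'))) =
    (diagBundle L).pt (m.mul (m.mulId p)) (φ.map (m.mulId p)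
      ((φ.map (p12 X p) ((a ⊗ₜ[ℂ] b) ⊗ₜ[ℂ] (l₁₂ ⊗ₜ[ℂ] l₁₂')) ⊗ₜ[ℂ] c) ⊗ₜ[ℂ]
        (χ.map p (l₁₃ ⊗ₜ[ℂ] l₂₃) ⊗ₜ[ℂ] χ.map p (l₁₃' ⊗ₜ[ℂ] l₂₃'))))
  ζ_one : ∀ (p : (X × X) × X) (a : (diagBundle L).Fib p.1.1) (b : (diagBundle L).Fib p.1.2)
    (c : (diagBundle L).Fib p.2) (l₁₂ l₁₂' : L.Fib (p12 X p)) (l₁₃ l₁₃' : L.Fib (p13 X p))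
    (l₂₃ l₂₃' : L.Fib (p23 X p)),
    (diagBundle L).pt (h (1, p)) (ζ.map (1, p) (((((a ⊗ₜ[ℂ] b) ⊗ₜ[ℂ] c) ⊗ₜ[ℂ]
      (l₁₂ ⊗ₜ[ℂ] l₁₂')) ⊗ₜ[ℂ] (l₁₃ ⊗ₜ[ℂ] l₁₃')) ⊗ₜ[ℂ] (l₂₃ ⊗ₜ[ℂ] l₂₃'))) =
    (diagBundle L).pt (m.mul (m.idMul p)) (φ.map (m.idMul p)
      ((a ⊗ₜ[ℂ] φ.map (p23 X p) ((b ⊗ₜ[ℂ] c) ⊗ₜ[ℂ] (l₂₃ ⊗ₜ[ℂ] l₂₃'))) ⊗ₜ[ℂ]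
        (ψ.map p (l₁₂ ⊗ₜ[ℂ] l₁₃) ⊗ₜ[ℂ] ψ.map p (l₁₂' ⊗ₜ[ℂ] l₁₃'))))

/-! ### Maps compatible with the line bundle data -/

/-- The line bundle `π₁^* f^* K ⊗ π₂^* f^* K ⊗ (f × f)^* L²` over `X × X`, where `K = Δ^* L`. -/
def pulledBundle (f : C(X, Y)) (L : LineBundle.{u, v} (Y × Y)) : LineBundle.{u, v} (X × X) :=
  ((((diagBundle L).pullback f).pullback .fst).tensor
    (((diagBundle L).pullback f).pullback .snd)).tensor ((L.tensor L).pullback (f.prodMap f))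

/-- An isomorphism `λ : (f × f)^* L_Y → L_X`, a homotopy `h : μ_Y ∘ (f × f) ≃ f ∘ μ_X`, and an
isomorphism `θ` over `[0,1] × X × X` to `h^* K_Y` interpolating between `(f × f)^* φ_Y` and
`μ_X^*(κ⁻¹) ∘ φ_X ∘ (π₁^* κ ⊗ π₂^* κ ⊗ λ²)`, where `κ = Δ^* λ`. -/
structure MapData {mX : HSpaceStr X} {mY : HSpaceStr Y} {LX : LineBundle.{u, v} (X × X)}
    {LY : LineBundle.{u, v} (Y × Y)} (φX : PhiIso mX LX) (φY : PhiIso mY LY) (f : C(X, Y)) where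
  lam : (LY.pullback (f.prodMap f)).Iso LX
  h : (mY.mul.comp (f.prodMap f)).Homotopy (f.comp mX.mul)
  θ : ((pulledBundle f LY).pullback .snd).Iso ((diagBundle LY).pullback h.toContinuousMap)
  θ_zero : ∀ (p : X × X) (a : (diagBundle LY).Fib (f p.1)) (b : (diagBundle LY).Fib (f p.2))
    (l l' : LY.Fib (f p.1, f p.2)),
    (diagBundle LY).pt (h (0, p)) (θ.map (0, p) ((a ⊗ₜ[ℂ] b) ⊗ₜ[ℂ] (l ⊗ₜ[ℂ] l'))) =
    (diagBundle LY).pt (mY.mul (f p.1, f p.2))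
      (φY.map (f p.1, f p.2) ((a ⊗ₜ[ℂ] b) ⊗ₜ[ℂ] (l ⊗ₜ[ℂ] l')))
  θ_one : ∀ (p : X × X) (a : (diagBundle LY).Fib (f p.1)) (b : (diagBundle LY).Fib (f p.2))
    (l l' : LY.Fib (f p.1, f p.2)),
    (diagBundle LY).pt (h (1, p)) (θ.map (1, p) ((a ⊗ₜ[ℂ] b) ⊗ₜ[ℂ] (l ⊗ₜ[ℂ] l'))) =
    (diagBundle LY).pt (f (mX.mul p)) (((diagIso f lam).map (mX.mul p)).symm
      (φX.map p (((diagIso f lam).map p.1 a ⊗ₜ[ℂ] (diagIso f lam).map p.2 b) ⊗ₜ[ℂ]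
        (lam.map p l ⊗ₜ[ℂ] lam.map p l'))))

end

/-! ### Singular homology -/

section Homology

open AlgebraicTopology Simplicial Opposite

variable (k : Type) [Field k] (X : Type u) [TopologicalSpace X] {Y : Type u} [TopologicalSpace Y]

/-- The coefficients `k`, in the universe of `X`. -/
abbrev coeff : ModuleCat.{u} k := ModuleCat.of k (ULift.{u} k)

/-- The singular chain complex of `X` with coefficients in `k`. -/
abbrev chains : ChainComplex (ModuleCat.{u} k) ℕ :=
  ((singularChainComplexFunctor (ModuleCat.{u} k)).obj (coeff.{u} k)).obj (TopCat.of X)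

/-- The singular homology `H_n(X, k)`. -/
abbrev H (n : ℕ) : ModuleCat.{u} k :=
  ((singularHomologyFunctor (ModuleCat.{u} k) n).obj (coeff.{u} k)).obj (TopCat.of X)

variable {X}

/-- The map `f_* : H_n(X, k) → H_n(Y, k)`. -/
def hmap (n : ℕ) (f : C(X, Y)) : H k X n →ₗ[k] H k Y n :=
  (((singularHomologyFunctor (ModuleCat.{u} k) n).obj (coeff.{u} k)).map (TopCat.ofHom f)).hom

/-- The map on singular chains induced by `f`. -/
def cmap (n : ℕ) (f : C(X, Y)) : (chains k X).X n →ₗ[k] (chains k Y).X n :=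
  ((((singularChainComplexFunctor (ModuleCat.{u} k)).obj (coeff.{u} k)).map
    (TopCat.ofHom f)).f n).hom

variable (X) in
/-- The boundary map `C_m(X, k) → C_n(X, k)`, for `m = n + 1`; zero otherwise. -/
def dmap (m n : ℕ) : (chains k X).X m →ₗ[k] (chains k X).X n := ((chains k X).d m n).hom

/-- The singular simplex `s`, as a chain. -/
def simplex {n : ℕ} (s : C(stdSimplex ℝ (Fin (n + 1)), X)) : (chains k X).X n :=
  (SSet.ιChainComplex (X := TopCat.toSSet.obj (TopCat.of X)) (R := coeff.{u} k)
    ((TopCat.toSSetObjEquiv (TopCat.of X) (op ⦋n⦌)).symm s)).hom ⟨1⟩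

/-- The map of standard simplices induced by a map of vertices. -/
def simplexMap {m n : ℕ} (a : Fin (m + 1) → Fin (n + 1)) :
    C(stdSimplex ℝ (Fin (m + 1)), stdSimplex ℝ (Fin (n + 1))) :=
  ⟨stdSimplex.map a, stdSimplex.continuous_map a⟩

/-- The linear map on singular chains with given values on singular simplices. -/
def chainLift {n : ℕ} {M : Type u} [AddCommGroup M] [Module k M]
    (c : C(stdSimplex ℝ (Fin (n + 1)), X) → M) : (chains k X).X n →ₗ[k] M :=
  (Limits.Sigma.desc (f := fun _ : (TopCat.toSSet.obj (TopCat.of X)) _⦋n⦌ => coeff.{u} k)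
    (P := ModuleCat.of k M) fun x => ModuleCat.ofHom
      ((LinearMap.toSpanSingleton k M
        (c (TopCat.toSSetObjEquiv (TopCat.of X) (op ⦋n⦌) x))).comp
          ULift.moduleEquiv.toLinearMap)).hom

@[simp] theorem chainLift_simplex {n : ℕ} {M : Type u} [AddCommGroup M] [Module k M]
    (c : C(stdSimplex ℝ (Fin (n + 1)), X) → M) (s : C(stdSimplex ℝ (Fin (n + 1)), X)) :
    chainLift k c (simplex k s) = c s := by
  have := ConcreteCategory.congr_hom (Limits.Sigma.ι_desc
    (f := fun _ : (TopCat.toSSet.obj (TopCat.of X)) _⦋n⦌ => coeff.{u} k)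
    (P := ModuleCat.of k M) (fun x => ModuleCat.ofHom
      ((LinearMap.toSpanSingleton k M
        (c (TopCat.toSSetObjEquiv (TopCat.of X) (op ⦋n⦌) x))).comp
          ULift.moduleEquiv.toLinearMap)) ((TopCat.toSSetObjEquiv (TopCat.of X) (op ⦋n⦌)).symm s))
            ⟨1⟩
  refine this.trans ?_
  simp

theorem chain_ext {n : ℕ} {M : Type u} [AddCommGroup M] [Module k M]
    {f g : (chains k X).X n →ₗ[k] M}
    (h : ∀ s : C(stdSimplex ℝ (Fin (n + 1)), X), f (simplex k s) = g (simplex k s)) : f = g := by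
  have : ModuleCat.ofHom f = ModuleCat.ofHom (Y := ModuleCat.of k M) g := by
    refine SSet.chainComplex_hom_ext (X := TopCat.toSSet.obj (TopCat.of X)) (R := coeff.{u} k)
      (T := ModuleCat.of k M) fun x => ?_
    ext r
    have hx := h (TopCat.toSSetObjEquiv (TopCat.of X) (op ⦋n⦌) x)
    unfold simplex at hx
    rw [Equiv.symm_apply_apply] at hx
    have hr : ∀ φ : coeff.{u} k ⟶ ModuleCat.of k M, φ.hom r = r.down • φ.hom ⟨1⟩ := by
      intro φ
      rw [← map_smul]
      congr 1
      ext
      simp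
    refine (hr _).trans (Eq.trans ?_ (hr _).symm)
    exact congrArg (fun z => r.down • z) hx
  exact congrArg ModuleCat.Hom.hom this

theorem cmap_simplex {n : ℕ} (f : C(X, Y)) (s : C(stdSimplex ℝ (Fin (n + 1)), X)) :
    cmap k n f (simplex k s) = simplex k (f.comp s) := by
  exact ConcreteCategory.congr_hom (SSet.ι_chainComplexMap_f
    (TopCat.toSSet.obj (TopCat.of X)) (TopCat.toSSet.obj (TopCat.of Y))
    (TopCat.toSSet.map (TopCat.ofHom f)) (coeff.{u} k)
    ((TopCat.toSSetObjEquiv (TopCat.of X) (op ⦋n⦌)).symm s)) ⟨1⟩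

theorem d_simplex {n : ℕ} (s : C(stdSimplex ℝ (Fin (n + 2)), X)) :
    dmap k X (n + 1) n (simplex k s) =
      ∑ i : Fin (n + 2), (-1 : ℤ) ^ (i : ℕ) • simplex k (s.comp (simplexMap i.succAbove)) := by
  have := ConcreteCategory.congr_hom (SSet.ιChainComplex_d
    (X := TopCat.toSSet.obj (TopCat.of X)) (R := coeff.{u} k)
    ((TopCat.toSSetObjEquiv (TopCat.of X) (op ⦋n + 1⦌)).symm s)) ⟨1⟩
  refine this.trans ?_
  simp only [ModuleCat.hom_sum, ModuleCat.hom_zsmul, LinearMap.sum_apply, LinearMap.smul_apply]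
  rfl

variable (X) in
/-- The `n`-cycles. -/
def cycles (n : ℕ) : Submodule k ((chains k X).X n) := LinearMap.ker (dmap k X n (n - 1))

/-- The homology class of a cycle. -/
def toH (n : ℕ) : cycles k X n →ₗ[k] H k X n :=
  ((((chains k X).sc n).moduleCatCyclesIso.inv ≫ (chains k X).homologyπ n).hom) ∘ₗ
    Submodule.inclusion (by
      have : (ComplexShape.down ℕ).next n = n - 1 := by
        cases n <;> simp
      change _ ≤ LinearMap.ker ((chains k X).d n ((ComplexShape.down ℕ).next n)).hom
      rw [this]
      exact le_rfl)

theorem toH_surjective (n : ℕ) : Function.Surjective (toH k (X := X) n) := by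
  intro c
  obtain ⟨z, rfl⟩ := (ModuleCat.epi_iff_surjective ((chains k X).homologyπ n)).1 inferInstance c
  obtain ⟨w, rfl⟩ := (ModuleCat.epi_iff_surjective
    ((chains k X).sc n).moduleCatCyclesIso.inv).1 inferInstance z
  refine ⟨⟨w.1, ?_⟩, rfl⟩
  have : (ComplexShape.down ℕ).next n = n - 1 := by
    cases n <;> simp
  rw [cycles, ← this]
  exact w.2

theorem toH_eq_zero_iff (n : ℕ) (z : cycles k X n) :
    toH k n z = 0 ↔ ∃ y, dmap k X (n + 1) n y = z := by
  have hi : Function.Injective ((chains k X).sc n).moduleCatHomologyIso.inv :=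
    (ModuleCat.mono_iff_injective _).1 inferInstance
  have hp : (ComplexShape.down ℕ).prev n = n + 1 := by simp
  have hn : (ComplexShape.down ℕ).next n = n - 1 := by
    cases n <;> simp
  have hz : z.1 ∈ LinearMap.ker ((chains k X).sc n).g.hom := by
    change _ ∈ LinearMap.ker ((chains k X).d n ((ComplexShape.down ℕ).next n)).hom
    rw [hn]
    exact z.2
  have h1 : toH k n z = ((chains k X).sc n).moduleCatHomologyIso.inv
      (((chains k X).sc n).moduleCatLeftHomologyData.π ⟨z.1, hz⟩) :=
    ConcreteCategory.congr_hom ((chains k X).sc n).moduleCatCyclesIso_inv_π ⟨z.1, hz⟩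
  rw [h1]
  refine (map_eq_zero_iff ((chains k X).sc n).moduleCatHomologyIso.inv.hom hi).trans ?_
  refine (Submodule.Quotient.mk_eq_zero _).trans ?_
  have h2 : (∃ y, (chains k X).d ((ComplexShape.down ℕ).prev n) n y = z.1) ↔
      ∃ y, (chains k X).d (n + 1) n y = z.1 := by rw [hp]
  refine Iff.trans ?_ h2
  exact ⟨fun ⟨y, hy⟩ => ⟨y, congrArg Subtype.val hy⟩, fun ⟨y, hy⟩ => ⟨y, Subtype.ext hy⟩⟩

theorem cmap_d (m n : ℕ) (f : C(X, Y)) (x) :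
    dmap k Y m n (cmap k m f x) = cmap k n f (dmap k X m n x) :=
  ConcreteCategory.congr_hom ((((singularChainComplexFunctor (ModuleCat.{u} k)).obj
    (coeff.{u} k)).map (TopCat.ofHom f)).comm m n) x

theorem cmap_mem_cycles {n : ℕ} (f : C(X, Y)) (z : cycles k X n) :
    cmap k n f z ∈ cycles k Y n :=
  (cmap_d k n (n - 1) f z).trans ((congrArg _ z.2).trans (map_zero _))

theorem hmap_toH {n : ℕ} (f : C(X, Y)) (z : cycles k X n) :
    hmap k n f (toH k n z) = toH k n ⟨cmap k n f z, cmap_mem_cycles k f z⟩ := by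
  let F := ((singularChainComplexFunctor (ModuleCat.{u} k)).obj (coeff.{u} k)).map (TopCat.ofHom f)
  have hi : Function.Injective ((chains k Y).iCycles n) :=
    (ModuleCat.mono_iff_injective _).1 inferInstance
  refine (ConcreteCategory.congr_hom (HomologicalComplex.homologyπ_naturality F n) _).trans ?_
  refine congrArg ((chains k Y).homologyπ n) (hi ?_)
  refine (ConcreteCategory.congr_hom (HomologicalComplex.cyclesMap_i F n) _).trans ?_
  refine (congrArg (F.f n) (ConcreteCategory.congr_hom
    ((chains k X).sc n).moduleCatCyclesIso_inv_iCycles _)).trans ?_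
  refine Eq.trans ?_ (ConcreteCategory.congr_hom
    ((chains k Y).sc n).moduleCatCyclesIso_inv_iCycles (Submodule.inclusion _
      ⟨cmap k n f z, cmap_mem_cycles k f z⟩)).symm
  rfl

end Homology

/-! ### Shuffles -/

/-- Pairs of sequences of vertices of the standard simplices of dimensions `p` and `q`. -/
abbrev Paths (n p q : ℕ) : Type := (Fin (n + 1) → Fin (p + 1)) × (Fin (n + 1) → Fin (q + 1))

namespace Paths

variable {n p q : ℕ}

/-- Start at `(0,0)` and continue with `x`, translated by `(1,0)`. -/
def stepL (x : Paths n p q) : Paths (n + 1) (p + 1) q :=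
  (Fin.cons 0 (Fin.succ ∘ x.1), Fin.cons 0 x.2)

/-- Start at `(0,0)` and continue with `x`, translated by `(0,1)`. -/
def stepR (x : Paths n p q) : Paths (n + 1) p (q + 1) :=
  (Fin.cons 0 x.1, Fin.cons 0 (Fin.succ ∘ x.2))

/-- The sum of all lattice paths from `(0,0)` to `(p,q)` with unit steps (that is, of all
`(p,q)`-shuffles), each with the sign of the corresponding shuffle; zero unless `n = p + q`. -/
def shuf : (n p q : ℕ) → (Paths n p q →₀ ℤ)
  | 0, 0, 0 => Finsupp.single (fun _ => 0, fun _ => 0) 1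
  | 0, 0, _ + 1 => 0
  | 0, _ + 1, _ => 0
  | _ + 1, 0, 0 => 0
  | n + 1, p + 1, 0 => (shuf n p 0).mapDomain stepL
  | n + 1, 0, q + 1 => (shuf n 0 q).mapDomain stepR
  | n + 1, p + 1, q + 1 => (shuf n p (q + 1)).mapDomain stepL +
      (-1 : ℤ) ^ (p + 1) • (shuf n (p + 1) q).mapDomain stepR

/-- Omit the `i`-th point. -/
def face (i : Fin (n + 2)) (x : Paths (n + 1) p q) : Paths n p q :=
  (x.1 ∘ i.succAbove, x.2 ∘ i.succAbove)

/-- The inclusion of the `i`-th face of the first simplex. -/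
def faceL (i : Fin (p + 2)) (x : Paths n p q) : Paths n (p + 1) q := (i.succAbove ∘ x.1, x.2)

/-- The inclusion of the `i`-th face of the second simplex. -/
def faceR (i : Fin (q + 2)) (x : Paths n p q) : Paths n p (q + 1) := (x.1, i.succAbove ∘ x.2)

/-- Start at `(0,0)` and continue with `x`. -/
def cone (x : Paths n p q) : Paths (n + 1) p q := (Fin.cons 0 x.1, Fin.cons 0 x.2)

/-- The linear extension of a map of paths. -/
abbrev lin {n p q n' p' q' : ℕ} (f : Paths n p q → Paths n' p' q') :
    (Paths n p q →₀ ℤ) →ₗ[ℤ] (Paths n' p' q' →₀ ℤ) := Finsupp.lmapDomain ℤ ℤ f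

/-- The simplicial boundary. -/
def bdry : (Paths (n + 1) p q →₀ ℤ) →ₗ[ℤ] (Paths n p q →₀ ℤ) :=
  ∑ i : Fin (n + 2), (-1 : ℤ) ^ (i : ℕ) • lin (face i)

theorem lin_comp {n p q n' p' q' n'' p'' q'' : ℕ} (f : Paths n p q → Paths n' p' q')
    (g : Paths n' p' q' → Paths n'' p'' q'') (x) : lin g (lin f x) = lin (g ∘ f) x :=
  (Finsupp.mapDomain_comp (v := x) (f := f) (g := g)).symm

/-- The first part of `shuf`: paths beginning with a horizontal step, without their first point. -/
def prevL (n : ℕ) : (p q : ℕ) → (Paths n p q →₀ ℤ)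
  | 0, _ => 0
  | p + 1, q => lin (faceL 0) (shuf n p q)

/-- The second part of `shuf`: paths beginning with a vertical step, without their first point. -/
def prevR (n p : ℕ) : (q : ℕ) → (Paths n p q →₀ ℤ)
  | 0 => 0
  | q + 1 => lin (faceR 0) (shuf n p q)

/-- Faces of the first simplex other than the zeroth. -/
def restL (n : ℕ) : (p q : ℕ) → (Paths n p q →₀ ℤ)
  | 0, _ => 0
  | p + 1, q => ∑ i : Fin (p + 1), (-1 : ℤ) ^ (i : ℕ) • lin (faceL i.succ) (shuf n p q)

/-- Faces of the second simplex other than the zeroth. -/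
def restR (n p : ℕ) : (q : ℕ) → (Paths n p q →₀ ℤ)
  | 0 => 0
  | q + 1 => ∑ i : Fin (q + 1), (-1 : ℤ) ^ (i : ℕ) • lin (faceR i.succ) (shuf n p q)

theorem shuf_succ (n p q : ℕ) :
    shuf (n + 1) p q = lin cone (prevL n p q) + (-1 : ℤ) ^ p • lin cone (prevR n p q) := by
  have hL : ∀ p q, lin cone (prevL n (p + 1) q) = (shuf n p q).mapDomain stepL := by
    intro p q
    rw [prevL, lin_comp]
    rfl
  have hR : ∀ p q, lin cone (prevR n p (q + 1)) = (shuf n p q).mapDomain stepR := by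
    intro p q
    rw [prevR, lin_comp]
    rfl
  rcases p with _ | p <;> rcases q with _ | q
  · simp [shuf, prevL, prevR]
  · rw [hR]; simp [shuf, prevL]
  · rw [hL]; simp [shuf, prevR]
  · rw [hR, hL]; rfl

theorem face_zero_cone (x : Paths n p q) : face 0 (cone x) = x := by
  ext i <;> simp [face, cone]

theorem face_succ_cone (i : Fin (n + 2)) (x : Paths (n + 1) p q) :
    face i.succ (cone x) = cone (face i x) := by
  ext j <;> refine Fin.cases ?_ (fun j => ?_) j <;>
    simp [face, cone, Fin.removeNth]

theorem faceL_succ_cone (i : Fin (p + 1)) (x : Paths n p q) :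
    faceL i.succ (cone x) = cone (faceL i.succ x) := by
  ext j <;> refine Fin.cases ?_ (fun j => ?_) j <;> simp [faceL, cone]

theorem faceR_succ_cone (i : Fin (q + 1)) (x : Paths n p q) :
    faceR i.succ (cone x) = cone (faceR i.succ x) := by
  ext j <;> refine Fin.cases ?_ (fun j => ?_) j <;> simp [faceR, cone]

theorem bdry_lin {p' q' : ℕ} (f : ∀ n, Paths n p q → Paths n p' q')
    (hf : ∀ n (i : Fin (n + 2)) x, face i (f (n + 1) x) = f n (face i x))
    (x : Paths (n + 1) p q →₀ ℤ) : bdry (lin (f (n + 1)) x) = lin (f n) (bdry x) := by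
  simp only [bdry, LinearMap.sum_apply, LinearMap.smul_apply, map_sum, map_smul, lin_comp]
  congr! 4 with i
  funext x
  exact hf n i x

theorem bdry_cone (x : Paths (n + 1) p q →₀ ℤ) : bdry (lin cone x) = x - lin cone (bdry x) := by
  have h0 : face (0 : Fin (n + 1 + 2)) ∘ cone (p := p) (q := q) = id :=
    funext fun x => face_zero_cone x
  have hs (i : Fin (n + 2)) : face i.succ ∘ cone (p := p) (q := q) = cone ∘ face i :=
    funext fun x => face_succ_cone i x
  have hid : lin (id : Paths (n + 1) p q → _) x = x := Finsupp.mapDomain_id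
  simp only [bdry, LinearMap.sum_apply, LinearMap.smul_apply, map_sum, map_smul, lin_comp]
  rw [Fin.sum_univ_succ]
  simp only [h0, hs, hid, Fin.val_zero, Fin.val_succ, pow_zero, one_smul, pow_succ, mul_neg,
    mul_one, neg_smul, Finset.sum_neg_distrib, sub_eq_add_neg]

theorem restL_prevL (n p q : ℕ) : ∑ i : Fin (p + 1), (-1 : ℤ) ^ (i : ℕ) •
    lin (faceL i.succ) (prevL n p q) = lin (faceL 0) (prevL n p q - restL n p q) := by
  rcases p with _ | p
  · simp [prevL, restL]
  · rw [Fin.sum_univ_succ]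
    simp only [prevL, restL, map_sub, map_sum, map_smul, lin_comp]
    have h (i : Fin (p + 2)) : faceL i.succ ∘ faceL (n := n) (p := p) (q := q) 0 =
        faceL 0 ∘ faceL i := by
      funext x
      ext j <;> simp [faceL]
    simp only [h, Fin.val_zero, Fin.val_succ, pow_zero, one_smul, pow_succ, mul_neg,
      mul_one, neg_smul, Finset.sum_neg_distrib, sub_eq_add_neg]

theorem restR_prevR (n p q : ℕ) : ∑ i : Fin (q + 1), (-1 : ℤ) ^ (i : ℕ) •
    lin (faceR i.succ) (prevR n p q) = lin (faceR 0) (prevR n p q - restR n p q) := by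
  rcases q with _ | q
  · simp [prevR, restR]
  · rw [Fin.sum_univ_succ]
    simp only [prevR, restR, map_sub, map_sum, map_smul, lin_comp]
    have h (i : Fin (q + 2)) : faceR i.succ ∘ faceR (n := n) (p := p) (q := q) 0 =
        faceR 0 ∘ faceR i := by
      funext x
      ext j <;> simp [faceR]
    simp only [h, Fin.val_zero, Fin.val_succ, pow_zero, one_smul, pow_succ, mul_neg,
      mul_one, neg_smul, Finset.sum_neg_distrib, sub_eq_add_neg]

theorem restL_prevR (n p q : ℕ) : ∑ i : Fin (p + 1), (-1 : ℤ) ^ (i : ℕ) •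
    lin (faceL i.succ) (prevR n p (q + 1)) = lin (faceR 0) (restL n (p + 1) q) := by
  simp only [prevR, restL, map_sum, map_smul, lin_comp]
  rfl

theorem restR_prevL (n p q : ℕ) : ∑ i : Fin (q + 1), (-1 : ℤ) ^ (i : ℕ) •
    lin (faceR i.succ) (prevL n (p + 1) q) = lin (faceL 0) (restR n p (q + 1)) := by
  simp only [prevL, restR, map_sum, map_smul, lin_comp]
  rfl

theorem bdry_shuf (n p q : ℕ) : bdry (shuf (n + 1) p q) =
    (prevL n p q - restL n p q) + (-1 : ℤ) ^ p • (prevR n p q - restR n p q) := by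
  induction n generalizing p q with
  | zero =>
    have hs {a b : ℕ} {P Q : Paths 0 a b} (h₁ : P.1 0 = Q.1 0) (h₂ : P.2 0 = Q.2 0) : P = Q := by
      ext i <;> rw [Fin.fin_one_eq_zero i] <;> simp [h₁, h₂]
    rcases p with _ | _ | p <;> rcases q with _ | _ | q <;>
      simp only [shuf, prevL, prevR, restL, restR, map_zero, smul_zero,
        Finset.sum_const_zero, sub_zero, add_zero, Finsupp.mapDomain_zero]
    · simp only [bdry, LinearMap.sum_apply, LinearMap.smul_apply, lin, Finsupp.lmapDomain_apply,
        Finsupp.mapDomain_single]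
      simp [sub_eq_add_neg, Fin.sum_univ_two]
      exact congrArg₂ (fun a b => Finsupp.single a 1 + -Finsupp.single b 1)
        (hs (by simp [face, stepR, faceR]) (by simp [face, stepR, faceR]))
        (hs (by simp [face, stepR, faceR]) (by simp [face, stepR, faceR]))
    · simp only [bdry, LinearMap.sum_apply, LinearMap.smul_apply, lin, Finsupp.lmapDomain_apply,
        Finsupp.mapDomain_single]
      simp [sub_eq_add_neg, Fin.sum_univ_two]
      exact congrArg₂ (fun a b => Finsupp.single a 1 + -Finsupp.single b 1)
        (hs (by simp [face, stepL, faceL]) (by simp [face, stepL, faceL]))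
        (hs (by simp [face, stepL, faceL]) (by simp [face, stepL, faceL]))
  | succ n ih =>
    have hL (i : Fin (n + 2)) (a b : ℕ) (x) : bdry (lin (faceL (n := n + 1) (p := a) (q := b) 0) x)
      = lin (faceL 0) (bdry x) := bdry_lin (fun _ => faceL 0) (fun _ _ _ => rfl) x
    have hR (i : Fin (n + 2)) (a b : ℕ) (x) : bdry (lin (faceR (n := n + 1) (p := a) (q := b) 0) x)
      = lin (faceR 0) (bdry x) := bdry_lin (fun _ => faceR 0) (fun _ _ _ => rfl) x
    have hcL (a b : ℕ) (i : Fin (a + 1)) (x) : lin (faceL i.succ)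
        (lin (cone (n := n) (p := a) (q := b)) x) = lin cone (lin (faceL i.succ) x) := by
      rw [lin_comp, lin_comp]
      exact congrArg (fun f => lin f x) (funext fun x => faceL_succ_cone i x)
    have hcR (a b : ℕ) (i : Fin (b + 1)) (x) : lin (faceR i.succ)
        (lin (cone (n := n) (p := a) (q := b)) x) = lin cone (lin (faceR i.succ) x) := by
      rw [lin_comp, lin_comp]
      exact congrArg (fun f => lin f x) (funext fun x => faceR_succ_cone i x)
    have eL (a b : ℕ) : restL (n + 1) (a + 1) b =
        lin cone (lin (faceL 0) (prevL n a b - restL n a b) + (-1 : ℤ) ^ a •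
          ∑ i : Fin (a + 1), (-1 : ℤ) ^ (i : ℕ) • lin (faceL i.succ) (prevR n a b)) := by
      rw [← restL_prevL, restL, shuf_succ]
      simp only [map_add, map_smul, hcL, map_sum, smul_add, Finset.sum_add_distrib, Finset.smul_sum]
      congr! 2
      rw [smul_comm]
    have eR (a b : ℕ) : restR (n + 1) a (b + 1) =
        lin cone (∑ i : Fin (b + 1), (-1 : ℤ) ^ (i : ℕ) • lin (faceR i.succ) (prevL n a b) +
          (-1 : ℤ) ^ a • lin (faceR 0) (prevR n a b - restR n a b)) := by
      rw [← restR_prevR, restR, shuf_succ]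
      simp only [map_add, map_smul, hcR, map_sum, smul_add, Finset.sum_add_distrib, Finset.smul_sum]
      congr! 2
      rw [smul_comm]
    have bL (a b : ℕ) : bdry (prevL (n + 1) (a + 1) b) = lin (faceL 0)
        ((prevL n a b - restL n a b) + (-1 : ℤ) ^ a • (prevR n a b - restR n a b)) := by
      rw [prevL, hL 0, ih]
    have bR (a b : ℕ) : bdry (prevR (n + 1) a (b + 1)) = lin (faceR 0)
        ((prevL n a b - restL n a b) + (-1 : ℤ) ^ a • (prevR n a b - restR n a b)) := by
      rw [prevR, hR 0, ih]
    have hsq (a : ℕ) : (-1 : ℤ) ^ a * (-1) ^ a = 1 := by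
      rw [← pow_add, ← two_mul, pow_mul]; simp
    have key : restL (n + 1) p q + (-1 : ℤ) ^ p • restR (n + 1) p q =
        lin cone (bdry (prevL (n + 1) p q) + (-1 : ℤ) ^ p • bdry (prevR (n + 1) p q)) := by
      rcases p with _ | p <;> rcases q with _ | q
      · simp [restL, restR, prevL, prevR]
      · rw [eR, bR]
        simp [restL, prevL]
      · rw [eL, bL]
        simp [restR, prevR]
      · rw [eL, eR, bL, bR, restL_prevR, restR_prevL]
        have hc : lin (faceL 0) (prevR n p (q + 1)) = lin (faceR 0) (prevL n (p + 1) q) := by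
          rw [prevR, prevL, lin_comp, lin_comp]; rfl
        simp only [map_add, map_smul, map_sub, hc, smul_add, smul_sub, smul_smul, hsq]
        simp only [pow_succ, mul_neg, mul_one, neg_smul]
        abel
    rw [shuf_succ, map_add, map_smul, bdry_cone, bdry_cone]
    rw [map_add, map_smul] at key
    rw [smul_sub, smul_sub, sub_add_sub_comm, sub_add_sub_comm, key]

end Paths

/-! ### The cross product -/

section Cross

variable (k : Type) [Field k] {X : Type u} [TopologicalSpace X] {Y : Type u} [TopologicalSpace Y]
  {X' : Type u} [TopologicalSpace X'] {Y' : Type u} [TopologicalSpace Y']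

/-- The chain of `X × Y` determined by simplices `s`, `t` of `X`, `Y` and a chain of paths. -/
def realize {p q : ℕ} (s : C(stdSimplex ℝ (Fin (p + 1)), X)) (t : C(stdSimplex ℝ (Fin (q + 1)), Y))
    (n : ℕ) : (Paths n p q →₀ ℤ) →ₗ[ℤ] (chains k (X × Y)).X n :=
  Finsupp.linearCombination ℤ fun x =>
    simplex k ((s.comp (simplexMap x.1)).prodMk (t.comp (simplexMap x.2)))

theorem realize_lin {n p q n' p' q' : ℕ} (f : Paths n p q → Paths n' p' q')
    (s : C(stdSimplex ℝ (Fin (p' + 1)), X)) (t : C(stdSimplex ℝ (Fin (q' + 1)), Y))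
    (x : Paths n p q →₀ ℤ) : realize k s t n' (Paths.lin f x) =
      Finsupp.linearCombination ℤ (fun x => simplex k
        ((s.comp (simplexMap (f x).1)).prodMk (t.comp (simplexMap (f x).2)))) x :=
  Finsupp.linearCombination_mapDomain ..

theorem simplexMap_comp {l m n : ℕ} (a : Fin (m + 1) → Fin (n + 1))
    (b : Fin (l + 1) → Fin (m + 1)) : simplexMap (a ∘ b) = (simplexMap a).comp (simplexMap b) :=
  ContinuousMap.ext fun x => (stdSimplex.map_comp_apply b a x).symm

theorem realize_faceL {n p q : ℕ} (i : Fin (p + 2)) (s : C(stdSimplex ℝ (Fin (p + 2)), X))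
    (t : C(stdSimplex ℝ (Fin (q + 1)), Y)) (x : Paths n p q →₀ ℤ) :
    realize k s t n (Paths.lin (Paths.faceL i) x) =
      realize k (s.comp (simplexMap i.succAbove)) t n x := by
  rw [realize_lin, realize]
  congr! 3 with y
  simp only [Paths.faceL, simplexMap_comp, ContinuousMap.comp_assoc]

theorem realize_faceR {n p q : ℕ} (i : Fin (q + 2)) (s : C(stdSimplex ℝ (Fin (p + 1)), X))
    (t : C(stdSimplex ℝ (Fin (q + 2)), Y)) (x : Paths n p q →₀ ℤ) :
    realize k s t n (Paths.lin (Paths.faceR i) x) =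
      realize k s (t.comp (simplexMap i.succAbove)) n x := by
  rw [realize_lin, realize]
  congr! 3 with y
  simp only [Paths.faceR, simplexMap_comp, ContinuousMap.comp_assoc]

theorem d_realize {n p q : ℕ} (s : C(stdSimplex ℝ (Fin (p + 1)), X))
    (t : C(stdSimplex ℝ (Fin (q + 1)), Y)) (x : Paths (n + 1) p q →₀ ℤ) :
    dmap k (X × Y) (n + 1) n (realize k s t (n + 1) x) =
      realize k s t n (Paths.bdry x) := by
  induction x using Finsupp.induction_linear with
  | zero => simp
  | add x y hx hy => rw [map_add, map_add, map_add, map_add, hx, hy]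
  | single y r =>
    have h (i : Fin (n + 2)) : ((s.comp (simplexMap y.1)).prodMk (t.comp (simplexMap y.2))).comp
        (simplexMap i.succAbove) = (s.comp (simplexMap (Paths.face i y).1)).prodMk
          (t.comp (simplexMap (Paths.face i y).2)) := by
      rw [Paths.face, simplexMap_comp, simplexMap_comp]
      rfl
    simp only [realize, Paths.bdry, Finsupp.linearCombination_single, map_zsmul, d_simplex,
      LinearMap.sum_apply, LinearMap.smul_apply, map_sum, map_smul, Finsupp.lmapDomain_apply,
      Finsupp.mapDomain_single, h, Finset.smul_sum]
    congr! 1 with i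
    rw [smul_comm]

/-- The cross product of chains. -/
def crossChain (p q n : ℕ) :
    (chains k X).X p →ₗ[k] (chains k Y).X q →ₗ[k] (chains k (X × Y)).X n :=
  chainLift k fun s => chainLift k fun t => realize k s t n (Paths.shuf n p q)

theorem crossChain_simplex {p q n : ℕ} (s : C(stdSimplex ℝ (Fin (p + 1)), X))
    (t : C(stdSimplex ℝ (Fin (q + 1)), Y)) : crossChain k p q n (simplex k s) (simplex k t) =
      realize k s t n (Paths.shuf n p q) := by
  simp [crossChain]

theorem chain_ext₂ {p q : ℕ} {M : Type u} [AddCommGroup M] [Module k M]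
    {f g : (chains k X).X p →ₗ[k] (chains k Y).X q →ₗ[k] M}
    (h : ∀ s t, f (simplex k s) (simplex k t) = g (simplex k s) (simplex k t)) : f = g :=
  chain_ext k fun s => chain_ext k fun t => h s t

theorem crossChain_dL (p q n : ℕ) (s : C(stdSimplex ℝ (Fin (p + 1)), X))
    (t : C(stdSimplex ℝ (Fin (q + 1)), Y)) :
    crossChain k (p - 1) q n (dmap k X p (p - 1) (simplex k s)) (simplex k t) =
      realize k s t n (Paths.prevL n p q - Paths.restL n p q) := by
  rcases p with _ | p
  · simp [Paths.prevL, Paths.restL, dmap]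
  · change crossChain k p q n (dmap k X (p + 1) p (simplex k s)) (simplex k t) = _
    simp only [d_simplex, map_sum, map_zsmul, LinearMap.sum_apply, LinearMap.smul_apply,
      crossChain_simplex]
    rw [Fin.sum_univ_succ]
    simp only [Paths.prevL, Paths.restL, map_add, map_neg, map_sum, map_smul, realize_faceL, Fin.val_zero,
      Fin.val_succ, pow_zero, one_smul, pow_succ, mul_neg, mul_one, neg_smul,
      Finset.sum_neg_distrib, sub_eq_add_neg]

theorem crossChain_dR (p q n : ℕ) (s : C(stdSimplex ℝ (Fin (p + 1)), X))
    (t : C(stdSimplex ℝ (Fin (q + 1)), Y)) :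
    crossChain k p (q - 1) n (simplex k s) (dmap k Y q (q - 1) (simplex k t)) =
      realize k s t n (Paths.prevR n p q - Paths.restR n p q) := by
  rcases q with _ | q
  · simp [Paths.prevR, Paths.restR, dmap]
  · change crossChain k p q n (simplex k s) (dmap k Y (q + 1) q (simplex k t)) = _
    simp only [d_simplex, map_sum, map_zsmul, crossChain_simplex]
    rw [Fin.sum_univ_succ]
    simp only [Paths.prevR, Paths.restR, map_add, map_neg, map_sum, map_smul, realize_faceR, Fin.val_zero,
      Fin.val_succ, pow_zero, one_smul, pow_succ, mul_neg, mul_one, neg_smul,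
      Finset.sum_neg_distrib, sub_eq_add_neg]

theorem d_crossChain (p q n : ℕ) (a : (chains k X).X p) (b : (chains k Y).X q) :
    dmap k (X × Y) (n + 1) n (crossChain k p q (n + 1) a b) =
      crossChain k (p - 1) q n (dmap k X p (p - 1) a) b +
      (-1 : ℤ) ^ p • crossChain k p (q - 1) n a (dmap k Y q (q - 1) b) := by
  have : (crossChain k p q (n + 1)).compr₂ (dmap k (X × Y) (n + 1) n) =
      (crossChain k (p - 1) q n).comp (dmap k X p (p - 1)) +
      (-1 : ℤ) ^ p • (crossChain k p (q - 1) n).compl₂ (dmap k Y q (q - 1)) := by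
    refine chain_ext₂ k fun s t => ?_
    simp only [LinearMap.compr₂_apply, LinearMap.add_apply, LinearMap.comp_apply,
      LinearMap.smul_apply, LinearMap.compl₂_apply]
    rw [crossChain_simplex, d_realize, Paths.bdry_shuf, map_add, map_smul, crossChain_dL,
      crossChain_dR]
  exact LinearMap.congr_fun₂ this a b

theorem cmap_crossChain (p q n : ℕ) (f : C(X, X')) (g : C(Y, Y')) (a : (chains k X).X p)
    (b : (chains k Y).X q) : cmap k n (f.prodMap g) (crossChain k p q n a b) =
      crossChain k p q n (cmap k p f a) (cmap k q g b) := by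
  have : (crossChain k p q n).compr₂ (cmap k n (f.prodMap g)) =
      (crossChain k p q n).compl₁₂ (cmap k p f) (cmap k q g) := by
    refine chain_ext₂ k fun s t => ?_
    simp only [LinearMap.compr₂_apply, LinearMap.compl₁₂_apply, cmap_simplex, crossChain_simplex]
    simp only [realize, Finsupp.linearCombination_apply, Finsupp.sum, map_sum, map_zsmul,
      cmap_simplex]
    rfl
  exact LinearMap.congr_fun₂ this a b

variable {k} in
/-- The linear map on homology induced by a linear map on cycles that vanishes on boundaries. -/
def descH {n : ℕ} {M : Type u} [AddCommGroup M] [Module k M] (g : cycles k X n →ₗ[k] M)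
    (hg : ∀ z : cycles k X n, (∃ y, dmap k X (n + 1) n y = z) → g z = 0) :
    H k X n →ₗ[k] M :=
  ((LinearMap.ker (toH k n)).liftQ g fun z hz => hg z ((toH_eq_zero_iff k n z).1 hz)) ∘ₗ
    ((toH k n).quotKerEquivOfSurjective (toH_surjective k n)).symm.toLinearMap

theorem descH_toH {n : ℕ} {M : Type u} [AddCommGroup M] [Module k M] (g : cycles k X n →ₗ[k] M)
    (hg) (z : cycles k X n) : descH g hg (toH k n z) = g z := by
  have : ((toH k n).quotKerEquivOfSurjective (toH_surjective k n)).symm (toH k n z) =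
      Submodule.Quotient.mk z := by
    rw [LinearEquiv.symm_apply_eq]
    rfl
  exact congrArg _ this

theorem crossChain_mem (p q n : ℕ) (a : cycles k X p) (b : cycles k Y q) :
    crossChain k p q n a b ∈ cycles k (X × Y) n := by
  rcases n with _ | n
  · simp [cycles, dmap]
  · refine (d_crossChain k p q n a.1 b.1).trans ?_
    rw [show dmap k X p (p - 1) a.1 = 0 from a.2,
      show dmap k Y q (q - 1) b.1 = 0 from b.2]
    simp

/-- The cross product of cycles. -/
def crossCycle (p q n : ℕ) : cycles k X p →ₗ[k] cycles k Y q →ₗ[k] H k (X × Y) n :=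
  LinearMap.mk₂ k (fun a b => toH k n ⟨crossChain k p q n a b, crossChain_mem k p q n a b⟩)
    (fun a a' b => by rw [← map_add]; exact congrArg _ (Subtype.ext (by simp)))
    (fun r a b => by rw [← map_smul]; exact congrArg _ (Subtype.ext (by simp)))
    (fun a b b' => by rw [← map_add]; exact congrArg _ (Subtype.ext (by simp)))
    (fun r a b => by rw [← map_smul]; exact congrArg _ (Subtype.ext (by simp)))

theorem crossCycle_bdry {p q n : ℕ} (a : cycles k X p) (b : cycles k Y q)
    (h : ∃ y, dmap k Y (q + 1) q y = b) : crossCycle k p q n a b = 0 := by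
  obtain ⟨y, hy⟩ := h
  refine (toH_eq_zero_iff k n _).2 ⟨(-1 : ℤ) ^ p • crossChain k p (q + 1) (n + 1) a.1 y, ?_⟩
  rw [map_zsmul, d_crossChain, show dmap k X p (p - 1) a.1 = 0 from a.2]
  change (-1 : ℤ) ^ p • (crossChain k (p - 1) (q + 1) n 0 y +
    (-1 : ℤ) ^ p • crossChain k p q n a.1 (dmap k Y (q + 1) q y)) = crossChain k p q n a.1 b.1
  rw [hy, map_zero, LinearMap.zero_apply, zero_add, smul_smul, ← pow_add, ← two_mul, pow_mul]
  simp

/-- The cross product of cycles with homology classes. -/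
def crossCycleH (p q n : ℕ) : cycles k X p →ₗ[k] H k Y q →ₗ[k] H k (X × Y) n where
  toFun a := descH (crossCycle k p q n a) (crossCycle_bdry k a)
  map_add' a a' := by
    ext c
    obtain ⟨b, rfl⟩ := toH_surjective k q c
    simp [descH_toH]
  map_smul' r a := by
    ext c
    obtain ⟨b, rfl⟩ := toH_surjective k q c
    simp [descH_toH]

theorem crossCycleH_toH {p q n : ℕ} (a : cycles k X p) (b : cycles k Y q) :
    crossCycleH k p q n a (toH k q b) = crossCycle k p q n a b :=
  descH_toH k _ (crossCycle_bdry k a) b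

/-- The homology cross product `H_p(X, k) × H_q(Y, k) → H_n(X × Y, k)`, given by the
Eilenberg-Zilber shuffle map, for `n = p + q`; zero otherwise. -/
def cross (p q n : ℕ) : H k X p →ₗ[k] H k Y q →ₗ[k] H k (X × Y) n :=
  descH (M := H k Y q →ₗ[k] H k (X × Y) n) (crossCycleH k p q n) (by
    rintro a ⟨y, hy⟩
    ext c
    obtain ⟨b, rfl⟩ := toH_surjective k q c
    rw [crossCycleH_toH, LinearMap.zero_apply]
    refine (toH_eq_zero_iff k n _).2 ⟨crossChain k (p + 1) q (n + 1) y b.1, ?_⟩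
    rw [d_crossChain, show dmap k Y q (q - 1) b.1 = 0 from b.2]
    change crossChain k p q n (dmap k X (p + 1) p y) b.1 +
      (-1 : ℤ) ^ (p + 1) • crossChain k (p + 1) (q - 1) n y 0 = crossChain k p q n a.1 b.1
    rw [hy, map_zero, smul_zero, add_zero])

theorem cross_toH {p q n : ℕ} (a : cycles k X p) (b : cycles k Y q) :
    cross k p q n (toH k p a) (toH k q b) =
      toH k n ⟨crossChain k p q n a b, crossChain_mem k p q n a b⟩ := by
  rw [cross, descH_toH, crossCycleH_toH]
  rfl

theorem hmap_cross {p q n : ℕ} (f : C(X, X')) (g : C(Y, Y')) (a : H k X p) (b : H k Y q) :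
    hmap k n (f.prodMap g) (cross k p q n a b) = cross k p q n (hmap k p f a) (hmap k q g b) := by
  obtain ⟨a, rfl⟩ := toH_surjective k p a
  obtain ⟨b, rfl⟩ := toH_surjective k q b
  rw [cross_toH, hmap_toH, hmap_toH, hmap_toH, cross_toH]
  exact congrArg _ (Subtype.ext (cmap_crossChain k p q n f g a b))

end Cross

/-! ### The Pontryagin ring -/

section Pontryagin

variable (k : Type) [Field k] {X : Type u} [TopologicalSpace X] {Y : Type u} [TopologicalSpace Y]

theorem hmap_congr {f g : C(X, Y)} (h : f.Homotopic g) (n : ℕ) : hmap k n f = hmap k n g := by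
  obtain ⟨F⟩ := h
  exact congrArg ModuleCat.Hom.hom
    (TopCat.Homotopy.congr_homologyMap_singularChainComplexFunctor
      (f := TopCat.ofHom f) (g := TopCat.ofHom g) F (coeff.{u} k) n)

theorem hmap_comp {Z : Type u} [TopologicalSpace Z] (f : C(X, Y)) (g : C(Y, Z)) (n : ℕ)
    (x : H k X n) : hmap k n g (hmap k n f x) = hmap k n (g.comp f) x := by
  rw [hmap, hmap, hmap, TopCat.ofHom_comp, Functor.map_comp]
  rfl

variable (X) in
/-- The total homology `H_*(X, k)`. -/
abbrev HStar : Type u := DirectSum ℕ fun n => H k X n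

/-- The class of the point `x` in `H_0(X, k)`. -/
def pointClass (x : X) : H k X 0 :=
  toH k 0 ⟨simplex k (ContinuousMap.const _ x), by simp [cycles, dmap]⟩

/-- The element `1_{[x]}` of `H_*(X, k)`. -/
def one (x : X) : HStar k X := DirectSum.lof k ℕ (fun n => H k X n) 0 (pointClass k x)

variable (X) in
/-- The augmentation `H_0(X, k) → k`, which maps the class of every point to `1`. -/
def aug : H k X 0 →ₗ[k] k :=
  ULift.moduleEquiv.toLinearMap ∘ₗ descH (M := ULift.{u} k)
    ((chainLift k fun _ => ⟨1⟩) ∘ₗ (cycles k X 0).subtype) (by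
      rintro z ⟨y, hy⟩
      have : (chainLift k (X := X) (n := 0) fun _ => (⟨1⟩ : ULift.{u} k)) ∘ₗ dmap k X 1 0 = 0 :=
        chain_ext k fun s => by simp [d_simplex, Fin.sum_univ_two]
      simpa [← hy] using LinearMap.congr_fun this y)

theorem aug_pointClass (x : X) : aug k X (pointClass k x) = 1 := by
  simp [aug, pointClass, descH_toH]

variable (X) in
/-- The map `ε : H_*(X, k) → k`: projection to degree `0`, followed by summation over components. -/
def eps : HStar k X →ₗ[k] k := aug k X ∘ₗ DirectSum.component k ℕ (fun n => H k X n) 0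

/-- The Pontryagin product on `H_*(X, k)`. -/
def HSpaceStr.pont (m : HSpaceStr X) : HStar k X →ₗ[k] HStar k X →ₗ[k] HStar k X :=
  DirectSum.toModule k ℕ _ fun p => LinearMap.flip <| DirectSum.toModule k ℕ _ fun q =>
    LinearMap.flip <| (cross k p q (p + q)).compr₂
      (DirectSum.lof k ℕ (fun n => H k X n) (p + q) ∘ₗ hmap k (p + q) m.mul)

theorem pont_lof (m : HSpaceStr X) (p q : ℕ) (a : H k X p) (b : H k X q) :
    m.pont k (DirectSum.lof k ℕ (fun n => H k X n) p a) (DirectSum.lof k ℕ (fun n => H k X n) q b) =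
      DirectSum.lof k ℕ (fun n => H k X n) (p + q)
        (hmap k (p + q) m.mul (cross k p q (p + q) a b)) := by
  simp [HSpaceStr.pont]

/-- The map `f_* : H_*(X, k) → H_*(Y, k)`. -/
def hstar (f : C(X, Y)) : HStar k X →ₗ[k] HStar k Y := DirectSum.lmap fun n => hmap k n f

theorem eps_hstar (f : C(X, Y)) (r : HStar k X) : eps k Y (hstar k f r) = eps k X r := by
  have h (c : H k X 0) : aug k Y (hmap k 0 f c) = aug k X c := by
    obtain ⟨z, rfl⟩ := toH_surjective k 0 c
    have : (chainLift k (X := Y) (n := 0) fun _ => (⟨1⟩ : ULift.{u} k)) ∘ₗ cmap k 0 f =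
        chainLift k fun _ => ⟨1⟩ := chain_ext k fun s => by simp [cmap_simplex]
    rw [hmap_toH]
    simpa [aug, descH_toH] using LinearMap.congr_fun this z.1
  have : eps k Y ∘ₗ hstar k f = eps k X := by
    ext i x
    rcases i with _ | i
    · simp [eps, hstar, DirectSum.component.lof_self, h]
    · simp [eps, hstar, DirectSum.component.of]
  exact LinearMap.congr_fun this r

theorem hstar_pont {mX : HSpaceStr X} {mY : HSpaceStr Y} {f : C(X, Y)} (hf : IsHMap mX mY f)
    (a b : HStar k X) : hstar k f (mX.pont k a b) = mY.pont k (hstar k f a) (hstar k f b) := by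
  have : (mX.pont k).compr₂ (hstar k f) = (mY.pont k).compl₁₂ (hstar k f) (hstar k f) := by
    ext p a q b : 4
    simp only [LinearMap.compr₂_apply, LinearMap.compl₁₂_apply, LinearMap.comp_apply, pont_lof,
      hstar, DirectSum.lmap_lof]
    congr 1
    rw [← hmap_cross, hmap_comp, hmap_comp, hmap_congr k hf.map_mul]
  exact LinearMap.congr_fun₂ this a b

end Pontryagin

/-! ### Hochschild-Pontryagin cohomology -/

section HP

variable (k : Type) [Field k] {X : Type u} [TopologicalSpace X] {Y : Type u} [TopologicalSpace Y]

variable (X) in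
/-- The Hochschild cochains `Hom(R^{⊗ i}, k)` for `R = H_*(X, k)`. -/
abbrev Cochain (i : ℕ) : Type u := MultilinearMap k (fun _ : Fin i => HStar k X) k

instance (i : ℕ) : AddCommGroup (Cochain k X i) := inferInstance

instance (i : ℕ) : Module k (Cochain k X i) := inferInstance

instance (i : ℕ) (S : Submodule k (Cochain k X i)) : AddCommGroup S := inferInstance

variable (X) in
/-- The cochains that lower degree by `j`, where `k` has degree `0`. -/
def cochains (i j : ℕ) : Submodule k (Cochain k X i) where
  carrier := {c | ∀ (d : Fin i → ℕ) (r : ∀ a, H k X (d a)), ∑ a, d a ≠ j →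
    c (fun a => DirectSum.lof k ℕ (fun n => H k X n) (d a) (r a)) = 0}
  add_mem' hc hc' d r hd := by simp [hc d r hd, hc' d r hd]
  zero_mem' := by simp
  smul_mem' s c hc d r hd := by simp [hc d r hd]

/-- The Hochschild differential for the `R`-bimodule `k` with action by `ε`. -/
def HSpaceStr.hochD (m : HSpaceStr X) (i : ℕ) :
    Cochain k X i →ₗ[k] (Fin (i + 1) → HStar k X) → k where
  toFun c r := eps k X (r 0) * c (fun a => r a.succ) +
    ∑ a : Fin i, (-1) ^ ((a : ℕ) + 1) * c (a.castSucc.contractNth (fun x y => m.pont k x y) r) +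
    (-1) ^ (i + 1) * (c (fun a => r a.castSucc) * eps k X (r (Fin.last i)))
  map_add' c c' := by
    ext r
    simp only [add_apply, Pi.add_apply, mul_add, add_mul, Finset.sum_add_distrib]
    ring
  map_smul' s c := by
    ext r
    simp only [smul_apply, Pi.smul_apply, smul_eq_mul, RingHom.id_apply, mul_add,
      Finset.mul_sum]
    refine congrArg₂ _ (congrArg₂ _ (by ring) (Finset.sum_congr rfl fun _ _ => ?_)) ?_ <;> ring

/-- Hochschild-Pontryagin cocycles of bidegree `(i, j)`. -/
def HSpaceStr.hochZ (m : HSpaceStr X) (i j : ℕ) : Submodule k (Cochain k X i) :=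
  cochains k X i j ⊓ LinearMap.ker (m.hochD k i)

/-- Hochschild-Pontryagin coboundaries of bidegree `(i, j)`. -/
def HSpaceStr.hochB (m : HSpaceStr X) : (i j : ℕ) → Submodule k (Cochain k X i)
  | 0, _ => ⊥
  | i + 1, j => ((cochains k X i j).map (m.hochD k i)).comap
      ({ toFun c := c, map_add' _ _ := rfl, map_smul' _ _ := rfl } :
        Cochain k X (i + 1) →ₗ[k] (Fin (i + 1) → HStar k X) → k)

/-- Hochschild-Pontryagin cohomology `HP^{i,j}(X, k)`. -/
abbrev HSpaceStr.HP (m : HSpaceStr X) (i j : ℕ) : Type u :=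
  m.hochZ k i j ⧸ (m.hochB k i j).comap (m.hochZ k i j).subtype

/-- The map on cochains induced by `f`. -/
def cochainMap (f : C(X, Y)) (i : ℕ) : Cochain k Y i →ₗ[k] Cochain k X i :=
  MultilinearMap.compLinearMapₗ fun _ => hstar k f

theorem cochainMap_mem (f : C(X, Y)) {i j : ℕ} {c : Cochain k Y i} (hc : c ∈ cochains k Y i j) :
    cochainMap k f i c ∈ cochains k X i j := by
  intro d r hd
  simpa [cochainMap, hstar] using hc d (fun a => hmap k (d a) f (r a)) hd

theorem hochD_cochainMap {mX : HSpaceStr X} {mY : HSpaceStr Y} {f : C(X, Y)}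
    (hf : IsHMap mX mY f) {i : ℕ} (c : Cochain k Y i) (r : Fin (i + 1) → HStar k X) :
    mX.hochD k i (cochainMap k f i c) r = mY.hochD k i c (hstar k f ∘ r) := by
  have h (a : Fin i) := Fin.comp_contractNth (fun x y => mX.pont k x y) (fun x y => mY.pont k x y)
    (hstar_pont k hf) a.castSucc r
  simp only [HSpaceStr.hochD, LinearMap.coe_mk, AddHom.coe_mk, ← h, Function.comp_apply, eps_hstar]
  rfl

/-- The map `f^* : HP^{i,j}(Y, k) → HP^{i,j}(X, k)` induced by an H-map `f`. -/
def HPmap {mX : HSpaceStr X} {mY : HSpaceStr Y} {f : C(X, Y)} (hf : IsHMap mX mY f) (i j : ℕ) :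
    mY.HP k i j →ₗ[k] mX.HP k i j :=
  Submodule.mapQ _ _
    ((cochainMap k f i).restrict (p := mY.hochZ k i j) (q := mX.hochZ k i j) fun c hc =>
      ⟨cochainMap_mem k f hc.1, funext fun r =>
        (hochD_cochainMap k hf c r).trans (congrFun hc.2 _)⟩) (by
    rintro ⟨c, hc⟩ h
    rcases i with _ | i
    · have : c = 0 := h
      subst this
      exact Submodule.zero_mem _
    · obtain ⟨g, hg, h⟩ := h
      refine ⟨cochainMap k f i g, cochainMap_mem k f hg, funext fun r => ?_⟩
      exact (hochD_cochainMap k hf g r).trans (congrFun h _))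

/-- The inclusion `HP^{1,1}(X, k) → Hom(H_1(X, k), k) = H^1(X, k)`. -/
def HSpaceStr.toH1 (m : HSpaceStr X) : m.HP k 1 1 →ₗ[k] H k X 1 →ₗ[k] k :=
  Submodule.liftQ _
    { toFun c := (MultilinearMap.ofSubsingleton k (HStar k X) k (0 : Fin 1)).symm c.1 ∘ₗ
        DirectSum.lof k ℕ (fun n => H k X n) 1
      map_add' _ _ := rfl
      map_smul' _ _ := rfl } (by
    rintro ⟨c, hc⟩ ⟨g, hg, h⟩
    ext r
    refine (congrFun h fun _ => DirectSum.lof k ℕ (fun n => H k X n) 1 r).symm.trans ?_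
    have (x y : Fin 0 → HStar k X) : g x = g y := congrArg g (Subsingleton.elim x y)
    simp [HSpaceStr.hochD, mul_comm, this _ default])

end HP

/-! ### First Stiefel-Whitney classes -/

section StiefelWhitney

variable {B : Type u} [TopologicalSpace B]

/-- The loop `t ↦ exp(2πit)` in the circle, as a singular `1`-simplex. -/
def loopSimplex : C(stdSimplex ℝ (Fin 2), Circle) :=
  ⟨fun t => Circle.exp (2 * Real.pi * t 1), by
    have : Continuous fun t : stdSimplex ℝ (Fin 2) => t 1 :=
      (continuous_apply (1 : Fin 2)).comp continuous_subtype_val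
    exact Circle.exp.continuous.comp (continuous_const.mul this)⟩

theorem loopSimplex_vertex (i : Fin 2) : loopSimplex (stdSimplex.vertex i) = 1 := by
  fin_cases i <;> simp [loopSimplex]

/-- The class in `H_1(B, ℤ₂)` of a loop in `B`. -/
def loopClass (γ : C(Circle, B)) : H (ZMod 2) B 1 :=
  toH (ZMod 2) 1 ⟨simplex (ZMod 2) (γ.comp loopSimplex), by
    have h (i : Fin 2) : (γ.comp loopSimplex).comp (simplexMap i.succAbove) =
        ContinuousMap.const (stdSimplex ℝ (Fin 1)) (γ 1) := by
      ext t
      rw [Subsingleton.elim t (stdSimplex.vertex 0)]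
      simp [simplexMap, loopSimplex_vertex]
    change dmap (ZMod 2) B 1 0 _ = 0
    rw [d_simplex, Fin.sum_univ_two, h, h]
    simp⟩

/-- `w ∈ H^1(B, ℤ₂) = Hom(H_1(B, ℤ₂), ℤ₂)` is the first Stiefel-Whitney class of the principal
`ℤ₂`-bundle `{ξ : P b ξ}` in `Hom(E, F)`: it vanishes on a loop `γ` if and only if the pullback of
the bundle along `γ` has a section. (This determines `w` since loops generate `H_1`.) -/
def IsW1 {E F : LineBundle.{u, v} B} (P : ∀ b, (E.Fib b ≃ₗ[ℂ] F.Fib b) → Prop)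
    (w : H (ZMod 2) B 1 →ₗ[ZMod 2] ZMod 2) : Prop :=
  ∀ γ : C(Circle, B), w (loopClass γ) = 0 ↔
    ∃ ξ : (E.pullback γ).Iso (F.pullback γ), ∀ t, P (γ t) (ξ.map t)

/-- The action of `α ∈ H^1(B, ℤ₂)` on square roots maps `s = [J, j]` to `s' = [J', j']`: this means
`J' = J ⊗ P` for a real line bundle `P` with `w₁(P) = α`. The associated principal `ℤ₂`-bundle of
`P` consists of the isomorphisms `ι : J_b → J'_b` such that `j'(ι x ⊗ ι y) = j(x ⊗ y)`. -/
def IsTwist {K : LineBundle.{u, v} B} (α : H (ZMod 2) B 1 →ₗ[ZMod 2] ZMod 2) (s s' : SqRoots K) :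
    Prop :=
  ∃ r r' : SquareRoot K, r.cls = s ∧ r'.cls = s' ∧
    IsW1 (E := r.J) (F := r'.J) (fun b ι => ∀ x y : r.J.Fib b,
      r'.j.map b (ι x ⊗ₜ[ℂ] ι y) = r.j.map b (x ⊗ₜ[ℂ] y)) α

end StiefelWhitney

/-! ### Obstruction classes -/

section Obstruction

variable {X : Type u} [TopologicalSpace X]

/-- `o ∈ HP^{2,1}(X, ℤ₂)` is the obstruction class: for some square root `[J, j]` of `K`, it is
the class of the cocycle `a ⊗ b ↦ w₁(Q)(a × b)`, where `Q` is the principal `ℤ₂`-bundle over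
`X × X` of all isomorphisms `ξ : J_x ⊗ J_y ⊗ L_{(x,y)} → J_{μ(x,y)}` squaring to `φ`. -/
def IsObstructionClass {m : HSpaceStr X} {L : LineBundle.{u, v} (X × X)} (φ : PhiIso m L)
    (o : m.HP (ZMod 2) 2 1) : Prop :=
  ∃ (r : SquareRoot (diagBundle L)) (w : H (ZMod 2) (X × X) 1 →ₗ[ZMod 2] ZMod 2)
    (c : m.hochZ (ZMod 2) 2 1),
    IsW1 (E := ((r.J.pullback .fst).tensor (r.J.pullback .snd)).tensor L)
      (F := r.J.pullback m.mul) (SquaresTo φ r) w ∧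
    o = Submodule.Quotient.mk c ∧
    ∀ (p q : ℕ) (a : H (ZMod 2) X p) (b : H (ZMod 2) X q),
      c.1 ![DirectSum.lof (ZMod 2) ℕ (fun n => H (ZMod 2) X n) p a,
        DirectSum.lof (ZMod 2) ℕ (fun n => H (ZMod 2) X n) q b] = w (cross (ZMod 2) p q 1 a b)

/-- A nowhere vanishing continuous section of `s^* K` for a singular simplex `s`. -/
structure SimplexFrame (K : LineBundle.{u, v} X) {n : ℕ} (s : C(stdSimplex ℝ (Fin (n + 1)), X)) where
  toFun : ∀ t, K.Fib (s t)
  continuous : Continuous fun t => K.pt (s t) (toFun t)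
  ne_zero : ∀ t, toFun t ≠ 0

/-- `o ∈ H^2(X, ℤ₂) = Hom(H_2(X, ℤ₂), ℤ₂)` is the mod `2` reduction of the first Chern class of `K`,
which is the primary obstruction to a nowhere vanishing section of `K`: choose frames of `K` over
all singular `1`-simplices which agree at vertices; then `o` is represented by the cocycle
whose value on a `2`-simplex `s` is the degree mod `2` of the map `∂Δ² → ℂ^*` that compares the
chosen frames on the boundary with a frame over `s`. The degree is even if and only if this map
has a continuous square root `g`. -/
def IsMod2Chern (K : LineBundle.{u, v} X) (o : H (ZMod 2) X 2 →ₗ[ZMod 2] ZMod 2) : Prop :=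
  ∃ (e : ∀ s : C(stdSimplex ℝ (Fin 2), X), SimplexFrame K s)
    (c : C(stdSimplex ℝ (Fin 3), X) → ZMod 2),
    (∀ (s s' : C(stdSimplex ℝ (Fin 2), X)) (i i' : Fin 2),
      s (stdSimplex.vertex i) = s' (stdSimplex.vertex i') →
        K.pt _ ((e s).toFun (stdSimplex.vertex i)) =
          K.pt _ ((e s').toFun (stdSimplex.vertex i'))) ∧
    (∀ s : C(stdSimplex ℝ (Fin 3), X), c s = 0 ↔
      ∃ (e' : SimplexFrame K s) (g : stdSimplex ℝ (Fin 3) → ℂ),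
        ContinuousOn g (⋃ i : Fin 3, Set.range (simplexMap i.succAbove)) ∧
        ∀ (i : Fin 3) (t : stdSimplex ℝ (Fin 2)),
          (e (s.comp (simplexMap i.succAbove))).toFun t =
            g (simplexMap i.succAbove t) ^ 2 • e'.toFun (simplexMap i.succAbove t)) ∧
    ∀ z : cycles (ZMod 2) X 2, o (toH (ZMod 2) 2 z) =
      (chainLift (ZMod 2) (fun s => ULift.up (c s)) z.1 : ULift.{u} (ZMod 2)).down

end Obstruction

/-! ### Group completions -/

section GroupCompletion

variable {X : Type u} [TopologicalSpace X] {Y : Type u} [TopologicalSpace Y]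

theorem joined_of_homotopic {f g : C(X, Y)} (h : f.Homotopic g) (x : X) : Joined (f x) (g x) :=
  h.elim fun F => ⟨F.evalAt x⟩

/-- The map `π₀(f)`. -/
def pi0Map (f : C(X, Y)) : ZerothHomotopy X → ZerothHomotopy Y :=
  ZerothHomotopy.lift (fun x => .mk (f x)) fun _ _ p => ZerothHomotopy.sound (p.map f.continuous)

/-- The commutative monoid structure of `π₀(X)`. -/
@[reducible] def HSpaceStr.pi0 (m : HSpaceStr X) : CommMonoid (ZerothHomotopy X) where
  mul := Quotient.map₂ (fun a b => m.mul (a, b)) fun _ _ ⟨p⟩ _ _ ⟨q⟩ =>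
    ⟨(p.prod q).map m.mul.continuous⟩
  one := .mk m.e
  mul_assoc := by
    rintro ⟨a⟩ ⟨b⟩ ⟨c⟩
    exact Quotient.sound (joined_of_homotopic m.assoc ((a, b), c))
  one_mul := by
    rintro ⟨a⟩
    exact Quotient.sound (joined_of_homotopic m.e_mul a)
  mul_one := by
    rintro ⟨a⟩
    exact Quotient.sound (joined_of_homotopic m.mul_e a)
  mul_comm := by
    rintro ⟨a⟩ ⟨b⟩
    exact Quotient.sound (joined_of_homotopic m.comm (a, b))

/-- `f` is a homotopy-theoretic group completion: an H-map to a grouplike H-space such that `π₀(f)`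
is a group completion, and `H_*(f, k)` is the localization at the multiplicative set
`{1_α | α ∈ π₀(X)}` for all fields `k` (in the form of the usual three conditions). -/
structure IsGroupCompletion (mX : HSpaceStr X) (mY : HSpaceStr Y) (f : C(X, Y)) : Prop where
  isHMap : IsHMap mX mY f
  grouplike : ∀ a, ∃ b, Joined (mY.mul (a, b)) mY.e
  pi0 : letI := mX.pi0
    letI := mY.pi0
    (⊤ : Submonoid (ZerothHomotopy X)).IsLocalizationMap (pi0Map f)
  isUnit : ∀ (k : Type) [Field k] (x : X), ∃ r : HStar k Y,
    mY.pont k (hstar k f (one k x)) r = one k mY.e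
  surj : ∀ (k : Type) [Field k] (z : HStar k Y), ∃ (x : X) (r : HStar k X),
    mY.pont k (hstar k f (one k x)) z = hstar k f r
  exists_of_eq_zero : ∀ (k : Type) [Field k] (r : HStar k X), hstar k f r = 0 →
    ∃ x : X, mX.pont k (one k x) r = 0

/-- `X` has the homotopy type of a CW complex. -/
def HasCWType (X : Type u) [TopologicalSpace X] : Prop :=
  ∃ (Z : Type u) (_ : TopologicalSpace Z) (_ : T2Space Z),
    Nonempty (CWComplex (Set.univ : Set Z)) ∧ Nonempty (ContinuousMap.HomotopyEquiv X Z)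

end GroupCompletion

end HochPont

end

open HochPont

noncomputable section

namespace HochPont

/-! ### Signs and locally constant differences -/

/-! Line bundles are handled relative to a fixed, possibly discontinuous, nowhere vanishing
reference section. A `FrameSys` records which functions `ρ : B → ℂˣ` turn that section into a
continuous local frame. Tensor products and pullbacks become `*` and `comap`, isomorphisms become
equalities up to `scale`, and a square root, after pointwise normalization, becomes an equation `G *
G = F`. Two roots of the same `F` differ by a double cover (a `SignTwist`) with class `rootW` in
degree-one cohomology. This class is additive and natural. Over spaces of CW homotopy type it
vanishes exactly when the roots are isomorphic, and twisting a root realizes every class. This gives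
(a).

For (b) and (c), let `w = obsW` be the class of the cover `Q` attached to a root. The root is
compatible if and only if `w = 0`. Twisting the root by `α` changes `w` by `δα = π₁^*α + π₂^*α +
μ^*α` (`obsW_change`), and `δ` is the Hochschild differential on degree-one cochains
(`crossCochain_delta`). Hence classes in `HP^{1,1}` preserve compatibility, and `w` modulo
coboundaries does not depend on the root. The homotopies `θ` and `ζ` enter through homotopy
invariance of `rootW` (`rootW_slice`): `θ` gives naturality of `w` (`obsW_map`), and `ζ` gives the
identity `IsAssoc`, which is the cocycle condition.

For (d), if `δα = 0` then `α` is invariant under translation by points. Every class of `H_1(Y)` is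
translated into the image of `H_1(X)` by some `f(x)`, so `f^*α = 0` forces `α = 0`; this is
injectivity. For surjectivity, restricting `φ_Y` to `{y} × Y` shows that `K_Y` and its translates
differ by squares. The mod 2 Chern class is therefore translation invariant, and it vanishes because
it vanishes on the image of `f_*`; so `K_Y` has some root `G`. The difference `g` between `f^*G` and
the given compatible root satisfies `(f × f)^*w = δg`. By `IsGroupCompletion.exists_delta_eq` there
is `α` with `w = δα` and `f^*α = g`, and the twist of `G` by `α` is the required preimage.

The topological input is `exists_local_potential`: points of a CW complex have small neighbourhoods
on which degree-one cocycles are coboundaries. It serves to build double covers with prescribed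
class and to glue local square roots when the mod 2 Chern class vanishes
(`exists_root_of_locallyFlat`). Homotopy invariance of both kinds of objects carries these results
to spaces of CW homotopy type. -/

theorem zmod_two_add_self (a : ZMod 2) : a + a = 0 := CharTwo.add_self_eq_zero a

theorem zmod_two_cases (a : ZMod 2) : a = 0 ∨ a = 1 := by
  revert a; decide

theorem zmod_two_eq_of_iff {a b : ZMod 2} (h : a = 0 ↔ b = 0) : a = b := by
  revert a b; decide

theorem zmod_two_add_eq_zero {a b : ZMod 2} : a + b = 0 ↔ a = b := by
  revert a b; decide

/-- The function `ε` is constant near `x` up to the function `ε'`. -/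
def NearConst {B : Type*} (l : Filter B) (ε ε' : B → ZMod 2) (x : B) : Prop :=
  ∀ᶠ y in l, ε y + ε' y = ε x + ε' x

section NearConst

variable {B : Type*} {l : Filter B} {ε ε' ε'' : B → ZMod 2} {x : B}

theorem NearConst.refl : NearConst l ε ε x := by simp [NearConst, zmod_two_add_self]

theorem NearConst.symm (h : NearConst l ε ε' x) : NearConst l ε' ε x := by
  simpa [NearConst, add_comm] using h

theorem NearConst.trans (h : NearConst l ε ε' x) (h' : NearConst l ε' ε'' x) :
    NearConst l ε ε'' x := by
  filter_upwards [h, h'] with y hy hy'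
  have : ε y + ε'' y = (ε y + ε' y) + (ε' y + ε'' y) := by
    rw [add_assoc, ← add_assoc (ε' y), zmod_two_add_self, zero_add]
  rw [this, hy, hy', add_assoc, ← add_assoc (ε' x), zmod_two_add_self, zero_add]

theorem NearConst.comp {T : Type*} {lT : Filter T} {g : T → B} {t : T}
    (h : NearConst l ε ε' (g t)) (hg : Filter.Tendsto g lT l) :
    NearConst lT (ε ∘ g) (ε' ∘ g) t := hg.eventually h

theorem NearConst.add {ρ ρ' : B → ZMod 2} (h : NearConst l ε ε' x) (h' : NearConst l ρ ρ' x) :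
    NearConst l (ε + ρ) (ε' + ρ') x := by
  filter_upwards [h, h'] with y hy hy'
  simp only [Pi.add_apply]
  rw [add_add_add_comm, hy, hy', add_add_add_comm]

end NearConst

/-! ### Double covers in terms of sign functions -/

/-- A double cover of `B` with a chosen point in each fibre, described by the sign functions that
are continuous sections at a given point. -/
structure SignTwist (B : Type*) [TopologicalSpace B] where
  adm : (B → ZMod 2) → B → Prop
  adm_iff : ∀ {ε ε' : B → ZMod 2} {x : B}, adm ε x → (adm ε' x ↔ NearConst (𝓝 x) ε ε' x)
  exists_adm : ∀ x, ∃ ε, ∀ᶠ y in 𝓝 x, adm ε y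

namespace SignTwist

variable {B : Type*} [TopologicalSpace B] {T : Type*} [TopologicalSpace T]
  {S : Type*} [TopologicalSpace S]

/-- The pullback of a double cover. -/
def comap (τ : SignTwist B) (g : C(T, B)) : SignTwist T where
  adm ε t := ∃ ε₀, τ.adm ε₀ (g t) ∧ NearConst (𝓝 t) ε (ε₀ ∘ g) t
  adm_iff := by
    rintro ε ε' x ⟨ε₀, h₀, h⟩
    refine ⟨?_, fun h' => ⟨ε₀, h₀, h'.symm.trans h⟩⟩
    rintro ⟨ε₁, h₁, h'⟩
    exact h.trans ((((τ.adm_iff h₀).1 h₁).comp g.continuous.continuousAt).trans h'.symm)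
  exists_adm x := by
    obtain ⟨ε, h⟩ := τ.exists_adm (g x)
    refine ⟨ε ∘ g, (g.continuous.continuousAt.eventually h).mono fun t ht => ?_⟩
    exact ⟨ε, ht, .refl⟩

/-- Global sections. -/
def IsSection (τ : SignTwist B) (ε : B → ZMod 2) : Prop := ∀ x, τ.adm ε x

theorem adm_comap (τ : SignTwist B) (g : C(T, B)) {ε : B → ZMod 2} {t : T} (h : τ.adm ε (g t)) :
    (τ.comap g).adm (ε ∘ g) t := ⟨ε, h, .refl⟩

/-- The relation `NearConst` built into `comap` makes pullback strictly functorial, so later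
arguments can rewrite with it. -/
theorem comap_comap (τ : SignTwist B) (g : C(T, B)) (k : C(S, T)) :
    (τ.comap g).comap k = τ.comap (g.comp k) := by
  have : ((τ.comap g).comap k).adm = (τ.comap (g.comp k)).adm := by
    funext ε s
    refine propext ⟨?_, ?_⟩
    · rintro ⟨ε₀, ⟨ε₁, h₁, h₂⟩, h⟩
      exact ⟨ε₁, h₁, h.trans (h₂.comp k.continuous.continuousAt)⟩
    · rintro ⟨ε₁, h₁, h⟩
      exact ⟨ε₁ ∘ g, ⟨ε₁, h₁, .refl⟩, h⟩
  revert this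
  generalize (τ.comap g).comap k = a
  generalize τ.comap (g.comp k) = b
  intro h
  cases a; cases b; cases h; rfl

theorem IsSection.comap {τ : SignTwist B} {ε : B → ZMod 2} (h : τ.IsSection ε) (g : C(T, B)) :
    (τ.comap g).IsSection (ε ∘ g) := fun t => τ.adm_comap g (h (g t))

theorem comap_const (τ : SignTwist B) (b : B) :
    (τ.comap (.const T b)).IsSection fun _ => 0 := by
  intro t
  obtain ⟨ε, h⟩ := τ.exists_adm b
  exact ⟨ε, h.self_of_nhds, by simp [NearConst]⟩

theorem IsSection.isLocallyConstant {τ : SignTwist B} {ε ε' : B → ZMod 2} (h : τ.IsSection ε)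
    (h' : τ.IsSection ε') : IsLocallyConstant (ε + ε') :=
  (IsLocallyConstant.iff_eventually_eq _).2 fun x => (τ.adm_iff (h x)).1 (h' x)

theorem IsSection.add_eq [PreconnectedSpace B] {τ : SignTwist B} {ε ε' : B → ZMod 2}
    (h : τ.IsSection ε) (h' : τ.IsSection ε') (x y : B) : ε x + ε' x = ε y + ε' y :=
  (h.isLocallyConstant h').apply_eq_of_isPreconnected isPreconnected_univ trivial trivial

theorem IsSection.add_eq' [PreconnectedSpace B] {τ : SignTwist B} {ε ε' : B → ZMod 2}
    (h : τ.IsSection ε) (h' : τ.IsSection ε') (x y : B) : ε x + ε y = ε' x + ε' y := by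
  have := h.add_eq h' x y
  revert this
  generalize ε x = a
  generalize ε y = b
  generalize ε' x = c
  generalize ε' y = d
  revert a b c d
  decide

theorem IsSection.add_const {τ : SignTwist B} {ε : B → ZMod 2} (h : τ.IsSection ε) (c : ZMod 2) :
    τ.IsSection fun x => ε x + c := fun x => (τ.adm_iff (h x)).2 (.of_forall fun y => by
  simp only [← add_assoc, zmod_two_add_self])

/-- Gluing along the unit interval. -/
theorem unitInterval_glue (P : I → I → Prop)
    (loc : ∀ t, ∃ U, IsOpen U ∧ t ∈ U ∧ ∀ a b, Set.Icc a b ⊆ U → a ≤ b → P a b)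
    (glue : ∀ a b c, a ≤ b → b ≤ c → P a b → P b c → P a c) : P 0 1 := by
  choose U hU hm hP using loc
  obtain ⟨t, h0, hmono, ⟨n, hn⟩, hsub⟩ := exists_monotone_Icc_subset_open_cover_unitInterval
    (c := U) hU (fun x _ => Set.mem_iUnion.2 ⟨x, hm x⟩)
  have key (m : ℕ) : P (t 0) (t m) := by
    induction m with
    | zero =>
      obtain ⟨i, hi⟩ := hsub 0
      exact hP i _ _ ((Set.Icc_subset_Icc le_rfl (hmono (Nat.zero_le 1))).trans hi) le_rfl
    | succ m ih =>
      obtain ⟨i, hi⟩ := hsub m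
      exact glue _ _ _ (hmono (Nat.zero_le m)) (hmono m.le_succ) ih (hP i _ _ hi (hmono m.le_succ))
  have := key n
  rwa [h0, hn n le_rfl] at this

/-- The inclusion of a slice. -/
def slice (B : Type*) [TopologicalSpace B] (t : I) : C(B, I × B) := ⟨fun b => (t, b), by fun_prop⟩

/-- The inclusion of an interval. -/
def line (b : B) : C(I, I × B) := ⟨fun t => (t, b), by fun_prop⟩

/-- Local extension of sections along intervals. -/
theorem exists_adm_nhds (τ : SignTwist (I × B)) (b₀ : B) : ∃ ε : I × B → ZMod 2,
    ∀ᶠ b in 𝓝 b₀, ∀ t, τ.adm ε (t, b) := by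
  -- The comparison filter is restricted to the strip over `[a, c]`: at its ends the sign function
  -- need only be right from one side, which makes strips easy to glue.
  let P (a c : I) : Prop := ∃ ε : I × B → ZMod 2, ∀ᶠ b in 𝓝 b₀, ∀ t ∈ Set.Icc a c,
    ∃ ε', τ.adm ε' (t, b) ∧ NearConst (𝓝[Set.Icc a c ×ˢ Set.univ] (t, b)) ε ε' (t, b)
  have : P 0 1 := by
    refine unitInterval_glue P ?_ ?_
    · intro t
      obtain ⟨ε, h⟩ := τ.exists_adm (t, b₀)
      rw [nhds_prod_eq, Filter.eventually_prod_iff] at h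
      obtain ⟨p, hp, q, hq, h⟩ := h
      obtain ⟨U, hU, hUo, htU⟩ := mem_nhds_iff.1 hp
      refine ⟨U, hUo, htU, fun a b hab _ => ⟨ε, hq.mono fun y hy t' ht' => ?_⟩⟩
      exact ⟨ε, h (hU (hab ht')) hy, .refl⟩
    · rintro a b c hab hbc ⟨ε₁, h₁⟩ ⟨ε₂, h₂⟩
      -- On the second strip the sign is corrected by the discrepancy on the common slice at `b`. It
      -- depends only on the second coordinate and is locally constant by `hd`.
      refine ⟨fun p => if p.1 ≤ b then ε₁ p else ε₂ p + (ε₂ (b, p.2) + ε₁ (b, p.2)), ?_⟩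
      have hev := (h₁.and h₂).eventually_nhds
      filter_upwards [hev] with y hy t ht
      have hy1 := hy.self_of_nhds.1
      have hy2 := hy.self_of_nhds.2
      -- the two sections differ by a locally constant function on the common slice
      have hd : ∀ᶠ y' in 𝓝 y, ε₂ (b, y') + ε₁ (b, y') = ε₂ (b, y) + ε₁ (b, y) := by
        obtain ⟨ρ₁, k₁, n₁⟩ := hy1 b ⟨hab, le_rfl⟩
        obtain ⟨ρ₂, k₂, n₂⟩ := hy2 b ⟨le_rfl, hbc⟩
        have ht {s : Set I} (hs : b ∈ s) : Filter.Tendsto (fun y' : B => (b, y')) (𝓝 y)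
            (𝓝[s ×ˢ Set.univ] (b, y)) :=
          tendsto_nhdsWithin_iff.2 ⟨Continuous.tendsto (by fun_prop) y,
            .of_forall fun _ => ⟨hs, trivial⟩⟩
        have e₁ := n₁.comp (g := fun y' : B => (b, y')) (t := y) (ht ⟨hab, le_rfl⟩)
        have e₂ := n₂.comp (g := fun y' : B => (b, y')) (t := y) (ht ⟨le_rfl, hbc⟩)
        have e₃ := ((τ.adm_iff k₁).1 k₂).comp (g := fun y' : B => (b, y')) (t := y)
          (Continuous.tendsto (by fun_prop) y)
        exact (e₂.trans (e₃.symm.trans e₁.symm))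
      have hd' (t' : I) : ∀ᶠ p : I × B in 𝓝 (t', y),
          ε₂ (b, p.2) + ε₁ (b, p.2) = ε₂ (b, y) + ε₁ (b, y) :=
        (continuous_snd.tendsto (t', y)).eventually hd
      rcases lt_trichotomy t b with htb | rfl | htb
      · obtain ⟨ρ, k, n⟩ := hy1 t ⟨ht.1, htb.le⟩
        refine ⟨ρ, k, ?_⟩
        have hlt : ∀ᶠ p : I × B in 𝓝[Set.Icc a c ×ˢ Set.univ] (t, y), p.1 < b :=
          ((continuous_fst.tendsto (t, y)).eventually (gt_mem_nhds htb)).filter_mono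
            nhdsWithin_le_nhds
        have := eventually_nhdsWithin_iff.1 n
        filter_upwards [hlt, this.filter_mono nhdsWithin_le_nhds, self_mem_nhdsWithin] with p hp hq hs
        have := hq ⟨⟨hs.1.1, hp.le⟩, trivial⟩
        simpa [hp.le, htb.le] using this
      · obtain ⟨ρ₁, k₁, n₁⟩ := hy1 t ⟨hab, le_rfl⟩
        obtain ⟨ρ₂, k₂, n₂⟩ := hy2 t ⟨le_rfl, hbc⟩
        refine ⟨ρ₁, k₁, ?_⟩
        have m := (τ.adm_iff k₁).1 k₂
        have n₁' := (eventually_nhdsWithin_iff.1 n₁).filter_mono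
          (nhdsWithin_le_nhds (s := Set.Icc a c ×ˢ Set.univ))
        have n₂' := (eventually_nhdsWithin_iff.1 n₂).filter_mono
          (nhdsWithin_le_nhds (s := Set.Icc a c ×ˢ Set.univ))
        have hd'' := (hd' t).filter_mono (nhdsWithin_le_nhds (s := Set.Icc a c ×ˢ Set.univ))
        have m' : ∀ᶠ p in 𝓝[Set.Icc a c ×ˢ Set.univ] (t, y), _ := m.filter_mono nhdsWithin_le_nhds
        filter_upwards [n₁', n₂', hd'', m', self_mem_nhdsWithin] with p q₁ q₂ q₃ q₄ hs
        simp only [le_refl, if_true]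
        split_ifs with hp
        · exact q₁ ⟨⟨hs.1.1, hp⟩, trivial⟩
        · have := q₂ ⟨⟨(not_le.1 hp).le, hs.1.2⟩, trivial⟩
          rw [q₃]
          revert this q₄
          generalize ε₂ p = A
          generalize ρ₁ p = A'
          generalize ρ₂ p = A''
          generalize ε₁ (t, y) = B₁
          generalize ε₂ (t, y) = B₂
          generalize ρ₁ (t, y) = B₃
          generalize ρ₂ (t, y) = B₄
          clear * -
          revert A A' A'' B₁ B₂ B₃ B₄
          decide
      · obtain ⟨ρ, k, n⟩ := hy2 t ⟨htb.le, ht.2⟩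
        refine ⟨ρ, k, ?_⟩
        have hlt : ∀ᶠ p : I × B in 𝓝[Set.Icc a c ×ˢ Set.univ] (t, y), b < p.1 :=
          ((continuous_fst.tendsto (t, y)).eventually (lt_mem_nhds htb)).filter_mono
            nhdsWithin_le_nhds
        have hd'' := (hd' t).filter_mono (nhdsWithin_le_nhds (s := Set.Icc a c ×ˢ Set.univ))
        have := eventually_nhdsWithin_iff.1 n
        filter_upwards [hlt, this.filter_mono nhdsWithin_le_nhds, self_mem_nhdsWithin, hd'']
          with p hp hq hs hr
        have := hq ⟨⟨hp.le, hs.1.2⟩, trivial⟩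
        simp only [not_le.2 hp, not_le.2 htb, if_false, hr]
        rw [add_right_comm, this, add_right_comm]
  obtain ⟨ε, h⟩ := this
  refine ⟨ε, h.mono fun b hb t => ?_⟩
  obtain ⟨ε', h1, h2⟩ := hb t ⟨t.2.1, t.2.2⟩
  refine (τ.adm_iff h1).2 (NearConst.symm ?_)
  have : Set.Icc (0 : I) 1 ×ˢ (Set.univ : Set B) = Set.univ := by
    ext p
    simp [unitInterval.le_one']
  rwa [this, nhdsWithin_univ] at h2

/-- Sections extend along intervals. -/
theorem exists_section_prod (τ : SignTwist (I × B)) {ε₀ : B → ZMod 2}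
    (h₀ : (τ.comap (slice B 0)).IsSection ε₀) :
    ∃ ε, τ.IsSection ε ∧ ∀ b, ε (0, b) = ε₀ b := by
  choose s hs using τ.exists_adm_nhds
  -- On each line `I × {b}` a local section is normalized to take the prescribed value at time `0`.
  refine ⟨fun p => s p.2 p + (s p.2 (0, p.2) + ε₀ p.2), ?_, fun b => by
    change s b (0, b) + (s b (0, b) + ε₀ b) = ε₀ b
    rw [← add_assoc, zmod_two_add_self, zero_add]⟩
  rintro ⟨t, b⟩
  have hb := (hs b).self_of_nhds t
  refine (τ.adm_iff hb).2 ?_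
  -- Although `s b'` and `s b` are unrelated choices, both are sections over the line through `b'`,
  -- so their increments from time `0` agree.
  have h1 : ∀ᶠ b' in 𝓝 b, ∀ t', s b' (t', b') + s b' (0, b') = s b (t', b') + s b (0, b') := by
    filter_upwards [hs b] with b' hb' t'
    exact IsSection.add_eq' (τ := τ.comap (line b')) (ε := s b' ∘ line b') (ε' := s b ∘ line b')
      (fun t => τ.adm_comap (line b') ((hs b').self_of_nhds t))
      (fun t => τ.adm_comap (line b') (hb' t)) t' 0
  have h2 : NearConst (𝓝 b) (s b ∘ slice B 0) ε₀ b :=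
    ((τ.comap (slice B 0)).adm_iff (τ.adm_comap (slice B 0) ((hs b).self_of_nhds 0))).1 (h₀ b)
  filter_upwards [(continuous_snd.tendsto (t, b)).eventually h1,
    (continuous_snd.tendsto (t, b)).eventually h2] with p hp1 hp2
  have e1 := hp1 p.1
  have e2 := h1.self_of_nhds t
  simp only [Function.comp_apply, slice, ContinuousMap.coe_mk] at hp2
  rw [← add_assoc (s p.2 p), show s p.2 p = s p.2 (p.1, p.2) from rfl, e1]
  rw [add_assoc, hp2, ← add_assoc, zmod_two_add_self]
  simp only [← add_assoc, zmod_two_add_self]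

/-- Homotopic maps pull back trivial covers to trivial covers. -/
theorem exists_section_of_homotopic (τ : SignTwist B) {f g : C(T, B)} (h : f.Homotopic g)
    (hf : ∃ ε, (τ.comap f).IsSection ε) : ∃ ε, (τ.comap g).IsSection ε := by
  obtain ⟨H⟩ := h
  obtain ⟨ε, hε⟩ := hf
  have e0 : H.toContinuousMap.comp (slice T 0) = f := ContinuousMap.ext fun x => H.apply_zero x
  have e1 : H.toContinuousMap.comp (slice T 1) = g := ContinuousMap.ext fun x => H.apply_one x
  obtain ⟨ρ, hρ, -⟩ := (τ.comap H.toContinuousMap).exists_section_prod (ε₀ := ε)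
    (by rw [comap_comap, e0]; exact hε)
  refine ⟨ρ ∘ slice T 1, ?_⟩
  rw [← e1, ← comap_comap]
  exact hρ.comap _

/-- The identity is homotopic to a constant map, and covers pulled back along constant maps are
trivial. -/
theorem exists_section_of_contractible [ContractibleSpace B] (τ : SignTwist B) :
    ∃ ε, τ.IsSection ε := by
  obtain ⟨b, hb⟩ := id_nullhomotopic B
  have := τ.exists_section_of_homotopic hb.symm ⟨_, τ.comap_const b⟩
  obtain ⟨ε, h⟩ := this
  refine ⟨ε, fun x => ?_⟩
  obtain ⟨ε₀, h1, h2⟩ := h x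
  exact (τ.adm_iff h1).2 h2.symm

end SignTwist

/-! ### Flat functions on paths and first cohomology -/

/-- The standard simplex. -/
abbrev Simp (n : ℕ) : Type := stdSimplex ℝ (Fin (n + 1))

instance (n : ℕ) : ContractibleSpace (Simp n) :=
  (convex_stdSimplex ℝ (Fin (n + 1))).contractibleSpace ⟨_, (stdSimplex.vertex (S := ℝ) 0).2⟩

/-- The two vertices of the standard `1`-simplex. -/
abbrev v0 : Simp 1 := stdSimplex.vertex 0

abbrev v1 : Simp 1 := stdSimplex.vertex 1

/-- The `i`-th face of the standard simplex. -/
abbrev faceMap {n : ℕ} (i : Fin (n + 2)) : C(Simp n, Simp (n + 1)) := simplexMap i.succAbove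

section Flat

variable {B : Type*} [TopologicalSpace B] {T : Type*} [TopologicalSpace T]

theorem simplexMap_vertex {m n : ℕ} (a : Fin (m + 1) → Fin (n + 1)) (i : Fin (m + 1)) :
    simplexMap a (stdSimplex.vertex i) = stdSimplex.vertex (a i) :=
  stdSimplex.map_vertex a i

/-- A function on paths whose sum over the boundary of each `2`-simplex in `U` vanishes. -/
def FlatOn (f : C(Simp 1, B) → ZMod 2) (U : Set B) : Prop :=
  ∀ s : C(Simp 2, B), (∀ x, s x ∈ U) → ∑ i : Fin 3, f (s.comp (faceMap i)) = 0

/-- The holonomy of a double cover. -/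
def SignTwist.hol (τ : SignTwist B) (s : C(Simp 1, B)) : ZMod 2 :=
  let ε := (τ.comap s).exists_section_of_contractible.choose
  ε v0 + ε v1

/-- Over the connected simplex two sections differ by a constant, which drops out of the sum of the
end values. -/
theorem SignTwist.hol_eq (τ : SignTwist B) (s : C(Simp 1, B)) {ε : Simp 1 → ZMod 2}
    (h : (τ.comap s).IsSection ε) : τ.hol s = ε v0 + ε v1 :=
  IsSection.add_eq' (τ.comap s).exists_section_of_contractible.choose_spec h _ _

theorem SignTwist.hol_comap (τ : SignTwist B) (g : C(T, B)) (s : C(Simp 1, T)) :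
    (τ.comap g).hol s = τ.hol (g.comp s) := by
  obtain ⟨ε, h⟩ := ((τ.comap g).comap s).exists_section_of_contractible
  rw [SignTwist.hol_eq _ _ h, SignTwist.hol_eq _ _ (by rwa [comap_comap] at h)]

/-- A section over the whole triangle computes all three holonomies, and each vertex value occurs
twice. -/
theorem SignTwist.flatOn_hol (τ : SignTwist B) (U : Set B) : FlatOn τ.hol U := by
  intro s _
  obtain ⟨ε, h⟩ := (τ.comap s).exists_section_of_contractible
  have (i : Fin 3) : τ.hol (s.comp (faceMap i)) =
      ε (stdSimplex.vertex (i.succAbove 0)) + ε (stdSimplex.vertex (i.succAbove 1)) := by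
    have := h.comap (faceMap i)
    rw [comap_comap] at this
    rw [τ.hol_eq _ this]
    simp only [Function.comp_apply, simplexMap_vertex]
  simp only [this, Fin.sum_univ_three]
  have e (a b c : ZMod 2) : (b + c) + (a + c) + (a + b) = 0 := by revert a b c; decide
  exact e _ _ _

end Flat

section FlatCohomology

variable {B : Type u} [TopologicalSpace B] {T : Type u} [TopologicalSpace T]

/-- Modulo 2 the alternating signs of the boundary disappear, so flatness is the cocycle condition.
-/
theorem chainLift_d (f : C(Simp 1, B) → ZMod 2) (s : C(Simp 2, B)) :
    (chainLift (ZMod 2) (fun s => ULift.up (f s))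
      (dmap (ZMod 2) B 2 1 (simplex (ZMod 2) s)) : ULift.{u} (ZMod 2)).down =
        ∑ i : Fin 3, f (s.comp (faceMap i)) := by
  rw [d_simplex]
  change (ULift.moduleEquiv (R := ZMod 2) (M := ZMod 2)) _ = _
  rw [map_sum, map_sum]
  refine Finset.sum_congr rfl fun i _ => ?_
  rw [map_zsmul, map_zsmul, chainLift_simplex]
  rcases neg_one_pow_eq_or ℤ (i : ℕ) with h | h
  · rw [h, one_smul]
    rfl
  · rw [h, neg_one_zsmul, ZMod.neg_eq_self_mod_two]
    rfl

/-- The element of `H^1(B, ℤ₂)` defined by a flat function on paths. -/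
def ofFlat (f : C(Simp 1, B) → ZMod 2) (hf : FlatOn f Set.univ) :
    H (ZMod 2) B 1 →ₗ[ZMod 2] ZMod 2 :=
  ULift.moduleEquiv.toLinearMap ∘ₗ descH (M := ULift.{u} (ZMod 2))
    ((chainLift (ZMod 2) fun s => ULift.up (f s)) ∘ₗ (cycles (ZMod 2) B 1).subtype) (by
      rintro z ⟨y, hy⟩
      have : (chainLift (ZMod 2) fun s => ULift.up.{u} (f s)) ∘ₗ dmap (ZMod 2) B 2 1 = 0 :=
        chain_ext _ fun s => ULift.ext _ _ ((chainLift_d f s).trans (hf s fun _ => trivial))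
      simpa [← hy] using LinearMap.congr_fun this y)

theorem ofFlat_toH (f : C(Simp 1, B) → ZMod 2) (hf) (z : cycles (ZMod 2) B 1) :
    ofFlat f hf (toH (ZMod 2) 1 z) =
      (chainLift (ZMod 2) (fun s => ULift.up (f s)) z.1 : ULift.{u} (ZMod 2)).down := by
  simp [ofFlat, descH_toH]

theorem ofFlat_loopClass (f : C(Simp 1, B) → ZMod 2) (hf) (γ : C(Circle, B)) :
    ofFlat f hf (loopClass γ) = f (γ.comp loopSimplex) := by
  rw [loopClass, ofFlat_toH, chainLift_simplex]

theorem chainLift_cmap (f : C(Simp 1, B) → ZMod 2) (g : C(T, B)) (z) :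
    (chainLift (ZMod 2) (fun s => ULift.up (f s)) (cmap (ZMod 2) 1 g z) : ULift.{u} (ZMod 2)) =
      chainLift (ZMod 2) (fun s => ULift.up (f (g.comp s))) z := by
  have : (chainLift (ZMod 2) (fun s => ULift.up.{u} (f s))) ∘ₗ (cmap (ZMod 2) 1 g) =
      chainLift (ZMod 2) (fun s => ULift.up (f (g.comp s))) :=
    chain_ext _ fun s => by simp [cmap_simplex]
  exact LinearMap.congr_fun this z

/-- The first Stiefel-Whitney class. -/
def SignTwist.w1 (τ : SignTwist B) : H (ZMod 2) B 1 →ₗ[ZMod 2] ZMod 2 :=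
  ofFlat τ.hol (τ.flatOn_hol _)

theorem SignTwist.w1_comap (τ : SignTwist B) (g : C(T, B)) :
    (τ.comap g).w1 = τ.w1 ∘ₗ hmap (ZMod 2) 1 g := by
  ext c
  obtain ⟨z, rfl⟩ := toH_surjective _ 1 c
  simp only [LinearMap.comp_apply, SignTwist.w1, hmap_toH, ofFlat_toH, chainLift_cmap, hol_comap]

theorem loopSimplex_apply (t : Simp 1) : loopSimplex t = Circle.exp (2 * Real.pi * t 1) := rfl

theorem simp_one_ext {s t : Simp 1} (h : s 1 = t 1) : s = t := by
  ext i
  have hs := stdSimplex.add_eq_one s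
  have ht := stdSimplex.add_eq_one t
  fin_cases i
  · simp; linarith
  · exact h

/-- The parameters differ by an integer, and since both lie in `[0, 1]` this integer is `-1`, `0` or
`1`. -/
theorem loopSimplex_eq_iff {s t : Simp 1} (h : loopSimplex s = loopSimplex t) :
    s = t ∨ (s = v0 ∧ t = v1) ∨ (s = v1 ∧ t = v0) := by
  rw [loopSimplex_apply, loopSimplex_apply, Circle.exp_eq_exp] at h
  obtain ⟨m, hm⟩ := h
  have hpi := Real.pi_pos
  have hm' : s 1 = t 1 + m := by
    have : (2 * Real.pi) * s 1 = (2 * Real.pi) * (t 1 + m) := by rw [hm]; ring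
    exact mul_left_cancel₀ (by positivity) this
  have h0 := stdSimplex.zero_le s 1
  have h1 := stdSimplex.le_one s 1
  have h2 := stdSimplex.zero_le t 1
  have h3 := stdSimplex.le_one t 1
  have hv0 : (v0 : Simp 1) 1 = 0 := by simp
  have hv1 : (v1 : Simp 1) 1 = 1 := by simp
  have hle : m ≤ 1 := by
    by_contra hh
    have : (2 : ℝ) ≤ m := by exact_mod_cast (by omega : (2 : ℤ) ≤ m)
    linarith
  have hge : -1 ≤ m := by
    by_contra hh
    have : (m : ℝ) ≤ -2 := by exact_mod_cast (by omega : m ≤ (-2 : ℤ))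
    linarith
  have : m = -1 ∨ m = 0 ∨ m = 1 := by omega
  rcases this with rfl | rfl | rfl
  · push_cast at hm'
    exact .inr (.inl ⟨simp_one_ext (by rw [hv0]; linarith), simp_one_ext (by rw [hv1]; linarith)⟩)
  · push_cast at hm'
    exact .inl (simp_one_ext (by linarith))
  · push_cast at hm'
    exact .inr (.inr ⟨simp_one_ext (by rw [hv1]; linarith), simp_one_ext (by rw [hv0]; linarith)⟩)

theorem loopSimplex_surjective : Function.Surjective loopSimplex := by
  intro z
  obtain ⟨x, rfl⟩ := Circle.exp_surjective z
  have hpi := Real.pi_pos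
  let y := Int.fract (x / (2 * Real.pi))
  refine ⟨⟨![1 - y, y], ?_, ?_⟩, ?_⟩
  · intro i
    fin_cases i
    · simpa using (Int.fract_lt_one _).le
    · exact Int.fract_nonneg _
  · simp [Fin.sum_univ_two]
  · rw [loopSimplex_apply, Circle.exp_eq_exp]
    refine ⟨-⌊x / (2 * Real.pi)⌋, ?_⟩
    change 2 * Real.pi * Int.fract (x / (2 * Real.pi)) = _
    rw [Int.fract]
    push_cast
    field_simp
    ring

instance (n : ℕ) : CompactSpace (Simp n) := isCompact_iff_compactSpace.1 (isCompact_stdSimplex ℝ _)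

theorem loopSimplex_isClosedMap : IsClosedMap loopSimplex := loopSimplex.continuous.isClosedMap

theorem loopSimplex_isQuotientMap : IsQuotientMap loopSimplex :=
  loopSimplex_isClosedMap.isQuotientMap loopSimplex.continuous loopSimplex_surjective

/-- A closed path is a loop. -/
theorem exists_loop {B : Type*} [TopologicalSpace B] (p : C(Simp 1, B)) (h : p v0 = p v1) :
    ∃ γ : C(Circle, B), γ.comp loopSimplex = p := by
  refine ⟨loopSimplex_isQuotientMap.lift p fun s t hst => ?_, loopSimplex_isQuotientMap.lift_comp ..⟩
  rcases loopSimplex_eq_iff hst with rfl | ⟨rfl, rfl⟩ | ⟨rfl, rfl⟩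
  · rfl
  · exact h
  · exact h.symm

/-- A double cover is trivial over a loop if and only if its holonomy vanishes. -/
theorem SignTwist.hol_loop_eq_zero_iff {B : Type*} [TopologicalSpace B] (τ : SignTwist B)
    (γ : C(Circle, B)) :
    τ.hol (γ.comp loopSimplex) = 0 ↔ ∃ ε, (τ.comap γ).IsSection ε := by
  constructor
  · intro h
    obtain ⟨ε, hε⟩ := ((τ.comap γ).comap loopSimplex).exists_section_of_contractible
    rw [← hol_comap, SignTwist.hol_eq _ _ hε, zmod_two_add_eq_zero] at h
    have hc (s t) (hst : loopSimplex s = loopSimplex t) : ε s = ε t := by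
      rcases loopSimplex_eq_iff hst with rfl | ⟨rfl, rfl⟩ | ⟨rfl, rfl⟩
      · rfl
      · exact h
      · exact h.symm
    -- Vanishing holonomy means equal end values, so the section over the simplex descends to a
    -- function on the circle.
    obtain ⟨ε₁, hs⟩ : ∃ ε₁ : Circle → ZMod 2, ∀ t, ε₁ (loopSimplex t) = ε t :=
      ⟨fun z => ε (loopSimplex_surjective z).choose, fun t =>
        hc _ _ (loopSimplex_surjective (loopSimplex t)).choose_spec⟩
    refine ⟨ε₁, fun z => ?_⟩
    obtain ⟨ε', h'⟩ := (τ.comap γ).exists_adm z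
    refine ((τ.comap γ).adm_iff h'.self_of_nhds).2 ?_
    have key : ∀ t, loopSimplex t = z → ∀ᶠ t' in 𝓝 t,
        ε t' + ε' (loopSimplex t') = ε t + ε' z := by
      rintro t rfl
      exact ((((τ.comap γ).comap loopSimplex).adm_iff (hε t)).1
        ((τ.comap γ).adm_comap loopSimplex h'.self_of_nhds))
    obtain ⟨t₀, ht₀⟩ := loopSimplex_surjective z
    -- The fibre over the base point has two points, so the local comparison is collected on a
    -- neighbourhood of the whole fibre. Since `loopSimplex` is closed, such a neighbourhood
    -- contains the preimage of a neighbourhood of `z`.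
    have hev : ∀ᶠ t' in 𝓝ˢ (loopSimplex ⁻¹' {z}), ε t' + ε' (loopSimplex t') = ε t₀ + ε' z := by
      refine Filter.eventually_iff_exists_mem.2 ⟨_, mem_nhdsSet_iff_forall.2 fun t ht => ?_, fun _ => id⟩
      have := key t ht
      rwa [hc t t₀ (ht.trans ht₀.symm)] at this
    have hcm : Filter.comap loopSimplex (𝓝 z) = 𝓝ˢ (loopSimplex ⁻¹' {z}) :=
      loopSimplex_isClosedMap.comap_nhds_eq loopSimplex.continuous z
    rw [← hcm, Filter.eventually_comap] at hev
    filter_upwards [hev] with y hy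
    obtain ⟨t, rfl⟩ := loopSimplex_surjective y
    rw [hs, ← ht₀, hs, ht₀, add_comm (ε' _), add_comm (ε' _)]
    exact hy t rfl
  · rintro ⟨ε, h⟩
    have := h.comap loopSimplex
    rw [← hol_comap, SignTwist.hol_eq _ _ this]
    rw [Function.comp_apply, Function.comp_apply, show loopSimplex v0 = 1 from loopSimplex_vertex 0,
      show loopSimplex v1 = 1 from loopSimplex_vertex 1, zmod_two_add_self]

theorem SignTwist.w1_loopClass_eq_zero_iff (τ : SignTwist B) (γ : C(Circle, B)) :
    τ.w1 (loopClass γ) = 0 ↔ ∃ ε, (τ.comap γ).IsSection ε := by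
  rw [SignTwist.w1, ofFlat_loopClass, hol_loop_eq_zero_iff]

end FlatCohomology

/-! ### Paths -/

/-- The `i`-th barycentric coordinate. -/
def coordI {n : ℕ} (i : Fin (n + 1)) : C(Simp n, I) :=
  ⟨fun t => ⟨t i, stdSimplex.zero_le t i, stdSimplex.le_one t i⟩, by
    have : Continuous fun t : Simp n => t i := (continuous_apply i).comp continuous_subtype_val
    exact this.subtype_mk _⟩

/-- The parametrization of the unit interval by the standard `1`-simplex. -/
abbrev param : C(Simp 1, I) := coordI 1

/-- The inverse of `param`. -/
def unparam : C(I, Simp 1) :=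
  ⟨fun t => ⟨![1 - t.1, t.1], by
    refine ⟨fun i => ?_, by simp [Fin.sum_univ_two]⟩
    fin_cases i
    · simpa using t.2.2
    · exact t.2.1⟩, by
    refine Continuous.subtype_mk (continuous_pi fun i => ?_) _
    fin_cases i
    · exact continuous_const.sub continuous_subtype_val
    · exact continuous_subtype_val⟩

theorem unparam_param (t : Simp 1) : unparam (param t) = t := simp_one_ext rfl

theorem param_v0 : param v0 = 0 := by ext; simp [coordI]

theorem param_v1 : param v1 = 1 := by ext; simp [coordI]

theorem unparam_zero : unparam 0 = v0 := by rw [← param_v0, unparam_param]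

theorem unparam_one : unparam 1 = v1 := by rw [← param_v1, unparam_param]

theorem faceMap_two_apply (t : Simp 1) :
    (faceMap 0 t 0 = 0 ∧ faceMap 0 t 1 = t 0 ∧ faceMap 0 t 2 = t 1) ∧
    (faceMap 1 t 0 = t 0 ∧ faceMap 1 t 1 = 0 ∧ faceMap 1 t 2 = t 1) ∧
    (faceMap 2 t 0 = t 0 ∧ faceMap 2 t 1 = t 1 ∧ faceMap 2 t 2 = 0) := by
  have key (i j) : faceMap i t j = ∑ k : Fin 2, if i.succAbove k = j then t k else 0 := by
    change (stdSimplex.map _ _ : stdSimplex ℝ _).1 j = _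
    rw [← Finset.sum_filter]
    simp [stdSimplex.map, FunOnFinite.linearMap_apply_apply]
  simp [key, Fin.sum_univ_two, Fin.succAbove]

section

variable {B : Type*} [TopologicalSpace B] {f : C(Simp 1, B) → ZMod 2} {U : Set B}

/-- The diagonal cuts the square into two triangles; it occurs in both cocycle relations and
cancels. -/
theorem FlatOn.square (hf : FlatOn f U) (F : C(I × I, B)) (hF : ∀ p, F p ∈ U) :
    f (F.comp (param.prodMk (.const _ 0))) + f (F.comp ((ContinuousMap.const _ 1).prodMk param)) =
      f (F.comp (param.prodMk (.const _ 1))) +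
        f (F.comp ((ContinuousMap.const _ 0).prodMk param)) := by
  let a : C(Simp 2, I) := ⟨fun x => unitInterval.symm (coordI 0 x), by fun_prop⟩
  have h1 := hf (F.comp (a.prodMk (coordI 2))) fun x => hF _
  have h2 := hf (F.comp ((coordI 2).prodMk a)) fun x => hF _
  have e (t : Simp 1) : t 0 = 1 - t 1 := by
    have := stdSimplex.add_eq_one t
    linarith
  have e0 : a.comp (faceMap 0) = .const _ 1 := by
    ext t; simp [a, coordI, (faceMap_two_apply t).1.1]
  have e1 : a.comp (faceMap 1) = param := by
    ext t; simp [a, coordI, (faceMap_two_apply t).2.1.1, e]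
  have e2 : a.comp (faceMap 2) = param := by
    ext t; simp [a, coordI, (faceMap_two_apply t).2.2.1, e]
  have k0 : (coordI 2).comp (faceMap (n := 1) 0) = param := by
    ext t; simp [coordI, (faceMap_two_apply t).1.2.2]
  have k1 : (coordI 2).comp (faceMap (n := 1) 1) = param := by
    ext t; simp [coordI, (faceMap_two_apply t).2.1.2.2]
  have k2 : (coordI 2).comp (faceMap (n := 1) 2) = .const _ 0 := by
    ext t; simp [coordI, (faceMap_two_apply t).2.2.2.2]
  have c (p q : C(Simp 2, I)) (i : Fin 3) : (F.comp (p.prodMk q)).comp (faceMap i) =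
      F.comp ((p.comp (faceMap i)).prodMk (q.comp (faceMap i))) := rfl
  rw [Fin.sum_univ_three] at h1 h2
  simp only [c, e0, e1, e2, k0, k1, k2] at h1 h2
  revert h1 h2
  generalize f _ = x
  generalize f _ = y
  generalize f _ = z
  generalize f _ = s
  generalize f _ = t
  revert x y z s t
  decide

/-- All three edges of a constant triangle are the same constant path, and three equals one modulo
2. -/
theorem FlatOn.const (hf : FlatOn f U) {b : B} (hb : b ∈ U) : f (.const _ b) = 0 := by
  have := hf (.const _ b) fun _ => hb
  rw [Fin.sum_univ_three] at this
  change f (.const _ b) + f (.const _ b) + f (.const _ b) = 0 at this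
  rwa [zmod_two_add_self, zero_add] at this

/-- A diagonal in a square. -/
theorem FlatOn.diag (hf : FlatOn f U) (F : C(I × I, B)) (hF : ∀ p, F p ∈ U) :
    f (F.comp (param.prodMk param)) = f (F.comp (param.prodMk (.const _ 0))) +
      f (F.comp ((ContinuousMap.const _ 1).prodMk param)) := by
  -- This map collapses the left edge to a point and turns the top edge into the diagonal, so the
  -- relation for the square becomes the one for the triangle.
  let m : C(I × I, I × I) := ⟨fun p => (p.1, p.1 ⊓ p.2), by fun_prop⟩
  have := hf.square (F.comp m) fun _ => hF _
  have e1 : (F.comp m).comp (param.prodMk (.const _ 1)) = F.comp (param.prodMk param) := by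
    ext t; simp [m, unitInterval.le_one']
  have e2 : (F.comp m).comp (param.prodMk (.const _ 0)) = F.comp (param.prodMk (.const _ 0)) := by
    ext t; simp [m]
  have e3 : (F.comp m).comp ((ContinuousMap.const _ 0).prodMk param) = .const _ (F (0, 0)) := by
    ext t; simp [m]
  have e4 : (F.comp m).comp ((ContinuousMap.const _ 1).prodMk param) =
      F.comp ((ContinuousMap.const _ 1).prodMk param) := by
    ext t; simp [m, unitInterval.le_one']
  rw [e1, e2, e3, e4, hf.const (hF _), add_zero] at this
  exact this.symm

/-- A path, parametrized by the standard simplex. -/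
def onSimp {x y : B} (p : Path x y) : C(Simp 1, B) := p.toContinuousMap.comp param

theorem onSimp_apply {x y : B} (p : Path x y) (t : Simp 1) : onSimp p t = p (param t) := rfl

theorem onSimp_v0 {x y : B} (p : Path x y) : onSimp p v0 = x := by
  rw [onSimp_apply, param_v0, p.source]

theorem onSimp_v1 {x y : B} (p : Path x y) : onSimp p v1 = y := by
  rw [onSimp_apply, param_v1, p.target]

/-- The path underlying a map of the standard simplex. -/
def toPath (s : C(Simp 1, B)) : Path (s v0) (s v1) where
  toContinuousMap := s.comp unparam
  source' := by simp [unparam_zero]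
  target' := by simp [unparam_one]

theorem onSimp_toPath (s : C(Simp 1, B)) : onSimp (toPath s) = s := by
  ext t
  change s (unparam (param t)) = s t
  rw [unparam_param]

theorem FlatOn.trans (hf : FlatOn f U) {x y z : B} (p : Path x y) (q : Path y z)
    (hp : ∀ t, p t ∈ U) (hq : ∀ t, q t ∈ U) :
    f (onSimp (p.trans q)) = f (onSimp p) + f (onSimp q) := by
  -- The affine map sending the vertices to `0`, `1/2`, `1`: its faces traverse `q`, the
  -- concatenation, and `p`.
  let a : C(Simp 2, I) := ⟨fun x => ⟨x 1 / 2 + x 2, by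
    have := stdSimplex.zero_le x 1
    have := stdSimplex.zero_le x 2
    have h0 := stdSimplex.zero_le x 0
    have := stdSimplex.sum_eq_one x
    rw [Fin.sum_univ_three] at this
    change 0 ≤ x 0 at h0
    constructor <;> linarith⟩, by
    have h1 : Continuous fun t : Simp 2 => t 1 :=
      (continuous_apply (1 : Fin 3)).comp continuous_subtype_val
    have h2 : Continuous fun t : Simp 2 => t 2 :=
      (continuous_apply (2 : Fin 3)).comp continuous_subtype_val
    exact ((h1.div_const 2).add h2).subtype_mk _⟩
  have hr (t) : p.trans q t ∈ U := by
    rw [Path.trans_apply]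
    split_ifs
    exacts [hp _, hq _]
  have h := hf ((p.trans q).toContinuousMap.comp a) fun x => hr _
  have e (t : Simp 1) : t 0 = 1 - t 1 := by
    have := stdSimplex.add_eq_one t
    linarith
  have e0 : ((p.trans q).toContinuousMap.comp a).comp (faceMap 0) = onSimp q := by
    ext t
    change p.trans q (a (faceMap 0 t)) = q (param t)
    have ht : (a (faceMap 0 t) : ℝ) = 1 / 2 + t 1 / 2 := by
      change (faceMap 0 t) 1 / 2 + (faceMap 0 t) 2 = _
      rw [(faceMap_two_apply t).1.2.1, (faceMap_two_apply t).1.2.2, e]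
      ring
    have h0 := stdSimplex.zero_le t 1
    rw [Path.trans_apply]
    split_ifs with hh
    · have h1 : t 1 = 0 := by rw [ht] at hh; linarith
      have e1 : param t = 0 := by ext; exact h1
      rw [e1, q.source]
      convert p.target
      rw [ht, h1]
      norm_num
    · congr 1
      ext
      change 2 * (a (faceMap 0 t) : ℝ) - 1 = t 1
      rw [ht]
      ring
  have e1 : ((p.trans q).toContinuousMap.comp a).comp (faceMap 1) = onSimp (p.trans q) := by
    ext t
    change p.trans q (a (faceMap 1 t)) = p.trans q (param t)
    congr 1
    ext
    change (faceMap 1 t) 1 / 2 + (faceMap 1 t) 2 = t 1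
    rw [(faceMap_two_apply t).2.1.2.1, (faceMap_two_apply t).2.1.2.2]
    ring
  have e2 : ((p.trans q).toContinuousMap.comp a).comp (faceMap 2) = onSimp p := by
    ext t
    change p.trans q (a (faceMap 2 t)) = p (param t)
    have ht : (a (faceMap 2 t) : ℝ) = t 1 / 2 := by
      change (faceMap 2 t) 1 / 2 + (faceMap 2 t) 2 = _
      rw [(faceMap_two_apply t).2.2.2.1, (faceMap_two_apply t).2.2.2.2]
      ring
    have h0 := stdSimplex.le_one t 1
    rw [Path.trans_apply, dif_pos (by rw [ht]; linarith)]
    congr 1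
    ext
    change 2 * (a (faceMap 2 t) : ℝ) = t 1
    rw [ht]
    ring
  rw [Fin.sum_univ_three, e0, e1, e2] at h
  revert h
  generalize f _ = x
  generalize f _ = y
  generalize f _ = z
  revert x y z
  decide

/-- A flat function on paths which vanishes on closed paths is a difference of values at the
end points. -/
theorem FlatOn.exists_potential (hf : FlatOn f Set.univ)
    (h : ∀ s : C(Simp 1, B), s v0 = s v1 → f s = 0) : ∃ g : B → ZMod 2, ∀ s, f s = g (s v0) + g (s v1) := by
  have hs (s : C(Simp 1, B)) (x y : B) (h0 : s v0 = x) (h1 : s v1 = y) :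
      ∃ p : Path x y, onSimp p = s := by
    subst h0 h1
    exact ⟨toPath s, onSimp_toPath s⟩
  have hcl {x : B} (p : Path x x) : f (onSimp p) = 0 := h _ (by rw [onSimp_v0, onSimp_v1])
  have hp {x y : B} (p q : Path x y) : f (onSimp p) = f (onSimp q) := by
    have h1 := hcl (p.trans q.symm)
    have h2 := hcl (q.trans q.symm)
    rw [hf.trans _ _ (fun _ => trivial) (fun _ => trivial), zmod_two_add_eq_zero] at h1 h2
    rw [h1, h2]
  -- A base point is chosen in every path component; the potential at `x` is the value of `f` on a
  -- path from the base point to `x`.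
  obtain ⟨b, hb, hbj⟩ : ∃ b : B → B, (∀ x, Joined (b x) x) ∧ ∀ x y, Joined x y → b x = b y :=
    ⟨fun x => Quotient.out (Quotient.mk (pathSetoid B) x),
      fun x => Quotient.exact (s := pathSetoid B) (Quotient.out_eq _),
      fun x y h => congrArg Quotient.out (Quotient.sound (s := pathSetoid B) h)⟩
  refine ⟨fun x => f (onSimp (hb x).somePath), fun s => ?_⟩
  obtain ⟨q, hq⟩ : ∃ q : Path (b (s v0)) (s v1), f (onSimp q) = f (onSimp (hb (s v1)).somePath) := by
    rw [hbj _ _ ⟨toPath s⟩]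
    exact ⟨_, rfl⟩
  have h1 := hf.trans (hb (s v0)).somePath (toPath s) (fun _ => trivial) (fun _ => trivial)
  rw [hp _ q, hq, onSimp_toPath] at h1
  change f s = f _ + f _
  rw [h1, ← add_assoc, zmod_two_add_self, zero_add]

end

/-! ### Degree-one classes, loops and the Künneth argument -/

section H1

variable {B : Type u} [TopologicalSpace B]

/-- The flat function on paths defining a given class in `H^1(B, ℤ₂)`. -/
theorem exists_eq_ofFlat (w : H (ZMod 2) B 1 →ₗ[ZMod 2] ZMod 2) :
    ∃ (f : C(Simp 1, B) → ZMod 2) (hf : FlatOn f Set.univ), w = ofFlat f hf := by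
  -- Over a field the functional on cycles extends to all chains, where it is given by its values on
  -- simplices; it is flat since it kills boundaries.
  obtain ⟨F, hF⟩ := LinearMap.exists_extend (p := cycles (ZMod 2) B 1)
    ((ULift.moduleEquiv (R := ZMod 2) (M := ZMod 2)).symm.toLinearMap ∘ₗ w ∘ₗ toH (ZMod 2) 1)
  let f (s : C(Simp 1, B)) : ZMod 2 := (F (simplex (ZMod 2) s)).down
  have hFf : F = chainLift (ZMod 2) (fun s => ULift.up (f s)) := chain_ext _ fun s => by simp [f]
  have hd (z : cycles (ZMod 2) B 1) : (F z.1).down = w (toH (ZMod 2) 1 z) :=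
    congrArg ULift.down (LinearMap.congr_fun hF z)
  have hf : FlatOn f Set.univ := by
    intro s _
    rw [← chainLift_d, ← hFf]
    have hz : dmap (ZMod 2) B 2 1 (simplex (ZMod 2) s) ∈ cycles (ZMod 2) B 1 :=
      ConcreteCategory.congr_hom ((chains (ZMod 2) B).d_comp_d 2 1 0) (simplex (ZMod 2) s)
    refine (hd ⟨_, hz⟩).trans ?_
    rw [(toH_eq_zero_iff (ZMod 2) 1 ⟨_, hz⟩).2 ⟨_, rfl⟩, map_zero]
  refine ⟨f, hf, ?_⟩
  ext c
  obtain ⟨z, rfl⟩ := toH_surjective _ 1 c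
  rw [ofFlat_toH, ← hFf, hd]

/-- The classes of loops generate `H_1(B, ℤ₂)`. -/
theorem H1_ext {w w' : H (ZMod 2) B 1 →ₗ[ZMod 2] ZMod 2}
    (h : ∀ γ, w (loopClass γ) = w' (loopClass γ)) : w = w' := by
  rw [← sub_eq_zero]
  obtain ⟨f, hf, hw⟩ := exists_eq_ofFlat (w - w')
  have hc (s : C(Simp 1, B)) (hs : s v0 = s v1) : f s = 0 := by
    obtain ⟨γ, rfl⟩ := exists_loop s hs
    rw [← ofFlat_loopClass f hf, ← hw, LinearMap.sub_apply, h, sub_self]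
  obtain ⟨g, hg⟩ := hf.exists_potential hc
  rw [hw]
  ext c
  obtain ⟨z, rfl⟩ := toH_surjective _ 1 c
  rw [ofFlat_toH]
  -- The potential exhibits the functional as a coboundary, so it vanishes on cycles.
  have : chainLift (ZMod 2) (fun s => ULift.up.{u} (f s)) = chainLift (ZMod 2) (n := 0)
      (fun s => ULift.up.{u} (g (s (stdSimplex.vertex 0)))) ∘ₗ dmap (ZMod 2) B 1 0 := by
    refine chain_ext _ fun s => ?_
    have a : simplexMap (m := 0) (n := 1) Fin.succ (stdSimplex.vertex 0) = v1 :=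
      simplexMap_vertex _ _
    have b : simplexMap (m := 0) (n := 1) (Fin.succAbove 1) (stdSimplex.vertex 0) = v0 :=
      simplexMap_vertex _ _
    simp only [LinearMap.comp_apply, d_simplex, chainLift_simplex, hg]
    ext
    simp [ZMod.neg_eq_self_mod_two, a, b, add_comm]
  rw [this]
  have hz : dmap (ZMod 2) B 1 0 z.1 = 0 := z.2
  simp [hz]

theorem H1_ext_iff_zero {w w' : H (ZMod 2) B 1 →ₗ[ZMod 2] ZMod 2}
    (h : ∀ γ, w (loopClass γ) = 0 ↔ w' (loopClass γ) = 0) : w = w' :=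
  H1_ext fun γ => zmod_two_eq_of_iff (h γ)

theorem hmap_loopClass {C : Type u} [TopologicalSpace C] (g : C(B, C)) (γ : C(Circle, B)) :
    hmap (ZMod 2) 1 g (loopClass γ) = loopClass (g.comp γ) := by
  rw [loopClass, loopClass, hmap_toH]
  congr 1
  exact Subtype.ext (cmap_simplex _ g _)

/-- The inclusion of a slice of a product. -/
def inclL {C : Type u} [TopologicalSpace C] (b : B) : C(C, B × C) :=
  (ContinuousMap.const C b).prodMk (.id C)

def inclR {C : Type u} [TopologicalSpace C] (c : C) : C(B, B × C) :=
  (ContinuousMap.id B).prodMk (.const B c)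

/-- The Künneth formula in degree `1`. -/
theorem H1_prod_ext {C : Type u} [TopologicalSpace C]
    {w w' : H (ZMod 2) (B × C) 1 →ₗ[ZMod 2] ZMod 2}
    (hL : ∀ b, w ∘ₗ hmap (ZMod 2) 1 (inclL b) = w' ∘ₗ hmap (ZMod 2) 1 (inclL b))
    (hR : ∀ c, w ∘ₗ hmap (ZMod 2) 1 (inclR c) = w' ∘ₗ hmap (ZMod 2) 1 (inclR c)) : w = w' := by
  refine H1_ext fun γ => ?_
  rw [← sub_eq_zero, ← LinearMap.sub_apply]
  obtain ⟨f, hf, hw⟩ := exists_eq_ofFlat (w - w')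
  rw [hw, ofFlat_loopClass]
  let p := (γ.comp loopSimplex).comp unparam
  have hp : p 0 = p 1 := by
    simp only [p, ContinuousMap.comp_apply, unparam_zero, unparam_one]
    rw [show loopSimplex v0 = 1 from loopSimplex_vertex 0,
      show loopSimplex v1 = 1 from loopSimplex_vertex 1]
  have hγ : γ.comp loopSimplex = p.comp param := by
    ext t <;> simp [p, unparam_param]
  -- The loop is the diagonal of this square. Two edges of the square replace it, and each of them
  -- is a loop in a slice of the product.
  let F : C(I × I, B × C) := ⟨fun q => ((p q.1).1, (p q.2).2), by fun_prop⟩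
  have h := hf.diag F fun _ => trivial
  have e : F.comp (param.prodMk param) = p.comp param := rfl
  rw [hγ, ← e, h]
  obtain ⟨γ₁, h₁⟩ := exists_loop (F.comp (param.prodMk (.const _ 0))) (by
    change ((p (param v0)).1, (p 0).2) = ((p (param v1)).1, (p 0).2)
    rw [param_v0, param_v1, hp])
  obtain ⟨γ₂, h₂⟩ := exists_loop (F.comp ((ContinuousMap.const _ 1).prodMk param)) (by
    change ((p 1).1, (p (param v0)).2) = ((p 1).1, (p (param v1)).2)
    rw [param_v0, param_v1, hp])
  obtain ⟨δ₁, rfl⟩ : ∃ δ, γ₁ = (inclR (p 0).2).comp δ := by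
    refine ⟨ContinuousMap.fst.comp γ₁, ContinuousMap.ext fun z => ?_⟩
    obtain ⟨t, rfl⟩ := loopSimplex_surjective z
    have : γ₁ (loopSimplex t) = F (param t, 0) := ContinuousMap.congr_fun h₁ t
    exact Prod.ext rfl (show (γ₁ _).2 = (p 0).2 by rw [this]; rfl)
  obtain ⟨δ₂, rfl⟩ : ∃ δ, γ₂ = (inclL (p 1).1).comp δ := by
    refine ⟨ContinuousMap.snd.comp γ₂, ContinuousMap.ext fun z => ?_⟩
    obtain ⟨t, rfl⟩ := loopSimplex_surjective z
    have : γ₂ (loopSimplex t) = F (1, param t) := ContinuousMap.congr_fun h₂ t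
    exact Prod.ext (show (γ₂ _).1 = (p 1).1 by rw [this]; rfl) rfl
  rw [← h₁, ← h₂, ← ofFlat_loopClass f hf, ← ofFlat_loopClass f hf, ← hw,
    ← hmap_loopClass, ← hmap_loopClass, LinearMap.sub_apply, LinearMap.sub_apply]
  have e₁ := LinearMap.congr_fun (hR (p 0).2) (loopClass δ₁)
  have e₂ := LinearMap.congr_fun (hL (p 1).1) (loopClass δ₂)
  simp only [LinearMap.comp_apply] at e₁ e₂
  rw [e₁, e₂, sub_self, sub_self, add_zero]

end H1

/-! ### Triviality of double covers -/

namespace SignTwist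

/-- Sums of sections are sections of a tensor product of double covers. -/
def IsSum {B : Type*} [TopologicalSpace B] (τ τ' τ'' : SignTwist B) : Prop :=
  ∀ (x : B) (ε ε' : B → ZMod 2), τ.adm ε x → τ'.adm ε' x → τ''.adm (ε + ε') x

theorem IsSum.comap {B T : Type*} [TopologicalSpace B] [TopologicalSpace T] {τ τ' τ'' : SignTwist B}
    (h : IsSum τ τ' τ'') (g : C(T, B)) : IsSum (τ.comap g) (τ'.comap g) (τ''.comap g) := by
  rintro t ε ε' ⟨ε₀, h₁, h₂⟩ ⟨ε₀', h₁', h₂'⟩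
  exact ⟨ε₀ + ε₀', h _ _ _ h₁ h₁', h₂.add h₂'⟩

theorem IsSum.hol {B : Type*} [TopologicalSpace B] {τ τ' τ'' : SignTwist B}
    (h : IsSum τ τ' τ'') (s : C(Simp 1, B)) : τ''.hol s = τ.hol s + τ'.hol s := by
  obtain ⟨ε, hε⟩ := (τ.comap s).exists_section_of_contractible
  obtain ⟨ε', hε'⟩ := (τ'.comap s).exists_section_of_contractible
  have h'' : (τ''.comap s).IsSection (ε + ε') := fun t => h.comap s _ _ _ (hε t) (hε' t)
  rw [hol_eq _ _ hε, hol_eq _ _ hε', hol_eq _ _ h'']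
  simp only [Pi.add_apply]
  exact add_add_add_comm ..

variable {B : Type u} [TopologicalSpace B]

theorem w1_eq_ext {w : H (ZMod 2) B 1 →ₗ[ZMod 2] ZMod 2} {τ : SignTwist B}
    (h : ∀ γ, w (loopClass γ) = τ.hol (γ.comp loopSimplex)) : τ.w1 = w :=
  H1_ext fun γ => by rw [h, w1, ofFlat_loopClass]

theorem w1_loopClass (τ : SignTwist B) (γ : C(Circle, B)) :
    τ.w1 (loopClass γ) = τ.hol (γ.comp loopSimplex) := by rw [w1, ofFlat_loopClass]

theorem IsSum.w1 {τ τ' τ'' : SignTwist B} (h : IsSum τ τ' τ'') : τ''.w1 = τ.w1 + τ'.w1 :=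
  w1_eq_ext fun γ => by rw [LinearMap.add_apply, w1_loopClass, w1_loopClass, h.hol]

/-- One inclusion is enough: a section of the first cover along a loop is also one of the second,
and holonomy can be computed from any section. -/
theorem w1_eq_of_le {τ τ' : SignTwist B} (h : ∀ ε x, τ.adm ε x → τ'.adm ε x) : τ.w1 = τ'.w1 := by
  refine w1_eq_ext fun γ => ?_
  obtain ⟨ε, hε⟩ := (τ.comap (γ.comp loopSimplex)).exists_section_of_contractible
  rw [w1_loopClass, hol_eq _ _ hε, hol_eq τ' _ (ε := ε)]
  intro t
  obtain ⟨ε₀, h1, h2⟩ := hε t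
  exact ⟨ε₀, h _ _ h1, h2⟩

theorem w1_eq_zero {τ : SignTwist B} {ε : B → ZMod 2} (h : τ.IsSection ε) : τ.w1 = 0 :=
  w1_eq_ext fun γ => ((τ.hol_loop_eq_zero_iff γ).2 ⟨_, h.comap γ⟩).symm

theorem hol_eq_zero_of_closed {τ : SignTwist B} (h : τ.w1 = 0) (s : C(Simp 1, B))
    (hs : s v0 = s v1) : τ.hol s = 0 := by
  obtain ⟨γ, rfl⟩ := exists_loop s hs
  rw [← w1_loopClass, h, LinearMap.zero_apply]

/-- The holonomy vanishes on closed paths and so has a potential. Near a point the potential is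
compared with a local section along paths inside the domain of that section, which shows that it is
continuous as a section. -/
theorem exists_section_of_locallyPathConnected [LocallyPathConnectedSpace B] {τ : SignTwist B}
    (h : τ.w1 = 0) : ∃ ε, τ.IsSection ε := by
  obtain ⟨g, hg⟩ := (τ.flatOn_hol Set.univ).exists_potential (hol_eq_zero_of_closed h)
  refine ⟨g, fun x => ?_⟩
  obtain ⟨ε, hε⟩ := τ.exists_adm x
  refine (τ.adm_iff hε.self_of_nhds).2 ?_
  obtain ⟨V, ⟨hVx, hV⟩, hVs⟩ := (LocallyPathConnectedSpace.path_connected_basis x).mem_iff.1 hε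
  filter_upwards [hVx] with y hy
  obtain ⟨p, hp⟩ := hV.joinedIn x (mem_of_mem_nhds hVx) y hy
  have hs : (τ.comap (onSimp p)).IsSection (ε ∘ onSimp p) := fun t => τ.adm_comap _ (hVs (hp _))
  have h1 := hg (onSimp p)
  rw [τ.hol_eq _ hs, Function.comp_apply, Function.comp_apply, onSimp_v0, onSimp_v1] at h1
  revert h1
  generalize ε x = a
  generalize ε y = b
  generalize g x = c
  generalize g y = d
  revert a b c d
  decide

/-- Spaces with the homotopy type of a locally path-connected space. -/
def _root_.HochPont.HasLPCType (B : Type u) [TopologicalSpace B] : Prop :=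
  ∃ (Z : Type u) (_ : TopologicalSpace Z), LocallyPathConnectedSpace Z ∧
    Nonempty (ContinuousMap.HomotopyEquiv B Z)

theorem _root_.HochPont.HasLPCType.prod {B C : Type u} [TopologicalSpace B] [TopologicalSpace C]
    (hB : HasLPCType B) (hC : HasLPCType C) : HasLPCType (B × C) := by
  obtain ⟨Z, _, _, ⟨e⟩⟩ := hB
  obtain ⟨Z', _, _, ⟨e'⟩⟩ := hC
  exact ⟨Z × Z', inferInstance, inferInstance, ⟨e.prodCongr e'⟩⟩

/-- Triviality is tested on a locally path-connected model, then pulled back; the homotopy from the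
round trip to the identity returns the section to the original cover. -/
theorem exists_section_of_w1 (hB : HasLPCType B) {τ : SignTwist B} (h : τ.w1 = 0) :
    ∃ ε, τ.IsSection ε := by
  obtain ⟨Z, _, _, ⟨e⟩⟩ := hB
  have h1 : (τ.comap e.invFun).w1 = 0 := by rw [w1_comap, h, LinearMap.zero_comp]
  obtain ⟨ε, hε⟩ := exists_section_of_locallyPathConnected h1
  have h2 := hε.comap e.toFun
  rw [comap_comap] at h2
  obtain ⟨ε', h3⟩ := τ.exists_section_of_homotopic e.left_inv ⟨_, h2⟩
  refine ⟨ε', fun x => ?_⟩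
  obtain ⟨ε₀, h4, h5⟩ := h3 x
  exact (τ.adm_iff h4).2 h5.symm

end SignTwist

/-! ### CW complexes: cells, local path-connectedness, compact subsets -/

section CW

open Metric

/-- The closed unit ball for the maximum norm. -/
abbrev Cube (n : ℕ) : Type := closedBall (0 : Fin n → ℝ) 1

theorem Cube.norm_le {n : ℕ} (y : Cube n) : ‖y.1‖ ≤ 1 :=
  mem_closedBall_zero_iff.1 y.2

/-- Linear interpolation in the ball. -/
def seg {n : ℕ} : C((Cube n × Cube n) × I, Cube n) :=
  ⟨fun p => ⟨(1 - p.2.1) • p.1.1.1 + p.2.1 • p.1.2.1,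
    convex_closedBall _ _ p.1.1.2 p.1.2.2 (by linarith [p.2.2.2]) p.2.2.1 (by ring)⟩, by
    refine Continuous.subtype_mk ?_ _
    fun_prop⟩

theorem seg_zero {n : ℕ} (y y' : Cube n) : seg ((y, y'), 0) = y := by ext; simp [seg]

theorem seg_one {n : ℕ} (y y' : Cube n) : seg ((y, y'), 1) = y' := by ext; simp [seg]

theorem seg_self {n : ℕ} (y : Cube n) (t : I) : seg ((y, y), t) = y := by
  ext; simp [seg, ← add_mul]

/-- Radial projection to the boundary, on the vectors of norm at least `1 / 2`. -/
def radial {n : ℕ} : C(Cube n, Cube n) :=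
  ⟨fun y => ⟨(max ‖y.1‖ (1 / 2))⁻¹ • y.1, by
    have h : 0 < max ‖y.1‖ (1 / 2) := lt_max_of_lt_right (by norm_num)
    rw [mem_closedBall_zero_iff, norm_smul, norm_inv, Real.norm_of_nonneg h.le,
      inv_mul_le_iff₀ h, mul_one]
    exact le_max_left _ _⟩, by
    refine Continuous.subtype_mk (Continuous.smul (Continuous.inv₀
      ((continuous_norm.comp continuous_subtype_val).max continuous_const) fun y => ?_)
      continuous_subtype_val) _
    exact (lt_max_of_lt_right (by norm_num)).ne'⟩

theorem norm_radial {n : ℕ} {y : Cube n} (h : 1 / 2 < ‖y.1‖) : ‖(radial y).1‖ = 1 := by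
  change ‖(max ‖y.1‖ (1 / 2))⁻¹ • y.1‖ = 1
  have h0 : 0 < ‖y.1‖ := by linarith
  rw [max_eq_left h.le, norm_smul, norm_inv, norm_norm, inv_mul_cancel₀ h0.ne']

theorem radial_eq {n : ℕ} {y : Cube n} (h : ‖y.1‖ = 1) : radial y = y := by
  ext i
  change ((max ‖y.1‖ (1 / 2))⁻¹ • y.1) i = y.1 i
  rw [h, max_eq_left (by norm_num), inv_one, one_smul]

instance (n : ℕ) : LocallyPathConnectedSpace (Cube n) := by
  refine LocallyPathConnectedSpace.of_bases (p := fun _ (r : ℝ) => 0 < r)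
    (s := fun y r => ball y r) (fun y => nhds_basis_ball) fun y r hr => ?_
  refine ⟨y, mem_ball_self hr, fun {z} hz => ?_⟩
  refine ⟨⟨⟨fun t => seg ((y, z), t), by fun_prop⟩, seg_zero _ _, seg_one _ _⟩, fun t => ?_⟩
  rw [mem_ball, Subtype.dist_eq, dist_eq_norm] at hz ⊢
  have e : (seg ((y, z), t)).1 - y.1 = t.1 • (z.1 - y.1) := by
    change (1 - t.1) • y.1 + t.1 • z.1 - y.1 = _
    rw [sub_smul, smul_sub, one_smul]
    abel
  change ‖(seg ((y, z), t)).1 - y.1‖ < r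
  rw [e, norm_smul, Real.norm_of_nonneg t.2.1]
  exact (mul_le_of_le_one_left (norm_nonneg _) t.2.2).trans_lt hz

variable {Z : Type u} [TopologicalSpace Z] [T2Space Z] [CWComplex (Set.univ : Set Z)]

open CWComplex

/-- The cells. -/
abbrev Cell (Z : Type u) [TopologicalSpace Z] [CWComplex (Set.univ : Set Z)] (n : ℕ) : Type u :=
  cell (Set.univ : Set Z) n

/-- The characteristic map of a cell. -/
def chi {n : ℕ} (i : Cell Z n) : C(Cube n, Z) :=
  ⟨fun y => map n i y.1, (RelCWComplex.continuousOn n i).domRestrict⟩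

theorem chi_mem_open {n : ℕ} (i : Cell Z n) {y : Cube n} (h : ‖y.1‖ < 1) :
    chi i y ∈ openCell n i := ⟨y.1, by simpa using h, rfl⟩

theorem chi_mem_frontier {n : ℕ} (i : Cell Z n) {y : Cube n} (h : ‖y.1‖ = 1) :
    chi i y ∈ cellFrontier n i := ⟨y.1, by simpa using h, rfl⟩

theorem chi_mem_closed {n : ℕ} (i : Cell Z n) (y : Cube n) : chi i y ∈ closedCell n i :=
  ⟨y.1, y.2, rfl⟩

theorem exists_chi_eq (x : Z) : ∃ (n : ℕ) (i : Cell Z n) (y : Cube n), ‖y.1‖ < 1 ∧ chi i y = x := by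
  have h : x ∈ (Set.univ : Set Z) := trivial
  rw [← iUnion_openCell_eq_complex (C := (Set.univ : Set Z))] at h
  obtain ⟨n, i, y, hy, rfl⟩ := by simpa only [Set.mem_iUnion] using h
  exact ⟨n, i, ⟨y, ball_subset_closedBall hy⟩, by simpa using hy, rfl⟩

/-- The dependent triple packages the equality of dimension, cell and point, so that case analysis
on it identifies all three at once. -/
theorem cell_unique {n m : ℕ} {i : Cell Z n} {j : Cell Z m} {y : Cube n} {y' : Cube m}
    (hy : ‖y.1‖ < 1) (hy' : ‖y'.1‖ < 1) (h : chi i y = chi j y') :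
    (⟨n, i, y⟩ : Σ n, Cell Z n × Cube n) = ⟨m, j, y'⟩ := by
  have h1 : (⟨n, i⟩ : Σ n, Cell Z n) = ⟨m, j⟩ := by
    by_contra hne
    exact (disjoint_openCell_of_ne hne).ne_of_mem (chi_mem_open i hy) (chi_mem_open j hy') h
  obtain ⟨rfl, h2⟩ := Sigma.mk.inj_iff.1 h1
  cases eq_of_heq h2
  have h3 : y = y' := Subtype.ext ((map n i).injOn
    (by rw [RelCWComplex.source_eq]; simpa using hy)
    (by rw [RelCWComplex.source_eq]; simpa using hy') h)
  rw [h3]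

/-- The frontier of an `n`-cell is covered by open cells of smaller dimension, and a point lies in
only one open cell. -/
theorem lt_of_frontier {n m : ℕ} {i : Cell Z n} {j : Cell Z m} {y : Cube n} {y' : Cube m}
    (hy : ‖y.1‖ = 1) (hy' : ‖y'.1‖ < 1) (h : chi i y = chi j y') : m < n := by
  obtain ⟨J, hJ⟩ := cellFrontier_subset_finite_openCell n i
  have h1 := hJ (chi_mem_frontier i hy)
  simp only [Set.mem_iUnion] at h1
  obtain ⟨l, hl, j', -, z, hz, hz'⟩ := h1
  have := cell_unique (y := ⟨z, ball_subset_closedBall hz⟩) (by simpa using hz) hy' (hz'.trans h)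
  cases this
  exact hl

/-- This is the weak topology: the trace of `A` on a closed cell is the image of a compact set. -/
theorem isClosed_of_preimage {A : Set Z} (h : ∀ n (i : Cell Z n), IsClosed (chi i ⁻¹' A)) :
    IsClosed A := by
  rw [CWComplex.closed (Set.univ : Set Z) A (Set.subset_univ A)]
  intro n i
  have : A ∩ closedCell n i = chi i '' (chi i ⁻¹' A) := by
    ext x
    constructor
    · rintro ⟨hx, y, hy, rfl⟩
      exact ⟨⟨y, hy⟩, hx, rfl⟩
    · rintro ⟨y, hy, rfl⟩
      exact ⟨hy, chi_mem_closed i y⟩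
  rw [this]
  exact ((h n i).isCompact.image (chi i).continuous).isClosed

/-- The complex is a quotient of a disjoint union of cubes, and local path-connectedness passes to
quotients. -/
instance CWComplex.locallyPathConnectedSpace : LocallyPathConnectedSpace Z := by
  let q : (Σ c : (Σ n, Cell Z n), Cube c.1) → Z := fun p => chi p.1.2 p.2
  have hq : IsQuotientMap q := by
    refine isQuotientMap_iff_isClosed.2 ⟨fun x => ?_, fun A => ⟨fun h => h.preimage ?_, fun h =>
      isClosed_of_preimage fun n i => ?_⟩⟩
    · obtain ⟨n, i, y, -, h⟩ := exists_chi_eq x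
      exact ⟨⟨⟨n, i⟩, y⟩, h⟩
    · exact continuous_sigma fun c => (chi c.2).continuous
    · exact h.preimage (continuous_sigmaMk (i := (⟨n, i⟩ : Σ n, Cell Z n)))
  exact hq.locallyPathConnectedSpace

/-- A compact subset meets only finitely many open cells. -/
theorem finite_cells_of_isCompact {K : Set Z} (hK : IsCompact K) :
    {c : Σ n, Cell Z n | (openCell c.1 c.2 ∩ K).Nonempty}.Finite := by
  set S := {c : Σ n, Cell Z n | (openCell c.1 c.2 ∩ K).Nonempty} with hS
  have hx (c : S) : ∃ x, x ∈ openCell c.1.1 c.1.2 ∩ K := c.2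
  choose x hx using hx
  have hinj : Function.Injective x := by
    intro c c' h
    by_contra hne
    exact (disjoint_openCell_of_ne (fun h' => hne (Subtype.ext h'))).ne_of_mem (hx c).1 (hx c').1 h
  -- With one point chosen in each cell that meets `K`, any set of such points meets a closed cell
  -- in a finite set and is therefore closed. The chosen points form a compact discrete space, hence
  -- a finite one.
  have hcl (A : Set Z) (hA : A ⊆ Set.range x) : IsClosed A := by
    rw [CWComplex.closed (Set.univ : Set Z) A (Set.subset_univ A)]
    intro n i
    refine Set.Finite.isClosed ?_
    obtain ⟨J, hJ⟩ := cellFrontier_subset_finite_openCell n i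
    have hone (m : ℕ) (j : Cell Z m) : (A ∩ openCell m j).Subsingleton := by
      rintro a ⟨ha, haj⟩ b ⟨hb, hbj⟩
      obtain ⟨c, rfl⟩ := hA ha
      obtain ⟨c', rfl⟩ := hA hb
      have e (d : S) (hd : x d ∈ openCell m j) : d.1 = ⟨m, j⟩ := by
        by_contra hne
        exact (disjoint_openCell_of_ne hne).ne_of_mem (hx d).1 hd rfl
      rw [Subtype.ext ((e c haj).trans (e c' hbj).symm)]
    have hfin : ((A ∩ openCell n i) ∪ ⋃ m ∈ Set.Iio n, ⋃ j ∈ (J m : Set (Cell Z m)),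
        A ∩ openCell m j).Finite :=
      (hone n i).finite.union <| (Set.finite_Iio n).biUnion fun m _ =>
        (J m).finite_toSet.biUnion fun j _ => (hone m j).finite
    refine hfin.subset ?_
    rintro a ⟨ha, hai⟩
    rw [← cellFrontier_union_openCell_eq_closedCell] at hai
    rcases hai with hai | hai
    · have := hJ hai
      simp only [Set.mem_iUnion] at this
      obtain ⟨m, hm, j, hj, haj⟩ := this
      exact .inr (Set.mem_biUnion (Set.mem_Iio.2 hm) (Set.mem_biUnion (Finset.mem_coe.2 hj) ⟨ha, haj⟩))
    · exact .inl ⟨ha, hai⟩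
  have hd : DiscreteTopology (Set.range x) := by
    refine discreteTopology_iff_forall_isClosed.2 fun s => ?_
    have := (hcl (Subtype.val '' s) (by rintro _ ⟨a, -, rfl⟩; exact a.2)).preimage
      (continuous_subtype_val (p := (· ∈ Set.range x)))
    rwa [Set.preimage_image_eq _ Subtype.val_injective] at this
  have hc : IsCompact (Set.range x) := hK.of_isClosed_subset (hcl _ subset_rfl) (by
    rintro _ ⟨c, rfl⟩
    exact (hx c).2)
  have hf : (Set.range x).Finite := hc.finite ⟨hd⟩
  have : Finite (Set.range x) := hf
  exact (Finite.of_injective (Set.rangeFactorization x)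
    fun a b h => hinj (congrArg Subtype.val h))

end CW

/-- For a free homotopy of closed paths the two side edges of the square coincide and cancel. -/
theorem FlatOn.eq_of_homotopy {B : Type*} [TopologicalSpace B] {f : C(Simp 1, B) → ZMod 2}
    {U : Set B} (hf : FlatOn f U) (F : C(I × I, B)) (hF : ∀ p, F p ∈ U)
    (h : ∀ t, F (0, t) = F (1, t)) :
    f (F.comp (param.prodMk (.const _ 0))) = f (F.comp (param.prodMk (.const _ 1))) := by
  have h1 := hf.square F hF
  have h2 : F.comp ((ContinuousMap.const _ 0).prodMk param) =
      F.comp ((ContinuousMap.const _ 1).prodMk param) := by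
    ext t
    exact h _
  rw [h2] at h1
  exact add_right_cancel h1

/-! ### Small neighbourhoods in CW complexes on which flat functions have potentials -/

section CW

open Metric CWComplex

variable {Z : Type u} [TopologicalSpace Z] [T2Space Z] [CWComplex (Set.univ : Set Z)]

/-- Continuity of a homotopy along a map from a compact space, checked on the finitely many cells
that cover its image. -/
theorem continuous_of_cells {T : Type*} [TopologicalSpace T] [CompactSpace T] [T2Space T]
    (s : C(T, Z)) (ρ : Z → I → Z) {S : Set (Σ n, Cell Z n)} (hS : S.Finite)
    (hcov : ∀ t, ∃ c ∈ S, ∃ y, chi c.2 y = s t)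
    (hρ : ∀ c ∈ S, ∃ G : C(Cube c.1 × I, Z), ∀ t y a, chi c.2 y = s t → ρ (s t) a = G (y, a)) :
    Continuous fun p : T × I => ρ (s p.1) p.2 := by
  have hρ' (c : S) := hρ c.1 c.2
  choose G hG using hρ'
  refine continuous_iff_isClosed.2 fun A hA => ?_
  -- The preimage of a closed set is a finite union of projections of closed sets along compact
  -- cubes.
  have : (fun p : T × I => ρ (s p.1) p.2) ⁻¹' A = ⋃ c : S, Prod.fst ''
      {q : (T × I) × Cube c.1.1 | chi c.1.2 q.2 = s q.1.1 ∧ G c (q.2, q.1.2) ∈ A} := by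
    ext p
    simp only [Set.mem_preimage, Set.mem_iUnion, Set.mem_image, Set.mem_ofPred_eq]
    constructor
    · intro h
      obtain ⟨c, hc, y, hy⟩ := hcov p.1
      exact ⟨⟨c, hc⟩, (p, y), ⟨hy, by rwa [← hG ⟨c, hc⟩ p.1 y p.2 hy]⟩, rfl⟩
    · rintro ⟨c, ⟨p, y⟩, ⟨h1, h2⟩, rfl⟩
      rwa [hG c p.1 y p.2 h1]
  rw [this]
  have := hS.to_subtype
  refine isClosed_iUnion_of_finite fun c => isClosedMap_fst_of_compactSpace _ ?_
  exact (isClosed_eq (by fun_prop) (by fun_prop)).inter (hA.preimage (by fun_prop))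

/-- The intersections of a star-like neighbourhood of a point of a cell with the skeleta. -/
def star {n : ℕ} (U : Set Z) (i₀ : Cell Z n) (y₀ : Cube n) : ℕ → Set Z
  | 0 => {x | ∃ y : Cube n, ‖y.1‖ < 1 ∧ chi i₀ y = x ∧ ∀ t, chi i₀ (seg ((y, y₀), t)) ∈ U}
  | k + 1 => star U i₀ y₀ k ∪ {x | ∃ (i : Cell Z (n + k + 1)) (y : Cube (n + k + 1)), ‖y.1‖ < 1 ∧
      chi i y = x ∧ 1 / 2 < ‖y.1‖ ∧ chi i (radial y) ∈ star U i₀ y₀ k ∧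
      ∀ t, chi i (seg ((y, radial y), t)) ∈ U}

variable {n : ℕ} {U : Set Z} {i₀ : Cell Z n} {y₀ : Cube n}

theorem star_mono : Monotone (star U i₀ y₀) := monotone_nat_of_le_succ fun _ => Set.subset_union_left

theorem star_subset (k : ℕ) : star U i₀ y₀ k ⊆ U := by
  induction k with
  | zero =>
    rintro _ ⟨y, -, rfl, h⟩
    have := h 0
    rwa [seg_zero] at this
  | succ k ih =>
    rintro x (h | ⟨i, y, -, rfl, -, -, h⟩)
    · exact ih h
    · have := h 0
      rwa [seg_zero] at this

theorem le_of_mem_star {k m : ℕ} {j : Cell Z m} {y : Cube m} (hy : ‖y.1‖ < 1)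
    (h : chi j y ∈ star U i₀ y₀ k) : n ≤ m ∧ m ≤ n + k := by
  induction k with
  | zero =>
    obtain ⟨y', hy', e, -⟩ := h
    cases cell_unique hy hy' e.symm
    exact ⟨le_rfl, le_rfl⟩
  | succ k ih =>
    rcases h with h | ⟨i, y', hy', e, -⟩
    · have := ih h
      omega
    · cases cell_unique hy hy' e.symm
      omega

/-- Stage `k + 1` adds only points in open cells of dimension `n + k + 1`, so membership of a point
in a cell of dimension at most `n + k` is already decided at stage `k`. -/
theorem mem_star_of_le {k m : ℕ} {j : Cell Z m} {y : Cube m} (hy : ‖y.1‖ < 1) (hm : m ≤ n + k)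
    {l : ℕ} (h : chi j y ∈ star U i₀ y₀ l) : chi j y ∈ star U i₀ y₀ k := by
  induction l with
  | zero => exact star_mono (Nat.zero_le k) h
  | succ l ih =>
    rcases h with h | h
    · exact ih h
    · obtain ⟨i, y', hy', e, -⟩ := id h
      cases cell_unique hy hy' e.symm
      exact star_mono (show l + 1 ≤ k by omega) (.inr h)

theorem mem_star_zero_iff {y : Cube n} (hy : ‖y.1‖ < 1) (i : Cell Z n) :
    chi i y ∈ star U i₀ y₀ 0 ↔ i = i₀ ∧ ∀ t, chi i (seg ((y, y₀), t)) ∈ U := by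
  constructor
  · rintro ⟨y', hy', e, h⟩
    cases cell_unique hy hy' e.symm
    exact ⟨rfl, h⟩
  · rintro ⟨rfl, h⟩
    exact ⟨y, hy, rfl, h⟩

theorem mem_star_succ_iff {k : ℕ} {i : Cell Z (n + k + 1)} {y : Cube (n + k + 1)} (hy : ‖y.1‖ < 1) :
    chi i y ∈ star U i₀ y₀ (k + 1) ↔ 1 / 2 < ‖y.1‖ ∧ chi i (radial y) ∈ star U i₀ y₀ k ∧
      ∀ t, chi i (seg ((y, radial y), t)) ∈ U := by
  constructor
  · rintro (h | ⟨i', y', hy', e, h⟩)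
    · have := le_of_mem_star hy h
      omega
    · cases cell_unique hy hy' e.symm
      exact h
  · exact fun h => .inr ⟨i, y, hy, rfl, h⟩

variable (U i₀ y₀) in
/-- A star-like neighbourhood. -/
def starNhd : Set Z := ⋃ k, star U i₀ y₀ k

theorem mem_starNhd_iff {m k : ℕ} {j : Cell Z m} {y : Cube m} (hy : ‖y.1‖ < 1) (hm : m ≤ n + k) :
    chi j y ∈ starNhd U i₀ y₀ ↔ chi j y ∈ star U i₀ y₀ k := by
  refine ⟨fun h => ?_, fun h => Set.mem_iUnion.2 ⟨k, h⟩⟩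
  obtain ⟨l, h⟩ := Set.mem_iUnion.1 h
  exact mem_star_of_le hy hm h

theorem le_of_mem_starNhd {m : ℕ} {j : Cell Z m} {y : Cube m}
    (h : chi j y ∈ starNhd U i₀ y₀) : n ≤ m ∧ (‖y.1‖ = 1 → n < m) := by
  obtain ⟨l, h⟩ := Set.mem_iUnion.1 h
  rcases y.norm_le.lt_or_eq with hy | hy
  · exact ⟨(le_of_mem_star hy h).1, fun h => absurd h hy.ne⟩
  · obtain ⟨m', j', y', hy', e⟩ := exists_chi_eq (chi j y)
    have h1 := lt_of_frontier hy hy' e.symm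
    rw [← e] at h
    have := (le_of_mem_star hy' h).1
    omega

theorem mem_star_iff_of_frontier {k : ℕ} {i : Cell Z (n + k + 1)} {y : Cube (n + k + 1)}
    (hy : ‖y.1‖ = 1) : chi i y ∈ starNhd U i₀ y₀ ↔ chi i y ∈ star U i₀ y₀ k := by
  obtain ⟨m', j', y', hy', e⟩ := exists_chi_eq (chi i y)
  have h1 := lt_of_frontier hy hy' e.symm
  rw [← e]
  exact mem_starNhd_iff hy' (by omega)

/-- The bad points are the projection of a closed set along the compact interval. -/
theorem isOpen_forall_seg {m : ℕ} (i : Cell Z m) (g : C(Cube m, Cube m)) (hU : IsOpen U) :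
    IsOpen {y : Cube m | ∀ t, chi i (seg ((y, g y), t)) ∈ U} := by
  have h1 : IsClosed {q : Cube m × I | chi i (seg ((q.1, g q.1), q.2)) ∈ Uᶜ} :=
    hU.isClosed_compl.preimage (by fun_prop)
  have h2 := (isClosedMap_fst_of_compactSpace (X := Cube m) (Y := I) _ h1).isOpen_compl
  convert h2 using 1
  ext y
  simp

/-- By the weak topology it suffices to look at each closed cell, by strong induction on its
dimension. In a cell of dimension above `n` the conditions are openness of the radial shell,
openness of the trace on the frontier pulled back by `radial`, and the tube condition of
`isOpen_forall_seg`. -/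
theorem isOpen_starNhd (hU : IsOpen U) : IsOpen (starNhd U i₀ y₀) := by
  refine isClosed_compl_iff.1 ?_
  have key (m : ℕ) : ∀ j : Cell Z m, IsOpen (chi j ⁻¹' starNhd U i₀ y₀) := by
    induction m using Nat.strong_induction_on with
    | _ m ih =>
    intro j
    rcases lt_or_ge m n with hm | hm
    · convert isOpen_empty
      refine Set.eq_empty_of_forall_notMem fun y hy => ?_
      have := (le_of_mem_starNhd hy).1
      omega
    obtain ⟨k, rfl⟩ := Nat.exists_eq_add_of_le hm
    rcases k with _ | k
    · have hopen : IsOpen {y : Cube n | ‖y.1‖ < 1} :=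
        isOpen_lt (continuous_norm.comp continuous_subtype_val) continuous_const
      by_cases hj : j = i₀
      · subst hj
        convert hopen.inter (isOpen_forall_seg j (.const _ y₀) hU)
        ext y
        constructor
        · intro h
          have hy : ‖y.1‖ < 1 := y.norm_le.lt_of_ne fun hy => (le_of_mem_starNhd h).2 hy |>.ne rfl
          exact ⟨hy, ((mem_star_zero_iff hy _).1 ((mem_starNhd_iff (k := 0) hy le_rfl).1 h)).2⟩
        · rintro ⟨hy, h⟩
          exact (mem_starNhd_iff (k := 0) hy le_rfl).2 ((mem_star_zero_iff hy _).2 ⟨rfl, h⟩)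
      · convert isOpen_empty
        refine Set.eq_empty_of_forall_notMem fun y h => hj ?_
        have hy : ‖y.1‖ < 1 := y.norm_le.lt_of_ne fun hy => (le_of_mem_starNhd h).2 hy |>.ne rfl
        exact ((mem_star_zero_iff hy _).1 ((mem_starNhd_iff (k := 0) hy le_rfl).1 h)).1
    · change Cell Z (n + k + 1) at j
      -- The trace of the complement on the frontier of `j` is controlled by its traces on cells of
      -- smaller dimension, where the induction hypothesis applies.
      have hfr : IsClosed ((starNhd U i₀ y₀)ᶜ ∩ cellFrontier (n + k + 1) j) := by
        refine isClosed_inter_cellFrontier_succ_of_le_isClosed_inter_closedCell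
          (C := (Set.univ : Set Z)) (fun m hm j' => ?_) j
        have : (starNhd U i₀ y₀)ᶜ ∩ closedCell m j' = chi j' '' (chi j' ⁻¹' (starNhd U i₀ y₀)ᶜ) := by
          ext x
          constructor
          · rintro ⟨hx, y, hy, rfl⟩
            exact ⟨⟨y, hy⟩, hx, rfl⟩
          · rintro ⟨y, hy, rfl⟩
            exact ⟨hy, chi_mem_closed j' y⟩
        rw [this]
        exact ((ih m (by omega) j').isClosed_compl.isCompact.image (chi j').continuous).isClosed
      have h1 : IsOpen {y : Cube (n + k + 1) | 1 / 2 < ‖y.1‖} :=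
        isOpen_lt continuous_const (continuous_norm.comp continuous_subtype_val)
      have h2 := (hfr.preimage ((chi j).continuous.comp radial.continuous)).isOpen_compl
      convert (h1.inter h2).inter (isOpen_forall_seg j radial hU)
      ext y
      have hrad : 1 / 2 < ‖y.1‖ → (chi j (radial y) ∈ star U i₀ y₀ k ↔
          ¬ (chi j (radial y) ∈ (starNhd U i₀ y₀)ᶜ ∧
            chi j (radial y) ∈ cellFrontier (n + k + 1) j)) := by
        intro h
        rw [← mem_star_iff_of_frontier (norm_radial h)]
        have := chi_mem_frontier j (norm_radial h)
        simp [this]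
      rcases y.norm_le.lt_or_eq with hy | hy
      · rw [Set.mem_preimage, mem_starNhd_iff (k := k + 1) hy (by omega), mem_star_succ_iff hy]
        constructor
        · rintro ⟨a, b, c⟩
          exact ⟨⟨a, (hrad a).1 b⟩, c⟩
        · rintro ⟨⟨a, b⟩, c⟩
          exact ⟨a, (hrad a).2 b, c⟩
      · rw [Set.mem_preimage, mem_star_iff_of_frontier hy]
        have hy2 : 1 / 2 < ‖y.1‖ := by rw [hy]; norm_num
        constructor
        · intro h
          refine ⟨⟨hy2, (hrad hy2).1 (by rwa [radial_eq hy])⟩, fun t => ?_⟩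
          rw [radial_eq hy, seg_self]
          exact star_subset k h
        · rintro ⟨⟨a, b⟩, -⟩
          have := (hrad a).2 b
          rwa [radial_eq hy] at this
  exact isClosed_of_preimage fun m j => (key m j).isClosed_compl

/-- The image of a compact space meets only finitely many open cells, which allows continuity to be
checked one cell at a time. -/
theorem chi_of_cells {T : Type*} [TopologicalSpace T] [CompactSpace T] (s : C(T, Z)) :
    ∃ S : Set (Σ n, Cell Z n), S.Finite ∧ (∀ t, ∃ c ∈ S, ∃ y, ‖y.1‖ < 1 ∧ chi c.2 y = s t) ∧
      ∀ c ∈ S, ∃ t y, ‖y.1‖ < 1 ∧ chi c.2 y = s t := by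
  refine ⟨_, finite_cells_of_isCompact (isCompact_range s.continuous), fun t => ?_, ?_⟩
  · obtain ⟨m, j, y, hy, e⟩ := exists_chi_eq (s t)
    exact ⟨⟨m, j⟩, ⟨s t, e ▸ chi_mem_open j hy, t, rfl⟩, y, hy, e⟩
  · rintro ⟨m, j⟩ ⟨x, ⟨y, hy, e⟩, t, rfl⟩
    exact ⟨t, ⟨y, ball_subset_closedBall hy⟩, by simpa using hy, e⟩


open Classical in
/-- The homotopy defined on the open cells of dimension `m` by a map to their closures. -/
def push {m : ℕ} (g : ∀ _ : Cell Z m, C(Cube m, Cube m)) (x : Z) (a : I) : Z :=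
  if h : ∃ (i : Cell Z m) (y : Cube m), ‖y.1‖ < 1 ∧ chi i y = x then
    chi h.choose (seg ((h.choose_spec.choose, g h.choose h.choose_spec.choose), a)) else x

theorem push_of_mem {m : ℕ} (g : ∀ _ : Cell Z m, C(Cube m, Cube m)) {i : Cell Z m} {y : Cube m}
    (hy : ‖y.1‖ < 1) (a : I) : push g (chi i y) a = chi i (seg ((y, g i y), a)) := by
  have h : ∃ (i' : Cell Z m) (y' : Cube m), ‖y'.1‖ < 1 ∧ chi i' y' = chi i y := ⟨i, y, hy, rfl⟩
  rw [push, dif_pos h]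
  have h2 := cell_unique h.choose_spec.choose_spec.1 hy h.choose_spec.choose_spec.2
  -- The chosen cell and point agree with the given ones only as a dependent triple, so the claim is
  -- transported along an equality of triples.
  have (c c' : Σ n, Cell Z n × Cube n) (e : c = c') (hc : c.1 = m) (hc' : c'.1 = m) :
      chi (hc ▸ c.2.1) (seg (((hc ▸ c.2.2 : Cube m), g (hc ▸ c.2.1) (hc ▸ c.2.2)), a)) =
        chi (hc' ▸ c'.2.1) (seg (((hc' ▸ c'.2.2 : Cube m), g (hc' ▸ c'.2.1) (hc' ▸ c'.2.2)), a)) := by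
    subst e
    rfl
  exact this _ _ h2 rfl rfl

theorem push_of_ne {m l : ℕ} (g : ∀ _ : Cell Z m, C(Cube m, Cube m)) {i : Cell Z l} {y : Cube l}
    (hy : ‖y.1‖ < 1) (h : l ≠ m) (a : I) : push g (chi i y) a = chi i y := by
  rw [push, dif_neg]
  rintro ⟨i', y', hy', e⟩
  exact h (congrArg Sigma.fst (cell_unique hy' hy e)).symm

/-- Pushing along the cells of a dimension preserves the values of flat functions. -/
theorem exists_push {f : C(Simp 1, Z) → ZMod 2} (hf : FlatOn f U) {m : ℕ}
    (g : ∀ _ : Cell Z m, C(Cube m, Cube m)) (s : C(Simp 1, Z)) (hs : s v0 = s v1)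
    (hU : ∀ t, s t ∈ U) (hle : ∀ (l : ℕ) (i : Cell Z l) (y : Cube l) (t), ‖y.1‖ < 1 →
      chi i y = s t → l ≤ m)
    (hg : ∀ (i : Cell Z m) (y : Cube m) t, chi i y = s t →
      (‖y.1‖ = 1 → g i y = y) ∧ ∀ a, chi i (seg ((y, g i y), a)) ∈ U) :
    ∃ s' : C(Simp 1, Z), s' v0 = s' v1 ∧ f s' = f s ∧ ∀ t, s' t = push g (s t) 1 := by
  obtain ⟨S, hS, hcov, hS'⟩ := chi_of_cells s
  -- Lower cells stay fixed, and `g` fixes the boundary points that are met, so the formula on open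
  -- `m`-cells also holds on the relevant part of their closures.
  have hc := continuous_of_cells s (push g) hS
    (fun t => by obtain ⟨c, hc, y, -, h⟩ := hcov t; exact ⟨c, hc, y, h⟩) (by
      rintro ⟨l, j⟩ hj
      obtain ⟨t, y, hy, e⟩ := hS' _ hj
      rcases (hle l j y t hy e).eq_or_lt with rfl | hl
      · refine ⟨⟨fun p => chi j (seg ((p.1, g j p.1), p.2)), by fun_prop⟩, fun t y a e => ?_⟩
        rw [← e]
        rcases y.norm_le.lt_or_eq with hy | hy
        · exact push_of_mem g hy a
        · obtain ⟨l', j', y', hy', e'⟩ := exists_chi_eq (chi j y)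
          have h1 := lt_of_frontier hy hy' e'.symm
          change _ = chi j (seg ((y, g j y), a))
          rw [((hg j y t e).1 hy), seg_self, ← e']
          exact push_of_ne g hy' h1.ne a
      · refine ⟨⟨fun p => chi j p.1, by fun_prop⟩, fun t y a e => ?_⟩
        rw [← e]
        obtain ⟨l', j', y', hy', e'⟩ := exists_chi_eq (chi j y)
        have h1 : l' ≤ l := by
          rcases y.norm_le.lt_or_eq with hy | hy
          · exact (congrArg Sigma.fst (cell_unique hy' hy e')).le
          · exact (lt_of_frontier hy hy' e'.symm).le
        change _ = chi j y
        rw [← e']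
        exact push_of_ne g hy' (by omega) a)
  let F : C(I × I, Z) := ⟨fun p => push g (s (unparam p.1)) p.2, hc.comp (by fun_prop :
    Continuous fun p : I × I => (unparam p.1, p.2))⟩
  have hFU (p : I × I) : F p ∈ U := by
    change push g (s (unparam p.1)) p.2 ∈ U
    obtain ⟨l, j, y, hy, e⟩ := exists_chi_eq (s (unparam p.1))
    rw [← e]
    by_cases hl : l = m
    · subst hl
      rw [push_of_mem g hy]
      exact (hg j y _ e).2 _
    · rw [push_of_ne g hy hl, e]
      exact hU _
  have h := hf.eq_of_homotopy F hFU fun t => by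
    change push g (s (unparam 0)) t = push g (s (unparam 1)) t
    rw [unparam_zero, unparam_one, hs]
  refine ⟨F.comp (param.prodMk (.const _ 1)), ?_, ?_, fun t => ?_⟩
  · change push g (s (unparam (param v0))) 1 = push g (s (unparam (param v1))) 1
    rw [unparam_param, unparam_param, hs]
  · rw [← h]
    congr 1
    ext t
    change push g (s (unparam (param t))) 0 = s t
    rw [unparam_param]
    obtain ⟨l, j, y, hy, e⟩ := exists_chi_eq (s t)
    rw [← e]
    by_cases hl : l = m
    · subst hl
      rw [push_of_mem g hy, seg_zero]
    · rw [push_of_ne g hy hl]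
  · change push g (s (unparam (param t))) 1 = _
    rw [unparam_param]

/-- A closed path is pushed radially out of the cells of top dimension `n + k`, which moves it to
the previous stage without changing the value of `f`. At stage `0` straight segments contract it to
the centre, and constant paths have value zero. All these homotopies stay in `U` by construction of
the star. -/
theorem eq_zero_of_mem_star {f : C(Simp 1, Z) → ZMod 2} (hf : FlatOn f U) (k : ℕ)
    (s : C(Simp 1, Z)) (hs : s v0 = s v1) (hk : ∀ t, s t ∈ star U i₀ y₀ k) : f s = 0 := by
  induction k generalizing s with
  | zero =>
    have hlt (i : Cell Z n) (y : Cube n) (t) (e : chi i y = s t) : ‖y.1‖ < 1 :=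
      y.norm_le.lt_of_ne fun hy => by
        have := hk t
        rw [← e] at this
        exact (le_of_mem_starNhd (Set.mem_iUnion.2 ⟨0, this⟩)).2 hy |>.ne rfl
    obtain ⟨s', hs', e, h⟩ := exists_push hf (fun _ => .const _ y₀) s hs
      (fun t => star_subset 0 (hk t)) (fun l i y t hy e => by
        have := hk t
        rw [← e] at this
        exact (le_of_mem_star hy this).2) (fun i y t e => by
        refine ⟨fun hy => absurd hy (hlt i y t e).ne, ?_⟩
        have := hk t
        rw [← e] at this
        exact ((mem_star_zero_iff (hlt i y t e) i).1 this).2)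
    have hc : s' = .const _ (chi i₀ y₀) := by
      ext t
      rw [h]
      obtain ⟨y, hy, e, -⟩ := hk t
      rw [← e, push_of_mem _ hy, ContinuousMap.const_apply, seg_one]
      rfl
    rw [← e, hc]
    refine hf.const ?_
    have := hk v0
    obtain ⟨y, -, -, hy⟩ := this
    have := hy 1
    rwa [seg_one] at this
  | succ k ih =>
    obtain ⟨s', hs', e, h⟩ := exists_push hf (m := n + k + 1) (fun _ => radial) s hs
      (fun t => star_subset _ (hk t)) (fun l i y t hy e => by
        have := hk t
        rw [← e] at this
        exact (le_of_mem_star hy this).2) (fun i y t e => by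
        refine ⟨radial_eq, fun a => ?_⟩
        have h1 := hk t
        rw [← e] at h1
        rcases y.norm_le.lt_or_eq with hy | hy
        · exact ((mem_star_succ_iff hy).1 h1).2.2 a
        · rw [radial_eq hy, seg_self]
          exact star_subset _ h1)
    rw [← e]
    refine ih s' hs' fun t => ?_
    rw [h]
    have h1 := hk t
    obtain ⟨l, j, y, hy, e⟩ := exists_chi_eq (s t)
    rw [← e] at h1 ⊢
    by_cases hl : l = n + k + 1
    · subst hl
      rw [push_of_mem _ hy, seg_one]
      exact ((mem_star_succ_iff hy).1 h1).2.1
    · rw [push_of_ne _ hy hl]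
      have := (le_of_mem_star hy h1).2
      exact mem_star_of_le hy (by omega) h1

/-- A path is compact and meets finitely many open cells, so it lies in a single stage of the star.
-/
theorem eq_zero_of_mem_starNhd {f : C(Simp 1, Z) → ZMod 2} (hf : FlatOn f U)
    (s : C(Simp 1, Z)) (hs : s v0 = s v1) (hk : ∀ t, s t ∈ starNhd U i₀ y₀) : f s = 0 := by
  obtain ⟨S, hS, hcov, -⟩ := chi_of_cells s
  obtain ⟨k, hk'⟩ : ∃ k, ∀ c ∈ S, c.1 ≤ k := by
    obtain ⟨k, hk⟩ := (hS.image Sigma.fst).bddAbove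
    exact ⟨k, fun c hc => hk ⟨c, hc, rfl⟩⟩
  refine eq_zero_of_mem_star (i₀ := i₀) (y₀ := y₀) hf k s hs fun t => ?_
  obtain ⟨c, hc, y, hy, e⟩ := hcov t
  have := hk t
  rw [← e] at this ⊢
  exact (mem_starNhd_iff hy (by have := hk' c hc; omega)).1 this

/-- Points of a CW complex have small neighbourhoods in which flat functions are trivial. -/
theorem exists_local_potential (z : Z) {U : Set Z} (hU : IsOpen U) (hz : z ∈ U) :
    ∃ V : Set Z, IsOpen V ∧ z ∈ V ∧ V ⊆ U ∧ ∀ f : C(Simp 1, Z) → ZMod 2, FlatOn f U →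
      ∃ g : Z → ZMod 2, ∀ s : C(Simp 1, Z), (∀ t, s t ∈ V) → f s = g (s v0) + g (s v1) := by
  obtain ⟨n, i₀, y₀, hy, rfl⟩ := exists_chi_eq z
  refine ⟨starNhd U i₀ y₀, isOpen_starNhd hU, Set.mem_iUnion.2 ⟨0, y₀, hy, rfl, fun t => by
    rwa [seg_self]⟩, Set.iUnion_subset star_subset, fun f hf => ?_⟩
  set V := starNhd U i₀ y₀
  let ι : C(V, Z) := ⟨Subtype.val, continuous_subtype_val⟩
  -- The potential is constructed in the subspace `V`, where every closed path has value zero; it is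
  -- then extended by zero, since only values on `V` matter.
  have hfV : FlatOn (fun s => f (ι.comp s)) (Set.univ : Set V) := fun s _ =>
    hf (ι.comp s) fun x => (Set.iUnion_subset star_subset) (s x).2
  obtain ⟨g, hg⟩ := hfV.exists_potential fun s hs =>
    eq_zero_of_mem_starNhd (i₀ := i₀) (y₀ := y₀) hf (ι.comp s) (congrArg Subtype.val hs)
      fun t => (s t).2
  classical
  refine ⟨fun x => if h : x ∈ V then g ⟨x, h⟩ else 0, fun s hs => ?_⟩
  have := hg ⟨fun t => ⟨s t, hs t⟩, s.continuous.subtype_mk _⟩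
  simp only [dif_pos (hs _)]
  exact this

end CW

/-! ### Realization of degree-one classes by double covers -/

/-- The affine path in the unit interval from `a` to `b`. -/
def affine (a b : I) : C(Simp 1, I) :=
  ⟨fun q => ⟨q 0 * a.1 + q 1 * b.1, by
    have h := stdSimplex.add_eq_one q
    have h0 := stdSimplex.zero_le q 0
    have h1 := stdSimplex.zero_le q 1
    constructor
    · have := a.2.1
      have := b.2.1
      positivity
    · nlinarith [a.2.2, b.2.2]⟩, by
    have h (i : Fin 2) : Continuous fun t : Simp 1 => t i :=
      (continuous_apply i).comp continuous_subtype_val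
    exact Continuous.subtype_mk (((h 0).mul continuous_const).add ((h 1).mul continuous_const)) _⟩

theorem affine_apply (a b : I) (q : Simp 1) : (affine a b q : ℝ) = q 0 * a.1 + q 1 * b.1 := rfl

theorem affine_self (a : I) : affine a a = .const _ a := by
  ext q
  rw [affine_apply, ← add_mul, stdSimplex.add_eq_one q, one_mul]
  rfl

theorem affine_zero_one : affine 0 1 = param := by
  ext q
  rw [affine_apply]
  simp [coordI]

theorem affine_mem {a b : I} {q : Simp 1} {c : I} {r : ℝ} (ha : dist a c < r) (hb : dist b c < r) :
    dist (affine a b q) c < r := by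
  exact convex_ball c.1 r ha hb (stdSimplex.zero_le q 0) (stdSimplex.zero_le q 1)
    (stdSimplex.add_eq_one q)

/-- Apply flatness to the affine, possibly degenerate, triangle with vertices `a`, `b`, `c`. -/
theorem FlatOn.affine_add {B : Type*} [TopologicalSpace B] {f : C(Simp 1, B) → ZMod 2}
    (hf : FlatOn f Set.univ) (p : C(I, B)) (a b c : I) :
    f (p.comp (affine a c)) = f (p.comp (affine a b)) + f (p.comp (affine b c)) := by
  let T : C(Simp 2, I) := ⟨fun x => ⟨x 0 * a.1 + x 1 * b.1 + x 2 * c.1, by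
    have h := stdSimplex.sum_eq_one x
    rw [Fin.sum_univ_three] at h
    have h0 := stdSimplex.zero_le x 0
    have h1 := stdSimplex.zero_le x 1
    have h2 := stdSimplex.zero_le x 2
    constructor
    · have := a.2.1
      have := b.2.1
      have := c.2.1
      positivity
    · nlinarith [a.2.2, b.2.2, c.2.2]⟩, by
    have h (i : Fin 3) : Continuous fun t : Simp 2 => t i :=
      (continuous_apply i).comp continuous_subtype_val
    exact Continuous.subtype_mk ((((h 0).mul continuous_const).add
      ((h 1).mul continuous_const)).add ((h 2).mul continuous_const)) _⟩
  have := hf (p.comp T) fun _ => trivial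
  rw [Fin.sum_univ_three] at this
  have e0 : (p.comp T).comp (faceMap 0) = p.comp (affine b c) := by
    ext t
    refine congrArg p (Subtype.ext ?_)
    change faceMap 0 t 0 * a.1 + faceMap 0 t 1 * b.1 + faceMap 0 t 2 * c.1 = _
    rw [(faceMap_two_apply t).1.1, (faceMap_two_apply t).1.2.1, (faceMap_two_apply t).1.2.2,
      affine_apply]
    ring
  have e1 : (p.comp T).comp (faceMap 1) = p.comp (affine a c) := by
    ext t
    refine congrArg p (Subtype.ext ?_)
    change faceMap 1 t 0 * a.1 + faceMap 1 t 1 * b.1 + faceMap 1 t 2 * c.1 = _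
    rw [(faceMap_two_apply t).2.1.1, (faceMap_two_apply t).2.1.2.1, (faceMap_two_apply t).2.1.2.2,
      affine_apply]
    ring
  have e2 : (p.comp T).comp (faceMap 2) = p.comp (affine a b) := by
    ext t
    refine congrArg p (Subtype.ext ?_)
    change faceMap 2 t 0 * a.1 + faceMap 2 t 1 * b.1 + faceMap 2 t 2 * c.1 = _
    rw [(faceMap_two_apply t).2.2.1, (faceMap_two_apply t).2.2.2.1, (faceMap_two_apply t).2.2.2.2,
      affine_apply]
    ring
  rw [e0, e1, e2] at this
  revert this
  generalize f (p.comp (affine b c)) = x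
  generalize f (p.comp (affine a c)) = y
  generalize f (p.comp (affine a b)) = z
  revert x y z
  decide

/-- A space in which flat functions on paths are locally trivial. -/
def LocallyFlat (Z : Type u) [TopologicalSpace Z] : Prop :=
  ∀ (z : Z) (U : Set Z), IsOpen U → z ∈ U →
    ∃ V : Set Z, IsOpen V ∧ z ∈ V ∧ V ⊆ U ∧ ∀ f : C(Simp 1, Z) → ZMod 2, FlatOn f U →
      ∃ g : Z → ZMod 2, ∀ s : C(Simp 1, Z), (∀ t, s t ∈ V) → f s = g (s v0) + g (s v1)

/-- Represent the class by a flat function. Its local potentials are declared to be the local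
sections of a double cover, whose holonomy is then that function on loops. -/
theorem SignTwist.exists_w1_eq_of_locallyFlat {Z : Type u} [TopologicalSpace Z]
    [LocallyPathConnectedSpace Z] (hZ : LocallyFlat Z) (α : H (ZMod 2) Z 1 →ₗ[ZMod 2] ZMod 2) :
    ∃ τ : SignTwist Z, τ.w1 = α := by
  obtain ⟨f, hf, rfl⟩ := exists_eq_ofFlat α
  have hV (z : Z) := hZ z Set.univ isOpen_univ trivial
  choose V hVo hVz _ hVg using hV
  have hVg' (z : Z) := hVg z f hf
  choose g hg using hVg'
  -- Two potentials have the same increments along paths in the overlap, so local path-connectedness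
  -- makes their difference locally constant.
  have key (x y : Z) (hy : y ∈ V x) : NearConst (𝓝 y) (g x) (g y) y := by
    obtain ⟨W, ⟨hW, hWc⟩, hWs⟩ := (LocallyPathConnectedSpace.path_connected_basis y).mem_iff.1
      (((hVo x).inter (hVo y)).mem_nhds ⟨hy, hVz y⟩)
    filter_upwards [hW] with y' hy'
    obtain ⟨p, hp⟩ := hWc.joinedIn y (mem_of_mem_nhds hW) y' hy'
    have h1 := hg x (onSimp p) fun t => (hWs (hp _)).1
    have h2 := hg y (onSimp p) fun t => (hWs (hp _)).2
    rw [onSimp_v0, onSimp_v1] at h1 h2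
    rw [h1] at h2
    revert h2
    generalize g x y = a
    generalize g y y = b
    generalize g x y' = c
    generalize g y y' = d
    revert a b c d
    decide
  let τ : SignTwist Z :=
    { adm := fun ε x => NearConst (𝓝 x) ε (g x) x
      adm_iff := fun h => ⟨fun h' => h.trans h'.symm, fun h' => h'.symm.trans h⟩
      exists_adm := fun x => ⟨g x, by filter_upwards [(hVo x).mem_nhds (hVz x)] with y using key x y⟩ }
  refine ⟨τ, w1_eq_ext fun γ => ?_⟩
  rw [ofFlat_loopClass]
  set s := γ.comp loopSimplex
  let p : C(I, Z) := s.comp unparam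
  -- The section along the path is the value of `f` on the initial segment up to time `t`;
  -- additivity along the interval compares it with the local potentials.
  let ε (t : I) : ZMod 2 := f (p.comp (affine 0 t))
  have hε : (τ.comap p).IsSection ε := by
    intro t
    refine ⟨g (p t), .refl, ?_⟩
    have hn : p ⁻¹' V (p t) ∈ 𝓝 t :=
      p.continuous.continuousAt ((hVo _).mem_nhds (hVz _))
    obtain ⟨r, hr, hrs⟩ := Metric.mem_nhds_iff.1 hn
    filter_upwards [Metric.ball_mem_nhds t hr] with t' ht'
    have h1 := hg (p t) (p.comp (affine t t')) fun q =>
      hrs (affine_mem (by simpa using hr) ht')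
    have h2 := hf.affine_add p 0 t t'
    have e0 : (p.comp (affine t t')) v0 = p t := by
      refine congrArg p (Subtype.ext ?_)
      rw [affine_apply]
      simp
    have e1 : (p.comp (affine t t')) v1 = p t' := by
      refine congrArg p (Subtype.ext ?_)
      rw [affine_apply]
      simp
    rw [e0, e1] at h1
    change f _ + g (p t) (p t') = f _ + g (p t) (p t)
    rw [h2, h1]
    generalize f (p.comp (affine 0 t)) = a
    generalize g (p t) (p t) = b
    generalize g (p t) (p t') = c
    revert a b c
    decide
  have h2 := hε.comap param
  have e : p.comp param = s := by
    ext t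
    change s (unparam (param t)) = s t
    rw [unparam_param]
  rw [comap_comap, e] at h2
  rw [τ.hol_eq s h2, Function.comp_apply, Function.comp_apply, param_v0, param_v1]
  change f s = f (p.comp (affine 0 0)) + f (p.comp (affine 0 1))
  rw [affine_self, affine_zero_one, e]
  change _ = f (.const _ (p 0)) + _
  rw [hf.const trivial, zero_add]

theorem HasCWType.exists_locallyFlat {X : Type u} [TopologicalSpace X] (h : HasCWType X) :
    ∃ (Z : Type u) (_ : TopologicalSpace Z), LocallyPathConnectedSpace Z ∧ LocallyFlat Z ∧
      Nonempty (ContinuousMap.HomotopyEquiv X Z) := by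
  obtain ⟨Z, _, _, ⟨_⟩, he⟩ := h
  exact ⟨Z, _, inferInstance, fun z U hU hz => exists_local_potential z hU hz, he⟩

theorem HasCWType.hasLPCType {X : Type u} [TopologicalSpace X] (h : HasCWType X) :
    HasLPCType X := by
  obtain ⟨Z, _, h1, _, h2⟩ := h.exists_locallyFlat
  exact ⟨Z, _, h1, h2⟩

theorem SignTwist.exists_w1_eq {X : Type u} [TopologicalSpace X] (h : HasCWType X)
    (α : H (ZMod 2) X 1 →ₗ[ZMod 2] ZMod 2) : ∃ τ : SignTwist X, τ.w1 = α := by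
  obtain ⟨Z, _, _, h1, ⟨e⟩⟩ := h.exists_locallyFlat
  obtain ⟨τ, hτ⟩ := exists_w1_eq_of_locallyFlat h1 (α ∘ₗ hmap (ZMod 2) 1 e.invFun)
  refine ⟨τ.comap e.toFun, ?_⟩
  rw [w1_comap, hτ, LinearMap.comp_assoc]
  have h2 : hmap (ZMod 2) 1 e.invFun ∘ₗ hmap (ZMod 2) 1 e.toFun = LinearMap.id := by
    refine LinearMap.ext fun c => ?_
    rw [LinearMap.comp_apply, hmap_comp, hmap_congr _ e.left_inv]
    obtain ⟨z, rfl⟩ := toH_surjective _ 1 c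
    rw [hmap_toH]
    refine congrArg _ (Subtype.ext ?_)
    have : cmap (ZMod 2) 1 (ContinuousMap.id X) = LinearMap.id :=
      chain_ext _ fun s => by rw [cmap_simplex]; rfl
    exact LinearMap.congr_fun this _
  rw [h2, LinearMap.comp_id]

/-! ### Line bundles as systems of local frames -/

section Cmp

variable {B T : Type*} [TopologicalSpace B] [TopologicalSpace T]

/-- The quotient of two functions is continuous at a point. -/
def Cmp (ρ ρ' : B → ℂˣ) (x : B) : Prop := ContinuousAt (fun y => ρ y / ρ' y) x

variable {ρ ρ' ρ'' η η' : B → ℂˣ} {x : B}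

theorem Cmp.refl : Cmp ρ ρ x := by simp [Cmp, continuousAt_const]

theorem Cmp.symm (h : Cmp ρ ρ' x) : Cmp ρ' ρ x := by
  have := ContinuousAt.inv h
  refine this.congr (.of_forall fun y => ?_)
  simp

theorem Cmp.trans (h : Cmp ρ ρ' x) (h' : Cmp ρ' ρ'' x) : Cmp ρ ρ'' x := by
  refine (ContinuousAt.mul h h').congr (.of_forall fun y => ?_)
  simp

theorem Cmp.mul (h : Cmp ρ ρ' x) (h' : Cmp η η' x) : Cmp (ρ * η) (ρ' * η') x := by
  refine (ContinuousAt.mul h h').congr (.of_forall fun y => ?_)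
  simp [div_mul_div_comm]

theorem Cmp.comp {g : T → B} {t : T} (h : Cmp ρ ρ' (g t)) (hg : ContinuousAt g t) :
    Cmp (ρ ∘ g) (ρ' ∘ g) t :=
  ContinuousAt.comp (g := fun y => ρ y / ρ' y) h hg

theorem Cmp.mul_right_iff : Cmp (ρ * η) (ρ' * η) x ↔ Cmp ρ ρ' x := by
  simp [Cmp, mul_div_mul_right_eq_div]

theorem Cmp.congr (h : Cmp ρ ρ' x) (h' : ∀ᶠ y in 𝓝 x, ρ'' y = ρ y) : Cmp ρ'' ρ' x :=
  ContinuousAt.congr h (h'.mono fun y hy => by simp only [hy])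

theorem Cmp.of_continuousAt (h : ContinuousAt η x) : Cmp (ρ * η) ρ x := by
  simpa [Cmp] using h

end Cmp

/-- The continuous nowhere vanishing local sections of a complex line bundle, written as
multiples of a fixed (not necessarily continuous) section. -/
structure FrameSys (B : Type*) [TopologicalSpace B] where
  adm : (B → ℂˣ) → B → Prop
  adm_iff : ∀ {ρ ρ' : B → ℂˣ} {x : B}, adm ρ x → (adm ρ' x ↔ Cmp ρ' ρ x)
  exists_adm : ∀ x, ∃ ρ, ∀ᶠ y in 𝓝 x, adm ρ y

namespace FrameSys

variable {B T S : Type*} [TopologicalSpace B] [TopologicalSpace T] [TopologicalSpace S]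

theorem adm_cmp (F : FrameSys B) {ρ ρ' : B → ℂˣ} {x : B} (h : F.adm ρ x) (h' : F.adm ρ' x) :
    Cmp ρ' ρ x := (F.adm_iff h).1 h'

theorem exists_adm_self (F : FrameSys B) (x : B) : ∃ ρ, F.adm ρ x := by
  obtain ⟨ρ, h⟩ := F.exists_adm x
  exact ⟨ρ, h.self_of_nhds⟩

/-- Admissible functions at a point form one class under `Cmp`, and this class is nonempty; hence an
inclusion is already an equality. -/
theorem ext_le {F F' : FrameSys B} (h : ∀ ρ x, F.adm ρ x → F'.adm ρ x) : F = F' := by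
  have : F.adm = F'.adm := by
    funext ρ x
    refine propext ⟨h ρ x, fun h' => ?_⟩
    obtain ⟨ρ₀, h₀⟩ := F.exists_adm_self x
    exact (F.adm_iff h₀).2 (F'.adm_cmp (h _ _ h₀) h')
  cases F; cases F'
  simpa using this

/-- The pullback. -/
def comap (F : FrameSys B) (g : C(T, B)) : FrameSys T where
  adm ρ t := ∃ ρ₀, F.adm ρ₀ (g t) ∧ Cmp ρ (ρ₀ ∘ g) t
  adm_iff := by
    rintro ρ ρ' t ⟨ρ₀, h₀, h⟩
    refine ⟨?_, fun h' => ⟨ρ₀, h₀, h'.trans h⟩⟩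
    rintro ⟨ρ₁, h₁, h'⟩
    exact (h'.trans ((F.adm_cmp h₀ h₁).comp g.continuous.continuousAt)).trans h.symm
  exists_adm := fun t => by
    obtain ⟨ρ, h⟩ := F.exists_adm (g t)
    refine ⟨ρ ∘ g, ?_⟩
    filter_upwards [g.continuous.continuousAt.eventually h] with t' ht'
    exact ⟨ρ, ht', .refl⟩

theorem adm_comap {F : FrameSys B} (g : C(T, B)) {ρ : B → ℂˣ} {t : T} (h : F.adm ρ (g t)) :
    (F.comap g).adm (ρ ∘ g) t := ⟨ρ, h, .refl⟩

theorem comap_comap (F : FrameSys B) (g : C(T, B)) (k : C(S, T)) :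
    (F.comap g).comap k = F.comap (g.comp k) := by
  refine ext_le ?_
  rintro ρ x ⟨ρ₀, ⟨ρ₁, h₁, h₂⟩, h⟩
  exact ⟨ρ₁, h₁, h.trans (h₂.comp k.continuous.continuousAt)⟩

theorem comap_id (F : FrameSys B) : F.comap (.id B) = F := by
  refine ext_le ?_
  rintro ρ x ⟨ρ₀, h₁, h⟩
  exact (F.adm_iff h₁).2 h

/-- The frames of a bundle with a continuous global frame. -/
def ofFun (R : B → ℂˣ) : FrameSys B where
  adm ρ x := Cmp ρ R x
  adm_iff h := ⟨fun h' => h'.trans h.symm, fun h' => h'.trans h⟩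
  exists_adm _ := ⟨R, .of_forall fun _ => .refl⟩

/-- The tensor product. -/
instance : Mul (FrameSys B) := ⟨fun F F' =>
  { adm := fun ρ x => ∃ ρ₁ ρ₂, F.adm ρ₁ x ∧ F'.adm ρ₂ x ∧ Cmp ρ (ρ₁ * ρ₂) x
    adm_iff := by
      rintro ρ ρ' x ⟨ρ₁, ρ₂, h₁, h₂, h⟩
      refine ⟨?_, fun h' => ⟨ρ₁, ρ₂, h₁, h₂, h'.trans h⟩⟩
      rintro ⟨ρ₁', ρ₂', h₁', h₂', h'⟩
      exact (h'.trans ((F.adm_cmp h₁ h₁').mul (F'.adm_cmp h₂ h₂'))).trans h.symm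
    exists_adm := fun x => by
      obtain ⟨ρ₁, h₁⟩ := F.exists_adm x
      obtain ⟨ρ₂, h₂⟩ := F'.exists_adm x
      refine ⟨ρ₁ * ρ₂, ?_⟩
      filter_upwards [h₁, h₂] with y hy hy'
      exact ⟨ρ₁, ρ₂, hy, hy', .refl⟩ }⟩

theorem adm_mul {F F' : FrameSys B} {ρ ρ' : B → ℂˣ} {x : B} (h : F.adm ρ x) (h' : F'.adm ρ' x) :
    (F * F').adm (ρ * ρ') x := ⟨ρ, ρ', h, h', .refl⟩

instance : One (FrameSys B) := ⟨ofFun 1⟩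

theorem adm_one_iff {ρ : B → ℂˣ} {x : B} : (1 : FrameSys B).adm ρ x ↔ ContinuousAt ρ x := by
  change Cmp ρ 1 x ↔ _
  simp [Cmp]

theorem adm_mul_continuousAt {F : FrameSys B} {ρ η : B → ℂˣ} {x : B} (h : F.adm ρ x)
    (hη : ContinuousAt η x) : F.adm (ρ * η) x :=
  (F.adm_iff h).2 (.of_continuousAt hη)

theorem ext_mul {F F' F'' : FrameSys B}
    (h : ∀ ρ ρ' x, F.adm ρ x → F'.adm ρ' x → F''.adm (ρ * ρ') x) : F * F' = F'' := by
  refine ext_le ?_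
  rintro ρ x ⟨ρ₁, ρ₂, h₁, h₂, h'⟩
  exact (F''.adm_iff (h _ _ _ h₁ h₂)).2 h'

/-- Relative to product reference sections the associativity, symmetry and unit isomorphisms of
tensor products act as the identity. They become equalities here, and coherence becomes commutative
algebra. -/
instance : CommMonoid (FrameSys B) where
  mul_assoc F F' F'' := by
    refine ext_mul ?_
    rintro ρ ρ' x ⟨ρ₁, ρ₂, h₁, h₂, h⟩ h'
    refine ⟨ρ₁, ρ₂ * ρ', h₁, adm_mul h₂ h', ?_⟩
    rw [← mul_assoc]
    exact h.mul .refl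
  mul_comm F F' := ext_mul fun ρ ρ' x h h' => by
    rw [mul_comm]
    exact adm_mul h' h
  one_mul F := ext_mul fun ρ ρ' x h h' => by
    rw [mul_comm]
    exact adm_mul_continuousAt h' (adm_one_iff.1 h)
  mul_one F := ext_mul fun ρ ρ' x h h' => adm_mul_continuousAt h (adm_one_iff.1 h')

theorem comap_mul (F F' : FrameSys B) (g : C(T, B)) :
    (F * F').comap g = F.comap g * F'.comap g := by
  refine (ext_mul ?_).symm
  rintro ρ ρ' t ⟨ρ₀, h₀, h⟩ ⟨ρ₀', h₀', h'⟩
  exact ⟨ρ₀ * ρ₀', adm_mul h₀ h₀', h.mul h'⟩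

/-- Change of the reference section. -/
def scale (F : FrameSys B) (c : B → ℂˣ) : FrameSys B where
  adm ρ x := F.adm (ρ * c) x
  adm_iff h := (F.adm_iff h).trans Cmp.mul_right_iff
  exists_adm x := by
    obtain ⟨ρ, h⟩ := F.exists_adm x
    refine ⟨ρ / c, ?_⟩
    rwa [div_mul_cancel]

theorem scale_adm {F : FrameSys B} {c ρ : B → ℂˣ} {x : B} :
    (F.scale c).adm ρ x ↔ F.adm (ρ * c) x := Iff.rfl

theorem scale_mul_scale (F F' : FrameSys B) (c c' : B → ℂˣ) :
    F.scale c * F'.scale c' = (F * F').scale (c * c') :=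
  ext_mul fun ρ ρ' x h h' => by
    rw [scale_adm, mul_mul_mul_comm]
    exact adm_mul h h'

theorem scale_one (F : FrameSys B) : F.scale 1 = F := ext_le fun ρ x h => by
  rwa [scale_adm, mul_one] at h

theorem mul_scale (F F' : FrameSys B) (c : B → ℂˣ) : F * F'.scale c = (F * F').scale c := by
  conv_lhs => rw [← F.scale_one]
  rw [scale_mul_scale, one_mul]

theorem scale_scale (F : FrameSys B) (c c' : B → ℂˣ) : (F.scale c).scale c' = F.scale (c * c') :=
  ext_le fun ρ x h => by
    rw [scale_adm, scale_adm] at h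
    rwa [scale_adm, mul_comm c, ← mul_assoc]

theorem comap_scale (F : FrameSys B) (c : B → ℂˣ) (g : C(T, B)) :
    (F.scale c).comap g = (F.comap g).scale (c ∘ g) := by
  refine ext_le ?_
  rintro ρ t ⟨ρ₀, h₀, h⟩
  exact ⟨ρ₀ * c, h₀, h.mul .refl⟩

/-- A continuous global frame. -/
def IsSection (F : FrameSys B) (ρ : B → ℂˣ) : Prop := ∀ x, F.adm ρ x

theorem IsSection.comap {F : FrameSys B} {ρ : B → ℂˣ} (h : F.IsSection ρ) (g : C(T, B)) :
    (F.comap g).IsSection (ρ ∘ g) := fun t => adm_comap g (h (g t))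

theorem IsSection.mul {F F' : FrameSys B} {ρ ρ' : B → ℂˣ} (h : F.IsSection ρ)
    (h' : F'.IsSection ρ') : (F * F').IsSection (ρ * ρ') := fun x => adm_mul (h x) (h' x)

theorem IsSection.mul_continuous {F : FrameSys B} {ρ η : B → ℂˣ} (h : F.IsSection ρ)
    (hη : Continuous η) : F.IsSection (ρ * η) :=
  fun x => adm_mul_continuousAt (h x) hη.continuousAt

theorem IsSection.continuous_div {F : FrameSys B} {ρ ρ' : B → ℂˣ} (h : F.IsSection ρ)
    (h' : F.IsSection ρ') : Continuous fun x => ρ' x / ρ x :=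
  continuous_iff_continuousAt.2 fun x => F.adm_cmp (h x) (h' x)

end FrameSys

/-! ### Signs and square roots of nonzero complex numbers -/

/-- The sign of an element of `ℤ / 2`. -/
def sgn (a : ZMod 2) : ℂˣ := if a = 0 then 1 else -1

theorem sgn_zero : sgn 0 = 1 := rfl

theorem sgn_add (a b : ZMod 2) : sgn (a + b) = sgn a * sgn b := by
  rcases zmod_two_cases a with rfl | rfl <;> rcases zmod_two_cases b with rfl | rfl <;>
    simp [sgn, zmod_two_add_self]

theorem sgn_mul_self (a : ZMod 2) : sgn a * sgn a = 1 := by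
  rw [← sgn_add, zmod_two_add_self, sgn_zero]

theorem sgn_inv (a : ZMod 2) : (sgn a)⁻¹ = sgn a := inv_eq_of_mul_eq_one_left (sgn_mul_self a)

theorem neg_one_ne_one : (-1 : ℂˣ) ≠ 1 := by
  intro h
  have := congrArg Units.val h
  norm_num at this

theorem sgn_injective : Function.Injective sgn := by
  intro a b h
  rcases zmod_two_cases a with rfl | rfl <;> rcases zmod_two_cases b with rfl | rfl
  · rfl
  · exact absurd h.symm neg_one_ne_one
  · exact absurd h neg_one_ne_one
  · rfl

theorem exists_sgn {z : ℂˣ} (h : z * z = 1) : ∃ a, z = sgn a := by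
  have h1 : (z : ℂ) * z = 1 := by rw [← Units.val_mul, h, Units.val_one]
  rcases mul_self_eq_one_iff.1 h1 with h2 | h2
  · exact ⟨0, Units.ext h2⟩
  · exact ⟨1, Units.ext h2⟩

theorem exists_sgn_mul {z z' : ℂˣ} (h : z * z = z' * z') : ∃ a, z = sgn a * z' := by
  obtain ⟨a, ha⟩ := exists_sgn (z := z / z') (by rw [div_mul_div_comm, h, div_self'])
  exact ⟨a, by rw [← ha, div_mul_cancel]⟩

/-- No continuity is needed: reference sections may be rescaled by arbitrary functions, so roots are
chosen pointwise. -/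
theorem exists_sqrt (z : ℂˣ) : ∃ z' : ℂˣ, z' * z' = z := by
  obtain ⟨y, hy⟩ := IsAlgClosed.exists_pow_nat_eq (z : ℂ) zero_lt_two
  have h0 : y ≠ 0 := by
    rintro rfl
    exact z.ne_zero (by rw [← hy]; simp)
  exact ⟨Units.mk0 y h0, Units.ext (by rw [Units.val_mul, Units.val_mk0, ← hy, sq])⟩

/-- Continuity of a function with two values. -/
theorem continuousAt_sgn_iff {B : Type*} [TopologicalSpace B] {s : B → ZMod 2} {x : B} :
    ContinuousAt (fun y => sgn (s y)) x ↔ ∀ᶠ y in 𝓝 x, s y = s x := by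
  constructor
  · intro h
    have h1 : {z : ℂˣ | z ≠ - sgn (s x)} ∈ 𝓝 (sgn (s x)) :=
      isOpen_ne.mem_nhds fun h => by
        have := congrArg Units.val h
        rw [Units.val_neg, self_eq_neg] at this
        exact Units.ne_zero _ this
    filter_upwards [h h1] with y hy
    by_contra hne
    refine hy ?_
    rcases zmod_two_cases (s x) with h0 | h0 <;> rcases zmod_two_cases (s y) with h0' | h0' <;>
      simp_all [sgn]
  · intro h
    exact (continuousAt_const : ContinuousAt (fun _ => sgn (s x)) x).congr
      (h.mono fun y hy => by simp only [hy])

/-- The square root near one. -/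
theorem exists_local_sqrt : ∃ q : ℂˣ → ℂˣ, ∀ᶠ z in 𝓝 1, ContinuousAt q z ∧ q z * q z = z := by
  let q (z : ℂˣ) : ℂˣ := Units.mk0 (Complex.exp (Complex.log z / 2)) (Complex.exp_ne_zero _)
  refine ⟨q, ?_⟩
  have h : ∀ᶠ z : ℂˣ in 𝓝 1, (z : ℂ) ∈ Complex.slitPlane :=
    Units.continuous_val.continuousAt (Complex.isOpen_slitPlane.mem_nhds (by simp))
  filter_upwards [h] with z hz
  constructor
  · refine (Units.isEmbedding_val₀.isInducing.continuousAt_iff).2 ?_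
    have h1 : ContinuousAt (fun z : ℂˣ => (z : ℂ)) z := Units.continuous_val.continuousAt
    exact Complex.continuous_exp.continuousAt.comp ((h1.clog hz).div_const 2)
  · ext
    change Complex.exp (Complex.log z / 2) * Complex.exp (Complex.log z / 2) = z
    rw [← Complex.exp_add, add_halves, Complex.exp_log z.ne_zero]

theorem cmp_sgn_iff {B : Type*} [TopologicalSpace B] {s s' : B → ZMod 2} {x : B} :
    Cmp (fun y => sgn (s y)) (fun y => sgn (s' y)) x ↔ NearConst (𝓝 x) s' s x := by
  have : (fun y => sgn (s y) / sgn (s' y)) = fun y => sgn (s' y + s y) := by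
    funext y
    rw [sgn_add, div_eq_mul_inv, sgn_inv, mul_comm]
  rw [Cmp, this, continuousAt_sgn_iff]
  rfl

/-- Two frames with comparable squares are comparable, locally up to sign. -/
theorem exists_cmp_of_sq {B : Type*} [TopologicalSpace B] {ρ ρ' : B → ℂˣ} {x : B}
    (h : ∀ᶠ y in 𝓝 x, Cmp (ρ * ρ) (ρ' * ρ') y) :
    ∃ s : B → ZMod 2, ∀ᶠ y in 𝓝 x, Cmp ((fun y => sgn (s y)) * ρ) ρ' y := by
  obtain ⟨q, hq⟩ := exists_local_sqrt
  -- Dividing by the value at `x` moves the quotient of squares close to `1`, where `q` is a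
  -- continuous square root.
  obtain ⟨c, hc⟩ := exists_sqrt (ρ x * ρ x / (ρ' x * ρ' x))
  let f (y : B) : ℂˣ := ρ y * ρ y / (ρ' y * ρ' y) / (c * c)
  have hf : ∀ᶠ y in 𝓝 x, ContinuousAt f y := by
    filter_upwards [h] with y hy
    exact ContinuousAt.div' hy continuousAt_const
  have hfx : f x = 1 := by simp [f, hc]
  have h1 : ∀ᶠ y in 𝓝 x, ContinuousAt q (f y) ∧ q (f y) * q (f y) = f y := by
    have := hf.self_of_nhds.eventually (p := fun z => ContinuousAt q z ∧ q z * q z = z)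
    rw [hfx] at this
    exact this hq
  have h2 (y : B) : ∃ a, q (f y) * q (f y) = f y → c * q (f y) * ρ' y = sgn a * ρ y := by
    by_cases hy : q (f y) * q (f y) = f y
    · obtain ⟨a, ha⟩ := exists_sgn_mul (z := c * q (f y) * ρ' y) (z' := ρ y) (by
        rw [mul_mul_mul_comm, mul_mul_mul_comm c, hy, mul_div_cancel, div_mul_cancel])
      exact ⟨a, fun _ => ha⟩
    · exact ⟨0, fun h => absurd h hy⟩
  choose s hs using h2
  refine ⟨s, ?_⟩
  filter_upwards [hf, h1.eventually_nhds] with y hy hy'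
  have h3 : Cmp (fun y => c * q (f y) * ρ' y) ρ' y := by
    have : ContinuousAt (fun y => c * q (f y)) y :=
      continuousAt_const.mul (ContinuousAt.comp (g := q) hy'.self_of_nhds.1 hy)
    refine this.congr (.of_forall fun z => ?_)
    simp
  refine h3.congr ?_
  filter_upwards [hy'] with z hz
  exact (hs z hz.2).symm

/-! ### The double cover of isomorphisms between two bundles with the same square -/

namespace FrameSys

variable {B T : Type*} [TopologicalSpace B] [TopologicalSpace T]

/-- The double cover of isomorphisms between two bundles with the same square. -/
def sgnTwist (F F' : FrameSys B) (h : F * F = F' * F') : SignTwist B where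
  adm s x := ∃ ρ, F.adm ρ x ∧ F'.adm ((fun y => sgn (s y)) * ρ) x
  adm_iff := by
    rintro s s' x ⟨ρ, h₁, h₂⟩
    rw [← cmp_sgn_iff]
    constructor
    · rintro ⟨ρ', h₁', h₂'⟩
      have h3 := F'.adm_cmp h₂ h₂'
      have h4 := h3.trans ((Cmp.refl (ρ := fun y => sgn (s y))).mul (F.adm_cmp h₁' h₁))
      exact Cmp.mul_right_iff.1 h4
    · intro h3
      exact ⟨ρ, h₁, (F'.adm_iff h₂).2 (h3.mul .refl)⟩
  exists_adm := fun x => by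
    obtain ⟨ρ, h₁⟩ := F.exists_adm x
    obtain ⟨ρ', h₂⟩ := F'.exists_adm x
    have h3 : ∀ᶠ y in 𝓝 x, Cmp (ρ * ρ) (ρ' * ρ') y := by
      filter_upwards [h₁, h₂] with y hy hy'
      refine (F' * F').adm_cmp (adm_mul hy' hy') ?_
      rw [← h]
      exact adm_mul hy hy
    obtain ⟨s, hs⟩ := exists_cmp_of_sq h3
    refine ⟨s, ?_⟩
    filter_upwards [h₁, h₂, hs] with y hy hy' hsy
    exact ⟨ρ, hy, (F'.adm_iff hy').2 hsy⟩

/-- Any frame of `F` may serve as a test, since two frames have a continuous ratio. -/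
theorem sgnTwist_adm_iff {F F' : FrameSys B} {h : F * F = F' * F'} {s : B → ZMod 2} {x : B}
    {ρ : B → ℂˣ} (hρ : F.adm ρ x) :
    (F.sgnTwist F' h).adm s x ↔ F'.adm ((fun y => sgn (s y)) * ρ) x := by
  refine ⟨?_, fun h' => ⟨ρ, hρ, h'⟩⟩
  rintro ⟨ρ', h₁, h₂⟩
  exact (F'.adm_iff h₂).2 (Cmp.refl.mul (F.adm_cmp h₁ hρ))

/-- A global section is an isomorphism acting on reference sections by signs, that is, an equality
of frame systems after rescaling. -/
theorem sgnTwist_isSection_iff {F F' : FrameSys B} {h : F * F = F' * F'} {s : B → ZMod 2} :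
    (F.sgnTwist F' h).IsSection s ↔ F = F'.scale fun y => sgn (s y) := by
  constructor
  · intro hs
    refine ext_le fun ρ x hρ => ?_
    rw [scale_adm, mul_comm]
    exact (sgnTwist_adm_iff hρ).1 (hs x)
  · intro hF x
    obtain ⟨ρ, hρ⟩ := F.exists_adm_self x
    refine (sgnTwist_adm_iff hρ).2 ?_
    rw [hF, scale_adm, mul_comm] at hρ
    exact hρ

theorem comap_sgnTwist (F F' : FrameSys B) (h : F * F = F' * F') (g : C(T, B))
    (h' : F.comap g * F.comap g = F'.comap g * F'.comap g) {s : T → ZMod 2} {t : T}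
    (hs : ((F.sgnTwist F' h).comap g).adm s t) : ((F.comap g).sgnTwist (F'.comap g) h').adm s t := by
  obtain ⟨s₀, ⟨ρ, h₁, h₂⟩, h₃⟩ := hs
  refine ⟨ρ ∘ g, adm_comap g h₁, (((F'.comap g)).adm_iff (adm_comap g h₂)).2 ?_⟩
  exact (cmp_sgn_iff.2 h₃.symm).mul .refl

end FrameSys

/-! ### The class comparing two square roots -/

section RootW

open FrameSys

variable {B T : Type u} [TopologicalSpace B] [TopologicalSpace T]

open Classical in
/-- The first Stiefel-Whitney class of the double cover of isomorphisms between two bundles with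
the same square. -/
def rootW (F F' : FrameSys B) : H (ZMod 2) B 1 →ₗ[ZMod 2] ZMod 2 :=
  -- The value zero for different squares is a mere default; it removes proof arguments from the
  -- later algebra.
  if h : F * F = F' * F' then (F.sgnTwist F' h).w1 else 0

theorem rootW_eq {F F' : FrameSys B} (h : F * F = F' * F') :
    rootW F F' = (F.sgnTwist F' h).w1 := dif_pos h

/-- Isomorphisms compose, and composition adds the exponents of their signs. -/
theorem rootW_add {F F' F'' : FrameSys B} (h : F * F = F' * F') (h' : F' * F' = F'' * F'') :
    rootW F F'' = rootW F F' + rootW F' F'' := by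
  rw [rootW_eq h, rootW_eq h', rootW_eq (h.trans h')]
  refine SignTwist.IsSum.w1 ?_
  rintro x s s' ⟨ρ, h₁, h₂⟩ h₃
  rw [sgnTwist_adm_iff h₂, ← mul_assoc] at h₃
  refine ⟨ρ, h₁, ?_⟩
  convert h₃ using 2
  funext y
  simp [sgn_add, mul_comm]

theorem rootW_mul {F F' G G' : FrameSys B} (h : F * F = F' * F') (h' : G * G = G' * G') :
    rootW (F * G) (F' * G') = rootW F F' + rootW G G' := by
  rw [rootW_eq h, rootW_eq h', rootW_eq (by rw [mul_mul_mul_comm, h, h', mul_mul_mul_comm])]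
  refine SignTwist.IsSum.w1 ?_
  rintro x s s' ⟨ρ, h₁, h₂⟩ ⟨ρ', h₁', h₂'⟩
  refine ⟨ρ * ρ', adm_mul h₁ h₁', ?_⟩
  convert adm_mul h₂ h₂' using 1
  funext y
  simp [sgn_add, mul_mul_mul_comm]

theorem rootW_scale {F F' : FrameSys B} (h : F * F = F' * F') (c : B → ℂˣ) :
    rootW (F.scale c) (F'.scale c) = rootW F F' := by
  rw [rootW_eq h, rootW_eq (by rw [scale_mul_scale, scale_mul_scale, h])]
  refine (SignTwist.w1_eq_of_le ?_).symm
  rintro s x ⟨ρ, h₁, h₂⟩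
  refine ⟨ρ / c, ?_, ?_⟩
  · rwa [scale_adm, div_mul_cancel]
  · rwa [scale_adm, mul_assoc, div_mul_cancel]

theorem rootW_comap {F F' : FrameSys B} (h : F * F = F' * F') (g : C(T, B)) :
    rootW (F.comap g) (F'.comap g) = rootW F F' ∘ₗ hmap (ZMod 2) 1 g := by
  rw [rootW_eq h, rootW_eq (by rw [← comap_mul, ← comap_mul, h]), ← SignTwist.w1_comap]
  exact (SignTwist.w1_eq_of_le fun s x hs => comap_sgnTwist F F' h g _ hs).symm

theorem rootW_self (F : FrameSys B) : rootW F F = 0 := by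
  rw [rootW_eq rfl]
  refine SignTwist.w1_eq_zero (ε := fun _ => 0) (sgnTwist_isSection_iff.2 ?_)
  exact F.scale_one.symm

theorem rootW_eq_zero_of_scale {F F' : FrameSys B} {s : B → ZMod 2}
    (h : F = F'.scale fun y => sgn (s y)) : rootW F F' = 0 := by
  have h' : F * F = F' * F' := by
    rw [h, scale_mul_scale]
    convert (F' * F').scale_one
    funext y
    exact sgn_mul_self _
  rw [rootW_eq h']
  exact SignTwist.w1_eq_zero (sgnTwist_isSection_iff.2 h)

/-- The homotopy type enters here: the class must detect triviality over the whole space and not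
only over loops. -/
theorem exists_scale_of_rootW (hB : HasLPCType B) {F F' : FrameSys B} (h : F * F = F' * F')
    (h0 : rootW F F' = 0) : ∃ s : B → ZMod 2, F = F'.scale fun y => sgn (s y) := by
  rw [rootW_eq h] at h0
  obtain ⟨s, hs⟩ := SignTwist.exists_section_of_w1 hB h0
  exact ⟨s, sgnTwist_isSection_iff.1 hs⟩

theorem rootW_swap {F F' : FrameSys B} (h : F * F = F' * F') : rootW F' F = rootW F F' := by
  have := rootW_add h h.symm
  rw [rootW_self] at this
  ext c
  have := LinearMap.congr_fun this c
  rw [LinearMap.zero_apply, LinearMap.add_apply] at this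
  exact (zmod_two_add_eq_zero.1 this.symm).symm

/-- The twist of a bundle by a double cover. -/
def FrameSys.twist (F : FrameSys B) (τ : SignTwist B) : FrameSys B where
  adm ρ x := ∃ s ρ₀, τ.adm s x ∧ F.adm ρ₀ x ∧ Cmp ρ ((fun y => sgn (s y)) * ρ₀) x
  adm_iff := by
    rintro ρ ρ' x ⟨s, ρ₀, hs, h₀, h⟩
    refine ⟨?_, fun h' => ⟨s, ρ₀, hs, h₀, h'.trans h⟩⟩
    rintro ⟨s', ρ₀', hs', h₀', h'⟩
    exact (h'.trans ((cmp_sgn_iff.2 ((τ.adm_iff hs).1 hs')).mul (F.adm_cmp h₀ h₀'))).trans h.symm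
  exists_adm := fun x => by
    obtain ⟨s, hs⟩ := τ.exists_adm x
    obtain ⟨ρ, hρ⟩ := F.exists_adm x
    refine ⟨(fun y => sgn (s y)) * ρ, ?_⟩
    filter_upwards [hs, hρ] with y hy hy'
    exact ⟨s, ρ, hy, hy', .refl⟩

theorem twist_mul_self (F : FrameSys B) (τ : SignTwist B) : F.twist τ * F.twist τ = F * F := by
  refine ext_mul ?_
  rintro ρ ρ' x ⟨s, ρ₀, hs, h₀, h⟩ ⟨s', ρ₀', hs', h₀', h'⟩
  refine ((F * F).adm_iff (adm_mul h₀ h₀')).2 ((h.mul h').trans ?_)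
  have h1 : Cmp (fun y => sgn (s y)) (fun y => sgn (s' y)) x :=
    cmp_sgn_iff.2 ((τ.adm_iff hs').1 hs)
  have h2 := h1.mul (Cmp.refl (ρ := fun y => sgn (s' y)))
  have h3 : ((fun y => sgn (s' y)) * fun y => sgn (s' y)) = 1 := funext fun y => sgn_mul_self _
  rw [h3] at h2
  have h4 := h2.mul (Cmp.refl (ρ := ρ₀ * ρ₀'))
  rwa [one_mul, mul_mul_mul_comm] at h4

/-- A frame of `F` multiplied by a section of `τ` is a frame of the twist, so sections of `τ` are
isomorphisms between the two. -/
theorem rootW_twist (F : FrameSys B) (τ : SignTwist B) : rootW F (F.twist τ) = τ.w1 := by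
  rw [rootW_eq (twist_mul_self F τ).symm]
  refine (SignTwist.w1_eq_of_le fun s x hs => ?_).symm
  obtain ⟨ρ, hρ⟩ := F.exists_adm_self x
  exact ⟨ρ, hρ, s, ρ, hs, hρ, .refl⟩

end RootW

/-! ### From line bundles to frame systems -/

namespace LineBundle

variable {B : Type u} [TopologicalSpace B] {T : Type*} [TopologicalSpace T]

/-- Continuity of a section along a map, in a local trivialization. -/
theorem continuousAt_pt_iff (E : LineBundle.{u, v} B) (e : Trivialization ℂ (π ℂ E.Fib))
    {g : T → B} {t : T} (hg : ContinuousAt g t) (ht : g t ∈ e.baseSet) (a : ∀ t, E.Fib (g t)) :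
    ContinuousAt (fun t => E.pt (g t) (a t)) t ↔
      ContinuousAt (fun t => (e (E.pt (g t) (a t))).2) t := by
  have := e.tendsto_nhds_iff (l := 𝓝 t) (f := fun t => E.pt (g t) (a t)) (z := E.pt (g t) (a t))
    (e.mem_source.2 ht)
  exact this.trans ⟨fun h => h.2, fun h => ⟨hg, h⟩⟩

theorem continuousAt_pt_id_iff (E : LineBundle.{u, v} B) (e : Trivialization ℂ (π ℂ E.Fib))
    {x : B} (hx : x ∈ e.baseSet) (a : ∀ y, E.Fib y) :
    ContinuousAt (fun y => E.pt y (a y)) x ↔ ContinuousAt (fun y => (e (E.pt y (a y))).2) x :=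
  E.continuousAt_pt_iff e continuousAt_id hx a

theorem continuousAt_pullback_pt_iff {T : Type w} [TopologicalSpace T] {E : LineBundle.{u, v} B}
    {g : C(T, B)} {t : T} {a : ∀ t, E.Fib (g t)} :
    ContinuousAt (fun t => (E.pullback g).pt t (a t)) t ↔
      ContinuousAt (fun t => E.pt (g t) (a t)) t := by
  refine (inducing_pullbackTotalSpaceEmbedding ℂ E.Fib g).continuousAt_iff.trans ?_
  exact ⟨fun h => continuous_snd.continuousAt.comp h, fun h => continuousAt_id.prodMk h⟩

theorem eventually_mem_baseSet (E : LineBundle.{u, v} B) {g : T → B} {t : T}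
    (hg : ContinuousAt g t) : ∀ᶠ t' in 𝓝 t, g t' ∈ (trivializationAt ℂ E.Fib (g t)).baseSet :=
  hg ((trivializationAt ℂ E.Fib (g t)).open_baseSet.mem_nhds (mem_baseSet_trivializationAt ..))

theorem triv_smul (E : LineBundle.{u, v} B) (b : B) {y : B}
    (hy : y ∈ (trivializationAt ℂ E.Fib b).baseSet) (z : ℂ) (x : E.Fib y) :
    (trivializationAt ℂ E.Fib b (E.pt y (z • x))).2 =
      z * (trivializationAt ℂ E.Fib b (E.pt y x)).2 :=
  ((trivializationAt ℂ E.Fib b).linear ℂ hy).map_smul z x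

theorem triv_ne_zero (E : LineBundle.{u, v} B) (b : B) {y : B}
    (hy : y ∈ (trivializationAt ℂ E.Fib b).baseSet) {x : E.Fib y} (hx : x ≠ 0) :
    (trivializationAt ℂ E.Fib b (E.pt y x)).2 ≠ 0 := by
  intro h
  refine hx (((trivializationAt ℂ E.Fib b).linearEquivAt ℂ y hy).map_eq_zero_iff.1 ?_)
  exact h

theorem continuousAt_smul (E : LineBundle.{u, v} B) {g : T → B} {t : T} (hg : ContinuousAt g t)
    {a : ∀ t, E.Fib (g t)} {z : T → ℂ} (hz : ContinuousAt z t)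
    (ha : ContinuousAt (fun t => E.pt (g t) (a t)) t) :
    ContinuousAt (fun t => E.pt (g t) (z t • a t)) t := by
  have ht := mem_baseSet_trivializationAt ℂ E.Fib (g t)
  rw [continuousAt_pt_iff E _ hg ht] at ha ⊢
  refine (hz.mul ha).congr ?_
  filter_upwards [E.eventually_mem_baseSet hg] with t' ht'
  exact (E.triv_smul _ ht' _ _).symm

/-- In a local trivialization the coefficient is a quotient of continuous coordinates with
denominator nonzero near `t`. -/
theorem continuousAt_of_smul (E : LineBundle.{u, v} B) {g : T → B} {t : T} (hg : ContinuousAt g t)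
    {a : ∀ t, E.Fib (g t)} {z : T → ℂ} (h0 : a t ≠ 0)
    (ha : ContinuousAt (fun t => E.pt (g t) (a t)) t)
    (hz : ContinuousAt (fun t => E.pt (g t) (z t • a t)) t) : ContinuousAt z t := by
  have ht := mem_baseSet_trivializationAt ℂ E.Fib (g t)
  rw [continuousAt_pt_iff E _ hg ht] at ha hz
  have hne := E.triv_ne_zero (g t) ht h0
  refine (hz.div ha hne).congr ?_
  filter_upwards [E.eventually_mem_baseSet hg, ha.eventually_ne hne] with t' ht' h
  rw [Pi.div_apply, E.triv_smul _ ht', mul_div_cancel_right₀ _ h]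

/-- A nowhere vanishing, not necessarily continuous section. -/
structure Ref (E : LineBundle.{u, v} B) where
  val : ∀ b, E.Fib b
  ne : ∀ b, val b ≠ 0

variable {E F : LineBundle.{u, v} B}

instance : Nonempty E.Ref := by
  have h (b : B) : ∃ x : E.Fib b, x ≠ 0 := by
    let e := (trivializationAt ℂ E.Fib b).linearEquivAt ℂ b (mem_baseSet_trivializationAt ..)
    exact ⟨e.symm 1, fun h => one_ne_zero (α := ℂ) (e.symm.map_eq_zero_iff.1 h)⟩
  choose x hx using h
  exact ⟨⟨x, hx⟩⟩

theorem exists_smul_eq (E : LineBundle.{u, v} B) {b : B} {x : E.Fib b} (hx : x ≠ 0) (y : E.Fib b) :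
    ∃ z : ℂ, z • x = y := by
  let e := (trivializationAt ℂ E.Fib b).linearEquivAt ℂ b (mem_baseSet_trivializationAt ..)
  have h : e x ≠ 0 := fun h => hx (e.map_eq_zero_iff.1 h)
  refine ⟨e y / e x, e.injective ?_⟩
  rw [map_smul, smul_eq_mul, div_mul_cancel₀ _ h]

namespace Ref

/-- The coordinate of a nonzero vector. -/
theorem exists_unit (ε : E.Ref) {b : B} {y : E.Fib b} (hy : y ≠ 0) : ∃ z : ℂˣ, y = (z : ℂ) • ε.val b := by
  obtain ⟨z, rfl⟩ := E.exists_smul_eq (ε.ne b) y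
  exact ⟨Units.mk0 z fun h => hy (by rw [h, zero_smul]), rfl⟩

/-- The coordinate of a fibre. -/
def equiv (ε : E.Ref) (b : B) : ℂ ≃ₗ[ℂ] E.Fib b :=
  LinearEquiv.ofBijective (LinearMap.toSpanSingleton ℂ _ (ε.val b))
    ⟨smul_left_injective ℂ (ε.ne b), fun y => E.exists_smul_eq (ε.ne b) y⟩

theorem equiv_apply (ε : E.Ref) (b : B) (z : ℂ) : ε.equiv b z = z • ε.val b := rfl

theorem equiv_symm_smul (ε : E.Ref) (b : B) (z : ℂ) : (ε.equiv b).symm (z • ε.val b) = z :=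
  (ε.equiv b).symm_apply_apply z

/-- Multiplication with a function. -/
def scale (ε : E.Ref) (c : B → ℂˣ) : E.Ref where
  val b := (c b : ℂ) • ε.val b
  ne b := smul_ne_zero (c b).ne_zero (ε.ne b)

def map (ε : E.Ref) (φ : E.Iso F) : F.Ref where
  val b := φ.map b (ε.val b)
  ne b := fun h => ε.ne b ((φ.map b).map_eq_zero_iff.1 h)

def pullback {T : Type w} [TopologicalSpace T] (ε : E.Ref) (g : C(T, B)) : (E.pullback g).Ref where
  val t := ε.val (g t)
  ne t := ε.ne (g t)

def tensor (ε : E.Ref) (η : F.Ref) : (E.tensor F).Ref where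
  val b := ε.val b ⊗ₜ[ℂ] η.val b
  ne b := by
    intro h
    replace h : (ε.val b ⊗ₜ[ℂ] η.val b : E.Fib b ⊗[ℂ] F.Fib b) = 0 := h
    have h1 := congrArg (fun t => TensorProduct.lid ℂ ℂ
      (TensorProduct.congr (ε.equiv b).symm (η.equiv b).symm t)) h
    have h2 : (ε.equiv b).symm (ε.val b) = 1 := by
      rw [← ε.equiv_symm_smul b 1, one_smul]
    have h3 : (η.equiv b).symm (η.val b) = 1 := by
      rw [← η.equiv_symm_smul b 1, one_smul]
    simp [h2, h3] at h1

theorem ext_val {ε η : E.Ref} (h : ∀ b, ε.val b = η.val b) : ε = η := by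
  cases ε; cases η
  congr
  exact funext h

theorem exists_eq_scale (ε η : E.Ref) : ∃ c, η = ε.scale c := by
  have h (b : B) := ε.exists_unit (η.ne b)
  choose c hc using h
  exact ⟨c, ext_val hc⟩

/-- The continuous local frames of a line bundle, in terms of a reference section. -/
def frames (ε : E.Ref) : FrameSys B where
  adm ρ x := ContinuousAt (fun y => E.pt y ((ρ y : ℂ) • ε.val y)) x
  adm_iff := by
    intro ρ ρ' x h
    have e : (fun y => E.pt y ((ρ' y : ℂ) • ε.val y)) =
        fun y => E.pt y (((ρ' y / ρ y : ℂˣ) : ℂ) • ((ρ y : ℂ) • ε.val y)) := by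
      funext y
      rw [smul_smul, ← Units.val_mul, div_mul_cancel]
    have hi : Cmp ρ' ρ x ↔ ContinuousAt (fun y => ((ρ' y / ρ y : ℂˣ) : ℂ)) x :=
      Units.isEmbedding_val₀.isInducing.continuousAt_iff
    rw [e, hi]
    exact ⟨fun h' => E.continuousAt_of_smul continuousAt_id
      (smul_ne_zero (ρ x).ne_zero (ε.ne x)) h h', fun h' => E.continuousAt_smul continuousAt_id h' h⟩
  exists_adm := by
    intro x
    let e := trivializationAt ℂ E.Fib x
    -- Over the trivializing set, `ρ` is chosen so that the frame has constant coordinate `1`.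
    have h (y : B) : ∃ z : ℂˣ, y ∈ e.baseSet → (e (E.pt y ((z : ℂ) • ε.val y))).2 = 1 := by
      by_cases hy : y ∈ e.baseSet
      · have h0 := E.triv_ne_zero x hy (ε.ne y)
        refine ⟨(Units.mk0 _ h0)⁻¹, fun _ => ?_⟩
        rw [E.triv_smul x hy]
        simp [h0]
      · exact ⟨1, fun h => absurd h hy⟩
    choose ρ hρ using h
    refine ⟨ρ, ?_⟩
    have hx : e.baseSet ∈ 𝓝 x := e.open_baseSet.mem_nhds (mem_baseSet_trivializationAt ..)
    filter_upwards [hx, eventually_mem_nhds_iff.2 hx] with y hy hy'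
    rw [continuousAt_pt_id_iff E e hy]
    exact (continuousAt_const (y := (1 : ℂ))).congr (Filter.mem_of_superset hy' fun z hz => (hρ z hz).symm)

theorem frames_adm {ε : E.Ref} {ρ : B → ℂˣ} {x : B} :
    ε.frames.adm ρ x ↔ ContinuousAt (fun y => E.pt y ((ρ y : ℂ) • ε.val y)) x := Iff.rfl

theorem frames_scale (ε : E.Ref) (c : B → ℂˣ) : (ε.scale c).frames = ε.frames.scale c :=
  FrameSys.ext_le fun ρ x h => by
    rw [FrameSys.scale_adm, frames_adm]
    rw [frames_adm] at h
    simpa only [scale, smul_smul, Pi.mul_apply, Units.val_mul] using h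

theorem frames_map (ε : E.Ref) (φ : E.Iso F) : (ε.map φ).frames = ε.frames :=
  (FrameSys.ext_le fun ρ x h => by
    have := φ.continuous_map.continuousAt.comp (frames_adm.1 h)
    refine frames_adm.2 (this.congr (.of_forall fun y => ?_))
    change F.pt y _ = F.pt y ((ρ y : ℂ) • φ.map y (ε.val y))
    rw [← map_smul]).symm

theorem frames_pullback {T : Type w} [TopologicalSpace T] (ε : E.Ref) (g : C(T, B)) :
    (ε.pullback g).frames = ε.frames.comap g := by
  refine (FrameSys.ext_le ?_).symm
  rintro ρ t ⟨ρ₀, h, h'⟩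
  refine ((ε.pullback g).frames.adm_iff ?_).2 h'
  exact continuousAt_pullback_pt_iff.2
    (ContinuousAt.comp (f := g) (frames_adm.1 h) g.continuous.continuousAt)

theorem frames_tensor (ε : E.Ref) (η : F.Ref) : (ε.tensor η).frames = ε.frames * η.frames := by
  refine (FrameSys.ext_mul fun ρ ρ' x h h' => ?_).symm
  rw [frames_adm, continuousAt_tensor_iff]
  refine ⟨continuousAt_id, ?_⟩
  rw [frames_adm, continuousAt_pt_id_iff E _ (mem_baseSet_trivializationAt ℂ E.Fib x)] at h
  rw [frames_adm, continuousAt_pt_id_iff F _ (mem_baseSet_trivializationAt ℂ F.Fib x)] at h'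
  refine (h.mul h').congr ?_
  filter_upwards [eventually_mem_base E F x] with y hy
  refine (tensorLin_tmul _ _ hy.1 hy.2 _ _).symm.trans ?_
  refine congrArg (tensorLin E F _ _ y) ?_
  rw [TensorProduct.smul_tmul_smul, ← Units.val_mul]
  rfl

/-- Sections along a map. -/
theorem comap_frames_adm {T : Type w} [TopologicalSpace T] {g : C(T, B)} {ε : E.Ref} {ρ : T → ℂˣ} {t : T} :
    (ε.frames.comap g).adm ρ t ↔ ContinuousAt (fun t => E.pt (g t) ((ρ t : ℂ) • ε.val (g t))) t := by
  rw [← frames_pullback]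
  exact continuousAt_pullback_pt_iff

/-- Near a point use a common `ρ`: a vector is a continuous coefficient times the frame of `E`, and
its image is the same coefficient times the frame of `F`. -/
theorem continuous_mapAux {ε : E.Ref} {η : F.Ref} (h : ε.frames = η.frames) :
    Continuous fun p : E.Tot => F.pt p.1 (η.equiv p.1 ((ε.equiv p.1).symm p.2)) := by
  refine continuous_iff_continuousAt.2 fun p => ?_
  have hp : ContinuousAt (fun p : E.Tot => p.1) p := (continuous_proj E).continuousAt
  obtain ⟨ρ, hρ⟩ := ε.frames.exists_adm_self p.1
  have hρ' := hρ
  rw [h] at hρ'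
  let z (q : E.Tot) : ℂ := (ε.equiv q.1).symm q.2 / ρ q.1
  have hz : ContinuousAt z p := by
    refine E.continuousAt_of_smul (a := fun q => (ρ q.1 : ℂ) • ε.val q.1) hp
      (smul_ne_zero (ρ p.1).ne_zero (ε.ne p.1)) (ContinuousAt.comp (frames_adm.1 hρ) hp) ?_
    refine (continuousAt_id (x := p)).congr (.of_forall fun q => ?_)
    change q = E.pt q.1 _
    rw [smul_smul, div_mul_cancel₀ _ (ρ q.1).ne_zero, ← equiv_apply, LinearEquiv.apply_symm_apply]
  refine (F.continuousAt_smul (a := fun q : E.Tot => (ρ q.1 : ℂ) • η.val q.1) hp hz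
    (ContinuousAt.comp (frames_adm.1 hρ') hp)).congr (.of_forall fun q => ?_)
  change F.pt q.1 _ = F.pt q.1 _
  rw [smul_smul, div_mul_cancel₀ _ (ρ q.1).ne_zero, ← equiv_apply]

/-- The isomorphism of line bundles with the same frames. -/
def iso {ε : E.Ref} {η : F.Ref} (h : ε.frames = η.frames) : E.Iso F where
  map b := (ε.equiv b).symm.trans (η.equiv b)
  continuous_map := continuous_mapAux h
  continuous_symm := continuous_mapAux h.symm

theorem iso_map {ε : E.Ref} {η : F.Ref} (h : ε.frames = η.frames) (b : B) :
    (iso h).map b (ε.val b) = η.val b := by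
  change η.equiv b ((ε.equiv b).symm (ε.val b)) = _
  have : (ε.equiv b).symm (ε.val b) = 1 := by rw [← ε.equiv_symm_smul b 1, one_smul]
  rw [this, equiv_apply, one_smul]

end Ref

end LineBundle

/-! ### Line bundles with given frames -/

namespace FrameSys

variable {B : Type u} [TopologicalSpace B] (F : FrameSys B)

theorem exists_open_adm (x : B) : ∃ (ρ : B → ℂˣ) (U : Set B), IsOpen U ∧ x ∈ U ∧
    ∀ y ∈ U, F.adm ρ y := by
  obtain ⟨ρ, h⟩ := F.exists_adm x
  obtain ⟨U, hU, ho, hx⟩ := mem_nhds_iff.1 h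
  exact ⟨ρ, U, ho, hx, hU⟩

/-- The trivialization defined by a local frame. -/
def pretriv (ρ : B → ℂˣ) (U : Set B) (hU : IsOpen U) :
    Pretrivialization ℂ (π ℂ fun _ : B => ULift.{v} ℂ) where
  toFun p := (p.1, p.2.down * (ρ p.1 : ℂ)⁻¹)
  invFun p := ⟨p.1, ⟨p.2 * ρ p.1⟩⟩
  source := TotalSpace.proj ⁻¹' U
  target := U ×ˢ Set.univ
  map_source' := fun ⟨_, _⟩ h ↦ ⟨h, Set.mem_univ _⟩
  map_target' := fun ⟨_, _⟩ h ↦ h.1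
  left_inv' := fun ⟨x, t⟩ h ↦ by simp
  right_inv' := fun ⟨x, z⟩ h ↦ by simp
  open_target := hU.prod isOpen_univ
  baseSet := U
  open_baseSet := hU
  source_eq := rfl
  target_eq := rfl
  proj_toFun _ _ := rfl

theorem pretriv_symm (ρ : B → ℂˣ) {U : Set B} (hU : IsOpen U) {b : B} (hb : b ∈ U) (z : ℂ) :
    (pretriv.{u, v} ρ U hU).symm b z = ⟨z * ρ b⟩ := by
  rw [Pretrivialization.symm_apply _ hb]
  rfl

/-- The local trivializations of the line bundle with given frames. -/
@[reducible] def prebundle : VectorPrebundle ℂ ℂ fun _ : B => ULift.{v} ℂ where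
  pretrivializationAtlas := {e | ∃ (ρ : B → ℂˣ) (U : Set B) (hU : IsOpen U),
    (∀ y ∈ U, F.adm ρ y) ∧ e = pretriv ρ U hU}
  pretrivialization_linear' := by
    rintro _ ⟨ρ, U, hU, -, rfl⟩
    exact ⟨fun b _ => ⟨fun x y => add_mul _ _ _, fun c x => mul_assoc _ _ _⟩⟩
  pretrivializationAt := fun b => pretriv (F.exists_open_adm b).choose _
    (F.exists_open_adm b).choose_spec.choose_spec.1
  mem_base_pretrivializationAt := fun b => (F.exists_open_adm b).choose_spec.choose_spec.2.1
  pretrivialization_mem_atlas := fun b => ⟨_, _, _, (F.exists_open_adm b).choose_spec.choose_spec.2.2, rfl⟩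
  exists_coordChange := by
    rintro _ ⟨ρ, U, hU, hρ, rfl⟩ _ ⟨ρ', U', hU', hρ', rfl⟩
    refine ⟨fun b => ((ρ b / ρ' b : ℂˣ) : ℂ) • ContinuousLinearMap.id ℂ ℂ, ?_, ?_⟩
    · intro b hb
      refine ContinuousWithinAt.smul (M := ℂ) ?_ continuousWithinAt_const
      exact (Units.continuous_val.continuousAt.comp
        (F.adm_cmp (hρ' b hb.2) (hρ b hb.1))).continuousWithinAt
    · rintro b ⟨hb, hb'⟩ z
      rw [pretriv_symm ρ hU hb]
      change ((ρ b / ρ' b : ℂˣ) : ℂ) * z = z * (ρ b : ℂ) * (ρ' b : ℂ)⁻¹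
      rw [div_eq_mul_inv, Units.val_mul, Units.val_inv_eq_inv_val]
      ring
  totalSpaceMk_isInducing := fun b => by
    refine isInducing_const_prod.mpr ?_
    have h1 : IsInducing (ULift.down : ULift.{v} ℂ → ℂ) := Homeomorph.ulift.isInducing
    have h2 (c : ℂ) (hc : c ≠ 0) : IsInducing fun x : ULift.{v} ℂ => x.down * c :=
      (Homeomorph.mulRight₀ c hc).isInducing.comp h1
    exact h2 _ (inv_ne_zero ((F.exists_open_adm b).choose b).ne_zero)

/-- The line bundle with given frames. -/
def bundle : LineBundle.{u, v} B where
  Fib _ := ULift.{v} ℂ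
  topTotal := (prebundle F).totalSpaceTopology
  fiberBundle := (prebundle F).toFiberBundle
  vectorBundle := (prebundle F).toVectorBundle

/-- The reference section of the line bundle with given frames. -/
def bundleRef : F.bundle.{u, v}.Ref where
  val _ := ULift.up 1
  ne _ := fun h => one_ne_zero (congrArg ULift.down h : (1 : ℂ) = 0)

/-- Every frame system comes from a line bundle, so roots and twists built at the level of frames
yield genuine bundles. -/
theorem frames_bundleRef : F.bundleRef.{u, v}.frames = F := by
  refine ext_le fun ρ x h => ?_
  rw [LineBundle.Ref.frames_adm, LineBundle.continuousAt_pt_id_iff _ _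
    (mem_baseSet_trivializationAt ℂ F.bundle.{u, v}.Fib x)] at h
  let ρ₀ := (F.exists_open_adm x).choose
  have hρ₀ : F.adm ρ₀ x := (F.exists_open_adm x).choose_spec.choose_spec.2.2 x
    (F.exists_open_adm x).choose_spec.choose_spec.2.1
  refine (F.adm_iff hρ₀).2 (Units.isEmbedding_val₀.isInducing.continuousAt_iff.2 ?_)
  refine h.congr (.of_forall fun y => ?_)
  change (ρ y : ℂ) * 1 * (ρ₀ y : ℂ)⁻¹ = ((ρ y / ρ₀ y : ℂˣ) : ℂ)
  simp [div_eq_mul_inv]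

end FrameSys

open LineBundle FrameSys

theorem SignTwist.ext_le {B : Type*} [TopologicalSpace B] {τ τ' : SignTwist B}
    (h : ∀ s x, τ.adm s x → τ'.adm s x) : τ = τ' := by
  have : τ.adm = τ'.adm := by
    funext s x
    refine propext ⟨h s x, fun h' => ?_⟩
    obtain ⟨s₀, h₀⟩ := τ.exists_adm x
    exact (τ.adm_iff h₀.self_of_nhds).2 ((τ'.adm_iff (h _ _ h₀.self_of_nhds)).1 h')
  cases τ; cases τ'
  simpa using this

theorem rootW_loopClass_eq_zero_iff {B : Type u} [TopologicalSpace B] {F F' : FrameSys B}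
    (h : F * F = F' * F') (γ : C(Circle, B)) : rootW F F' (loopClass γ) = 0 ↔
      ∃ s : Circle → ZMod 2, F.comap γ = (F'.comap γ).scale fun y => sgn (s y) := by
  have h' : F.comap γ * F.comap γ = F'.comap γ * F'.comap γ := by rw [← comap_mul, h, comap_mul]
  rw [rootW_eq h, SignTwist.w1_loopClass_eq_zero_iff,
    SignTwist.ext_le (fun s x hs => comap_sgnTwist F F' h γ h' hs)]
  exact exists_congr fun s => sgnTwist_isSection_iff

/-! ### Isomorphisms and Stiefel–Whitney classes in terms of frames -/

section Circle

variable {B : Type u} [TopologicalSpace B] {E N : LineBundle.{u, v} B}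

/-- A fibrewise isomorphism is determined by the image of the reference section, and it is
continuous in both directions exactly when the frames agree. -/
theorem Ref.map_eq_iff_frames {ε : E.Ref} {η : N.Ref} :
    (∃ φ : E.Iso N, ∀ b, φ.map b (ε.val b) = η.val b) ↔ ε.frames = η.frames := by
  constructor
  · rintro ⟨φ, h⟩
    rw [← ε.frames_map φ, Ref.ext_val (ε := ε.map φ) (η := η) h]
  · exact fun h => ⟨Ref.iso h, Ref.iso_map h⟩

/-- The characterization of the first Stiefel-Whitney class of a double cover in `Hom(E, N)`. -/
theorem isW1_iff (ε : E.Ref) (η : N.Ref) (h : ε.frames * ε.frames = η.frames * η.frames)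
    {P : ∀ b, (E.Fib b ≃ₗ[ℂ] N.Fib b) → Prop}
    (hP : ∀ b ξ, P b ξ ↔ ∃ a, ξ (ε.val b) = (sgn a : ℂ) • η.val b)
    {w : H (ZMod 2) B 1 →ₗ[ZMod 2] ZMod 2} : IsW1 P w ↔ w = rootW ε.frames η.frames := by
  have key (γ : C(Circle, B)) : rootW ε.frames η.frames (loopClass γ) = 0 ↔
      ∃ ξ : (E.pullback γ).Iso (N.pullback γ), ∀ t, P (γ t) (ξ.map t) := by
    rw [rootW_loopClass_eq_zero_iff h]
    simp only [← Ref.frames_pullback, ← Ref.frames_scale, ← Ref.map_eq_iff_frames]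
    constructor
    · rintro ⟨s, ξ, hξ⟩
      exact ⟨ξ, fun t => (hP _ _).2 ⟨s t, hξ t⟩⟩
    · rintro ⟨ξ, hξ⟩
      have h1 (t) := (hP _ _).1 (hξ t)
      choose s hs using h1
      exact ⟨s, ξ, hs⟩
  constructor
  · exact fun hw => H1_ext_iff_zero fun γ => (hw γ).trans (key γ).symm
  · rintro rfl γ
    exact key γ

theorem exists_iso_iff (ε : E.Ref) (η : N.Ref) {P : ∀ b, (E.Fib b ≃ₗ[ℂ] N.Fib b) → Prop}
    (hP : ∀ b ξ, P b ξ ↔ ∃ a, ξ (ε.val b) = (sgn a : ℂ) • η.val b) :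
    (∃ ξ : E.Iso N, ∀ b, P b (ξ.map b)) ↔
      ∃ s : B → ZMod 2, ε.frames = η.frames.scale fun y => sgn (s y) := by
  simp only [← Ref.frames_scale, ← Ref.map_eq_iff_frames]
  constructor
  · rintro ⟨ξ, hξ⟩
    have h1 (b) := (hP _ _).1 (hξ b)
    choose s hs using h1
    exact ⟨s, ξ, hs⟩
  · rintro ⟨s, ξ, hξ⟩
    exact ⟨ξ, fun b => (hP _ _).2 ⟨s b, hξ b⟩⟩

/-- The condition `hP` says that admissible isomorphisms send one reference vector to plus or minus
the other. This covers isometries of square roots as well as the maps `ξ` of the compatibility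
condition. -/
theorem exists_iso_iff_rootW (hB : HasLPCType B) (ε : E.Ref) (η : N.Ref)
    (h : ε.frames * ε.frames = η.frames * η.frames)
    {P : ∀ b, (E.Fib b ≃ₗ[ℂ] N.Fib b) → Prop}
    (hP : ∀ b ξ, P b ξ ↔ ∃ a, ξ (ε.val b) = (sgn a : ℂ) • η.val b) :
    (∃ ξ : E.Iso N, ∀ b, P b (ξ.map b)) ↔ rootW ε.frames η.frames = 0 := by
  rw [exists_iso_iff ε η hP]
  exact ⟨fun ⟨s, hs⟩ => rootW_eq_zero_of_scale hs, exists_scale_of_rootW hB h⟩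

end Circle

/-! ### Square roots -/

section Roots

variable {B : Type u} [TopologicalSpace B] {K : LineBundle.{u, v} B}

/-- A reference section of a square root which is compatible with that of `K`. -/
def SquareRoot.IsNormal (r : SquareRoot K) (k : K.Ref) (u : r.J.Ref) : Prop :=
  ∀ b, r.j.map b (u.val b ⊗ₜ[ℂ] u.val b) = k.val b

/-- An arbitrary reference section of `J` is rescaled by pointwise square roots of its discrepancy
with `k`. -/
theorem SquareRoot.exists_isNormal (r : SquareRoot K) (k : K.Ref) : ∃ u, r.IsNormal k u := by
  obtain ⟨u⟩ : Nonempty r.J.Ref := inferInstance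
  obtain ⟨c, hc⟩ := ((u.tensor u).map r.j).exists_eq_scale k
  choose d hd using fun b => exists_sqrt (c b)
  refine ⟨u.scale d, fun b => ?_⟩
  rw [hc]
  change r.j.map b (((d b : ℂ) • u.val b) ⊗ₜ[ℂ] ((d b : ℂ) • u.val b)) =
    (c b : ℂ) • r.j.map b (u.val b ⊗ₜ[ℂ] u.val b)
  rw [TensorProduct.smul_tmul_smul, ← hd, Units.val_mul]
  exact (r.j.map b).map_smul _ _

/-- With normalized references, continuity of `j` and of its inverse is this single equation. -/
theorem SquareRoot.IsNormal.frames_mul {r : SquareRoot K} {k : K.Ref} {u : r.J.Ref}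
    (h : r.IsNormal k u) : u.frames * u.frames = k.frames := by
  rw [← Ref.frames_tensor, ← Ref.frames_map _ r.j, Ref.ext_val (ε := (u.tensor u).map r.j) (η := k) h]

theorem SquareRoot.IsNormal.map_smul {r : SquareRoot K} {k : K.Ref} {u : r.J.Ref}
    (h : r.IsNormal k u) (b : B) (z z' : ℂ) :
    r.j.map b ((z • u.val b) ⊗ₜ[ℂ] (z' • u.val b)) = (z * z') • k.val b := by
  rw [TensorProduct.smul_tmul_smul, ← h]
  exact (r.j.map b).map_smul _ _

/-- The fibres are lines, so an isometry has one coordinate, whose square is `1`. -/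
theorem isometry_iff {r r' : SquareRoot K} {k : K.Ref} {u : r.J.Ref} {u' : r'.J.Ref}
    (h : r.IsNormal k u) (h' : r'.IsNormal k u') (b : B) (ι : r.J.Fib b ≃ₗ[ℂ] r'.J.Fib b) :
    (∀ x y : r.J.Fib b, r'.j.map b (ι x ⊗ₜ[ℂ] ι y) = r.j.map b (x ⊗ₜ[ℂ] y)) ↔
      ∃ a, ι (u.val b) = (sgn a : ℂ) • u'.val b := by
  constructor
  · intro hι
    obtain ⟨z, hz⟩ := u'.exists_unit (b := b) (y := ι (u.val b))
      fun h0 => u.ne b (ι.map_eq_zero_iff.1 h0)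
    have h1 := hι (u.val b) (u.val b)
    rw [hz, h'.map_smul, h b] at h1
    have h2 : (z : ℂ) * z = 1 := by
      refine smul_left_injective ℂ (k.ne b) ?_
      simpa using h1
    obtain ⟨a, ha⟩ := exists_sgn (z := z) (Units.ext (by simpa using h2))
    exact ⟨a, by rw [hz, ha]⟩
  · rintro ⟨a, ha⟩ x y
    obtain ⟨x, rfl⟩ := r.J.exists_smul_eq (u.ne b) x
    obtain ⟨y, rfl⟩ := r.J.exists_smul_eq (u.ne b) y
    rw [map_smul, map_smul, ha, smul_smul, smul_smul, h.map_smul, h'.map_smul,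
      mul_mul_mul_comm, ← Units.val_mul, sgn_mul_self, Units.val_one, mul_one]

theorem equiv_iff {r r' : SquareRoot K} {k : K.Ref} {u : r.J.Ref} {u' : r'.J.Ref}
    (h : r.IsNormal k u) (h' : r'.IsNormal k u') :
    r.cls = r'.cls ↔ ∃ s : B → ZMod 2, u.frames = u'.frames.scale fun y => sgn (s y) := by
  rw [← exists_iso_iff (P := fun b ι => ∀ x y : r.J.Fib b,
      r'.j.map b (ι x ⊗ₜ[ℂ] ι y) = r.j.map b (x ⊗ₜ[ℂ] y)) u u' (isometry_iff h h')]
  refine Quotient.eq.trans ?_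
  exact exists_congr fun ι => forall_congr' fun b =>
    ⟨fun h x y => (h x y).symm, fun h x y => (h x y).symm⟩

theorem rootW_of_cls_eq {r r' : SquareRoot K} {k : K.Ref} {u : r.J.Ref} {u' : r'.J.Ref}
    (h : r.IsNormal k u) (h' : r'.IsNormal k u') (he : r.cls = r'.cls) :
    rootW u.frames u'.frames = 0 := by
  obtain ⟨s, hs⟩ := (equiv_iff h h').1 he
  exact rootW_eq_zero_of_scale hs

theorem cls_eq_of_rootW (hB : HasLPCType B) {r r' : SquareRoot K} {k : K.Ref} {u : r.J.Ref}
    {u' : r'.J.Ref} (h : r.IsNormal k u) (h' : r'.IsNormal k u')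
    (h0 : rootW u.frames u'.frames = 0) : r.cls = r'.cls :=
  (equiv_iff h h').2 (exists_scale_of_rootW hB (h.frames_mul.trans h'.frames_mul.symm) h0)

/-- Isomorphic representatives have difference class zero, so additivity of `rootW` makes the
criterion independent of the representatives. -/
theorem isTwist_cls_iff {r r' : SquareRoot K} {k : K.Ref} {u : r.J.Ref}
    {u' : r'.J.Ref} (h : r.IsNormal k u) (h' : r'.IsNormal k u')
    {α : H (ZMod 2) B 1 →ₗ[ZMod 2] ZMod 2} :
    IsTwist α r.cls r'.cls ↔ α = rootW u.frames u'.frames := by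
  constructor
  · rintro ⟨r₁, r₁', e, e', hα⟩
    obtain ⟨u₁, h₁⟩ := r₁.exists_isNormal k
    obtain ⟨u₁', h₁'⟩ := r₁'.exists_isNormal k
    rw [isW1_iff u₁ u₁' (h₁.frames_mul.trans h₁'.frames_mul.symm) (isometry_iff h₁ h₁')] at hα
    rw [hα, rootW_add (h.frames_mul.trans h₁.frames_mul.symm) (h₁.frames_mul.trans h'.frames_mul.symm),
      rootW_add (h₁.frames_mul.trans h₁'.frames_mul.symm) (h₁'.frames_mul.trans h'.frames_mul.symm),
      rootW_of_cls_eq h h₁ e.symm, rootW_of_cls_eq h₁' h' e', zero_add, add_zero]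
  · intro hα
    exact ⟨r, r', rfl, rfl,
      (isW1_iff u u' (h.frames_mul.trans h'.frames_mul.symm) (isometry_iff h h')).2 hα⟩

/-- The square root with given frames. -/
theorem exists_root (k : K.Ref) (G : FrameSys B) (h : G * G = k.frames) :
    ∃ (r : SquareRoot K) (u : r.J.Ref), r.IsNormal k u ∧ u.frames = G := by
  have h1 : (G.bundleRef.{u, v}.tensor G.bundleRef).frames = k.frames := by
    rw [Ref.frames_tensor, frames_bundleRef, h]
  exact ⟨⟨G.bundle, Ref.iso h1⟩, G.bundleRef, Ref.iso_map h1, G.frames_bundleRef⟩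

theorem exists_cls_eq (s : SqRoots K) : ∃ r : SquareRoot K, r.cls = s :=
  Quotient.exists_rep s

/-- Existence: twist the frames by a double cover of class `α`. Uniqueness: two candidates differ by
`α + α = 0` and are therefore isomorphic. -/
theorem existsUnique_isTwist (hB : HasCWType B) (α : H (ZMod 2) B 1 →ₗ[ZMod 2] ZMod 2)
    (s : SqRoots K) : ∃! s', IsTwist α s s' := by
  obtain ⟨r, rfl⟩ := exists_cls_eq s
  obtain ⟨k⟩ : Nonempty K.Ref := inferInstance
  obtain ⟨u, hu⟩ := r.exists_isNormal k
  obtain ⟨τ, hτ⟩ := SignTwist.exists_w1_eq hB α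
  obtain ⟨r', u', hu', e⟩ := exists_root k (u.frames.twist τ)
    ((twist_mul_self _ τ).trans hu.frames_mul)
  have hα : α = rootW u.frames u'.frames := by rw [e, rootW_twist, hτ]
  refine ⟨r'.cls, (isTwist_cls_iff hu hu').2 hα, ?_⟩
  intro s' hs'
  obtain ⟨r₁, rfl⟩ := exists_cls_eq s'
  obtain ⟨u₁, hu₁⟩ := r₁.exists_isNormal k
  rw [isTwist_cls_iff hu hu₁] at hs'
  refine cls_eq_of_rootW hB.hasLPCType hu₁ hu' ?_
  have hsq := hu.frames_mul.trans hu₁.frames_mul.symm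
  rw [rootW_add hsq.symm (hu.frames_mul.trans hu'.frames_mul.symm), rootW_swap hsq, ← hα, ← hs']
  ext c
  exact zmod_two_add_self _

end Roots

/-! ### Pullback of square roots -/

section Pull

variable {X Y : Type u} [TopologicalSpace X] [TopologicalSpace Y] {KX : LineBundle.{u, v} X}
  {KY : LineBundle.{u, v} Y}

theorem SquareRoot.IsNormal.pull {r : SquareRoot KY} {k : KY.Ref} {u : r.J.Ref}
    (h : r.IsNormal k u) (f : C(X, Y)) (κ : (KY.pullback f).Iso KX) :
    (r.pull f κ).IsNormal ((k.pullback f).map κ) (u.pullback f) :=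
  fun b => congrArg (κ.map b) (h (f b))

theorem isTwist_pull (f : C(X, Y)) (κ : (KY.pullback f).Iso KX)
    (α : H (ZMod 2) Y 1 →ₗ[ZMod 2] ZMod 2) (s s' : SqRoots KY) (h : IsTwist α s s') :
    IsTwist (α ∘ₗ hmap (ZMod 2) 1 f) (SqRoots.pull f κ s) (SqRoots.pull f κ s') := by
  obtain ⟨r, rfl⟩ := exists_cls_eq s
  obtain ⟨r', rfl⟩ := exists_cls_eq s'
  obtain ⟨k⟩ : Nonempty KY.Ref := inferInstance
  obtain ⟨u, hu⟩ := r.exists_isNormal k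
  obtain ⟨u', hu'⟩ := r'.exists_isNormal k
  rw [isTwist_cls_iff hu hu'] at h
  refine (isTwist_cls_iff (hu.pull f κ) (hu'.pull f κ)).2 ?_
  have e := rootW_comap (hu.frames_mul.trans hu'.frames_mul.symm) f
  rw [← Ref.frames_pullback, ← Ref.frames_pullback, ← h] at e
  exact e.symm

end Pull

/-! ### Compatibility -/

section Multilinear

variable {V W U U' N : Type*} [AddCommGroup V] [AddCommGroup W] [AddCommGroup U] [AddCommGroup U']
  [AddCommGroup N] [Module ℂ V] [Module ℂ W] [Module ℂ U] [Module ℂ U'] [Module ℂ N]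

theorem map_smul_tmul₃ (φ : ((V ⊗[ℂ] W) ⊗[ℂ] U) ≃ₗ[ℂ] N) (z₁ z₂ z₃ : ℂ) (x : V) (y : W) (t : U) :
    φ (((z₁ • x) ⊗ₜ[ℂ] (z₂ • y)) ⊗ₜ[ℂ] (z₃ • t)) = (z₁ * z₂ * z₃) • φ ((x ⊗ₜ[ℂ] y) ⊗ₜ[ℂ] t) := by
  rw [TensorProduct.smul_tmul_smul, TensorProduct.smul_tmul_smul, map_smul]

theorem map_smul_tmul₄ (φ : ((V ⊗[ℂ] W) ⊗[ℂ] (U ⊗[ℂ] U')) ≃ₗ[ℂ] N) (z₁ z₂ z₃ z₄ : ℂ) (x : V) (y : W)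
    (t : U) (t' : U') : φ (((z₁ • x) ⊗ₜ[ℂ] (z₂ • y)) ⊗ₜ[ℂ] ((z₃ • t) ⊗ₜ[ℂ] (z₄ • t'))) =
      (z₁ * z₂ * (z₃ * z₄)) • φ ((x ⊗ₜ[ℂ] y) ⊗ₜ[ℂ] (t ⊗ₜ[ℂ] t')) := by
  rw [TensorProduct.smul_tmul_smul, TensorProduct.smul_tmul_smul, TensorProduct.smul_tmul_smul,
    map_smul]

end Multilinear

section Compat

variable {X : Type u} [TopologicalSpace X] {m : HSpaceStr X} {L : LineBundle.{u, v} (X × X)}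

/-- The coordinates of `φ` are squares of `c`. -/
def PhiCoord (φ : PhiIso m L) (k : (diagBundle L).Ref) (l : L.Ref) (c : X × X → ℂˣ) : Prop :=
  ∀ p, φ.map p ((k.val p.1 ⊗ₜ[ℂ] k.val p.2) ⊗ₜ[ℂ] (l.val p ⊗ₜ[ℂ] l.val p)) =
    ((c p * c p : ℂˣ) : ℂ) • k.val (m.mul p)

theorem exists_phiCoord (φ : PhiIso m L) (k : (diagBundle L).Ref) (l : L.Ref) :
    ∃ c, PhiCoord φ k l c := by
  let η : ((((diagBundle L).pullback .fst).tensor ((diagBundle L).pullback .snd)).tensor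
    (L.tensor L)).Ref := ((k.pullback .fst).tensor (k.pullback .snd)).tensor (l.tensor l)
  obtain ⟨c, hc⟩ := (k.pullback m.mul).exists_eq_scale (η.map φ)
  choose d hd using fun p => exists_sqrt (c p)
  refine ⟨d, fun p => ?_⟩
  rw [hd]
  exact congrFun (congrArg Ref.val hc) p

variable {φ : PhiIso m L} {k : (diagBundle L).Ref} {l : L.Ref} {c : X × X → ℂˣ}

/-- This is the isomorphism `φ` at the level of frames. Its coordinate is written as a square
because the roots of that coordinate are what `ξ` must match. -/
theorem PhiCoord.frames_eq (h : PhiCoord φ k l c) :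
    k.frames.comap .fst * k.frames.comap .snd * (l.frames * l.frames) =
      (k.frames.comap m.mul).scale (c * c) := by
  have e : (((k.pullback .fst).tensor (k.pullback .snd)).tensor (l.tensor l)).map φ =
      (k.pullback m.mul).scale (c * c) := Ref.ext_val h
  have := Ref.frames_map (((k.pullback .fst).tensor (k.pullback .snd)).tensor (l.tensor l)) φ
  rw [e] at this
  simpa only [Ref.frames_tensor, Ref.frames_pullback, Ref.frames_scale] using this.symm

/-- The first Stiefel-Whitney class of the double cover `Q`, in terms of frames. -/
def obsW (m : HSpaceStr X) (G : FrameSys X) (Λ : FrameSys (X × X)) (c : X × X → ℂˣ) :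
    H (ZMod 2) (X × X) 1 →ₗ[ZMod 2] ZMod 2 :=
  rootW (G.comap .fst * G.comap .snd * Λ) ((G.comap m.mul).scale c)

variable {r : SquareRoot (diagBundle L)} {u : r.J.Ref}

/-- The two sides compared in `obsW` have equal squares, so the class is defined by an actual double
cover. -/
theorem obsW_sq {F G : FrameSys X} {Λ : FrameSys (X × X)}
    (h : F.comap .fst * F.comap .snd * (Λ * Λ) = (F.comap m.mul).scale (c * c)) (hG : G * G = F) :
    (G.comap .fst * G.comap .snd * Λ) * (G.comap .fst * G.comap .snd * Λ) =
      (G.comap m.mul).scale c * (G.comap m.mul).scale c := by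
  rw [mul_mul_mul_comm, mul_mul_mul_comm (G.comap _), scale_mul_scale, ← comap_mul, ← comap_mul,
    ← comap_mul, hG, h]

/-- The fibres are lines: the coordinate of `ξ` relative to `c` must have square `1`, and the value
on reference vectors determines the rest by multilinearity. -/
theorem squaresTo_iff (h : PhiCoord φ k l c) (hu : r.IsNormal k u) (p : X × X)
    (ξ : (((r.J.pullback .fst).tensor (r.J.pullback .snd)).tensor L).Fib p ≃ₗ[ℂ]
      (r.J.pullback m.mul).Fib p) :
    SquaresTo φ r p ξ ↔ ∃ a, ξ ((((u.pullback .fst).tensor (u.pullback .snd)).tensor l).val p) =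
      (sgn a : ℂ) • ((u.pullback m.mul).scale c).val p := by
  have hφ (z₁ z₂ z₃ z₄ : ℂ) : φ.map p (((z₁ • k.val p.1) ⊗ₜ[ℂ] (z₂ • k.val p.2)) ⊗ₜ[ℂ]
      ((z₃ • l.val p) ⊗ₜ[ℂ] (z₄ • l.val p))) =
      (((z₁ * z₂) * (z₃ * z₄)) * ((c p * c p : ℂˣ) : ℂ)) • k.val (m.mul p) := by
    rw [mul_smul, ← h p]
    exact map_smul_tmul₄ (φ.map p) z₁ z₂ z₃ z₄ _ _ _ _
  constructor
  · intro hξ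
    obtain ⟨z, hz⟩ := ((u.pullback m.mul).scale c).exists_unit (b := p)
      (y := ξ ((((u.pullback .fst).tensor (u.pullback .snd)).tensor l).val p))
      fun h0 => (((u.pullback .fst).tensor (u.pullback .snd)).tensor l).ne p (ξ.map_eq_zero_iff.1 h0)
    have h1 := hξ (u.val p.1) (u.val p.1) (u.val p.2) (u.val p.2) (l.val p) (l.val p)
    rw [hu, hu, h p] at h1
    have h2 : r.j.map (m.mul p) ((((z * c p : ℂˣ) : ℂ) • u.val (m.mul p)) ⊗ₜ[ℂ]
        (((z * c p : ℂˣ) : ℂ) • u.val (m.mul p))) = ((c p * c p : ℂˣ) : ℂ) • k.val (m.mul p) := by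
      refine Eq.trans ?_ h1
      have : ξ ((u.val p.1 ⊗ₜ[ℂ] u.val p.2) ⊗ₜ[ℂ] l.val p) =
          ((z * c p : ℂˣ) : ℂ) • u.val (m.mul p) := by
        refine hz.trans ?_
        rw [Units.val_mul, mul_smul]
        rfl
      rw [this]
    rw [hu.map_smul, ← Units.val_mul, mul_mul_mul_comm] at h2
    have h3 : (((z * z) * (c p * c p) : ℂˣ) : ℂ) = ((c p * c p : ℂˣ) : ℂ) :=
      smul_left_injective ℂ (k.ne _) h2
    obtain ⟨a, ha⟩ := exists_sgn (z := z) (mul_eq_right.1 (Units.ext h3))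
    exact ⟨a, by rw [hz, ha]⟩
  · rintro ⟨a, ha⟩ x x' y y' t t'
    obtain ⟨x, rfl⟩ := r.J.exists_smul_eq (u.ne p.1) x
    obtain ⟨x', rfl⟩ := r.J.exists_smul_eq (u.ne p.1) x'
    obtain ⟨y, rfl⟩ := r.J.exists_smul_eq (u.ne p.2) y
    obtain ⟨y', rfl⟩ := r.J.exists_smul_eq (u.ne p.2) y'
    obtain ⟨t, rfl⟩ := L.exists_smul_eq (l.ne p) t
    obtain ⟨t', rfl⟩ := L.exists_smul_eq (l.ne p) t'
    have h1 (x y t : ℂ) : ξ (((x • u.val p.1) ⊗ₜ[ℂ] (y • u.val p.2)) ⊗ₜ[ℂ] (t • l.val p)) =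
        (x * y * t * ((sgn a * c p : ℂˣ) : ℂ)) • u.val (m.mul p) := by
      rw [mul_smul _ ((sgn a * c p : ℂˣ) : ℂ)]
      refine (map_smul_tmul₃ ξ x y t _ _ _).trans (congrArg _ (ha.trans ?_))
      rw [Units.val_mul, mul_smul]
      rfl
    rw [h1, h1, hu.map_smul, hu.map_smul, hu.map_smul, hφ]
    congr 1
    have h2 : ((sgn a * c p : ℂˣ) : ℂ) * ((sgn a * c p : ℂˣ) : ℂ) = ((c p * c p : ℂˣ) : ℂ) := by
      rw [← Units.val_mul, mul_mul_mul_comm, sgn_mul_self, one_mul]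
    rw [← h2]
    ring

theorem isW1_squaresTo_iff (h : PhiCoord φ k l c) (hu : r.IsNormal k u)
    {w : H (ZMod 2) (X × X) 1 →ₗ[ZMod 2] ZMod 2} :
    IsW1 (E := ((r.J.pullback .fst).tensor (r.J.pullback .snd)).tensor L)
      (F := r.J.pullback m.mul) (SquaresTo φ r) w ↔ w = obsW m u.frames l.frames c := by
  rw [isW1_iff (((u.pullback .fst).tensor (u.pullback .snd)).tensor l) ((u.pullback m.mul).scale c) ?_
    (squaresTo_iff h hu)]
  · simp only [Ref.frames_tensor, Ref.frames_pullback, Ref.frames_scale, obsW]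
  · simp only [Ref.frames_tensor, Ref.frames_pullback, Ref.frames_scale]
    exact obsW_sq h.frames_eq hu.frames_mul

theorem exists_squaresTo_iff (hX : HasLPCType X) (h : PhiCoord φ k l c) (hu : r.IsNormal k u) :
    (∃ ξ : (((r.J.pullback .fst).tensor (r.J.pullback .snd)).tensor L).Iso (r.J.pullback m.mul),
      ∀ p, SquaresTo φ r p (ξ.map p)) ↔ obsW m u.frames l.frames c = 0 := by
  rw [exists_iso_iff_rootW (hX.prod hX) (((u.pullback .fst).tensor (u.pullback .snd)).tensor l)
    ((u.pullback m.mul).scale c) ?_ (squaresTo_iff h hu)]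
  · simp only [Ref.frames_tensor, Ref.frames_pullback, Ref.frames_scale, obsW]
  · simp only [Ref.frames_tensor, Ref.frames_pullback, Ref.frames_scale]
    exact obsW_sq h.frames_eq hu.frames_mul

end Compat

open LineBundle FrameSys

theorem slice_homotopic (B : Type*) [TopologicalSpace B] :
    (SignTwist.slice B 0).Homotopic (SignTwist.slice B 1) :=
  ⟨{ toFun := id
     map_zero_left := fun _ => rfl
     map_one_left := fun _ => rfl }⟩

/-- The root need not be continuous, so its values at the two ends can be prescribed freely and the
rest chosen pointwise. -/
theorem exists_sqrt_family {T : Type*} (Θ : I × T → ℂˣ) {C₀ C₁ : T → ℂˣ}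
    (h₀ : ∀ p, C₀ p * C₀ p = Θ (0, p)) (h₁ : ∀ p, C₁ p * C₁ p = Θ (1, p)) :
    ∃ C : I × T → ℂˣ, C * C = Θ ∧ (∀ p, C (0, p) = C₀ p) ∧ ∀ p, C (1, p) = C₁ p := by
  classical
  choose q hq using exists_sqrt
  refine ⟨fun p => if p.1 = 0 then C₀ p.2 else if p.1 = 1 then C₁ p.2 else q (Θ p), ?_,
    fun p => by simp, fun p => by simp⟩
  funext p
  change (if p.1 = 0 then C₀ p.2 else if p.1 = 1 then C₁ p.2 else q (Θ p)) *
    (if p.1 = 0 then C₀ p.2 else if p.1 = 1 then C₁ p.2 else q (Θ p)) = Θ p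
  split_ifs with h h'
  · rw [h₀, ← h]
  · rw [h₁, ← h']
  · exact hq _

/-- The end conditions on `θ` and `ζ` compare points of a total space over provably equal base
points; this extracts coordinates from them without casts. -/
theorem LineBundle.Ref.eq_of_pt_eq {B : Type u} [TopologicalSpace B] {E : LineBundle.{u, v} B} (ε : E.Ref)
    {b b' : B} {z z' : ℂˣ} (h : E.pt b ((z : ℂ) • ε.val b) = E.pt b' ((z' : ℂ) • ε.val b')) :
    z = z' := by
  obtain ⟨rfl, h'⟩ := (TotalSpace.mk.injEq .. ▸ h : b = b' ∧ _)
  exact Units.ext (smul_left_injective ℂ (ε.ne b) (eq_of_heq h'))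

/-! ### Dependence of the obstruction on the square root -/

section Delta

variable {X : Type u} [TopologicalSpace X]

/-- The difference `π₁^* + π₂^* + μ^*` on `H^1`. -/
def HSpaceStr.delta (m : HSpaceStr X) (α : H (ZMod 2) X 1 →ₗ[ZMod 2] ZMod 2) :
    H (ZMod 2) (X × X) 1 →ₗ[ZMod 2] ZMod 2 :=
  α ∘ₗ hmap (ZMod 2) 1 .fst + α ∘ₗ hmap (ZMod 2) 1 .snd + α ∘ₗ hmap (ZMod 2) 1 m.mul

variable {m : HSpaceStr X} {F G G' : FrameSys X} {Λ : FrameSys (X × X)} {c : X × X → ℂˣ}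

/-- Replacing `G` changes the source by the pullbacks of the difference along both projections and
the target by the pullback along `μ`. Additivity of `rootW` collects the three terms. -/
theorem obsW_change (h : F.comap .fst * F.comap .snd * (Λ * Λ) = (F.comap m.mul).scale (c * c))
    (hG : G * G = F) (hG' : G' * G' = F) :
    obsW m G' Λ c = obsW m G Λ c + m.delta (rootW G G') := by
  have hs := hG.trans hG'.symm
  have hc {T : Type u} [TopologicalSpace T] (g : C(T, X)) :
      G.comap g * G.comap g = G'.comap g * G'.comap g := by rw [← comap_mul, hs, comap_mul]
  have hg := obsW_sq h hG
  have hg' := obsW_sq h hG'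
  have h1 := mul_mul_mul_comm (G.comap .fst) (G.comap .snd) (G.comap .fst) (G.comap .snd)
  have h12 : G'.comap .fst * G'.comap .snd * (G'.comap .fst * G'.comap .snd) =
      G.comap .fst * G.comap .snd * (G.comap .fst * G.comap .snd) := by
    rw [mul_mul_mul_comm, ← hc, ← hc, mul_mul_mul_comm]
  have h3 : G'.comap .fst * G'.comap .snd * Λ * (G'.comap .fst * G'.comap .snd * Λ) =
      G.comap .fst * G.comap .snd * Λ * (G.comap .fst * G.comap .snd * Λ) := by
    rw [mul_mul_mul_comm, h12, mul_mul_mul_comm]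
  have h4 : (G.comap m.mul).scale c * (G.comap m.mul).scale c =
      (G'.comap m.mul).scale c * (G'.comap m.mul).scale c := by
    rw [scale_mul_scale, scale_mul_scale, hc]
  rw [obsW, rootW_add h3 (hg.trans h4), rootW_add hg h4, rootW_scale (hc _), rootW_comap hs,
    rootW_mul h12 rfl, rootW_self, add_zero, rootW_mul (hc _).symm (hc _).symm,
    rootW_swap (hc _), rootW_swap (hc _), rootW_comap hs, rootW_comap hs, HSpaceStr.delta, obsW]
  abel

end Delta

/-! ### Naturality of the obstruction -/

/-- The class over `I × T` restricts to the same class on the two homotopic end slices, and `E` does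
not depend on time. -/
theorem rootW_slice {T : Type u} [TopologicalSpace T] {E : FrameSys T} {N : FrameSys (I × T)}
    (h : E.comap (.snd : C(I × T, T)) * E.comap .snd = N * N) :
    rootW E (N.comap (SignTwist.slice T 0)) = rootW E (N.comap (SignTwist.slice T 1)) := by
  have hs (t : I) : (E.comap (.snd : C(I × T, T))).comap (SignTwist.slice _ t) = E := by
    rw [FrameSys.comap_comap]
    exact comap_id _
  have k0 := rootW_comap h (SignTwist.slice T 0)
  have k1 := rootW_comap h (SignTwist.slice T 1)
  rw [hmap_congr _ (slice_homotopic _), ← k1, hs, hs] at k0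
  exact k0

theorem comap_homotopy_zero {T B : Type*} [TopologicalSpace T] [TopologicalSpace B] {g₀ g₁ : C(T, B)}
    (h : g₀.Homotopy g₁) (G : FrameSys B) {C : I × T → ℂˣ} {c : T → ℂˣ} (hC : ∀ p, C (0, p) = c p) :
    ((G.comap h.toContinuousMap).scale C).comap (SignTwist.slice T 0) = (G.comap g₀).scale c := by
  have e : h.toContinuousMap.comp (SignTwist.slice _ 0) = g₀ :=
    ContinuousMap.ext fun p => h.apply_zero p
  rw [comap_scale, FrameSys.comap_comap, e]
  congr 1
  exact funext hC

theorem comap_homotopy_one {T B : Type*} [TopologicalSpace T] [TopologicalSpace B] {g₀ g₁ : C(T, B)}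
    (h : g₀.Homotopy g₁) (G : FrameSys B) {C : I × T → ℂˣ} {c : T → ℂˣ} (hC : ∀ p, C (1, p) = c p) :
    ((G.comap h.toContinuousMap).scale C).comap (SignTwist.slice T 1) = (G.comap g₁).scale c := by
  have e : h.toContinuousMap.comp (SignTwist.slice _ 1) = g₁ :=
    ContinuousMap.ext fun p => h.apply_one p
  rw [comap_scale, FrameSys.comap_comap, e]
  congr 1
  exact funext hC

theorem LineBundle.Ref.frames_eq_of_map {B : Type u} [TopologicalSpace B] {E F : LineBundle.{u, v} B}
    {ε : E.Ref} {η : F.Ref} {φ : E.Iso F} {c : B → ℂˣ}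
    (h : ∀ b, φ.map b (ε.val b) = (c b : ℂ) • η.val b) : ε.frames = η.frames.scale c := by
  rw [← ε.frames_map φ, show ε.map φ = η.scale c from Ref.ext_val h, Ref.frames_scale]

theorem LineBundle.Ref.exists_map_eq {B : Type u} [TopologicalSpace B] {E F : LineBundle.{u, v} B}
    (ε : E.Ref) (η : F.Ref) (φ : E.Iso F) :
    ∃ c : B → ℂˣ, ∀ b, φ.map b (ε.val b) = (c b : ℂ) • η.val b := by
  obtain ⟨c, hc⟩ := η.exists_eq_scale (ε.map φ)
  exact ⟨c, fun b => congrFun (congrArg Ref.val hc) b⟩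

section Map

variable {X Y : Type u} [TopologicalSpace X] [TopologicalSpace Y] {mX : HSpaceStr X}
  {mY : HSpaceStr Y} {f : C(X, Y)}

/-- Pulling `G` back along the homotopy and scaling by a root of the coordinate of `θ` gives a
bundle over `I × (X × X)`. Its ends are the targets in the two obstruction classes, so `rootW_slice`
identifies them. -/
theorem obsW_map {F G : FrameSys Y} {Λ : FrameSys (Y × Y)} {cX : X × X → ℂˣ} {cY : Y × Y → ℂˣ}
    (hY : F.comap .fst * F.comap .snd * (Λ * Λ) = (F.comap mY.mul).scale (cY * cY))
    (hG : G * G = F) (h : (mY.mul.comp (f.prodMap f)).Homotopy (f.comp mX.mul))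
    {C : I × (X × X) → ℂˣ} (h₀ : ∀ p, C (0, p) = cY (f.prodMap f p)) (h₁ : ∀ p, C (1, p) = cX p)
    (hC : ((F.comap f).comap .fst * (F.comap f).comap .snd *
      ((Λ * Λ).comap (f.prodMap f))).comap .snd = (F.comap h.toContinuousMap).scale (C * C)) :
    obsW mX (G.comap f) (Λ.comap (f.prodMap f)) cX =
      obsW mY G Λ cY ∘ₗ hmap (ZMod 2) 1 (f.prodMap f) := by
  let E := (G.comap f).comap .fst * (G.comap f).comap .snd * Λ.comap (f.prodMap f)
  let N := (G.comap h.toContinuousMap).scale C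
  have hEN : E.comap (.snd : C(I × (X × X), X × X)) * E.comap .snd = N * N := by
    rw [scale_mul_scale, ← comap_mul, ← comap_mul, hG, ← hC, mul_mul_mul_comm, mul_mul_mul_comm
      ((G.comap f).comap _), ← comap_mul, ← comap_mul, ← comap_mul, ← comap_mul, ← comap_mul, hG]
  have k := rootW_slice hEN
  rw [comap_homotopy_zero h G h₀, comap_homotopy_one h G h₁] at k
  have hE : E = (G.comap .fst * G.comap .snd * Λ).comap (f.prodMap f) := by
    rw [comap_mul, comap_mul, FrameSys.comap_comap, FrameSys.comap_comap]
    simp only [E]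
    rw [FrameSys.comap_comap, FrameSys.comap_comap]
    rfl
  have e : ((G.comap mY.mul).scale cY).comap (f.prodMap f) =
      (G.comap (mY.mul.comp (f.prodMap f))).scale fun p => cY (f.prodMap f p) := by
    rw [comap_scale, FrameSys.comap_comap]
    rfl
  rw [obsW, obsW, ← rootW_comap (obsW_sq hY hG), ← hE, e, FrameSys.comap_comap G f mX.mul]
  exact k.symm

/-- Naturality of the class of the double cover `Q` under maps with data as in `MapData`. -/
theorem exists_phiCoord_map {LX : LineBundle.{u, v} (X × X)} {LY : LineBundle.{u, v} (Y × Y)}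
    {φX : PhiIso mX LX} {φY : PhiIso mY LY} (D : MapData φX φY f) {k : (diagBundle LY).Ref}
    {l : LY.Ref} {cY : Y × Y → ℂˣ} (hY : PhiCoord φY k l cY) :
    ∃ cX, PhiCoord φX ((k.pullback f).map (diagIso f D.lam)) ((l.pullback (f.prodMap f)).map D.lam)
      cX ∧ ∀ G : FrameSys Y, G * G = k.frames →
        obsW mX (G.comap f) ((l.pullback (f.prodMap f)).map D.lam).frames cX =
          obsW mY G l.frames cY ∘ₗ hmap (ZMod 2) 1 (f.prodMap f) := by
  obtain ⟨cX, hX⟩ := exists_phiCoord φX ((k.pullback f).map (diagIso f D.lam))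
    ((l.pullback (f.prodMap f)).map D.lam)
  refine ⟨cX, hX, fun G hG => ?_⟩
  let η : (pulledBundle f LY).Ref := (((k.pullback f).pullback .fst).tensor
    ((k.pullback f).pullback .snd)).tensor ((l.tensor l).pullback (f.prodMap f))
  obtain ⟨Θ, hΘ⟩ := Ref.exists_map_eq (η.pullback .snd) (k.pullback D.h.toContinuousMap) D.θ
  -- The end conditions on `θ` say that its coordinate is the square of the coordinate `cY` at time
  -- `0` and of `cX` at time `1`.
  have hΘ0 (p : X × X) : cY (f.prodMap f p) * cY (f.prodMap f p) = Θ (0, p) := by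
    refine (k.eq_of_pt_eq (b := D.h (0, p)) (b' := mY.mul (f p.1, f p.2)) ?_).symm
    have e := D.θ_zero p (k.val _) (k.val _) (l.val _) (l.val _)
    have e1 := hΘ (0, p)
    have e2 := hY (f p.1, f p.2)
    refine Eq.trans ?_ (e.trans ?_)
    · exact congrArg ((diagBundle LY).pt (D.h (0, p))) e1.symm
    · exact congrArg ((diagBundle LY).pt (mY.mul (f p.1, f p.2))) e2
  have hΘ1 (p : X × X) : cX p * cX p = Θ (1, p) := by
    refine (k.eq_of_pt_eq (b := D.h (1, p)) (b' := f (mX.mul p)) ?_).symm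
    have e := D.θ_one p (k.val _) (k.val _) (l.val _) (l.val _)
    have e1 := hΘ (1, p)
    have e2 := congrArg ((diagIso f D.lam).map (mX.mul p)).symm (hX p)
    refine Eq.trans ?_ (e.trans ?_)
    · exact congrArg ((diagBundle LY).pt (D.h (1, p))) e1.symm
    · refine congrArg ((diagBundle LY).pt (f (mX.mul p))) (e2.trans ?_)
      refine (map_smul ((diagIso f D.lam).map (mX.mul p)).symm _ _).trans ?_
      exact congrArg _ (LinearEquiv.symm_apply_apply _ _)
  obtain ⟨C, hC, h0, h1⟩ := exists_sqrt_family Θ hΘ0 hΘ1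
  have hfr := Ref.frames_eq_of_map hΘ
  have hη : η.frames = _ := Ref.frames_tensor (((k.pullback f).pullback .fst).tensor
    ((k.pullback f).pullback .snd)) ((l.tensor l).pullback (f.prodMap f))
  simp only [Ref.frames_pullback, Ref.frames_tensor] at hη
  rw [Ref.frames_pullback, Ref.frames_pullback, hη, ← hC] at hfr
  rw [Ref.frames_map, Ref.frames_pullback]
  exact obsW_map hY.frames_eq hG D.h h0 h1 hfr

end Map

/-! ### Associativity -/

section Assoc

variable {X : Type u} [TopologicalSpace X] {m : HSpaceStr X}

theorem obsW_comap {T : Type u} [TopologicalSpace T] {F G : FrameSys X} {Λ : FrameSys (X × X)}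
    {c : X × X → ℂˣ}
    (h : F.comap .fst * F.comap .snd * (Λ * Λ) = (F.comap m.mul).scale (c * c))
    (hG : G * G = F) (g : C(T, X × X)) :
    obsW m G Λ c ∘ₗ hmap (ZMod 2) 1 g =
      rootW (G.comap (ContinuousMap.fst.comp g) * G.comap (ContinuousMap.snd.comp g) * Λ.comap g)
        ((G.comap (m.mul.comp g)).scale (c ∘ g)) := by
  rw [obsW, ← rootW_comap (obsW_sq h hG), comap_mul, comap_mul, comap_scale]
  simp only [FrameSys.comap_comap]

theorem obsW_comap_sq {T : Type u} [TopologicalSpace T] {F G : FrameSys X} {Λ : FrameSys (X × X)}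
    {c : X × X → ℂˣ}
    (h : F.comap .fst * F.comap .snd * (Λ * Λ) = (F.comap m.mul).scale (c * c))
    (hG : G * G = F) (g : C(T, X × X)) :
    (G.comap (ContinuousMap.fst.comp g) * G.comap (ContinuousMap.snd.comp g) * Λ.comap g) *
      (G.comap (ContinuousMap.fst.comp g) * G.comap (ContinuousMap.snd.comp g) * Λ.comap g) =
        (G.comap (m.mul.comp g)).scale (c ∘ g) * (G.comap (m.mul.comp g)).scale (c ∘ g) := by
  have := congrArg (FrameSys.comap · g) (obsW_sq h hG)
  simpa only [comap_mul, comap_scale, FrameSys.comap_comap] using this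

/-- An isomorphism on some factors followed by one on the result is a composite isomorphism, so the
classes add; the scalar `x` accounts for the identification of the remaining factors. -/
theorem rootW_chain {T : Type u} [TopologicalSpace T] {E₁ E₂ E₃ N₁ N₂ E : FrameSys T} {a b x : T → ℂˣ}
    (h₁ : E₁ * E₁ = N₁.scale a * N₁.scale a)
    (h₂ : (N₁ * E₂) * (N₁ * E₂) = N₂.scale b * N₂.scale b)
    (h₃ : E₃ = E₂.scale x) (hE : E = E₁ * E₃) :
    rootW E₁ (N₁.scale a) + rootW (N₁ * E₂) (N₂.scale b) = rootW E (N₂.scale (b * (a * x))) := by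
  have e : N₁.scale a * E₃ = (N₁ * E₂).scale (a * x) := by rw [h₃, scale_mul_scale]
  have h₄ : E * E = N₁.scale a * E₃ * (N₁.scale a * E₃) := by
    rw [hE, mul_mul_mul_comm, h₁, mul_mul_mul_comm]
  have h₅ : N₁.scale a * E₃ * (N₁.scale a * E₃) =
      (N₂.scale b).scale (a * x) * (N₂.scale b).scale (a * x) := by
    rw [e, scale_mul_scale, scale_mul_scale, h₂]
  rw [← FrameSys.scale_scale, rootW_add h₄ h₅, e, rootW_scale h₂, ← e, hE, rootW_mul h₁ rfl, rootW_self,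
    add_zero]

/-- Both bracketings start from the same six-factor product `E`. By `rootW_chain` each side of the
identity is the class of a composite double cover from `E` to a triple product, and `ζ` deforms one
into the other. -/
theorem obsW_assoc {F G : FrameSys X} {Λ : FrameSys (X × X)} {c : X × X → ℂˣ}
    (hF : F.comap .fst * F.comap .snd * (Λ * Λ) = (F.comap m.mul).scale (c * c))
    (hG : G * G = F) (h : (m.mul.comp m.mulId).Homotopy (m.mul.comp m.idMul))
    {x y : (X × X) × X → ℂˣ} {C : I × ((X × X) × X) → ℂˣ}
    (hx : Λ.comap (p13 X) * Λ.comap (p23 X) = (Λ.comap m.mulId).scale x)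
    (hy : Λ.comap (p12 X) * Λ.comap (p13 X) = (Λ.comap m.idMul).scale y)
    (h₀ : ∀ p, C (0, p) = c (m.mulId p) * (c (p12 X p) * x p))
    (h₁ : ∀ p, C (1, p) = c (m.idMul p) * (c (p23 X p) * y p))
    (hC : ((((((F.comap ⟨fun p => p.1.1, by fun_prop⟩ * F.comap ⟨fun p => p.1.2, by fun_prop⟩) *
      F.comap .snd) * (Λ.comap (p12 X) * Λ.comap (p12 X))) *
      (Λ.comap (p13 X) * Λ.comap (p13 X))) * (Λ.comap (p23 X) * Λ.comap (p23 X))) :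
        FrameSys ((X × X) × X)).comap .snd = (F.comap h.toContinuousMap).scale (C * C)) :
    obsW m G Λ c ∘ₗ hmap (ZMod 2) 1 (p12 X) + obsW m G Λ c ∘ₗ hmap (ZMod 2) 1 m.mulId =
      obsW m G Λ c ∘ₗ hmap (ZMod 2) 1 (p23 X) + obsW m G Λ c ∘ₗ hmap (ZMod 2) 1 m.idMul := by
  let A₁ := G.comap (⟨fun p => p.1.1, by fun_prop⟩ : C((X × X) × X, X))
  let A₂ := G.comap (⟨fun p => p.1.2, by fun_prop⟩ : C((X × X) × X, X))
  let A₃ := G.comap (.snd : C((X × X) × X, X))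
  let E : FrameSys ((X × X) × X) :=
    A₁ * A₂ * A₃ * Λ.comap (p12 X) * Λ.comap (p13 X) * Λ.comap (p23 X)
  have hEN : E.comap (.snd : C(I × ((X × X) × X), (X × X) × X)) * E.comap .snd =
      (G.comap h.toContinuousMap).scale C * (G.comap h.toContinuousMap).scale C := by
    rw [scale_mul_scale, ← comap_mul, ← comap_mul, hG, ← hC, ← hG]
    congr 1
    simp only [E, A₁, A₂, A₃, comap_mul]
    ac_rfl
  have k := rootW_slice hEN
  rw [comap_homotopy_zero h G h₀, comap_homotopy_one h G h₁] at k
  rw [obsW_comap hF hG, obsW_comap hF hG, obsW_comap hF hG, obsW_comap hF hG]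
  have s12 := obsW_comap_sq hF hG (p12 X)
  have s23 := obsW_comap_sq hF hG (p23 X)
  have smi := obsW_comap_sq hF hG m.mulId
  have sim := obsW_comap_sq hF hG m.idMul
  have L := rootW_chain (E₁ := A₁ * A₂ * Λ.comap (p12 X)) (E₂ := A₃ * Λ.comap m.mulId)
    (N₁ := G.comap (m.mul.comp (p12 X))) (N₂ := G.comap (m.mul.comp m.mulId)) (a := c ∘ p12 X)
    (b := c ∘ m.mulId) (x := x) (E₃ := A₃ * (Λ.comap (p13 X) * Λ.comap (p23 X))) (E := E) s12
    ((congrArg (fun z => z * z) (mul_assoc _ _ _)).symm.trans smi) (by rw [hx, mul_scale]) (by simp only [E]; ac_rfl)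
  have R := rootW_chain (E₁ := A₂ * A₃ * Λ.comap (p23 X)) (E₂ := A₁ * Λ.comap m.idMul)
    (N₁ := G.comap (m.mul.comp (p23 X))) (N₂ := G.comap (m.mul.comp m.idMul)) (a := c ∘ p23 X)
    (b := c ∘ m.idMul) (x := y) (E₃ := A₁ * (Λ.comap (p12 X) * Λ.comap (p13 X))) (E := E) s23
    ((congrArg (fun z => z * z) (mul_left_comm _ _ _)).trans
      ((congrArg (fun z => z * z) (mul_assoc _ _ _)).symm.trans sim)) (by rw [hy, mul_scale])
    (by simp only [E]; ac_rfl)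
  rw [← mul_assoc] at L R
  rw [mul_comm (G.comap _) A₁] at R
  exact L.trans (k.trans R.symm)

variable {L : LineBundle.{u, v} (X × X)} {φ : PhiIso m L} {k : (diagBundle L).Ref} {l : L.Ref}
  {c : X × X → ℂˣ}

theorem exists_assocRef (k : (diagBundle L).Ref) (l : L.Ref) : ∃ η : (assocBundle L).Ref,
    η.frames = ((((((k.frames.comap ⟨fun p => p.1.1, by fun_prop⟩ *
      k.frames.comap ⟨fun p => p.1.2, by fun_prop⟩) * k.frames.comap .snd) *
      (l.frames.comap (p12 X) * l.frames.comap (p12 X))) *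
      (l.frames.comap (p13 X) * l.frames.comap (p13 X))) *
      (l.frames.comap (p23 X) * l.frames.comap (p23 X))) : FrameSys ((X × X) × X)) ∧
    ∀ p, η.val p = (((((k.val p.1.1 ⊗ₜ[ℂ] k.val p.1.2) ⊗ₜ[ℂ] k.val p.2) ⊗ₜ[ℂ]
      (l.val (p12 X p) ⊗ₜ[ℂ] l.val (p12 X p))) ⊗ₜ[ℂ] (l.val (p13 X p) ⊗ₜ[ℂ] l.val (p13 X p))) ⊗ₜ[ℂ]
      (l.val (p23 X p) ⊗ₜ[ℂ] l.val (p23 X p))) := by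
  let η := (((((k.pullback (⟨fun p => p.1.1, by fun_prop⟩ : C((X × X) × X, X))).tensor
    (k.pullback ⟨fun p => p.1.2, by fun_prop⟩)).tensor (k.pullback .snd)).tensor
    ((l.pullback (p12 X)).tensor (l.pullback (p12 X)))).tensor
    ((l.pullback (p13 X)).tensor (l.pullback (p13 X)))).tensor
    ((l.pullback (p23 X)).tensor (l.pullback (p23 X)))
  obtain ⟨N, h⟩ : ∃ N, N = η.frames := ⟨_, rfl⟩
  have h' := h
  simp only [η, Ref.frames_pullback, Ref.frames_tensor] at h'
  exact ⟨η, h.symm.trans h', fun p => rfl⟩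

theorem AssocData.obsW_assoc (D : AssocData φ) (hc : PhiCoord φ k l c) {G : FrameSys X}
    (hG : G * G = k.frames) :
    obsW m G l.frames c ∘ₗ hmap (ZMod 2) 1 (p12 X) +
        obsW m G l.frames c ∘ₗ hmap (ZMod 2) 1 m.mulId =
      obsW m G l.frames c ∘ₗ hmap (ZMod 2) 1 (p23 X) +
        obsW m G l.frames c ∘ₗ hmap (ZMod 2) 1 m.idMul := by
  obtain ⟨x, hx⟩ := Ref.exists_map_eq ((l.pullback (p13 X)).tensor (l.pullback (p23 X)))
    (l.pullback m.mulId) D.χ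
  obtain ⟨y, hy⟩ := Ref.exists_map_eq ((l.pullback (p12 X)).tensor (l.pullback (p13 X)))
    (l.pullback m.idMul) D.ψ
  obtain ⟨η, hη, hηv⟩ := exists_assocRef k l
  obtain ⟨Θ, hΘ⟩ := Ref.exists_map_eq (η.pullback .snd) (k.pullback D.h.toContinuousMap) D.ζ
  have hφ (p : X × X) (z z₁ z₂ z₃ : ℂ) : φ.map p (((z • k.val p.1) ⊗ₜ[ℂ] (z₁ • k.val p.2)) ⊗ₜ[ℂ]
      ((z₂ • l.val p) ⊗ₜ[ℂ] (z₃ • l.val p))) =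
      ((z * z₁ * (z₂ * z₃)) * ((c p * c p : ℂˣ) : ℂ)) • k.val (m.mul p) := by
    rw [mul_smul, ← hc p]
    exact map_smul_tmul₄ (φ.map p) _ _ _ _ _ _ _ _
  have hΘ0 (p : (X × X) × X) : (c (m.mulId p) * (c (p12 X p) * x p)) *
      (c (m.mulId p) * (c (p12 X p) * x p)) = Θ (0, p) := by
    refine (k.eq_of_pt_eq (b := D.h (0, p)) (b' := m.mul (m.mulId p)) ?_).symm
    have e := D.ζ_zero p (k.val _) (k.val _) (k.val _) (l.val _) (l.val _) (l.val _) (l.val _)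
      (l.val _) (l.val _)
    refine Eq.trans ?_ (e.trans ?_)
    · exact congrArg ((diagBundle L).pt (D.h (0, p)))
        ((congrArg (D.ζ.map (0, p)) (hηv p)).symm.trans (hΘ (0, p))).symm
    · refine congrArg ((diagBundle L).pt (m.mul (m.mulId p))) ?_
      have e1 : φ.map (p12 X p) ((k.val p.1.1 ⊗ₜ[ℂ] k.val p.1.2) ⊗ₜ[ℂ]
        (l.val (p12 X p) ⊗ₜ[ℂ] l.val (p12 X p))) = _ := hc (p12 X p)
      have e2 : D.χ.map p (l.val (p13 X p) ⊗ₜ[ℂ] l.val (p23 X p)) = (x p : ℂ) • l.val (m.mulId p) :=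
        hx p
      rw [e1, e2]
      have e3 := hφ (m.mulId p) (c (p12 X p) * c (p12 X p) : ℂˣ) 1 (x p) (x p)
      rw [one_smul] at e3
      refine e3.trans ?_
      congr 1
      push_cast
      ring
  have hΘ1 (p : (X × X) × X) : (c (m.idMul p) * (c (p23 X p) * y p)) *
      (c (m.idMul p) * (c (p23 X p) * y p)) = Θ (1, p) := by
    refine (k.eq_of_pt_eq (b := D.h (1, p)) (b' := m.mul (m.idMul p)) ?_).symm
    have e := D.ζ_one p (k.val _) (k.val _) (k.val _) (l.val _) (l.val _) (l.val _) (l.val _)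
      (l.val _) (l.val _)
    refine Eq.trans ?_ (e.trans ?_)
    · exact congrArg ((diagBundle L).pt (D.h (1, p)))
        ((congrArg (D.ζ.map (1, p)) (hηv p)).symm.trans (hΘ (1, p))).symm
    · refine congrArg ((diagBundle L).pt (m.mul (m.idMul p))) ?_
      have e1 : φ.map (p23 X p) ((k.val p.1.2 ⊗ₜ[ℂ] k.val p.2) ⊗ₜ[ℂ]
        (l.val (p23 X p) ⊗ₜ[ℂ] l.val (p23 X p))) = _ := hc (p23 X p)
      have e2 : D.ψ.map p (l.val (p12 X p) ⊗ₜ[ℂ] l.val (p13 X p)) = (y p : ℂ) • l.val (m.idMul p) :=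
        hy p
      rw [e1, e2]
      have e3 := hφ (m.idMul p) 1 (c (p23 X p) * c (p23 X p) : ℂˣ) (y p) (y p)
      rw [one_smul] at e3
      refine e3.trans ?_
      congr 1
      push_cast
      ring
  obtain ⟨C, hC, h0, h1⟩ := exists_sqrt_family Θ hΘ0 hΘ1
  have hfr := Ref.frames_eq_of_map hΘ
  have hxf := Ref.frames_eq_of_map hx
  have hyf := Ref.frames_eq_of_map hy
  simp only [Ref.frames_pullback, Ref.frames_tensor] at hxf hyf
  rw [Ref.frames_pullback, Ref.frames_pullback, hη, ← hC] at hfr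
  exact HochPont.obsW_assoc hc.frames_eq hG D.h hxf hyf h0 h1 hfr

end Assoc

/-! ### Compatible roots -/

section CompatRoots

variable {X : Type u} [TopologicalSpace X] {m : HSpaceStr X} {L : LineBundle.{u, v} (X × X)}
  {φ : PhiIso m L} {k : (diagBundle L).Ref} {l : L.Ref} {c : X × X → ℂˣ}

theorem HSpaceStr.delta_zero (m : HSpaceStr X) : m.delta 0 = 0 := by
  simp [HSpaceStr.delta]

/-- Compatibility is defined by some representative; `obsW_change` with zero difference class
carries it to any other. -/
theorem cls_mem_compatRoots_iff (hX : HasLPCType X) (hc : PhiCoord φ k l c)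
    {r : SquareRoot (diagBundle L)} {u : r.J.Ref} (hu : r.IsNormal k u) :
    r.cls ∈ CompatRoots φ ↔ obsW m u.frames l.frames c = 0 := by
  constructor
  · rintro ⟨r', hr', h⟩
    obtain ⟨u', hu'⟩ := r'.exists_isNormal k
    have h0 := rootW_of_cls_eq hu' hu hr'
    have e := obsW_change hc.frames_eq hu'.frames_mul hu.frames_mul
    rwa [h0, m.delta_zero, add_zero, (exists_squaresTo_iff hX hc hu').1 h] at e
  · intro h
    exact ⟨r, rfl, (exists_squaresTo_iff hX hc hu).2 h⟩

end CompatRoots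

/-! ### Triviality of line bundles over simplices -/

namespace FrameSys

/-- Line bundles over `B × K` are trivial near each `{b} × K`. -/
def TrivAlong (K : Type) [TopologicalSpace K] : Prop :=
  ∀ (B : Type w) [TopologicalSpace B] (F : FrameSys (B × K)) (b : B),
    ∃ ρ, ∀ᶠ b' in 𝓝 b, ∀ k, F.adm ρ (b', k)

variable {K L : Type} [TopologicalSpace K] [TopologicalSpace L]

theorem adm_of_inverse {B T : Type*} [TopologicalSpace B] [TopologicalSpace T] {F : FrameSys B}
    {m : C(T, B)} {m' : C(B, T)} (h : m.comp m' = .id B) {ρ : T → ℂˣ} {x : B}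
    (hρ : (F.comap m).adm ρ (m' x)) : F.adm (ρ ∘ m') x := by
  have := adm_comap m' hρ
  rwa [FrameSys.comap_comap, h, comap_id] at this

theorem trivAlong_unit : TrivAlong.{w} PUnit := by
  intro B _ F b
  obtain ⟨ρ, h⟩ := F.exists_adm (b, ⟨⟩)
  have hc : ContinuousAt (fun b' : B => (b', PUnit.unit)) b := by fun_prop
  exact ⟨ρ, (hc.eventually h).mono fun _ h' _ => h'⟩

/-- Treat the interval coordinate as part of the base to get frames over short intervals, then glue
them along the interval. -/
theorem TrivAlong.prod (h : TrivAlong.{w} L) : TrivAlong.{w} (I × L) := by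
  intro B _ F b
  let P (s t : I) : Prop := ∃ ρ, ∀ᶠ b' in 𝓝 b, ∀ x ∈ Set.Icc s t, ∀ l, F.adm ρ (b', x, l)
  have key : P 0 1 := by
    refine SignTwist.unitInterval_glue P ?_ ?_
    · intro t
      let m : C((B × I) × L, B × (I × L)) := ⟨fun p => (p.1.1, p.1.2, p.2), by fun_prop⟩
      let m' : C(B × (I × L), (B × I) × L) := ⟨fun p => ((p.1, p.2.1), p.2.2), by fun_prop⟩
      obtain ⟨ρ, hρ⟩ := h (B × I) (F.comap m) (b, t)
      obtain ⟨V, U, hV, hbV, hU, htU, hs⟩ := mem_nhds_prod_iff'.1 hρ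
      refine ⟨U, hU, htU, fun s u hsu _ => ⟨ρ ∘ m', ?_⟩⟩
      filter_upwards [hV.mem_nhds hbV] with b' hb' x hx l
      exact adm_of_inverse (m := m) (m' := m') rfl
        (hs (show (b', x) ∈ V ×ˢ U from ⟨hb', hsu hx⟩) l)
    · rintro s t u hst htu ⟨ρ₁, h₁⟩ ⟨ρ₂, h₂⟩
      let pr : C(B × (I × L), B × (I × L)) := ⟨fun p => (p.1, t, p.2.2), by fun_prop⟩
      -- The second frame is multiplied by the ratio of the two on the slice at `t`, so that both
      -- pieces agree there.
      let ρ (p : B × (I × L)) : ℂˣ :=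
        if p.2.1 ≤ t then ρ₁ p else ρ₂ p * (ρ₁ (pr p) / ρ₂ (pr p))
      refine ⟨ρ, ?_⟩
      filter_upwards [h₁, h₂] with b' hb₁ hb₂ x hx l
      have hq : ContinuousAt (fun p => ρ₁ (pr p) / ρ₂ (pr p)) (b', x, l) :=
        ContinuousAt.comp (g := fun p => ρ₁ p / ρ₂ p) (f := pr)
          (F.adm_cmp (hb₂ t ⟨le_rfl, htu⟩ l) (hb₁ t ⟨hst, le_rfl⟩ l)) pr.continuous.continuousAt
      have hx' : ContinuousAt (fun p : B × (I × L) => p.2.1) (b', x, l) := by fun_prop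
      rcases lt_trichotomy x t with hlt | rfl | hlt
      · refine (F.adm_iff (hb₁ x ⟨hx.1, hlt.le⟩ l)).2 (Cmp.refl.congr ?_)
        filter_upwards [hx'.eventually (gt_mem_nhds hlt)] with p hp
        exact if_pos hp.le
      · have e₁ := hb₁ x ⟨hst, le_rfl⟩ l
        have e₂ := hb₂ x ⟨le_rfl, htu⟩ l
        have hc := ContinuousAt.mul (F.adm_cmp e₁ e₂) hq
        refine (F.adm_iff e₁).2 ?_
        have h1 : Filter.Tendsto (fun _ : B × (I × L) => (1 : ℂˣ)) (𝓝 (b', x, l)) (𝓝 1) :=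
          tendsto_const_nhds
        have h2 : Filter.Tendsto (fun p => ρ₂ p / ρ₁ p * (ρ₁ (pr p) / ρ₂ (pr p)))
            (𝓝 (b', x, l)) (𝓝 1) := by
          have e : ρ₂ (b', x, l) / ρ₁ (b', x, l) * (ρ₁ (pr (b', x, l)) / ρ₂ (pr (b', x, l))) = 1 := by
            change ρ₂ (b', x, l) / ρ₁ (b', x, l) * (ρ₁ (b', x, l) / ρ₂ (b', x, l)) = 1
            simp
          rw [← e]
          exact hc.tendsto
        -- At the seam continuity only requires both branches of the ratio to tend to `1`.
        have h3 := h1.if' (p := fun p => p.2.1 ≤ x) h2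
        have e : (fun p => ρ p / ρ₁ p) = fun p : B × (I × L) => if p.2.1 ≤ x then 1 else
            ρ₂ p / ρ₁ p * (ρ₁ (pr p) / ρ₂ (pr p)) := by
          funext p
          simp only [ρ]
          split_ifs
          · exact div_self' _
          · rw [mul_div_right_comm]
        rw [Cmp, e, ContinuousAt, if_pos le_rfl]
        exact h3
      · refine (F.adm_iff (hb₂ x ⟨hlt.le, hx.2⟩ l)).2 ((Cmp.of_continuousAt hq).congr ?_)
        filter_upwards [hx'.eventually (lt_mem_nhds hlt)] with p hp
        exact if_neg (not_le.2 hp)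
  obtain ⟨ρ, hρ⟩ := key
  refine ⟨ρ, hρ.mono fun b' h' k => h' k.1 ⟨k.1.2.1, k.1.2.2⟩ k.2⟩

/-- Pull the bundle back by the retraction, trivialize it there, and restrict along the inclusion.
-/
theorem TrivAlong.retract (h : TrivAlong.{w} L) (i : C(K, L)) (r : C(L, K)) (hr : r.comp i = .id K) :
    TrivAlong.{w} K := by
  intro B _ F b
  obtain ⟨ρ, hρ⟩ := h B (F.comap ((ContinuousMap.id B).prodMap r)) b
  refine ⟨ρ ∘ (ContinuousMap.id B).prodMap i, hρ.mono fun b' h' k => ?_⟩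
  refine adm_of_inverse ?_ (h' (i k))
  exact ContinuousMap.ext fun p => Prod.ext rfl (DFunLike.congr_fun hr p.2)

theorem TrivAlong.exists_section (h : TrivAlong.{0} K) (F : FrameSys K) : ∃ ρ, F.IsSection ρ := by
  obtain ⟨ρ, hρ⟩ := h Unit (F.comap .snd) ()
  refine ⟨ρ ∘ fun k => ((), k), fun k => ?_⟩
  have := adm_comap (⟨fun k => ((), k), by fun_prop⟩ : C(K, Unit × K)) (hρ.self_of_nhds k)
  rwa [FrameSys.comap_comap, show ContinuousMap.snd.comp
    (⟨fun k => ((), k), by fun_prop⟩ : C(K, Unit × K)) = .id K from rfl, comap_id] at this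

theorem trivAlong_unitInterval : TrivAlong.{w} I :=
  trivAlong_unit.prod.retract ⟨fun t => (t, ⟨⟩), by fun_prop⟩ .fst rfl

theorem trivAlong_simp_one : TrivAlong.{w} (Simp 1) :=
  trivAlong_unitInterval.retract param unparam (ContinuousMap.ext unparam_param)

/-- A retraction of the square to the triangle. -/
def triangleRetract : C(I × I, Simp 2) :=
  ⟨fun p => ⟨![1 - (p.1.1 + p.2.1) / max 1 (p.1.1 + p.2.1), p.1.1 / max 1 (p.1.1 + p.2.1),
      p.2.1 / max 1 (p.1.1 + p.2.1)], by
    have h0 : 0 < max 1 ((p.1 : ℝ) + p.2) := lt_of_lt_of_le one_pos (le_max_left _ _)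
    refine ⟨fun i => ?_, by simp [Fin.sum_univ_three]; ring⟩
    fin_cases i
    · change 0 ≤ 1 - (p.1.1 + p.2.1) / max 1 (p.1.1 + p.2.1)
      rw [sub_nonneg, div_le_one h0]
      exact le_max_right _ _
    · exact div_nonneg p.1.2.1 h0.le
    · exact div_nonneg p.2.2.1 h0.le⟩, by
    have h0 (p : I × I) : max 1 ((p.1 : ℝ) + p.2) ≠ 0 :=
      (lt_of_lt_of_le one_pos (le_max_left _ _)).ne'
    refine Continuous.subtype_mk (continuous_pi fun i => ?_) _
    fin_cases i
    · exact continuous_const.sub (Continuous.div (by fun_prop) (by fun_prop) h0)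
    · exact Continuous.div (by fun_prop) (by fun_prop) h0
    · exact Continuous.div (by fun_prop) (by fun_prop) h0⟩

theorem trivAlong_simp_two : TrivAlong.{w} (Simp 2) := by
  refine trivAlong_unitInterval.prod.retract ((coordI 1).prodMk (coordI 2)) triangleRetract ?_
  ext t i
  have hs : t 0 + t 1 + t 2 = 1 := by
    rw [← Fin.sum_univ_three]; exact t.2.2
  have h0 : 0 ≤ t 0 := stdSimplex.zero_le t 0
  have hm : max 1 (t 1 + t 2) = 1 := max_eq_left (by linarith)
  fin_cases i
  · change 1 - (t 1 + t 2) / max 1 (t 1 + t 2) = t 0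
    rw [hm]; linarith
  · change t 1 / max 1 (t 1 + t 2) = t 1
    rw [hm, div_one]
  · change t 2 / max 1 (t 1 + t 2) = t 2
    rw [hm, div_one]

theorem ofFun_eq {B : Type*} [TopologicalSpace B] {F : FrameSys B} {ρ : B → ℂˣ}
    (h : F.IsSection ρ) : ofFun ρ = F := ext_le fun _ x h' => (F.adm_iff (h x)).2 h'

theorem ofFun_mul {B : Type*} [TopologicalSpace B] (ρ ρ' : B → ℂˣ) :
    ofFun ρ * ofFun ρ' = ofFun (ρ * ρ') := ext_mul fun _ _ _ h h' => Cmp.mul h h'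

theorem isSection_ofFun {B : Type*} [TopologicalSpace B] (ρ : B → ℂˣ) : (ofFun ρ).IsSection ρ :=
  fun _ => Cmp.refl

theorem ofFun_continuous {B : Type*} [TopologicalSpace B] {ρ : B → ℂˣ} (h : Continuous ρ) :
    ofFun ρ = 1 := ofFun_eq fun _ => adm_one_iff.2 h.continuousAt

/-! ### Continuous square roots -/

/-- The sign choices that make `p` continuous form a double cover, trivial over a contractible
space; a constant sign normalizes the choice at `t₀`. -/
theorem exists_continuous_sgn_mul {T : Type*} [TopologicalSpace T] [ContractibleSpace T]
    {p : T → ℂˣ} (h : Continuous (p * p)) (t₀ : T) :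
    ∃ ε : T → ZMod 2, ε t₀ = 0 ∧ Continuous fun t => sgn (ε t) * p t := by
  have hsq : (1 : FrameSys T) * 1 = ofFun p * ofFun p := by
    rw [ofFun_mul, ofFun_continuous h, one_mul]
  obtain ⟨ε, hε⟩ := (sgnTwist 1 (ofFun p) hsq).exists_section_of_contractible
  refine ⟨fun t => ε t + ε t₀, zmod_two_add_self _, ?_⟩
  have h1 := hε.add_const (ε t₀)
  rw [sgnTwist_isSection_iff] at h1
  have h2 : (1 : FrameSys T).IsSection fun t => sgn (ε t + ε t₀) * p t := by
    intro t
    rw [h1, scale_adm]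
    change Cmp _ p t
    refine Cmp.refl.congr (.of_forall fun y => ?_)
    simp only [Pi.mul_apply]
    rw [mul_right_comm, sgn_mul_self, one_mul]
  exact continuous_iff_continuousAt.2 fun t => adm_one_iff.1 (h2 t)

theorem exists_continuous_sqrt {T : Type*} [TopologicalSpace T] [ContractibleSpace T]
    {q : T → ℂˣ} (h : Continuous q) : ∃ p, Continuous p ∧ p * p = q := by
  choose p hp using fun t => exists_sqrt (q t)
  obtain ⟨t₀⟩ : Nonempty T := inferInstance
  obtain ⟨ε, -, hε⟩ := exists_continuous_sgn_mul (p := p) (by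
    rwa [show p * p = q from funext hp]) t₀
  refine ⟨_, hε, funext fun t => ?_⟩
  change sgn (ε t) * p t * (sgn (ε t) * p t) = q t
  rw [mul_mul_mul_comm, sgn_mul_self, one_mul, hp]

theorem eq_of_continuous_sgn {T : Type*} [TopologicalSpace T] [PreconnectedSpace T] {ε : T → ZMod 2}
    (h : Continuous fun t => sgn (ε t)) (t t' : T) : ε t = ε t' := by
  have : IsLocallyConstant ε := (IsLocallyConstant.iff_eventually_eq _).2 fun x =>
    continuousAt_sgn_iff.1 h.continuousAt
  exact this.apply_eq_of_isPreconnected isPreconnected_univ trivial trivial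

/-- A version in families along the interval: the cover of sign choices over `I × V` has sections
near each line. The value of `δ` outside `V` is irrelevant since `V` is open. -/
theorem exists_adm_sgn_mul {B : Type*} [TopologicalSpace B] {p : I × B → ℂˣ} {V : Set B}
    (hV : IsOpen V) (h : ∀ t, ∀ v ∈ V, ContinuousAt (p * p) (t, v)) {v₀ : B} (hv₀ : v₀ ∈ V) :
    ∃ δ : I × B → ZMod 2, ∀ᶠ v in 𝓝 v₀, ∀ t, ContinuousAt (fun y => sgn (δ y) * p y) (t, v) := by
  classical
  let j : I × V → I × B := Prod.map id Subtype.val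
  have hj : IsOpenEmbedding j := IsOpenEmbedding.id.prodMap hV.isOpenEmbedding_subtypeVal
  have hc : Continuous ((p ∘ j) * (p ∘ j)) := continuous_iff_continuousAt.2 fun x =>
    ContinuousAt.comp (g := p * p) (h x.1 x.2 x.2.2) hj.continuous.continuousAt
  have hsq : (1 : FrameSys (I × V)) * 1 = ofFun (p ∘ j) * ofFun (p ∘ j) := by
    rw [ofFun_mul, ofFun_continuous hc, one_mul]
  obtain ⟨δ, hδ⟩ := (sgnTwist 1 (ofFun (p ∘ j)) hsq).exists_adm_nhds ⟨v₀, hv₀⟩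
  refine ⟨fun y => if hy : y.2 ∈ V then δ (y.1, ⟨y.2, hy⟩) else 0, ?_⟩
  rw [nhds_subtype_eq_comap, Filter.eventually_comap] at hδ
  filter_upwards [hδ, hV.mem_nhds hv₀] with v hv hvV t
  have h1 := hv ⟨v, hvV⟩ rfl t
  rw [sgnTwist_adm_iff (ρ := 1) (adm_one_iff.2 continuousAt_const)] at h1
  refine (hj.continuousAt_iff (f := j) (x := (t, ⟨v, hvV⟩))).1 ?_
  have h2 : ContinuousAt (fun y => ((fun y => sgn (δ y)) * 1 : I × V → ℂˣ) y / (p ∘ j) y)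
    (t, ⟨v, hvV⟩) := h1
  refine h2.inv.congr (.of_forall fun y => ?_)
  have e : y.2.1 ∈ V := y.2.2
  simp only [Pi.mul_apply, Pi.one_apply, mul_one, Function.comp_apply, j, Prod.map, id, e,
    dif_pos]
  change (sgn (δ y) / p (y.1, y.2))⁻¹ = sgn (δ y) * p (y.1, y.2)
  rw [inv_div, div_eq_mul_inv, sgn_inv, mul_comm]

end FrameSys

/-! ### Extension of square roots along homotopies -/

instance : ContractibleSpace I :=
  (convex_Icc (0 : ℝ) 1).contractibleSpace ⟨0, le_rfl, zero_le_one⟩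

namespace FrameSys

variable {B T : Type*} [TopologicalSpace B] [TopologicalSpace T]

/-- Glue functions with continuous ratios. -/
def ofLocal (w : B → B → ℂˣ) (h : ∀ x, ∀ᶠ y in 𝓝 x, Cmp (w x) (w y) y) : FrameSys B where
  adm ρ x := Cmp ρ (w x) x
  adm_iff h := ⟨fun h' => h'.trans h.symm, fun h' => h'.trans h⟩
  exists_adm x := ⟨w x, h x⟩

theorem mul_ext_self {F G : FrameSys B} (w : B → B → ℂˣ) (hG : ∀ x, G.adm (w x) x)
    (hF : ∀ x, F.adm (w x * w x) x) : G * G = F := by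
  refine ext_mul fun ρ ρ' x h h' => ?_
  refine (F.adm_iff (hF x)).2 ?_
  exact (G.adm_cmp (hG x) h).mul (G.adm_cmp (hG x) h')

theorem mul_div_cross (d x e z z' z'' : ℂˣ) :
    d * (z / z') / (x * (z / z'')) * (e * (z' / z'')) = d * x⁻¹ * e := by
  refine Units.ext ?_
  push_cast
  have h1 := x.ne_zero
  have h2 := z.ne_zero
  have h3 := z'.ne_zero
  have h4 := z''.ne_zero
  field_simp

theorem exists_adm_line (F : FrameSys (I × B)) (b : B) :
    ∃ ρ, ∀ᶠ v in 𝓝 b, ∀ t, F.adm ρ (t, v) := by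
  obtain ⟨ρ, hρ⟩ := trivAlong_unitInterval B (F.comap ⟨fun p => (p.2, p.1), by fun_prop⟩) b
  refine ⟨ρ ∘ (⟨fun p => (p.2, p.1), by fun_prop⟩ : C(I × B, B × I)), hρ.mono fun v hv t => ?_⟩
  exact adm_of_inverse (m := ⟨fun p => (p.2, p.1), by fun_prop⟩) rfl (hv t)

/-- Over a neighbourhood of a line `F` has a frame; a factor constant in time makes it the square of
a frame of `G₀` at time `0`. Pointwise roots that start with that frame give `R`, whose signs are
not yet continuous in time. -/
theorem exists_local_root {F : FrameSys (I × B)} {G₀ : FrameSys B}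
    (h : G₀ * G₀ = F.comap (SignTwist.slice B 0)) (b : B) :
    ∃ (R : I × B → ℂˣ) (U : Set B), IsOpen U ∧ b ∈ U ∧ ∀ v ∈ U,
      (∀ t, F.adm (R * R) (t, v)) ∧ G₀.adm (R ∘ SignTwist.slice B 0) v := by
  obtain ⟨ρ, hρ⟩ := F.exists_adm_line b
  obtain ⟨r, hr⟩ := G₀.exists_adm b
  obtain ⟨U, hU, hUo, hb⟩ := eventually_nhds_iff.1 (hρ.and hr)
  choose q hq using exists_sqrt
  let η (p : I × B) : ℂˣ := r p.2 * r p.2 / ρ (0, p.2)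
  obtain ⟨R, hRR, hR0', -⟩ := exists_sqrt_family (ρ * η) (C₀ := r)
    (C₁ := fun v => q ((ρ * η) (1, v)))
    (fun v => by
      change _ = ρ (0, v) * (r v * r v / ρ (0, v))
      rw [mul_div_cancel]) fun v => hq _
  have hR0 : R ∘ SignTwist.slice B 0 = r := funext hR0'
  refine ⟨R, U, hUo, hb, fun v hv => ⟨fun t => ?_, by rw [hR0]; exact (hU v hv).2⟩⟩
  rw [hRR]
  have h2 : (F.comap (SignTwist.slice B 0)).adm (r * r) v := by
    rw [← h]; exact adm_mul (hU v hv).2 (hU v hv).2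
  have h3 := adm_cmp _ (adm_comap (SignTwist.slice B 0) (t := v) ((hU v hv).1 0)) h2
  have h4 : ContinuousAt η (t, v) := ContinuousAt.comp (x := (t, v)) (f := Prod.snd)
    (g := fun v => r v * r v / ρ (0, v)) h3 continuousAt_snd
  exact adm_mul_continuousAt ((hU v hv).1 t) h4

/-- A square root of a bundle over `{0} × B` extends to a square root over `I × B`. -/
theorem exists_root_extend {F : FrameSys (I × B)} {G₀ : FrameSys B}
    (h : G₀ * G₀ = F.comap (SignTwist.slice B 0)) : ∃ G, G * G = F := by
  choose R U hU hbU hR using exists_local_root h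
  have hF (b : B) (v) (hv : v ∈ U b) (t : I) : F.adm (R b * R b) (t, v) := (hR b v hv).1 t
  -- On the line over `v` the signs of `R b` are adjusted to follow `R v`, starting with the trivial
  -- sign at time `0`.
  have hline (b : B) (v) (hv : v ∈ U b) : ∃ ε : I → ZMod 2, ε 0 = 0 ∧
      Continuous fun t => sgn (ε t) * (R b (t, v) / R v (t, v)) := by
    refine exists_continuous_sgn_mul (p := fun t => R b (t, v) / R v (t, v)) ?_ 0
    refine continuous_iff_continuousAt.2 fun t => ?_
    have := (F.adm_cmp (hF v v (hbU v) t) (hF b v hv t)).comp (g := SignTwist.line v) (t := t)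
      (SignTwist.line v).continuous.continuousAt
    refine ContinuousAt.congr this (.of_forall fun t => ?_)
    simp only [Function.comp_apply, Pi.mul_apply]
    rw [div_mul_div_comm]
    rfl
  choose! ε hε0 hε using hline
  let W (b : B) (p : I × B) : ℂˣ := sgn (ε b p.2 p.1) * R b p
  have hWW (b : B) : W b * W b = R b * R b := funext fun p => by
    simp only [W, Pi.mul_apply]
    rw [mul_mul_mul_comm, sgn_mul_self, one_mul]
  -- The adjusted roots `W b` and `W c` are comparable: their ratio is a continuous family of sign
  -- choices, fixed by its behaviour at time `0`.
  have key (b c v : B) (hb : v ∈ U b) (hc : v ∈ U c) (t : I) : Cmp (W b) (W c) (t, v) := by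
    let p (y : I × B) : ℂˣ := R b y / R c y
    obtain ⟨δ, hδ⟩ := exists_adm_sgn_mul (p := p) (V := U b ∩ U c) ((hU b).inter (hU c))
      (fun t y hy => by
        refine ContinuousAt.congr (F.adm_cmp (hF c y hy.2 t) (hF b y hy.1 t)) (.of_forall fun x => ?_)
        simp only [p, Pi.mul_apply, div_mul_div_comm]) (v₀ := v) ⟨hb, hc⟩
    -- At time `0` both roots are frames of `G₀`, so the ratio is already continuous and the sign is
    -- locally constant.
    have hconst : ∀ᶠ y in 𝓝 v, δ (0, y) = δ (0, v) := by
      rw [← continuousAt_sgn_iff (s := fun y => δ (0, y))]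
      have h1 : ContinuousAt (fun y => sgn (δ (0, y)) * p (0, y)) v :=
        ContinuousAt.comp (g := fun y => sgn (δ y) * p y) (f := SignTwist.slice B 0)
          (hδ.self_of_nhds 0) (SignTwist.slice B 0).continuous.continuousAt
      have h2 : ContinuousAt (fun y => p (0, y)) v := G₀.adm_cmp (hR c v hc).2 (hR b v hb).2
      refine (h1.div' h2).congr (.of_forall fun y => ?_)
      exact mul_div_cancel_right _ _
    have hy : ∀ᶠ y in 𝓝 v, ∀ t, W b (t, y) / W c (t, y) =
        sgn (δ (0, v)) * (sgn (δ (t, y)) * p (t, y)) := by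
      filter_upwards [hδ, hconst, (hU b).mem_nhds hb, (hU c).mem_nhds hc] with y h1 h2 hb hc t
      have h3 : Continuous fun t => sgn (δ (t, y)) * p (t, y) := continuous_iff_continuousAt.2 fun t =>
        ContinuousAt.comp (g := fun y => sgn (δ y) * p y) (f := SignTwist.line y) (h1 t)
          (SignTwist.line y).continuous.continuousAt
      have h4 := (h3.div' (hε b y hb)).mul (hε c y hc)
      -- The combined sign is a ratio of functions continuous in `t`, so it is constant along each
      -- line and equals its value at time `0`.
      have h5 : Continuous fun t => sgn (δ (t, y) + ε b y t + ε c y t) := by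
        refine h4.congr fun t => ?_
        rw [sgn_add, sgn_add, ← sgn_inv (ε b y t)]
        simp only [p, Pi.mul_apply, Pi.div_apply]
        generalize sgn (ε b y t) = x
        generalize R b (t, y) = z
        generalize R c (t, y) = z'
        generalize R y (t, y) = z''
        exact mul_div_cross _ _ _ _ _ _
      have h6 := eq_of_continuous_sgn h5 t 0
      rw [hε0 b y hb, hε0 c y hc, h2, add_zero, add_zero] at h6
      rw [← h6, sgn_add, sgn_add]
      simp only [W, p]
      rw [mul_div_mul_comm, div_eq_mul_inv (sgn _), sgn_inv]
      calc _ = (sgn (δ (t, y)) * sgn (δ (t, y))) * (sgn (ε b y t) * sgn (ε c y t) *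
            (R b (t, y) / R c (t, y))) := by rw [sgn_mul_self, one_mul]
        _ = _ := by ac_rfl
    have h7 : ContinuousAt (fun y => sgn (δ (0, v)) * (sgn (δ y) * p y)) (t, v) :=
      continuousAt_const.mul (hδ.self_of_nhds t)
    refine ContinuousAt.congr h7 ?_
    have hs : ContinuousAt (Prod.snd : I × B → B) (t, v) := continuousAt_snd
    filter_upwards [hs.eventually hy] with y hy
    exact (hy y.1).symm
  refine ⟨ofLocal (fun x => W x.2) fun x => ?_, mul_ext_self (fun x => W x.2) (fun x => Cmp.refl)
    fun x => ?_⟩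
  · have hs : ContinuousAt (Prod.snd : I × B → B) x := continuousAt_snd
    filter_upwards [hs.eventually ((hU x.2).mem_nhds (hbU x.2))] with y hy
    exact key x.2 y.2 y.2 hy (hbU _) y.1
  · rw [hWW]
    exact hF _ _ (hbU _) _

/-- Over the cylinder the root at one end extends to the other. Thus existence of roots is homotopy
invariant, without use of a Chern class. -/
theorem exists_root_of_homotopic {F : FrameSys B} {f g : C(T, B)} (h : f.Homotopic g)
    (hf : ∃ G, G * G = F.comap f) : ∃ G, G * G = F.comap g := by
  obtain ⟨H⟩ := h
  obtain ⟨G, hG⟩ := hf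
  have e0 : H.toContinuousMap.comp (SignTwist.slice T 0) = f := ContinuousMap.ext fun x => H.apply_zero x
  have e1 : H.toContinuousMap.comp (SignTwist.slice T 1) = g := ContinuousMap.ext fun x => H.apply_one x
  obtain ⟨G', hG'⟩ := exists_root_extend (F := F.comap H.toContinuousMap) (G₀ := G)
    (by rw [FrameSys.comap_comap, e0, hG])
  exact ⟨G'.comap (SignTwist.slice T 1), by rw [← comap_mul, hG', FrameSys.comap_comap, e1]⟩

theorem comap_const (F : FrameSys B) (b : B) : F.comap (.const T b) = 1 := by
  refine ext_le ?_
  rintro ρ t ⟨ρ₀, -, h⟩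
  rw [adm_one_iff]
  have := ContinuousAt.mul h (continuousAt_const (y := ρ₀ b))
  refine this.congr (.of_forall fun y => ?_)
  exact div_mul_cancel _ _

theorem exists_root_of_contractible [ContractibleSpace T] (F : FrameSys T) : ∃ G, G * G = F := by
  obtain ⟨b, hb⟩ := id_nullhomotopic T
  have := exists_root_of_homotopic (F := F) hb.symm ⟨1, by rw [comap_const, one_mul]⟩
  rwa [comap_id] at this

theorem exists_root_of_homotopyEquiv {B T : Type u} [TopologicalSpace B] [TopologicalSpace T]
    (e : ContinuousMap.HomotopyEquiv B T) (F : FrameSys B) (h : ∃ G, G * G = F.comap e.invFun) :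
    ∃ G, G * G = F := by
  obtain ⟨G, hG⟩ := h
  have := exists_root_of_homotopic (F := F) e.left_inv
    ⟨G.comap e.toFun, by rw [← comap_mul, hG, FrameSys.comap_comap]⟩
  rwa [comap_id] at this

end FrameSys

/-! ### The degree modulo `2` of frames on the boundary of a triangle -/

namespace FrameSys

theorem exists_edge_section {G : FrameSys (Simp 1)} {a : Simp 1 → ℂˣ} (h : (G * G).IsSection a) :
    ∃ ρ, G.IsSection ρ ∧ ρ * ρ = a := by
  obtain ⟨ρ, hρ⟩ := trivAlong_simp_one.exists_section G
  obtain ⟨p, hp, hpa⟩ := exists_continuous_sqrt ((hρ.mul hρ).continuous_div h)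
  refine ⟨ρ * p, hρ.mul_continuous hp, ?_⟩
  rw [mul_mul_mul_comm, hpa]
  exact funext fun t => mul_div_cancel _ _

/-- Divide a section by the exponential of the linear interpolation of logarithms of its end values.
-/
theorem exists_section_ends (G : FrameSys (Simp 1)) :
    ∃ ρ, G.IsSection ρ ∧ ρ v0 = 1 ∧ ρ v1 = 1 := by
  obtain ⟨ρ, hρ⟩ := trivAlong_simp_one.exists_section G
  let c (t : Simp 1) : ℂ := ((t 0 : ℝ) : ℂ) * Complex.log (ρ v0) + ((t 1 : ℝ) : ℂ) * Complex.log (ρ v1)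
  have hc : Continuous c := by
    have h (i : Fin 2) : Continuous fun t : Simp 1 => ((t i : ℝ) : ℂ) :=
      Complex.continuous_ofReal.comp ((continuous_apply i).comp continuous_subtype_val)
    exact ((h 0).mul continuous_const).add ((h 1).mul continuous_const)
  let e (t : Simp 1) : ℂˣ := Units.mk0 (Complex.exp (c t)) (Complex.exp_ne_zero _)
  have he : Continuous e := by
    refine Units.continuous_iff.2 ⟨Complex.continuous_exp.comp hc, ?_⟩
    refine (Complex.continuous_exp.comp hc.neg).congr fun t => ?_
    simp [e, Complex.exp_neg]
  have e0 : e v0 = ρ v0 := Units.ext (by simp [e, c, Complex.exp_log])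
  have e1 : e v1 = ρ v1 := Units.ext (by simp [e, c, Complex.exp_log])
  refine ⟨ρ * e⁻¹, hρ.mul_continuous he.inv, ?_, ?_⟩
  · simp [e0]
  · simp [e1]

/-- `a` is the square of a section of `G` whose values at the end points have quotient `sgn b`. -/
def EdgeRel (G : FrameSys (Simp 1)) (a : Simp 1 → ℂˣ) (b : ZMod 2) : Prop :=
  ∃ ρ, G.IsSection ρ ∧ ρ * ρ = a ∧ ρ v0 * ρ v1 = sgn b

theorem exists_sgn_of_sq {T : Type*} {ρ ρ' : T → ℂˣ} (h : ρ' * ρ' = ρ * ρ) :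
    ∃ e : T → ZMod 2, ρ' = (fun t => sgn (e t)) * ρ := by
  choose e he using fun t => exists_sgn_mul (congrFun h t)
  exact ⟨e, funext he⟩

variable {G G' : FrameSys (Simp 1)} {a a' : Simp 1 → ℂˣ} {b b' : ZMod 2}

theorem sgn_mul_mul_sgn (e e' : ZMod 2) (z z' : ℂˣ) :
    sgn e * z * (sgn e' * z') = sgn (e + e') * (z * z') := by
  rw [mul_mul_mul_comm, sgn_add]

/-- Two sections of `G` with the same square differ by a continuous sign, which is constant on the
edge and cancels in the product of the end values. -/
theorem EdgeRel.unique (h : EdgeRel G a b) (h' : EdgeRel G a b') : b = b' := by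
  obtain ⟨ρ, hρ, hs, hv⟩ := h
  obtain ⟨ρ', hρ', hs', hv'⟩ := h'
  obtain ⟨e, rfl⟩ := exists_sgn_of_sq (hs'.trans hs.symm)
  have hc : Continuous fun t => sgn (e t) := (hρ.continuous_div hρ').congr fun t => by
    simp
  have he := eq_of_continuous_sgn hc v0 v1
  refine sgn_injective (hv.symm.trans (Eq.trans ?_ hv'))
  change _ = sgn (e v0) * ρ v0 * (sgn (e v1) * ρ v1)
  rw [sgn_mul_mul_sgn, he, zmod_two_add_self, sgn_zero, one_mul]

open Classical in
/-- The element `b` with `EdgeRel G a b`. -/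
def edgeSign (G : FrameSys (Simp 1)) (a : Simp 1 → ℂˣ) : ZMod 2 :=
  if h : ∃ b, EdgeRel G a b then h.choose else 0

theorem EdgeRel.edgeSign_eq (h : EdgeRel G a b) : edgeSign G a = b := by
  have h' : ∃ b, EdgeRel G a b := ⟨b, h⟩
  rw [edgeSign, dif_pos h']
  exact h'.choose_spec.unique h

theorem edgeRel_edgeSign (h : (G * G).IsSection a) (h0 : a v0 = 1) (h1 : a v1 = 1) :
    EdgeRel G a (edgeSign G a) := by
  obtain ⟨ρ, hρ, hs⟩ := exists_edge_section h
  have hv : ρ v0 * ρ v1 * (ρ v0 * ρ v1) = 1 := by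
    rw [mul_mul_mul_comm, ← Pi.mul_apply, ← Pi.mul_apply, hs, h0, h1, one_mul]
  obtain ⟨b, hb⟩ := exists_sgn hv
  have hr : EdgeRel G a b := ⟨ρ, hρ, hs, hb⟩
  rwa [hr.edgeSign_eq]

theorem EdgeRel.mul (h : EdgeRel G a b) (h' : EdgeRel G' a' b') :
    EdgeRel (G * G') (a * a') (b + b') := by
  obtain ⟨ρ, hρ, hs, hv⟩ := h
  obtain ⟨ρ', hρ', hs', hv'⟩ := h'
  refine ⟨ρ * ρ', hρ.mul hρ', by rw [mul_mul_mul_comm, hs, hs'], ?_⟩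
  rw [Pi.mul_apply, Pi.mul_apply, mul_mul_mul_comm, hv, hv', sgn_add]

variable {T : Type*} [TopologicalSpace T]

theorem comap_sgnTwist_eq {F F' : FrameSys T} (h : F * F = F' * F') {S : Type*} [TopologicalSpace S]
    (g : C(S, T)) (h' : F.comap g * F.comap g = F'.comap g * F'.comap g) :
    (F.sgnTwist F' h).comap g = (F.comap g).sgnTwist (F'.comap g) h' :=
  SignTwist.ext_le fun _ _ hs => comap_sgnTwist F F' h g h' hs

/-- The two roots of the frame differ by a section of the cover comparing `H` and `H'`; its end
values give the holonomy. -/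
theorem edgeSign_add_hol {H H' : FrameSys T} (h : H * H = H' * H') (γ : C(Simp 1, T))
    (ha : ((H * H).comap γ).IsSection a) (h0 : a v0 = 1) (h1 : a v1 = 1) :
    edgeSign (H'.comap γ) a = edgeSign (H.comap γ) a + (H.sgnTwist H' h).hol γ := by
  have ha' : ((H'.comap γ) * (H'.comap γ)).IsSection a := by rwa [← comap_mul, ← h]
  rw [comap_mul] at ha
  obtain ⟨ρ, hρ, hs, hv⟩ := edgeRel_edgeSign ha h0 h1
  obtain ⟨ρ', hρ', hs', hv'⟩ := edgeRel_edgeSign ha' h0 h1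
  obtain ⟨e, rfl⟩ := exists_sgn_of_sq (hs'.trans hs.symm)
  have hsq : H.comap γ * H.comap γ = H'.comap γ * H'.comap γ := by
    rw [← comap_mul, h, comap_mul]
  have he : ((H.sgnTwist H' h).comap γ).IsSection e := by
    rw [comap_sgnTwist_eq h γ hsq]
    exact fun t => (sgnTwist_adm_iff (hρ t)).2 (hρ' t)
  rw [SignTwist.hol_eq _ _ he]
  refine sgn_injective ?_
  rw [← hv', sgn_add, ← hv]
  change sgn (e v0) * ρ v0 * (sgn (e v1) * ρ v1) = _
  rw [sgn_mul_mul_sgn, mul_comm]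

/-- Frames over all paths, equal to the reference frame at end points. -/
def IsEdgeFrame (F : FrameSys T) (A : C(Simp 1, T) → Simp 1 → ℂˣ) : Prop :=
  ∀ s, (F.comap s).IsSection (A s) ∧ A s v0 = 1 ∧ A s v1 = 1

theorem exists_isEdgeFrame (F : FrameSys T) : ∃ A, F.IsEdgeFrame A := by
  choose A hA using fun s : C(Simp 1, T) => exists_section_ends (F.comap s)
  exact ⟨A, hA⟩

variable {S : Type*} [TopologicalSpace S] {F F' : FrameSys T} {A A' : C(Simp 1, T) → Simp 1 → ℂˣ}

theorem IsEdgeFrame.comap (h : F.IsEdgeFrame A) (g : C(S, T)) :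
    (F.comap g).IsEdgeFrame fun s => A (g.comp s) := fun s => by
  rw [FrameSys.comap_comap]
  exact h _

theorem IsEdgeFrame.mul (h : F.IsEdgeFrame A) (h' : F'.IsEdgeFrame A') :
    (F * F').IsEdgeFrame (A * A') := fun s => by
  rw [comap_mul]
  exact ⟨(h s).1.mul (h' s).1, by simp [(h s).2.1, (h' s).2.1], by simp [(h s).2.2, (h' s).2.2]⟩

/-- The degree modulo `2` of the given frames on the boundary of a triangle. -/
def chernC (F : FrameSys T) (A : C(Simp 1, T) → Simp 1 → ℂˣ) (s : C(Simp 2, T)) : ZMod 2 :=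
  ∑ i : Fin 3, edgeSign ((exists_root_of_contractible (F.comap s)).choose.comap (faceMap i))
    (A (s.comp (faceMap i)))

/-- Another root over the triangle changes the edge signs by the holonomies of a double cover, whose
sum around the boundary is zero. -/
theorem IsEdgeFrame.chernC_eq (hA : F.IsEdgeFrame A) {s : C(Simp 2, T)} {G : FrameSys (Simp 2)}
    (hG : G * G = F.comap s) : F.chernC A s =
      ∑ i : Fin 3, edgeSign (G.comap (faceMap i)) (A (s.comp (faceMap i))) := by
  have h0 := (exists_root_of_contractible (F.comap s)).choose_spec
  set G₀ := (exists_root_of_contractible (F.comap s)).choose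
  have hs : G₀ * G₀ = G * G := h0.trans hG.symm
  have hi (i : Fin 3) := edgeSign_add_hol hs (faceMap i) (a := A (s.comp (faceMap i)))
    (by rw [h0, FrameSys.comap_comap]; exact (hA _).1) (hA _).2.1 (hA _).2.2
  simp only [hi, Finset.sum_add_distrib]
  have hf := (G₀.sgnTwist G hs).flatOn_hol Set.univ (.id _) fun _ => trivial
  have hf' : ∑ i : Fin 3, (G₀.sgnTwist G hs).hol (faceMap i) = 0 := hf
  rw [hf', add_zero]
  rfl

/-- The invariant of a square root over a path, relative to given frames. -/
def pathSign (G : FrameSys S) (A : C(Simp 1, S) → Simp 1 → ℂˣ) (γ : C(Simp 1, S)) : ZMod 2 :=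
  edgeSign (G.comap γ) (A γ)

theorem IsEdgeFrame.chernC_comap (hA : F.IsEdgeFrame A) (g : C(S, T)) (τ : C(Simp 2, S)) :
    (F.comap g).chernC (fun s => A (g.comp s)) τ = F.chernC A (g.comp τ) := by
  obtain ⟨G, hG⟩ := exists_root_of_contractible ((F.comap g).comap τ)
  rw [(hA.comap g).chernC_eq hG, hA.chernC_eq (by rw [hG, FrameSys.comap_comap])]
  rfl

/-- A global root makes the cochain a coboundary. This is the easy direction of the obstruction
theory, also used over simplices for the cocycle property. -/
theorem IsEdgeFrame.chernC_of_root (hA : F.IsEdgeFrame A) {G : FrameSys T} (hG : G * G = F)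
    (τ : C(Simp 2, T)) : F.chernC A τ = ∑ i : Fin 3, G.pathSign A (τ.comp (faceMap i)) := by
  rw [hA.chernC_eq (G := G.comap τ) (by rw [← comap_mul, hG])]
  simp only [FrameSys.comap_comap, pathSign]

theorem IsEdgeFrame.chernC_mul (hA : F.IsEdgeFrame A) (hA' : F'.IsEdgeFrame A')
    (s : C(Simp 2, T)) : (F * F').chernC (A * A') s = F.chernC A s + F'.chernC A' s := by
  obtain ⟨G, hG⟩ := exists_root_of_contractible (F.comap s)
  obtain ⟨G', hG'⟩ := exists_root_of_contractible (F'.comap s)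
  have hGG : G * G' * (G * G') = (F * F').comap s := by
    rw [mul_mul_mul_comm, hG, hG', comap_mul]
  rw [(hA.mul hA').chernC_eq hGG, hA.chernC_eq hG, hA'.chernC_eq hG', ← Finset.sum_add_distrib]
  refine Finset.sum_congr rfl fun i _ => ?_
  have key {H H' : FrameSys T} {D : C(Simp 1, T) → Simp 1 → ℂˣ} (hD : H.IsEdgeFrame D)
      {K : FrameSys (Simp 2)} (hK : K * K = H.comap s) :
      EdgeRel (K.comap (faceMap i)) (D (s.comp (faceMap i)))
        (edgeSign (K.comap (faceMap i)) (D (s.comp (faceMap i)))) := by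
    refine edgeRel_edgeSign ?_ (hD _).2.1 (hD _).2.2
    rw [← comap_mul, hK, FrameSys.comap_comap]
    exact (hD _).1
  rw [comap_mul]
  exact ((key (H' := F) hA hG).mul (key (H' := F) hA' hG')).edgeSign_eq

end FrameSys

/-! ### The cohomology class -/

section Homology

open FrameSys

variable {B : Type u} [TopologicalSpace B] {T : Type u} [TopologicalSpace T]

theorem dmap_dmap (n : ℕ) (z : (chains (ZMod 2) B).X (n + 2)) :
    dmap (ZMod 2) B (n + 1) n (dmap (ZMod 2) B (n + 2) (n + 1) z) = 0 :=
  ConcreteCategory.congr_hom ((chains (ZMod 2) B).d_comp_d (n + 2) (n + 1) n) z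

/-- The linear extension of `chernC`. -/
def chernL (F : FrameSys B) (A : C(Simp 1, B) → Simp 1 → ℂˣ) :
    (chains (ZMod 2) B).X 2 →ₗ[ZMod 2] ULift.{u} (ZMod 2) :=
  chainLift (ZMod 2) fun s => ULift.up (F.chernC A s)

variable {F F' : FrameSys B} {A A' : C(Simp 1, B) → Simp 1 → ℂˣ}

theorem chernL_cmap (hA : F.IsEdgeFrame A) (g : C(T, B)) :
    chernL F A ∘ₗ cmap (ZMod 2) 2 g = chernL (F.comap g) fun s => A (g.comp s) :=
  chain_ext _ fun s => by
    rw [LinearMap.comp_apply, cmap_simplex, chernL, chernL, chainLift_simplex, chainLift_simplex,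
      hA.chernC_comap]

theorem chernL_of_root (hA : F.IsEdgeFrame A) {G : FrameSys B} (hG : G * G = F) :
    chernL F A = chainLift (ZMod 2) (fun s => ULift.up (G.pathSign A s)) ∘ₗ dmap (ZMod 2) B 2 1 :=
  chain_ext _ fun s => by
    rw [LinearMap.comp_apply, chernL, chainLift_simplex]
    refine ULift.ext _ _ ?_
    rw [chainLift_d, hA.chernC_of_root hG]

/-- Pulled back to the contractible 3-simplex, the bundle has a root, so the cochain is a coboundary
there and kills boundaries. -/
theorem chernL_dmap (hA : F.IsEdgeFrame A) : chernL F A ∘ₗ dmap (ZMod 2) B 3 2 = 0 := by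
  refine chain_ext _ fun s => ?_
  -- The simplex is lifted to the universe of `B`, where its chain complex can be compared with that
  -- of `B`.
  let g : C(ULift.{u} (Simp 3), B) := s.comp ⟨ULift.down, by fun_prop⟩
  let t : C(Simp 3, ULift.{u} (Simp 3)) := ⟨ULift.up, by fun_prop⟩
  have : ContractibleSpace (ULift.{u} (Simp 3)) := Homeomorph.ulift.contractibleSpace
  obtain ⟨G, hG⟩ := exists_root_of_contractible (F.comap g)
  have e : simplex (ZMod 2) s = cmap (ZMod 2) 3 g (simplex (ZMod 2) t) := by
    rw [cmap_simplex]; rfl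
  rw [LinearMap.comp_apply, e, cmap_d, ← LinearMap.comp_apply, chernL_cmap hA g,
    chernL_of_root (hA.comap g) hG, LinearMap.comp_apply, dmap_dmap, map_zero, LinearMap.zero_apply]

/-- The class of `chernC` in `H^2`. -/
def chernH (F : FrameSys B) (A : C(Simp 1, B) → Simp 1 → ℂˣ) (hA : F.IsEdgeFrame A) :
    H (ZMod 2) B 2 →ₗ[ZMod 2] ZMod 2 :=
  ULift.moduleEquiv.toLinearMap ∘ₗ descH (M := ULift.{u} (ZMod 2))
    (chernL F A ∘ₗ (cycles (ZMod 2) B 2).subtype) (by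
      rintro z ⟨y, hy⟩
      change chernL F A z.1 = 0
      rw [← hy]
      exact LinearMap.congr_fun (chernL_dmap hA) y)

theorem chernH_toH (hA : F.IsEdgeFrame A) (z : cycles (ZMod 2) B 2) :
    chernH F A hA (toH (ZMod 2) 2 z) = (chernL F A z.1).down := by
  simp [chernH, descH_toH]

theorem chernH_comap (hA : F.IsEdgeFrame A) (g : C(T, B)) :
    chernH F A hA ∘ₗ hmap (ZMod 2) 2 g = chernH (F.comap g) _ (hA.comap g) := by
  ext c
  obtain ⟨z, rfl⟩ := toH_surjective _ 2 c
  rw [LinearMap.comp_apply, hmap_toH, chernH_toH, chernH_toH, ← chernL_cmap hA]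
  rfl

theorem chernH_mul (hA : F.IsEdgeFrame A) (hA' : F'.IsEdgeFrame A') :
    chernH (F * F') _ (hA.mul hA') = chernH F A hA + chernH F' A' hA' := by
  have h : chernL (F * F') (A * A') = chernL F A + chernL F' A' := chain_ext _ fun s => by
    rw [LinearMap.add_apply, chernL, chernL, chernL, chainLift_simplex, chainLift_simplex,
      chainLift_simplex, hA.chernC_mul hA']
    rfl
  ext c
  obtain ⟨z, rfl⟩ := toH_surjective _ 2 c
  rw [LinearMap.add_apply, chernH_toH, chernH_toH, chernH_toH, h]
  rfl

theorem chernH_of_root (hA : F.IsEdgeFrame A) {G : FrameSys B} (hG : G * G = F) :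
    chernH F A hA = 0 := by
  ext c
  obtain ⟨z, rfl⟩ := toH_surjective _ 2 c
  rw [chernH_toH, chernL_of_root hA hG, LinearMap.comp_apply,
    show dmap (ZMod 2) B 2 1 z.1 = 0 from z.2, map_zero]
  rfl

end Homology

open FrameSys

/-! ### Existence of square roots -/

/-- Factor through the range of `d` and extend from this subspace. With `d` the boundary, a
functional that vanishes on cycles is a coboundary. -/
theorem LinearMap.exists_eq_comp_of_ker_le {k V W M : Type*} [Field k] [AddCommGroup V]
    [AddCommGroup W] [AddCommGroup M] [Module k V] [Module k W] [Module k M] (d : V →ₗ[k] W)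
    (L : V →ₗ[k] M) (h : LinearMap.ker d ≤ LinearMap.ker L) : ∃ β : W →ₗ[k] M, L = β ∘ₗ d := by
  obtain ⟨β, hβ⟩ := LinearMap.exists_extend
    ((LinearMap.ker d).liftQ L h ∘ₗ d.quotKerEquivRange.symm.toLinearMap)
  refine ⟨β, LinearMap.ext fun x => ?_⟩
  have := LinearMap.congr_fun hβ ⟨d x, LinearMap.mem_range_self d x⟩
  refine Eq.symm (this.trans ?_)
  rw [LinearMap.comp_apply, LinearEquiv.coe_coe, LinearMap.quotKerEquivRange_symm_apply_image,
    Submodule.mkQ_apply, Submodule.liftQ_apply]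

theorem FrameSys.ofFun_comap {B T : Type*} [TopologicalSpace B] [TopologicalSpace T] (ρ : B → ℂˣ)
    (g : C(T, B)) : (ofFun ρ).comap g = ofFun (ρ ∘ g) :=
  (ofFun_eq ((isSection_ofFun ρ).comap g)).symm

/-- Passing from the local root `r` to `r'` multiplies the section over the edge by the sign `s`, so
only the end values of `s` enter. -/
theorem FrameSys.edgeSign_of_cmp {B : Type*} [TopologicalSpace B] {r r' : B → ℂˣ} {s : B → ZMod 2}
    {γ : C(Simp 1, B)} (h : ∀ t, Cmp ((fun y => sgn (s y)) * r) r' (γ t)) {a : Simp 1 → ℂˣ}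
    (ha : (ofFun ((r * r) ∘ γ)).IsSection a) (h0 : a v0 = 1) (h1 : a v1 = 1) :
    edgeSign ((ofFun r').comap γ) a = edgeSign ((ofFun r).comap γ) a + (s (γ v0) + s (γ v1)) := by
  have ha' : ((ofFun r).comap γ * (ofFun r).comap γ).IsSection a := by
    rwa [ofFun_comap, ofFun_mul]
  obtain ⟨ρ, hρ, hs, hv⟩ := edgeRel_edgeSign ha' h0 h1
  refine EdgeRel.edgeSign_eq ⟨(fun t => sgn (s (γ t))) * ρ, fun t => ?_, ?_, ?_⟩
  · obtain ⟨ρ₀, h₁, h₂⟩ := hρ t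
    have h₁' : Cmp ρ₀ r (γ t) := h₁
    exact ⟨(fun y => sgn (s y)) * ρ₀, (Cmp.refl.mul h₁').trans (h t), Cmp.refl.mul h₂⟩
  · rw [← hs]
    funext t
    simp only [Pi.mul_apply]
    rw [mul_mul_mul_comm, sgn_mul_self, one_mul]
  · simp only [Pi.mul_apply]
    rw [sgn_mul_mul_sgn, hv, sgn_add (edgeSign _ _), mul_comm]

/-- If the class vanishes, the Chern cochain is the coboundary of some `b`. Local roots `r z` have
edge signs with the same coboundary, so these plus `b` are flat and have local potentials.
Correcting the signs of `r z` by the potentials makes them comparable on overlaps, and they glue to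
a global root. -/
theorem exists_root_of_locallyFlat {Z : Type u} [TopologicalSpace Z] [LocallyPathConnectedSpace Z]
    (hZ : LocallyFlat Z) {F : FrameSys Z} {A : C(Simp 1, Z) → Simp 1 → ℂˣ} (hA : F.IsEdgeFrame A)
    (h0 : chernH F A hA = 0) : ∃ G, G * G = F := by
  have hker : LinearMap.ker (dmap (ZMod 2) Z 2 1) ≤ LinearMap.ker (chernL F A) := by
    intro z hz
    have h := chernH_toH hA ⟨z, hz⟩
    rw [h0] at h
    exact ULift.ext _ _ h.symm
  obtain ⟨β, hβ⟩ := LinearMap.exists_eq_comp_of_ker_le _ _ hker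
  let b (s : C(Simp 1, Z)) : ZMod 2 := (β (simplex (ZMod 2) s)).down
  have hb : β = chainLift (ZMod 2) fun s => ULift.up (b s) :=
    chain_ext _ fun s => by rw [chainLift_simplex]
  have hbc (τ : C(Simp 2, Z)) : F.chernC A τ = ∑ i : Fin 3, b (τ.comp (faceMap i)) := by
    have h := LinearMap.congr_fun hβ (simplex (ZMod 2) τ)
    rw [hb, LinearMap.comp_apply, chernL, chainLift_simplex] at h
    rw [← chainLift_d, ← h]
  choose ρ U hU hzU hρ using F.exists_open_adm
  choose q hq using exists_sqrt
  let r (z y : Z) : ℂˣ := q (ρ z y)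
  have hrr (z : Z) : r z * r z = ρ z := funext fun y => hq _
  have hsec (z : Z) {T : Type} [TopologicalSpace T] (g : C(T, Z)) (hg : ∀ t, g t ∈ U z) :
      ofFun ((r z * r z) ∘ g) = F.comap g := by
    rw [hrr]
    exact ofFun_eq fun t => adm_comap g (hρ z _ (hg t))
  have hflat (z : Z) : FlatOn (fun s => (ofFun (r z)).pathSign A s + b s) (U z) := by
    intro τ hτ
    rw [Finset.sum_add_distrib, ← hbc, hA.chernC_eq (s := τ) (G := (ofFun (r z)).comap τ)
      (by rw [ofFun_comap, ofFun_mul, ← hsec z τ hτ]; rfl)]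
    simp only [pathSign, FrameSys.comap_comap]
    exact zmod_two_add_self _
  choose V hV hzV hVU hpot using fun z => hZ z (U z) (hU z) (hzU z)
  choose ε hε using fun z => hpot z _ (hflat z)
  let W (z y : Z) : ℂˣ := sgn (ε z y) * r z y
  have hWW (z : Z) : W z * W z = ρ z := by
    rw [← hrr]
    funext y
    simp only [W, Pi.mul_apply]
    rw [mul_mul_mul_comm, sgn_mul_self, one_mul]
  -- On the overlap the two local roots differ by a sign `s`. Along a short path its increment is
  -- the difference of edge signs, hence the difference of the increments of the potentials; so the
  -- corrected sign is locally constant.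
  have key (z y : Z) (hy : y ∈ V z) : Cmp (W z) (W y) y := by
    have hcmp : ∀ᶠ y' in 𝓝 y, Cmp (r z * r z) (r y * r y) y' := by
      filter_upwards [(hU z).mem_nhds (hVU z hy), (hU y).mem_nhds (hzU y)] with y' h1 h2
      rw [hrr, hrr]
      exact F.adm_cmp (hρ y y' h2) (hρ z y' h1)
    obtain ⟨s, hs⟩ := exists_cmp_of_sq hcmp
    obtain ⟨N, ⟨hN, hNc⟩, hNs⟩ := (LocallyPathConnectedSpace.path_connected_basis y).mem_iff.1
      (Filter.inter_mem hs (((hV z).inter (hV y)).mem_nhds ⟨hy, hzV y⟩))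
    have hc : ContinuousAt (fun y' => sgn (ε z y + ε y y + s y) *
        (((fun y => sgn (s y)) * r z) y' / r y y')) y :=
      continuousAt_const.mul hs.self_of_nhds
    refine ContinuousAt.congr hc ?_
    filter_upwards [hN] with y' hy'
    obtain ⟨p, hp⟩ := hNc.joinedIn y (mem_of_mem_nhds hN) y' hy'
    have e1 := hε z (onSimp p) fun t => (hNs (hp _)).2.1
    have e2 := hε y (onSimp p) fun t => (hNs (hp _)).2.2
    have e3 : (ofFun (r y)).pathSign A (onSimp p) = (ofFun (r z)).pathSign A (onSimp p) + _ :=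
      edgeSign_of_cmp (γ := onSimp p) (fun t => (hNs (hp _)).1)
        (by rw [hsec z (onSimp p) fun t => hVU z (hNs (hp _)).2.1]; exact (hA _).1) (hA _).2.1 (hA _).2.2
    rw [onSimp_v0, onSimp_v1] at e1 e2 e3
    have e4 : ε z y + ε y y + s y = ε z y' + ε y y' + s y' := by
      rw [e3] at e2
      revert e1 e2
      generalize (ofFun (r z)).pathSign A (onSimp p) = a₁
      generalize b (onSimp p) = a₂
      generalize ε z y = a₃
      generalize ε y y = a₄
      generalize ε z y' = a₅
      generalize ε y y' = a₆
      generalize s y = a₇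
      generalize s y' = a₈
      revert a₁ a₂ a₃ a₄ a₅ a₆ a₇ a₈
      decide
    rw [e4, sgn_add, sgn_add]
    simp only [W, Pi.mul_apply]
    rw [mul_div_mul_comm, div_eq_mul_inv (sgn _), sgn_inv]
    calc _ = (sgn (s y') * sgn (s y')) * (sgn (ε z y') * sgn (ε y y') *
          (r z y' / r y y')) := by rw [mul_div_assoc]; ac_rfl
      _ = _ := by rw [sgn_mul_self, one_mul]
  refine ⟨ofLocal W fun z => ?_, mul_ext_self W (fun z => Cmp.refl) fun z => ?_⟩
  · filter_upwards [(hV z).mem_nhds (hzV z)] with y hy using key z y hy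
  · rw [hWW]
    exact hρ z z (hzU z)

theorem exists_root_of_chernH {B : Type u} [TopologicalSpace B] (hB : HasCWType B) {F : FrameSys B}
    {A : C(Simp 1, B) → Simp 1 → ℂˣ} (hA : F.IsEdgeFrame A) (h0 : chernH F A hA = 0) :
    ∃ G, G * G = F := by
  obtain ⟨Z, _, _, hZ, ⟨e⟩⟩ := hB.exists_locallyFlat
  refine exists_root_of_homotopyEquiv e F
    (exists_root_of_locallyFlat hZ (hA.comap e.invFun) ?_)
  rw [← chernH_comap hA, h0, LinearMap.zero_comp]

open FrameSys

/-! ### Chern classes and square roots -/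

/-- The boundary of the triangle. -/
def triangleBdry : Set (Simp 2) := ⋃ i : Fin 3, Set.range (faceMap (n := 1) i)

theorem faceMap_two_injective (i : Fin 3) : Function.Injective (faceMap (n := 1) i) := by
  intro t t' h
  have h0 (j : Fin 3) : faceMap i t j = faceMap i t' j := by rw [h]
  have e := faceMap_two_apply t
  have e' := faceMap_two_apply t'
  refine Subtype.ext (funext fun j => ?_)
  change t j = t' j
  fin_cases i <;> fin_cases j
  · exact e.1.2.1.symm.trans ((h0 1).trans e'.1.2.1)
  · exact e.1.2.2.symm.trans ((h0 2).trans e'.1.2.2)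
  · exact e.2.1.1.symm.trans ((h0 0).trans e'.2.1.1)
  · exact e.2.1.2.2.symm.trans ((h0 2).trans e'.2.1.2.2)
  · exact e.2.2.1.symm.trans ((h0 0).trans e'.2.2.1)
  · exact e.2.2.2.1.symm.trans ((h0 1).trans e'.2.2.2.1)

theorem faceMap_two_self (i : Fin 3) (t : Simp 1) : faceMap i t i = 0 := by
  fin_cases i
  · exact (faceMap_two_apply t).1.1
  · exact (faceMap_two_apply t).2.1.2.1
  · exact (faceMap_two_apply t).2.2.2.2

theorem eq_vertex_of_apply {n : ℕ} {x : Simp n} {l : Fin (n + 1)} (h : ∀ j, j ≠ l → x j = 0) :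
    x = stdSimplex.vertex l := by
  have h1 : x l = 1 := by
    rw [← stdSimplex.sum_eq_one x]
    exact (Finset.sum_eq_single l (fun j _ hj => h j hj) (by simp)).symm
  refine Subtype.ext (funext fun j => ?_)
  change x j = (stdSimplex.vertex l : Simp n) j
  by_cases hj : j = l
  · subst hj
    simp [h1]
  · simp [h j hj, hj]

/-- A point on two faces has two vanishing barycentric coordinates, so it is the remaining vertex.
-/
theorem exists_vertex_of_faceMap_eq {i j : Fin 3} (hij : i ≠ j) {t t' : Simp 1}
    (h : faceMap i t = faceMap j t') : ∃ a b, t = stdSimplex.vertex a ∧ t' = stdSimplex.vertex b ∧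
      i.succAbove a = j.succAbove b := by
  obtain ⟨l, hl⟩ : ∃ l, ∀ m, m ≠ l → m = i ∨ m = j := by
    clear h; revert i j; decide
  have hx : faceMap i t = stdSimplex.vertex l := eq_vertex_of_apply fun m hm => by
    rcases hl m hm with rfl | rfl
    · exact faceMap_two_self m t
    · rw [h]; exact faceMap_two_self m t'
  have hne (x : Simp 1) (m : Fin 3) (hm : faceMap m x = stdSimplex.vertex l) : m ≠ l := by
    rintro rfl
    have := faceMap_two_self m x
    rw [hm] at this
    simp at this
  obtain ⟨a, ha⟩ := Fin.exists_succAbove_eq (hne t i hx).symm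
  obtain ⟨b, hb⟩ := Fin.exists_succAbove_eq (hne t' j (h ▸ hx)).symm
  refine ⟨a, b, faceMap_two_injective i ?_, faceMap_two_injective j ?_, ha.trans hb.symm⟩
  · rw [hx, simplexMap_vertex, ha]
  · rw [← h, hx, simplexMap_vertex, hb]

/-- Distinct edges meet only in vertices, where the prescribed values agree; the boundary is a
finite union of closed embedded edges. -/
theorem exists_glue_faces {M : Type*} [TopologicalSpace M] [Nonempty M] (m : Fin 3 → Simp 1 → M)
    (hm : ∀ i, Continuous (m i)) (q : Fin 3 → M)
    (hq : ∀ i a, m i (stdSimplex.vertex a) = q (i.succAbove a)) :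
    ∃ g : Simp 2 → M, ContinuousOn g triangleBdry ∧ ∀ i t, g (faceMap i t) = m i t := by
  classical
  let g (x : Simp 2) : M :=
    if h : ∃ i t, faceMap (n := 1) i t = x then m h.choose h.choose_spec.choose
    else Classical.arbitrary M
  have hg (i t) : g (faceMap i t) = m i t := by
    have h : ∃ j t', faceMap (n := 1) j t' = faceMap i t := ⟨i, t, rfl⟩
    have e : g (faceMap i t) = m h.choose h.choose_spec.choose := dif_pos h
    rw [e]
    have hs := h.choose_spec.choose_spec
    revert hs
    generalize h.choose_spec.choose = t'
    generalize h.choose = j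
    intro hs
    by_cases hij : j = i
    · subst hij
      rw [faceMap_two_injective _ hs]
    · obtain ⟨a, b, rfl, rfl, hab⟩ := exists_vertex_of_faceMap_eq hij hs
      rw [hq, hq, hab]
  refine ⟨g, ?_, hg⟩
  have hemb (i : Fin 3) : IsClosedEmbedding (faceMap (n := 1) i) :=
    (faceMap i).continuous.isClosedEmbedding (faceMap_two_injective i)
  refine (locallyFinite_of_finite _).continuousOn_iUnion (fun i => (hemb i).isClosed_range)
    fun i => ?_
  rw [continuousOn_iff_continuous_domRestrict]
  refine ((hm i).comp (hemb i).isEmbedding.toHomeomorph.symm.continuous).congr fun x => ?_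
  obtain ⟨t, rfl⟩ := (hemb i).isEmbedding.toHomeomorph.surjective x
  rw [Function.comp_apply, Homeomorph.symm_apply_apply]
  exact (hg i t).symm

variable {T : Type*} [TopologicalSpace T] {F : FrameSys T} {A : C(Simp 1, T) → Simp 1 → ℂˣ}

theorem FrameSys.IsEdgeFrame.vertex (hA : F.IsEdgeFrame A) (γ : C(Simp 1, T)) (a : Fin 2) :
    A γ (stdSimplex.vertex a) = 1 := by
  fin_cases a
  · exact (hA γ).2.1
  · exact (hA γ).2.2

/-- Over each edge the comparison function has a root. The roots can be made to agree at the
vertices by signs exactly when the three edge signs have sum zero. -/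
theorem FrameSys.IsEdgeFrame.chernC_eq_zero_iff (hA : F.IsEdgeFrame A) (s : C(Simp 2, T)) :
    F.chernC A s = 0 ↔ ∃ R, (F.comap s).IsSection R ∧ ∃ g : Simp 2 → ℂˣ,
      ContinuousOn g triangleBdry ∧
        ∀ i t, A (s.comp (faceMap i)) t = g (faceMap i t) * g (faceMap i t) * R (faceMap i t) := by
  obtain ⟨G, hG⟩ := exists_root_of_contractible (F.comap s)
  obtain ⟨r, hr⟩ := trivAlong_simp_two.exists_section G
  rw [hA.chernC_eq hG]
  constructor
  · intro h0
    have hE (i : Fin 3) := edgeRel_edgeSign (G := G.comap (faceMap i))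
      (a := A (s.comp (faceMap i)))
      (by rw [← comap_mul, hG, FrameSys.comap_comap]; exact (hA _).1) (hA _).2.1 (hA _).2.2
    choose ρ hρ hs hv using hE
    obtain ⟨b, hb⟩ : ∃ b : Fin 3 → ZMod 2, ∀ i : Fin 3,
      edgeSign (G.comap (faceMap i)) (A (s.comp (faceMap i))) = b i := ⟨_, fun _ => rfl⟩
    simp only [hb] at hv h0
    have hsq (i t) : ρ i t * ρ i t = A (s.comp (faceMap i)) t := congrFun (hs i) t
    choose a ha using fun i => exists_sgn ((hsq i v0).trans (hA.vertex _ 0))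
    have ha' (i) : ρ i v1 = sgn (a i + b i) := by
      rw [sgn_add, ← hv, ← ha, ← mul_assoc, ha, sgn_mul_self, one_mul]
    -- Vertex signs: `0` at the first vertex, then the signs of the edges joining it to the others,
    -- which are faces `2` and `1`. The condition on the remaining edge is the vanishing of the sum.
    let p : Fin 3 → ZMod 2 := ![0, b 2, b 1]
    have hb0 : b 0 = b 1 + b 2 := by
      rw [Fin.sum_univ_three] at h0
      revert h0
      generalize b 0 = x
      generalize b 1 = y
      generalize b 2 = z
      revert x y z
      decide
    have hp (i : Fin 3) : p (i.succAbove 0) + b i = p (i.succAbove 1) := by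
      have e (x y : ZMod 2) : x + (y + x) = y := by revert x y; decide
      fin_cases i
      · change b 2 + b 0 = b 1
        rw [hb0, e]
      · exact zero_add _
      · exact zero_add _
    have key (i : Fin 3) (j : Fin 2) :
        sgn (a i + p (i.succAbove 0)) * ρ i (stdSimplex.vertex j) = sgn (p (i.succAbove j)) := by
      fin_cases j
      · change _ * ρ i v0 = _
        rw [ha, ← sgn_add, add_right_comm, zmod_two_add_self, zero_add]
        rfl
      · change _ * ρ i v1 = _
        rw [ha', ← sgn_add, add_add_add_comm, zmod_two_add_self, zero_add, hp]
        rfl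
    obtain ⟨g, hg, hgm⟩ := exists_glue_faces
      (fun i t => sgn (a i + p (i.succAbove 0)) * (ρ i t / r (faceMap i t)))
      (fun i => continuous_const.mul ((hr.comap (faceMap i)).continuous_div (hρ i)))
      (fun j => sgn (p j) / r (stdSimplex.vertex j)) fun i j => by
        rw [simplexMap_vertex, ← mul_div_assoc, key]
    refine ⟨r * r, hG ▸ hr.mul hr, g, hg, fun i t => ?_⟩
    rw [hgm, mul_mul_mul_comm, sgn_mul_self, one_mul, Pi.mul_apply, div_mul_div_comm,
      div_mul_cancel, hsq]
  · rintro ⟨R, hR, g, hg, hAg⟩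
    -- Over the simplex the frame `R` is itself the square of a section of `G`. Multiplied by `g`,
    -- that section gives roots over all edges with common vertex values, each of which is counted
    -- twice.
    obtain ⟨p, hp, hpq⟩ := exists_continuous_sqrt ((hr.mul hr).continuous_div (hG ▸ hR))
    have hr' := hr.mul_continuous hp
    have hrR : (r * p) * (r * p) = R := by
      rw [mul_mul_mul_comm, hpq]
      exact funext fun t => mul_div_cancel _ _
    have hZ (i t) : (g (faceMap i t) * (r * p) (faceMap i t)) *
        (g (faceMap i t) * (r * p) (faceMap i t)) = A (s.comp (faceMap i)) t := by
      rw [hAg, mul_mul_mul_comm]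
      exact congrArg _ (congrFun hrR _)
    have hz (j : Fin 3) : ∃ z, g (stdSimplex.vertex j) * (r * p) (stdSimplex.vertex j) = sgn z := by
      obtain ⟨i, a, rfl⟩ : ∃ (i : Fin 3) (a : Fin 2), i.succAbove a = j := by
        revert j; decide
      rw [← simplexMap_vertex]
      exact exists_sgn ((hZ i _).trans (hA.vertex _ a))
    choose z hz using hz
    have hE (i : Fin 3) : edgeSign (G.comap (faceMap i)) (A (s.comp (faceMap i))) =
        z (i.succAbove 0) + z (i.succAbove 1) := by
      refine EdgeRel.edgeSign_eq ⟨(g ∘ faceMap i) * ((r * p) ∘ faceMap i), ?_, funext (hZ i), ?_⟩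
      · rw [mul_comm]
        refine (hr'.comap (faceMap i)).mul_continuous ?_
        exact hg.comp_continuous (faceMap i).continuous fun t =>
          Set.mem_iUnion.2 ⟨i, t, rfl⟩
      · simp only [Pi.mul_apply, Function.comp_apply] at hz ⊢
        rw [simplexMap_vertex, simplexMap_vertex, hz, hz, sgn_add]
    simp only [hE, Fin.sum_univ_three]
    have e (a b c : ZMod 2) : (b + c) + (a + c) + (a + b) = 0 := by revert a b c; decide
    exact e _ _ _

/-! ### Frames over simplices and the mod 2 Chern class -/

variable {B : Type u} [TopologicalSpace B] {K : LineBundle.{u, v} B}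

theorem exists_simplexFrame (k : K.Ref) {n : ℕ} {s : C(Simp n, B)} (e : SimplexFrame K s) :
    ∃ R : Simp n → ℂˣ, (k.frames.comap s).IsSection R ∧
      ∀ t, e.toFun t = (R t : ℂ) • k.val (s t) := by
  choose R hR using fun t => k.exists_unit (e.ne_zero t)
  refine ⟨R, fun t => LineBundle.Ref.comap_frames_adm.2 ?_, hR⟩
  simp only [← hR]
  exact e.continuous.continuousAt

/-- The frame with given coordinates. -/
def simplexFrame (k : K.Ref) {n : ℕ} {s : C(Simp n, B)} {R : Simp n → ℂˣ}
    (hR : (k.frames.comap s).IsSection R) : SimplexFrame K s where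
  toFun t := (R t : ℂ) • k.val (s t)
  continuous := continuous_iff_continuousAt.2 fun t => LineBundle.Ref.comap_frames_adm.1 (hR t)
  ne_zero t := smul_ne_zero (R t).ne_zero (k.ne _)

theorem chernC_eq_zero_iff_simplexFrame {k : K.Ref} {A : C(Simp 1, B) → Simp 1 → ℂˣ}
    (hA : k.frames.IsEdgeFrame A) {e : ∀ s : C(Simp 1, B), SimplexFrame K s}
    (he : ∀ s t, (e s).toFun t = (A s t : ℂ) • k.val (s t)) (s : C(Simp 2, B)) :
    k.frames.chernC A s = 0 ↔ ∃ (e' : SimplexFrame K s) (g : Simp 2 → ℂ),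
      ContinuousOn g triangleBdry ∧ ∀ (i : Fin 3) (t : Simp 1),
        (e (s.comp (faceMap i))).toFun t = g (faceMap i t) ^ 2 • e'.toFun (faceMap i t) := by
  classical
  rw [hA.chernC_eq_zero_iff]
  constructor
  · rintro ⟨R, hR, g, hg, h⟩
    refine ⟨simplexFrame k hR, fun x => g x, Units.continuous_val.comp_continuousOn hg, ?_⟩
    intro i t
    refine (he _ _).trans ?_
    rw [h]
    change _ = _ • ((R _ : ℂ) • k.val _)
    rw [smul_smul, sq]
    rfl
  · rintro ⟨e', g, hg, h⟩
    obtain ⟨R, hR, hR'⟩ := exists_simplexFrame k e'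
    have hne (i : Fin 3) (t : Simp 1) : g (faceMap i t) ≠ 0 := by
      intro h0
      refine (e (s.comp (faceMap i))).ne_zero t ?_
      rw [h, h0]
      simp
    have hne' (x) (hx : x ∈ triangleBdry) : g x ≠ 0 := by
      obtain ⟨i, t, rfl⟩ := Set.mem_iUnion.1 hx
      exact hne i t
    -- The given `g` may vanish in the interior; the value `1` there is harmless, since only the
    -- boundary is used.
    let g' (x : Simp 2) : ℂˣ := if hx : g x = 0 then 1 else Units.mk0 (g x) hx
    have hg' (x) (hx : g x ≠ 0) : (g' x : ℂ) = g x := by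
      simp [g', hx]
    refine ⟨R, hR, g', ?_, fun i t => Units.ext ?_⟩
    · rw [Units.isEmbedding_val₀.isInducing.continuousOn_iff]
      exact hg.congr fun x hx => hg' x (hne' x hx)
    · have h1 := (he _ _).symm.trans (h i t)
      rw [hR', smul_smul] at h1
      rw [Units.val_mul, Units.val_mul, hg' _ (hne i t), ← sq]
      exact smul_left_injective ℂ (k.ne (s (faceMap i t))) h1

/-- Squares of sections of the root with value `1` at both ends are frames all of whose edge signs
are zero. -/
theorem isMod2Chern_of_root {k : K.Ref} {G : FrameSys B} (hG : G * G = k.frames) :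
    IsMod2Chern K 0 := by
  choose ρ hρ h0 h1 using fun s : C(Simp 1, B) => exists_section_ends (G.comap s)
  let A (s : C(Simp 1, B)) : Simp 1 → ℂˣ := ρ s * ρ s
  have hA : k.frames.IsEdgeFrame A := fun s => by
    refine ⟨?_, by simp [A, h0], by simp [A, h1]⟩
    rw [← hG, comap_mul]
    exact (hρ s).mul (hρ s)
  have hc (s : C(Simp 2, B)) : k.frames.chernC A s = 0 := by
    rw [hA.chernC_of_root hG]
    refine Finset.sum_eq_zero fun i _ => EdgeRel.edgeSign_eq ⟨_, hρ _, rfl, ?_⟩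
    rw [h0, h1, one_mul, sgn_zero]
  refine ⟨fun s => simplexFrame k (hA s).1, fun _ => 0, ?_, fun s => ?_, fun z => ?_⟩
  · intro s s' i i' h
    have e (s : C(Simp 1, B)) (i : Fin 2) : (simplexFrame k (hA s).1).toFun (stdSimplex.vertex i) =
        k.val (s (stdSimplex.vertex i)) := by
      change (A s _ : ℂ) • k.val _ = _
      rw [hA.vertex, Units.val_one, one_smul]
    rw [e, e, h]
  · exact iff_of_true rfl ((chernC_eq_zero_iff_simplexFrame hA
      (e := fun s => simplexFrame k (hA s).1) (fun _ _ => rfl) s).1 (hc s))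
  · have : chainLift (ZMod 2) (X := B) (n := 2) (fun _ => (ULift.up 0 : ULift.{u} (ZMod 2))) = 0 :=
      chain_ext _ fun s => by rw [chainLift_simplex]; rfl
    rw [this]
    rfl

/-- The frames over constant paths form a reference section; agreement at vertices means that every
frame has coordinate `1` at its ends. -/
theorem exists_root_of_isMod2Chern (hB : HasCWType B) (h : IsMod2Chern K 0) (k : K.Ref) :
    ∃ G, G * G = k.frames := by
  obtain ⟨e, c, hend, hc, hz⟩ := h
  let k₀ : K.Ref := ⟨fun b => (e (.const _ b)).toFun v0, fun b => (e (.const _ b)).ne_zero v0⟩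
  choose A hAs hA using fun s => exists_simplexFrame k₀ (e s)
  have hE : k₀.frames.IsEdgeFrame A := by
    intro s
    have hv (a : Fin 2) : A s (stdSimplex.vertex a) = 1 := by
      have h1 := hend s (.const _ (s (stdSimplex.vertex a))) a 0 rfl
      rw [hA] at h1
      refine LineBundle.Ref.eq_of_pt_eq k₀ (b' := s (stdSimplex.vertex a)) (h1.trans ?_)
      rw [Units.val_one, one_smul]
      rfl
    exact ⟨hAs s, hv 0, hv 1⟩
  have hcc (s : C(Simp 2, B)) : c s = k₀.frames.chernC A s :=
    zmod_two_eq_of_iff ((hc s).trans (chernC_eq_zero_iff_simplexFrame hE hA s).symm)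
  have h0 : chernH k₀.frames A hE = 0 := by
    ext x
    obtain ⟨z, rfl⟩ := toH_surjective _ 2 x
    rw [chernH_toH, chernL]
    have := hz z
    simp only [hcc] at this
    exact this.symm
  obtain ⟨G, hG⟩ := exists_root_of_chernH hB hE h0
  -- The root was found for the reference `k₀`; a pointwise root of the ratio transfers it to `k`.
  obtain ⟨d, rfl⟩ := k₀.exists_eq_scale k
  choose q hq using fun b => exists_sqrt (d b)
  refine ⟨G.scale q, ?_⟩
  rw [scale_mul_scale, hG, LineBundle.Ref.frames_scale]
  exact congrArg _ (funext hq)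

/-! ### Cross products with points -/

section Cross

variable (k : Type) [Field k] {X Y : Type u} [TopologicalSpace X] [TopologicalSpace Y]

theorem Paths.shuf_eq_zero {n p q : ℕ} (h : n ≠ p + q) : Paths.shuf n p q = 0 := by
  induction n generalizing p q with
  | zero => rcases p with _ | p <;> rcases q with _ | q <;> first | rfl | exact absurd rfl h
  | succ n ih =>
    rcases p with _ | p <;> rcases q with _ | q
    · rfl
    · rw [Paths.shuf, ih (by omega), Finsupp.mapDomain_zero]
    · rw [Paths.shuf, ih (by omega), Finsupp.mapDomain_zero]
    · rw [Paths.shuf, ih (by omega), ih (by omega), Finsupp.mapDomain_zero, Finsupp.mapDomain_zero,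
        smul_zero, add_zero]

theorem Paths.shuf_zero_left (n : ℕ) :
    Paths.shuf n 0 n = Finsupp.single (fun _ => 0, id) 1 := by
  induction n with
  | zero =>
    rw [Paths.shuf]
    congr 2
    funext i
    exact Subsingleton.elim (α := Fin 1) _ _
  | succ n ih =>
    rw [Paths.shuf, ih, Finsupp.mapDomain_single, Paths.stepR]
    congr 2
    · funext i
      refine Fin.cases rfl (fun _ => rfl) i
    · funext i
      refine Fin.cases rfl (fun _ => rfl) i

theorem Paths.shuf_zero_right (n : ℕ) :
    Paths.shuf n n 0 = Finsupp.single (id, fun _ => 0) 1 := by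
  induction n with
  | zero =>
    rw [Paths.shuf]
    congr 2
    funext i
    exact Subsingleton.elim (α := Fin 1) _ _
  | succ n ih =>
    rw [Paths.shuf, ih, Finsupp.mapDomain_single, Paths.stepL]
    congr 2
    · funext i
      refine Fin.cases rfl (fun _ => rfl) i
    · funext i
      refine Fin.cases rfl (fun _ => rfl) i

theorem simplexMap_id (n : ℕ) : simplexMap (id : Fin (n + 1) → Fin (n + 1)) = .id _ :=
  ContinuousMap.ext fun t => stdSimplex.map_id_apply t

theorem cross_eq_zero {p q n : ℕ} (h : n ≠ p + q) (a : H k X p) (b : H k Y q) :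
    cross k p q n a b = 0 := by
  obtain ⟨a, rfl⟩ := toH_surjective k p a
  obtain ⟨b, rfl⟩ := toH_surjective k q b
  have h0 : crossChain k (X := X) (Y := Y) p q n = 0 := chain_ext₂ k fun s t => by
    rw [crossChain_simplex, Paths.shuf_eq_zero h, map_zero]
    rfl
  rw [cross_toH]
  simp only [h0, LinearMap.zero_apply]
  exact map_zero (toH k n)

theorem crossChain_const_left (n : ℕ) (x : X) (s : C(stdSimplex ℝ (Fin 1), X))
    (hs : s = .const _ x) (z : (chains k Y).X n) :
    crossChain k 0 n n (simplex k s) z = cmap k n (inclL x) z := by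
  subst hs
  have : crossChain k (Y := Y) 0 n n (simplex k (.const _ x)) = cmap k n (inclL x) :=
    chain_ext k fun t => by
      rw [crossChain_simplex, Paths.shuf_zero_left, realize, Finsupp.linearCombination_single,
        one_smul, cmap_simplex, simplexMap_id]
      rfl
  exact LinearMap.congr_fun this z

theorem crossChain_const_right (n : ℕ) (y : Y) (z : (chains k X).X n) :
    crossChain k n 0 n z (simplex k (.const _ y)) = cmap k n (inclR y) z := by
  have : (crossChain k (X := X) n 0 n).flip (simplex k (.const _ y)) = cmap k n (inclR y) :=
    chain_ext k fun t => by
      rw [LinearMap.flip_apply, crossChain_simplex, Paths.shuf_zero_right, realize,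
        Finsupp.linearCombination_single, one_smul, cmap_simplex, simplexMap_id]
      rfl
  exact LinearMap.congr_fun this z

theorem cross_pointClass_left (n : ℕ) (x : X) (b : H k Y n) :
    cross k 0 n n (pointClass k x) b = hmap k n (inclL x) b := by
  obtain ⟨b, rfl⟩ := toH_surjective k n b
  rw [pointClass, cross_toH, hmap_toH]
  exact congrArg _ (Subtype.ext (crossChain_const_left k n x _ rfl _))

theorem cross_pointClass_right (n : ℕ) (y : Y) (a : H k X n) :
    cross k n 0 n a (pointClass k y) = hmap k n (inclR y) a := by
  obtain ⟨a, rfl⟩ := toH_surjective k n a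
  rw [pointClass, cross_toH, hmap_toH]
  exact congrArg _ (Subtype.ext (crossChain_const_right k n y _))

/-- Singular 0-simplices are points, so identities linear in a degree-zero class need only be
checked on point classes. -/
theorem span_pointClass : Submodule.span k (Set.range (pointClass k (X := X))) = ⊤ := by
  set S := Submodule.span k (Set.range (pointClass k (X := X)))
  have hz (z : (chains k X).X 0) : z ∈ cycles k X 0 := by simp [cycles, dmap]
  have h0 : S.mkQ ∘ₗ toH k 0 ∘ₗ LinearMap.id.codRestrict (cycles k X 0) hz = 0 :=
    chain_ext k fun s => by
      refine (Submodule.Quotient.mk_eq_zero S).2 (Submodule.subset_span ⟨s (stdSimplex.vertex 0), ?_⟩)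
      refine congrArg (toH k 0) (Subtype.ext (congrArg (simplex k) (ContinuousMap.ext fun t => ?_)))
      rw [Subsingleton.elim t (stdSimplex.vertex 0)]
      rfl
  refine eq_top_iff.2 fun c _ => ?_
  obtain ⟨z, rfl⟩ := toH_surjective k 0 c
  exact (Submodule.Quotient.mk_eq_zero S).1 (LinearMap.congr_fun h0 z.1)

theorem H0_induction {P : H k X 0 → Prop} (hp : ∀ x, P (pointClass k x)) (h0 : P 0)
    (ha : ∀ a b, P a → P b → P (a + b)) (hs : ∀ (r : k) a, P a → P (r • a)) (a : H k X 0) : P a := by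
  have h : a ∈ Submodule.span k (Set.range (pointClass k (X := X))) := by
    rw [span_pointClass]; trivial
  induction h using Submodule.span_induction with
  | mem _ h => obtain ⟨x, rfl⟩ := h; exact hp x
  | zero => exact h0
  | add a b _ _ h₁ h₂ => exact ha a b h₁ h₂
  | smul r a _ h₁ => exact hs r a h₁

/-- The constant 1-simplex is the boundary of the constant 2-simplex, since `1 - 1 + 1 = 1`. -/
theorem hmap_const (y : Y) : hmap k 1 (.const X y) = 0 := by
  refine LinearMap.ext fun c => ?_
  obtain ⟨z, rfl⟩ := toH_surjective k 1 c
  rw [hmap_toH]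
  refine (toH_eq_zero_iff k 1 _).2 ⟨chainLift k (fun _ => simplex k (.const _ y)) z.1, ?_⟩
  have : dmap k Y 2 1 ∘ₗ chainLift k (X := X) (n := 1) (fun _ => simplex k (.const _ y)) =
      cmap k 1 (.const X y) := chain_ext k fun s => by
    rw [LinearMap.comp_apply, chainLift_simplex, d_simplex, cmap_simplex, Fin.sum_univ_three]
    have h (i : Fin 3) : (ContinuousMap.const (stdSimplex ℝ (Fin 3)) y).comp
        (simplexMap (m := 1) i.succAbove) = (ContinuousMap.const X y).comp s := rfl
    simp only [h]
    simp
  exact LinearMap.congr_fun this z.1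

theorem hmap_id (n : ℕ) : hmap k n (.id X) = LinearMap.id := by
  refine LinearMap.ext fun c => ?_
  obtain ⟨z, rfl⟩ := toH_surjective k n c
  rw [hmap_toH]
  have : cmap k n (.id X) = LinearMap.id := chain_ext k fun s => by rw [cmap_simplex]; rfl
  exact congrArg _ (Subtype.ext (LinearMap.congr_fun this z.1))

end Cross

/-! ### Translations -/

section Translation

variable (k : Type) [Field k] {X Y : Type u} [TopologicalSpace X] [TopologicalSpace Y]
  {mX : HSpaceStr X} {mY : HSpaceStr Y} {f : C(X, Y)}

theorem inclL_homotopic {y y' : Y} (h : Joined y y') :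
    (inclL y : C(X, Y × X)).Homotopic (inclL y') := by
  obtain ⟨p⟩ := h
  refine ⟨⟨⟨fun x => (p x.1, x.2), by fun_prop⟩, fun x => Prod.ext p.source rfl, fun x => Prod.ext p.target rfl⟩⟩

theorem inclR_homotopic {y y' : Y} (h : Joined y y') :
    (inclR y : C(X, X × Y)).Homotopic (inclR y') := by
  obtain ⟨p⟩ := h
  refine ⟨⟨⟨fun x => (x.2, p x.1), by fun_prop⟩, fun x => Prod.ext rfl p.source, fun x => Prod.ext rfl p.target⟩⟩

/-- Left multiplication with `y`. -/
def HSpaceStr.trans (m : HSpaceStr Y) (y : Y) : C(Y, Y) := m.mul.comp (inclL y)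

theorem HSpaceStr.hmap_trans_congr (m : HSpaceStr Y) {y y' : Y} (h : Joined y y') (n : ℕ) :
    hmap k n (m.trans y) = hmap k n (m.trans y') :=
  hmap_congr k ((ContinuousMap.Homotopic.refl m.mul).comp (inclL_homotopic h)) n

theorem HSpaceStr.hmap_mul_inclR (m : HSpaceStr Y) (y : Y) (n : ℕ) :
    hmap k n (m.mul.comp (inclR y)) = hmap k n (m.trans y) :=
  hmap_congr k (m.comm.comp (.refl (inclR y))) n

theorem HSpaceStr.hmap_trans_mul (m : HSpaceStr Y) (y y' : Y) (n : ℕ) (z : H k Y n) :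
    hmap k n (m.trans (m.mul (y, y'))) z = hmap k n (m.trans y) (hmap k n (m.trans y') z) := by
  rw [hmap_comp]
  refine LinearMap.congr_fun (hmap_congr k ?_ n) z
  exact m.assoc.comp (.refl ((ContinuousMap.const Y (y, y')).prodMk (.id Y)))

theorem HSpaceStr.joined_mul_comm (m : HSpaceStr Y) (y y' : Y) :
    Joined (m.mul (y, y')) (m.mul (y', y)) :=
  joined_of_homotopic m.comm (y, y')

theorem HSpaceStr.hmap_trans_comm (m : HSpaceStr Y) (y y' : Y) (n : ℕ) (z : H k Y n) :
    hmap k n (m.trans y) (hmap k n (m.trans y') z) =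
      hmap k n (m.trans y') (hmap k n (m.trans y) z) := by
  rw [← hmap_trans_mul, ← hmap_trans_mul, m.hmap_trans_congr k (m.joined_mul_comm y y')]

theorem IsHMap.hmap_trans (hf : IsHMap mX mY f) (x : X) (n : ℕ) (z : H k X n) :
    hmap k n f (hmap k n (mX.trans x) z) = hmap k n (mY.trans (f x)) (hmap k n f z) := by
  rw [hmap_comp, hmap_comp]
  exact LinearMap.congr_fun (hmap_congr k (hf.map_mul.comp (.refl (inclL x))) n) z

theorem IsHMap.joined (hf : IsHMap mX mY f) (x x' : X) :
    Joined (f (mX.mul (x, x'))) (mY.mul (f x, f x')) :=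
  joined_of_homotopic hf.map_mul (x, x')

theorem hmap_pointClass (x : X) : hmap k 0 f (pointClass k x) = pointClass k (f x) := by
  rw [pointClass, hmap_toH]
  exact congrArg _ (Subtype.ext (cmap_simplex k f _))

theorem hstar_lof (n : ℕ) (z : H k X n) :
    hstar k f (DirectSum.lof k ℕ (fun n => H k X n) n z) =
      DirectSum.lof k ℕ (fun n => H k Y n) n (hmap k n f z) := by
  simp [hstar]

theorem hstar_one (x : X) : hstar k f (one k x) = one k (f x) := by
  rw [one, hstar_lof, hmap_pointClass, one]

theorem HSpaceStr.pont_lof_of_eq (m : HSpaceStr X) {p q n : ℕ} (h : p + q = n) (a : H k X p)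
    (b : H k X q) :
    m.pont k (DirectSum.lof k ℕ (fun n => H k X n) p a) (DirectSum.lof k ℕ (fun n => H k X n) q b) =
      DirectSum.lof k ℕ (fun n => H k X n) n (hmap k n m.mul (cross k p q n a b)) := by
  subst h
  exact pont_lof k m p q a b

theorem HSpaceStr.pont_one (m : HSpaceStr X) (x : X) {n : ℕ} (z : H k X n) :
    m.pont k (one k x) (DirectSum.lof k ℕ (fun n => H k X n) n z) =
      DirectSum.lof k ℕ (fun n => H k X n) n (hmap k n (m.trans x) z) := by
  rw [one, m.pont_lof_of_eq k (zero_add n), cross_pointClass_left, hmap_comp]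
  rfl

theorem HSpaceStr.pont_lof_one (m : HSpaceStr X) (x : X) {n : ℕ} (z : H k X n) :
    m.pont k (DirectSum.lof k ℕ (fun n => H k X n) n z) (one k x) =
      DirectSum.lof k ℕ (fun n => H k X n) n (hmap k n (m.trans x) z) := by
  rw [one, m.pont_lof_of_eq k (add_zero n), cross_pointClass_right, hmap_comp, m.hmap_mul_inclR k]

theorem component_hstar (n : ℕ) (r : HStar k X) :
    DirectSum.component k ℕ (fun n => H k Y n) n (hstar k f r) =
      hmap k n f (DirectSum.component k ℕ (fun n => H k X n) n r) := rfl

/-- The localization property in a single degree: compare homogeneous components, as multiplication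
by a point class preserves degree. -/
theorem IsGroupCompletion.exists_hmap_eq (h : IsGroupCompletion mX mY f) (n : ℕ) (z : H k Y n) :
    ∃ (x : X) (r : H k X n), hmap k n (mY.trans (f x)) z = hmap k n f r := by
  obtain ⟨x, r, hr⟩ := h.surj k (DirectSum.lof k ℕ (fun n => H k Y n) n z)
  refine ⟨x, DirectSum.component k ℕ (fun n => H k X n) n r, ?_⟩
  rw [hstar_one, HSpaceStr.pont_one] at hr
  rw [← component_hstar, ← hr, DirectSum.component.lof_self]

theorem IsGroupCompletion.exists_trans_eq_zero (h : IsGroupCompletion mX mY f) (n : ℕ)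
    (r : H k X n) (hr : hmap k n f r = 0) : ∃ x, hmap k n (mX.trans x) r = 0 := by
  obtain ⟨x, hx⟩ := h.exists_of_eq_zero k (DirectSum.lof k ℕ (fun n => H k X n) n r)
    (by rw [hstar_lof, hr, map_zero])
  refine ⟨x, ?_⟩
  rw [HSpaceStr.pont_one] at hx
  rw [← DirectSum.component.lof_self (M := fun n => H k X n) k n (hmap k n (mX.trans x) r), hx,
    map_zero]

theorem IsGroupCompletion.exists_joined (h : IsGroupCompletion mX mY f) (y : Y) :
    ∃ x x', Joined (mY.mul (f x, y)) (f x') := by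
  let _ := mX.pi0
  let _ := mY.pi0
  obtain ⟨⟨a, s⟩, h₁⟩ := h.pi0.surj (.mk y)
  obtain ⟨x', rfl⟩ := Quotient.exists_rep a
  obtain ⟨s, hs⟩ := s
  obtain ⟨x, rfl⟩ := Quotient.exists_rep s
  have h₂ : Joined (mY.mul (y, f x)) (f x') := Quotient.exact h₁
  exact ⟨x, x', (mY.joined_mul_comm _ _).trans h₂⟩

end Translation

/-! ### Square roots and group completions -/

section Chern

variable {X Y : Type u} [TopologicalSpace X] [TopologicalSpace Y]
  {mX : HSpaceStr X} {mY : HSpaceStr Y} {f : C(X, Y)} {F : FrameSys Y} {Λ : FrameSys (Y × Y)}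
  {c : Y × Y → ℂˣ}

open FrameSys

/-- Restrict `φ` to `{y} × Y`: the factor `K_y` is constant and `L` enters as a square, so `K` and
its translate agree up to a square and their product has a root. -/
theorem exists_root_mul_comap_trans
    (h : F.comap .fst * F.comap .snd * (Λ * Λ) = (F.comap mY.mul).scale (c * c)) (y : Y) :
    ∃ G, G * G = F * F.comap (mY.trans y) := by
  have e := congrArg (FrameSys.comap · (inclL y : C(Y, Y × Y))) h
  simp only [comap_mul, comap_scale, FrameSys.comap_comap] at e
  rw [show (ContinuousMap.fst.comp (inclL y : C(Y, Y × Y))) = .const Y y from rfl, comap_const,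
    show (ContinuousMap.snd.comp (inclL y : C(Y, Y × Y))) = .id Y from rfl, comap_id, one_mul] at e
  let c' : Y → ℂˣ := c ∘ (inclL y : C(Y, Y × Y))
  have e' : F.comap (mY.trans y) =
      (F * (Λ.comap (inclL y) * Λ.comap (inclL y))).scale (c'⁻¹ * c'⁻¹) := by
    rw [e, scale_scale]
    refine (scale_one _).symm.trans (congrArg _ (funext fun t => ?_))
    simp [c']
  refine ⟨F * (Λ.comap (inclL y)).scale c'⁻¹, ?_⟩
  rw [e', mul_mul_mul_comm, scale_mul_scale, mul_scale, mul_scale, mul_assoc]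

/-- The Chern class takes the same value on a degree-two class and on its translates. Some translate
by `f(x)` comes from `X`, where the pulled-back bundle has a root, so the class is zero. -/
theorem IsGroupCompletion.exists_root (hf : IsGroupCompletion mX mY f) (hY : HasCWType Y)
    (h : F.comap .fst * F.comap .snd * (Λ * Λ) = (F.comap mY.mul).scale (c * c))
    (hX : ∃ G, G * G = F.comap f) : ∃ G, G * G = F := by
  obtain ⟨A, hA⟩ := F.exists_isEdgeFrame
  refine exists_root_of_chernH hY hA ?_
  ext z
  obtain ⟨x, r, hr⟩ := hf.exists_hmap_eq (ZMod 2) 2 z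
  obtain ⟨G, hG⟩ := exists_root_mul_comap_trans h (f x)
  have h0 := chernH_of_root (hA.mul (hA.comap (mY.trans (f x)))) hG
  rw [chernH_mul hA (hA.comap (mY.trans (f x))), ← chernH_comap hA] at h0
  have h1 := LinearMap.congr_fun h0 z
  rw [LinearMap.add_apply, LinearMap.comp_apply, hr, ← LinearMap.comp_apply, chernH_comap hA] at h1
  obtain ⟨G', hG'⟩ := hX
  rw [chernH_of_root (hA.comap f) hG', LinearMap.zero_apply, add_zero] at h1
  exact h1

end Chern

/-! ### Hochschild cochains of low degree -/

section LowDegree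

variable (k : Type) [Field k] {X Y : Type u} [TopologicalSpace X] [TopologicalSpace Y]
  (m : HSpaceStr X)

theorem HSpaceStr.hochD_one (c : Cochain k X 1) (r : Fin 2 → HStar k X) :
    m.hochD k 1 c r = eps k X (r 0) * c (fun _ => r 1) - c (fun _ => m.pont k (r 0) (r 1)) +
      c (fun _ => r 0) * eps k X (r 1) := by
  have e0 : (fun a : Fin 1 => r a.succ) = fun _ => r 1 := by
    funext a
    rw [Fin.fin_one_eq_zero a]
    rfl
  have e1 : (fun a : Fin 1 => r a.castSucc) = fun _ => r 0 := by
    funext a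
    rw [Fin.fin_one_eq_zero a]
    rfl
  have e2 : (Fin.castSucc (0 : Fin 1)).contractNth (fun x y => m.pont k x y) r =
      fun _ => m.pont k (r 0) (r 1) := by
    funext a
    rw [Fin.fin_one_eq_zero a]
    rfl
  simp only [HSpaceStr.hochD, LinearMap.coe_mk, AddHom.coe_mk, e0, e1, Fin.sum_univ_one, e2]
  simp [sub_eq_add_neg]

theorem HSpaceStr.hochD_two (c : Cochain k X 2) (r : Fin 3 → HStar k X) :
    m.hochD k 2 c r = eps k X (r 0) * c ![r 1, r 2] - c ![m.pont k (r 0) (r 1), r 2] +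
      c ![r 0, m.pont k (r 1) (r 2)] - c ![r 0, r 1] * eps k X (r 2) := by
  have e0 : (fun a : Fin 2 => r a.succ) = ![r 1, r 2] := by
    funext a
    fin_cases a <;> rfl
  have e1 : (fun a : Fin 2 => r a.castSucc) = ![r 0, r 1] := by
    funext a
    fin_cases a <;> rfl
  have e2 : (Fin.castSucc (0 : Fin 2)).contractNth (fun x y => m.pont k x y) r =
      ![m.pont k (r 0) (r 1), r 2] := by
    funext a
    fin_cases a <;> rfl
  have e3 : (Fin.castSucc (1 : Fin 2)).contractNth (fun x y => m.pont k x y) r =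
      ![r 0, m.pont k (r 1) (r 2)] := by
    funext a
    fin_cases a <;> rfl
  simp only [HSpaceStr.hochD, LinearMap.coe_mk, AddHom.coe_mk, e0, e1, Fin.sum_univ_two, e2, e3]
  simp only [Fin.val_zero, Fin.val_one, Fin.last]
  have : r ⟨2, by omega⟩ = r 2 := rfl
  rw [this]
  ring

theorem eps_one (x : X) : eps k X (one k x) = 1 := by
  rw [eps, one, LinearMap.comp_apply, DirectSum.component.lof_self, aug_pointClass]

theorem eps_lof {n : ℕ} (h : n ≠ 0) (a : H k X n) :
    eps k X (DirectSum.lof k ℕ (fun n => H k X n) n a) = 0 := by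
  rw [eps, LinearMap.comp_apply, DirectSum.component.of, dif_neg h, map_zero]

variable {k} in
theorem HStar_induction {P : HStar k X → Prop}
    (h : ∀ n a, P (DirectSum.lof k ℕ (fun n => H k X n) n a)) (h0 : P 0)
    (ha : ∀ r s, P r → P s → P (r + s)) (r : HStar k X) : P r :=
  DirectSum.induction_on r h0 h ha

theorem HSpaceStr.pont_one_one (x y : X) :
    m.pont k (one k x) (one k y) = one k (m.mul (x, y)) := by
  conv_lhs => rw [one.eq_def k y]
  rw [m.pont_one k, hmap_pointClass]
  rfl

variable {k} in
theorem HSpaceStr.toH1_mk (c : m.hochZ k 1 1) (z : H k X 1) :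
    m.toH1 k (Submodule.Quotient.mk c) z =
      c.1 fun _ => DirectSum.lof k ℕ (fun n => H k X n) 1 z := rfl

theorem toH1_HPmap {mX : HSpaceStr X} {mY : HSpaceStr Y} {f : C(X, Y)} (hf : IsHMap mX mY f)
    (a : mY.HP k 1 1) : mX.toH1 k (HPmap k hf 1 1 a) = mY.toH1 k a ∘ₗ hmap k 1 f := by
  obtain ⟨c, rfl⟩ := Submodule.Quotient.mk_surjective _ a
  ext z
  rw [LinearMap.comp_apply, mY.toH1_mk]
  refine Eq.trans ?_ (congrArg c.1 (funext fun _ => hstar_lof k (f := f) 1 z))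
  rfl

end LowDegree

/-! ### The difference operator on degree-one classes -/

section Delta

variable {X Y : Type u} [TopologicalSpace X] [TopologicalSpace Y] (m : HSpaceStr X)

theorem HSpaceStr.delta_inclL (α : H (ZMod 2) X 1 →ₗ[ZMod 2] ZMod 2) (x : X) (z : H (ZMod 2) X 1) :
    m.delta α (hmap (ZMod 2) 1 (inclL x) z) = α z + α (hmap (ZMod 2) 1 (m.trans x) z) := by
  simp only [delta, LinearMap.add_apply, LinearMap.comp_apply, hmap_comp]
  rw [show ContinuousMap.fst.comp (inclL x : C(X, X × X)) = .const X x from rfl,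
    show ContinuousMap.snd.comp (inclL x : C(X, X × X)) = .id X from rfl, hmap_const, hmap_id,
    LinearMap.zero_apply, map_zero, zero_add]
  rfl

theorem HSpaceStr.delta_inclR (α : H (ZMod 2) X 1 →ₗ[ZMod 2] ZMod 2) (x : X) (z : H (ZMod 2) X 1) :
    m.delta α (hmap (ZMod 2) 1 (inclR x) z) = α z + α (hmap (ZMod 2) 1 (m.trans x) z) := by
  simp only [delta, LinearMap.add_apply, LinearMap.comp_apply, hmap_comp]
  rw [show ContinuousMap.fst.comp (inclR x : C(X, X × X)) = .id X from rfl,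
    show ContinuousMap.snd.comp (inclR x : C(X, X × X)) = .const X x from rfl, hmap_const, hmap_id,
    LinearMap.zero_apply, map_zero, add_zero, m.hmap_mul_inclR (ZMod 2)]
  rfl

/-- By the Künneth argument it suffices to compare on slices, where one projection is constant and
`μ` is a translation up to homotopy. -/
theorem HSpaceStr.eq_delta {w : H (ZMod 2) (X × X) 1 →ₗ[ZMod 2] ZMod 2}
    {α : H (ZMod 2) X 1 →ₗ[ZMod 2] ZMod 2}
    (hL : ∀ x z, w (hmap (ZMod 2) 1 (inclL x) z) = α z + α (hmap (ZMod 2) 1 (m.trans x) z))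
    (hR : ∀ x z, w (hmap (ZMod 2) 1 (inclR x) z) = α z + α (hmap (ZMod 2) 1 (m.trans x) z)) :
    w = m.delta α :=
  H1_prod_ext (fun x => LinearMap.ext fun z => (hL x z).trans (m.delta_inclL α x z).symm)
    fun x => LinearMap.ext fun z => (hR x z).trans (m.delta_inclR α x z).symm

/-- This is the cocycle condition evaluated on a point class and a degree-one class: the class is
translation invariant. -/
theorem HSpaceStr.toH1_trans (a : m.HP (ZMod 2) 1 1) (x : X) (z : H (ZMod 2) X 1) :
    0 = m.toH1 (ZMod 2) a z + m.toH1 (ZMod 2) a (hmap (ZMod 2) 1 (m.trans x) z) := by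
  obtain ⟨c, rfl⟩ := Submodule.Quotient.mk_surjective _ a
  have h := congrFun c.2.2 ![one (ZMod 2) x, DirectSum.lof (ZMod 2) ℕ (fun n => H (ZMod 2) X n) 1 z]
  rw [m.hochD_one (ZMod 2)] at h
  simp only [Matrix.cons_val_zero, Matrix.cons_val_one, eps_one, eps_lof _ one_ne_zero, one_mul,
    mul_zero, add_zero, m.pont_one (ZMod 2)] at h
  rw [m.toH1_mk, m.toH1_mk, ← CharTwo.sub_eq_add]
  exact h.symm

theorem HSpaceStr.delta_toH1 (a : m.HP (ZMod 2) 1 1) : m.delta (m.toH1 (ZMod 2) a) = 0 :=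
  (m.eq_delta (fun x z => m.toH1_trans a x z) fun x z => m.toH1_trans a x z).symm

end Delta

/-! ### The obstruction cocycle -/

section Cocycle

variable {X Y : Type u} [TopologicalSpace X] [TopologicalSpace Y]

local notation "lof2" => DirectSum.lof (ZMod 2) ℕ (fun n => H (ZMod 2) X n)

/-- The bilinear form `a ⊗ b ↦ w(a × b)`. -/
def crossForm (w : H (ZMod 2) (X × X) 1 →ₗ[ZMod 2] ZMod 2) :
    HStar (ZMod 2) X →ₗ[ZMod 2] HStar (ZMod 2) X →ₗ[ZMod 2] ZMod 2 :=
  DirectSum.toModule (ZMod 2) ℕ _ fun p => LinearMap.flip <| DirectSum.toModule (ZMod 2) ℕ _ fun q =>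
    LinearMap.flip <| (cross (ZMod 2) p q 1).compr₂ w

variable {w : H (ZMod 2) (X × X) 1 →ₗ[ZMod 2] ZMod 2}

theorem crossForm_lof (p q : ℕ) (a : H (ZMod 2) X p) (b : H (ZMod 2) X q) :
    crossForm w (lof2 p a) (lof2 q b) = w (cross (ZMod 2) p q 1 a b) := by
  simp [crossForm]

theorem crossForm_eq_zero {p q : ℕ} (h : 1 ≠ p + q) (a : H (ZMod 2) X p) (b : H (ZMod 2) X q) :
    crossForm w (lof2 p a) (lof2 q b) = 0 := by
  rw [crossForm_lof, cross_eq_zero _ h, map_zero]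

theorem crossForm_one_left (x : X) (z : H (ZMod 2) X 1) :
    crossForm w (one (ZMod 2) x) (lof2 1 z) = w (hmap (ZMod 2) 1 (inclL x) z) := by
  rw [one, crossForm_lof, cross_pointClass_left]

theorem crossForm_one_right (x : X) (z : H (ZMod 2) X 1) :
    crossForm w (lof2 1 z) (one (ZMod 2) x) = w (hmap (ZMod 2) 1 (inclR x) z) := by
  rw [one, crossForm_lof, cross_pointClass_right]

/-- The identity satisfied by `w` in the presence of an associativity structure. -/
def HSpaceStr.IsAssoc (m : HSpaceStr X) (w : H (ZMod 2) (X × X) 1 →ₗ[ZMod 2] ZMod 2) : Prop :=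
  w ∘ₗ hmap (ZMod 2) 1 (p12 X) + w ∘ₗ hmap (ZMod 2) 1 m.mulId =
    w ∘ₗ hmap (ZMod 2) 1 (p23 X) + w ∘ₗ hmap (ZMod 2) 1 m.idMul

variable {m : HSpaceStr X}

theorem HSpaceStr.IsAssoc.comap (h : m.IsAssoc w) {T : Type u} [TopologicalSpace T]
    (g : C(T, (X × X) × X)) (z : H (ZMod 2) T 1) :
    w (hmap (ZMod 2) 1 ((p12 X).comp g) z) + w (hmap (ZMod 2) 1 (m.mulId.comp g) z) =
      w (hmap (ZMod 2) 1 ((p23 X).comp g) z) + w (hmap (ZMod 2) 1 (m.idMul.comp g) z) := by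
  have := LinearMap.congr_fun h (hmap (ZMod 2) 1 g z)
  simpa only [LinearMap.add_apply, LinearMap.comp_apply, hmap_comp] using this

/-- Associativity for classes in the third factor. -/
theorem HSpaceStr.IsAssoc.third (h : m.IsAssoc w) (x y : X) (z : H (ZMod 2) X 1) :
    w (hmap (ZMod 2) 1 (inclL (m.mul (x, y))) z) = w (hmap (ZMod 2) 1 (inclL y) z) +
      w (hmap (ZMod 2) 1 (inclL x) (hmap (ZMod 2) 1 (m.trans y) z)) := by
  have := h.comap ((ContinuousMap.const X (x, y)).prodMk (.id X)) z
  rw [show (p12 X).comp ((ContinuousMap.const X (x, y)).prodMk (.id X)) = .const X (x, y) from rfl,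
    hmap_const, LinearMap.zero_apply, map_zero, zero_add] at this
  rw [hmap_comp]
  exact this

/-- Associativity for classes in the second factor. -/
theorem HSpaceStr.IsAssoc.second (h : m.IsAssoc w) (x y : X) (z : H (ZMod 2) X 1) :
    w (hmap (ZMod 2) 1 (inclL x) z) + w (hmap (ZMod 2) 1 (inclR y) (hmap (ZMod 2) 1 (m.trans x) z)) =
      w (hmap (ZMod 2) 1 (inclR y) z) +
        w (hmap (ZMod 2) 1 (inclL x) (hmap (ZMod 2) 1 (m.trans y) z)) := by
  have := h.comap (((ContinuousMap.const X x).prodMk (.id X)).prodMk (.const X y)) z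
  rw [← m.hmap_mul_inclR (ZMod 2) y, hmap_comp, hmap_comp]
  exact this

/-- Associativity for classes in the first factor. -/
theorem HSpaceStr.IsAssoc.first (h : m.IsAssoc w) (x y : X) (z : H (ZMod 2) X 1) :
    w (hmap (ZMod 2) 1 (inclR (m.mul (x, y))) z) = w (hmap (ZMod 2) 1 (inclR x) z) +
      w (hmap (ZMod 2) 1 (inclR y) (hmap (ZMod 2) 1 (m.trans x) z)) := by
  have := h.comap (((ContinuousMap.id X).prodMk (.const X x)).prodMk (.const X y)) z
  rw [show (p23 X).comp (((ContinuousMap.id X).prodMk (.const X x)).prodMk (.const X y)) =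
    .const X (x, y) from rfl, hmap_const, LinearMap.zero_apply, map_zero, zero_add] at this
  rw [← m.hmap_mul_inclR (ZMod 2) x, hmap_comp]
  exact this.symm

/-- Every term vanishes unless the total degree is one. Then exactly one argument has degree one,
the others reduce to point classes, and the identity is `third`, `second` or `first`. -/
theorem HSpaceStr.IsAssoc.crossForm_lof (h : m.IsAssoc w) {p q n : ℕ} (a : H (ZMod 2) X p)
    (b : H (ZMod 2) X q) (c : H (ZMod 2) X n) :
    eps (ZMod 2) X (lof2 p a) * crossForm w (lof2 q b) (lof2 n c) +
      crossForm w (m.pont (ZMod 2) (lof2 p a) (lof2 q b)) (lof2 n c) +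
      crossForm w (lof2 p a) (m.pont (ZMod 2) (lof2 q b) (lof2 n c)) +
      crossForm w (lof2 p a) (lof2 q b) * eps (ZMod 2) X (lof2 n c) = 0 := by
  by_cases hd : p + q + n = 1
  · have hpqn : (p = 0 ∧ q = 0 ∧ n = 1) ∨ (p = 0 ∧ q = 1 ∧ n = 0) ∨ (p = 1 ∧ q = 0 ∧ n = 0) := by
      omega
    rcases hpqn with ⟨rfl, rfl, rfl⟩ | ⟨rfl, rfl, rfl⟩ | ⟨rfl, rfl, rfl⟩
    · refine H0_induction (ZMod 2)
          (P := fun a => eps (ZMod 2) X (lof2 0 a) * crossForm w (lof2 0 b) (lof2 1 c) +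
          crossForm w (m.pont (ZMod 2) (lof2 0 a) (lof2 0 b)) (lof2 1 c) +
          crossForm w (lof2 0 a) (m.pont (ZMod 2) (lof2 0 b) (lof2 1 c)) +
          crossForm w (lof2 0 a) (lof2 0 b) * eps (ZMod 2) X (lof2 1 c) = 0) (fun x => ?_) (by simp)
        (fun a a' h h' => by
          simp only [map_add, LinearMap.add_apply]; linear_combination h + h')
        (fun r a h => by
          simp only [map_smul, LinearMap.smul_apply, smul_eq_mul]; linear_combination r * h) a
      refine H0_induction (ZMod 2)
            (P := fun b => eps (ZMod 2) X (one _ x) * crossForm w (lof2 0 b) (lof2 1 c) +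
            crossForm w (m.pont (ZMod 2) (one _ x) (lof2 0 b)) (lof2 1 c) +
            crossForm w (one _ x) (m.pont (ZMod 2) (lof2 0 b) (lof2 1 c)) +
            crossForm w (one _ x) (lof2 0 b) * eps (ZMod 2) X (lof2 1 c) = 0)
            (fun y => ?_) (by simp)
        (fun a a' h h' => by
          simp only [map_add, LinearMap.add_apply]; linear_combination h + h')
        (fun r a h => by
          simp only [map_smul, LinearMap.smul_apply, smul_eq_mul]; linear_combination r * h) b
      have e := h.third x y c
      rw [← crossForm_one_left, ← crossForm_one_left, ← crossForm_one_left, ← m.pont_one (ZMod 2)] at e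
      change eps _ _ (one _ x) * crossForm w (one _ y) _ + crossForm w (m.pont _ (one _ x) (one _ y)) _ +
        crossForm w (one _ x) (m.pont _ (one _ y) _) + crossForm w (one _ x) (one _ y) * _ = 0
      rw [eps_one, one_mul, eps_lof _ one_ne_zero, mul_zero, add_zero, m.pont_one_one (ZMod 2), e, ← add_assoc,
        zmod_two_add_self, zero_add, zmod_two_add_self]
    · refine H0_induction (ZMod 2)
          (P := fun a => eps (ZMod 2) X (lof2 0 a) * crossForm w (lof2 1 b) (lof2 0 c) +
          crossForm w (m.pont (ZMod 2) (lof2 0 a) (lof2 1 b)) (lof2 0 c) +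
          crossForm w (lof2 0 a) (m.pont (ZMod 2) (lof2 1 b) (lof2 0 c)) +
          crossForm w (lof2 0 a) (lof2 1 b) * eps (ZMod 2) X (lof2 0 c) = 0) (fun x => ?_) (by simp)
        (fun a a' h h' => by
          simp only [map_add, LinearMap.add_apply]; linear_combination h + h')
        (fun r a h => by
          simp only [map_smul, LinearMap.smul_apply, smul_eq_mul]; linear_combination r * h) a
      refine H0_induction (ZMod 2)
            (P := fun c => eps (ZMod 2) X (one _ x) * crossForm w (lof2 1 b) (lof2 0 c) +
            crossForm w (m.pont (ZMod 2) (one _ x) (lof2 1 b)) (lof2 0 c) +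
            crossForm w (one _ x) (m.pont (ZMod 2) (lof2 1 b) (lof2 0 c)) +
            crossForm w (one _ x) (lof2 1 b) * eps (ZMod 2) X (lof2 0 c) = 0)
            (fun y => ?_) (by simp)
        (fun a a' h h' => by
          simp only [map_add]; linear_combination h + h')
        (fun r a h => by
          simp only [map_smul, smul_eq_mul]; linear_combination r * h) c
      have e := h.second x y b
      rw [← crossForm_one_left, ← crossForm_one_left, ← crossForm_one_right, ← crossForm_one_right,
        ← m.pont_one (ZMod 2), ← m.pont_lof_one (ZMod 2)] at e
      change eps _ _ (one _ x) * crossForm w _ (one _ y) + crossForm w (m.pont _ (one _ x) _) (one _ y) +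
        crossForm w (one _ x) (m.pont _ _ (one _ y)) + crossForm w (one _ x) _ * eps _ _ (one _ y) = 0
      rw [eps_one, one_mul, eps_one, mul_one]
      revert e
      generalize crossForm w _ _ = a₁
      generalize crossForm w _ _ = a₂
      generalize crossForm w _ _ = a₃
      generalize crossForm w _ _ = a₄
      revert a₁ a₂ a₃ a₄
      decide
    · refine H0_induction (ZMod 2)
          (P := fun b => eps (ZMod 2) X (lof2 1 a) * crossForm w (lof2 0 b) (lof2 0 c) +
          crossForm w (m.pont (ZMod 2) (lof2 1 a) (lof2 0 b)) (lof2 0 c) +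
          crossForm w (lof2 1 a) (m.pont (ZMod 2) (lof2 0 b) (lof2 0 c)) +
          crossForm w (lof2 1 a) (lof2 0 b) * eps (ZMod 2) X (lof2 0 c) = 0) (fun x => ?_) (by simp)
        (fun a a' h h' => by
          simp only [map_add, LinearMap.add_apply]; linear_combination h + h')
        (fun r a h => by
          simp only [map_smul, LinearMap.smul_apply, smul_eq_mul]; linear_combination r * h) b
      refine H0_induction (ZMod 2)
            (P := fun c => eps (ZMod 2) X (lof2 1 a) * crossForm w (one _ x) (lof2 0 c) +
            crossForm w (m.pont (ZMod 2) (lof2 1 a) (one _ x)) (lof2 0 c) +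
            crossForm w (lof2 1 a) (m.pont (ZMod 2) (one _ x) (lof2 0 c)) +
            crossForm w (lof2 1 a) (one _ x) * eps (ZMod 2) X (lof2 0 c) = 0)
            (fun y => ?_) (by simp)
        (fun a a' h h' => by
          simp only [map_add]; linear_combination h + h')
        (fun r a h => by
          simp only [map_smul, smul_eq_mul]; linear_combination r * h) c
      have e := h.first x y a
      rw [← crossForm_one_right, ← crossForm_one_right, ← crossForm_one_right, ← m.pont_lof_one (ZMod 2)] at e
      change _ * crossForm w (one _ x) (one _ y) + crossForm w (m.pont _ _ (one _ x)) (one _ y) +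
        crossForm w _ (m.pont _ (one _ x) (one _ y)) + crossForm w _ (one _ x) * eps _ _ (one _ y) = 0
      rw [eps_one, mul_one, eps_lof _ one_ne_zero, zero_mul, zero_add, m.pont_one_one (ZMod 2), e,
        add_comm (crossForm w (lof2 1 a) _), ← add_assoc, zmod_two_add_self, zero_add,
        zmod_two_add_self]
  · have h1 : eps (ZMod 2) X (lof2 p a) * crossForm w (lof2 q b) (lof2 n c) = 0 := by
      by_cases hp : p = 0
      · rw [crossForm_eq_zero (by omega), mul_zero]
      · rw [eps_lof _ hp, zero_mul]
    have h2 : crossForm w (lof2 p a) (lof2 q b) * eps (ZMod 2) X (lof2 n c) = 0 := by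
      by_cases hp : n = 0
      · rw [crossForm_eq_zero (by omega), zero_mul]
      · rw [eps_lof _ hp, mul_zero]
    rw [h1, h2, pont_lof, pont_lof, crossForm_eq_zero (by omega), crossForm_eq_zero (by omega)]
    simp

theorem HSpaceStr.IsAssoc.crossForm_eq (h : m.IsAssoc w) (r s t : HStar (ZMod 2) X) :
    eps (ZMod 2) X r * crossForm w s t + crossForm w (m.pont (ZMod 2) r s) t +
      crossForm w r (m.pont (ZMod 2) s t) + crossForm w r s * eps (ZMod 2) X t = 0 := by
  refine HStar_induction (P := fun r => eps (ZMod 2) X (r) * crossForm w (s) (t) +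
        crossForm w (m.pont (ZMod 2) (r) (s)) (t) + crossForm w (r) (m.pont (ZMod 2) (s) (t)) +
        crossForm w (r) (s) * eps (ZMod 2) X (t) = 0) (fun p a => ?_) (by simp) (fun r r' h h' => by
    simp only [map_add, LinearMap.add_apply]; linear_combination h + h') r
  refine HStar_induction (P := fun s => eps (ZMod 2) X (lof2 p a) * crossForm w (s) (t) +
        crossForm w (m.pont (ZMod 2) (lof2 p a) (s)) (t) +
        crossForm w (lof2 p a) (m.pont (ZMod 2) (s) (t)) +
        crossForm w (lof2 p a) (s) * eps (ZMod 2) X (t) =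
        0) (fun q b => ?_) (by simp) (fun r r' h h' => by
    simp only [map_add, LinearMap.add_apply]; linear_combination h + h') s
  refine HStar_induction (P := fun t => eps (ZMod 2) X (lof2 p a) * crossForm w (lof2 q b) (t) +
        crossForm w (m.pont (ZMod 2) (lof2 p a) (lof2 q b)) (t) +
        crossForm w (lof2 p a) (m.pont (ZMod 2) (lof2 q b) (t)) +
        crossForm w (lof2 p a) (lof2 q b) * eps (ZMod 2) X (t) =
        0) (fun n c => ?_) (by simp) (fun r r' h h' => by
    simp only [map_add]; linear_combination h + h') t
  exact h.crossForm_lof a b c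

variable (w) in
/-- The cochain `a ⊗ b ↦ w(a × b)`. -/
def crossCochain : Cochain (ZMod 2) X 2 where
  toFun r := crossForm w (r 0) (r 1)
  map_update_add' r i x y := by
    fin_cases i <;> simp
  map_update_smul' r i s x := by
    fin_cases i <;> simp

theorem crossCochain_apply (r : Fin 2 → HStar (ZMod 2) X) :
    crossCochain w r = crossForm w (r 0) (r 1) := rfl

theorem crossCochain_mem : crossCochain w ∈ cochains (ZMod 2) X 2 1 := by
  intro d r hd
  rw [crossCochain_apply, crossForm_eq_zero]
  rw [Fin.sum_univ_two] at hd
  exact hd.symm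

theorem HSpaceStr.IsAssoc.crossCochain_mem (h : m.IsAssoc w) :
    crossCochain w ∈ m.hochZ (ZMod 2) 2 1 := by
  refine ⟨HochPont.crossCochain_mem, funext fun r => ?_⟩
  rw [m.hochD_two (ZMod 2), CharTwo.sub_eq_add, CharTwo.sub_eq_add]
  exact h.crossForm_eq _ _ _

/-- A cochain is determined by homogeneous tensors, so a cocycle defining an obstruction class is
determined by `w`. -/
theorem eq_crossCochain {c : Cochain (ZMod 2) X 2}
    (h : ∀ (p q : ℕ) (a : H (ZMod 2) X p) (b : H (ZMod 2) X q),
      c ![lof2 p a, lof2 q b] = w (cross (ZMod 2) p q 1 a b)) : c = crossCochain w := by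
  ext d x
  refine Eq.trans (congrArg c ?_) ((h (d 0) (d 1) (x 0) (x 1)).trans (crossForm_lof _ _ _ _).symm)
  funext i
  fin_cases i <;> rfl

/-- The degree one cochain given by `α`. -/
def degOneCochain (α : H (ZMod 2) X 1 →ₗ[ZMod 2] ZMod 2) : Cochain (ZMod 2) X 1 :=
  MultilinearMap.ofSubsingleton (ZMod 2) (HStar (ZMod 2) X) (ZMod 2) (0 : Fin 1)
    (α ∘ₗ DirectSum.component (ZMod 2) ℕ (fun n => H (ZMod 2) X n) 1)

theorem degOneCochain_apply (α : H (ZMod 2) X 1 →ₗ[ZMod 2] ZMod 2) (r : Fin 1 → HStar (ZMod 2) X) :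
    degOneCochain α r = α (DirectSum.component (ZMod 2) ℕ (fun n => H (ZMod 2) X n) 1 (r 0)) := rfl

theorem degOneCochain_lof (α : H (ZMod 2) X 1 →ₗ[ZMod 2] ZMod 2) (z : H (ZMod 2) X 1) :
    degOneCochain α (fun _ => lof2 1 z) = α z := by
  rw [degOneCochain_apply, DirectSum.component.lof_self]

theorem degOneCochain_lof_of_ne (α : H (ZMod 2) X 1 →ₗ[ZMod 2] ZMod 2) {n : ℕ} (hn : n ≠ 1)
    (z : H (ZMod 2) X n) : degOneCochain α (fun _ => lof2 n z) = 0 := by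
  rw [degOneCochain_apply, DirectSum.component.of, dif_neg hn, map_zero]

/-- The three terms of the Hochschild differential correspond to the two projections and to `μ`.
Only total degree one matters, and there a degree-zero argument reduces to a point class. -/
theorem crossCochain_delta (α : H (ZMod 2) X 1 →ₗ[ZMod 2] ZMod 2) (r : Fin 2 → HStar (ZMod 2) X) :
    m.hochD (ZMod 2) 1 (degOneCochain α) r = crossCochain (m.delta α) r := by
  rw [m.hochD_one (ZMod 2), CharTwo.sub_eq_add, crossCochain_apply]
  generalize r 0 = s
  generalize r 1 = t
  refine HStar_induction (P := fun s => eps (ZMod 2) X (s) * degOneCochain α (fun _ => t) +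
        degOneCochain α (fun _ => m.pont (ZMod 2) (s) (t)) +
        degOneCochain α (fun _ => s) * eps (ZMod 2) X (t) =
        crossForm (m.delta α) (s) (t)) (fun p a => ?_) (by simp [degOneCochain_apply]) (fun r r' h h' => by
    simp only [degOneCochain_apply] at h h' ⊢
    simp only [map_add, LinearMap.add_apply, ← h, ← h']; ring) s
  refine HStar_induction (P := fun t => eps (ZMod 2) X (lof2 p a) * degOneCochain α (fun _ => t) +
        degOneCochain α (fun _ => m.pont (ZMod 2) (lof2 p a) (t)) +
        degOneCochain α (fun _ => lof2 p a) * eps (ZMod 2) X (t) =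
        crossForm (m.delta α) (lof2 p a) (t)) (fun q b => ?_) (by simp [degOneCochain_apply]) (fun r r' h h' => by
    simp only [degOneCochain_apply] at h h' ⊢
    simp only [map_add, ← h, ← h']; ring) t
  by_cases hd : p + q = 1
  · have hpq : (p = 0 ∧ q = 1) ∨ (p = 1 ∧ q = 0) := by omega
    rcases hpq with ⟨rfl, rfl⟩ | ⟨rfl, rfl⟩
    · refine H0_induction (ZMod 2)
          (P := fun a => eps (ZMod 2) X (lof2 0 a) * degOneCochain α (fun _ => lof2 1 b) +
          degOneCochain α (fun _ => m.pont (ZMod 2) (lof2 0 a) (lof2 1 b)) +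
          degOneCochain α (fun _ => lof2 0 a) * eps (ZMod 2) X (lof2 1 b) =
          crossForm (m.delta α) (lof2 0 a) (lof2 1 b)) (fun x => ?_) (by simp [degOneCochain_apply])
        (fun a a' h h' => by
          simp only [degOneCochain_apply] at h h' ⊢
          simp only [map_add, LinearMap.add_apply, ← h, ← h']; ring)
        (fun r a h => by
          simp only [degOneCochain_apply] at h ⊢
          simp only [map_smul, LinearMap.smul_apply, smul_eq_mul, ← h]; ring) a
      change eps _ _ (one _ x) * _ + degOneCochain α (fun _ => m.pont _ (one _ x) _) + _ =
        crossForm _ (one _ x) _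
      rw [crossForm_one_left, m.delta_inclL, eps_one, one_mul, degOneCochain_lof, m.pont_one (ZMod 2),
        degOneCochain_lof, eps_lof _ one_ne_zero, mul_zero, add_zero]
    · refine H0_induction (ZMod 2)
          (P := fun b => eps (ZMod 2) X (lof2 1 a) * degOneCochain α (fun _ => lof2 0 b) +
          degOneCochain α (fun _ => m.pont (ZMod 2) (lof2 1 a) (lof2 0 b)) +
          degOneCochain α (fun _ => lof2 1 a) * eps (ZMod 2) X (lof2 0 b) =
          crossForm (m.delta α) (lof2 1 a) (lof2 0 b)) (fun x => ?_) (by simp [degOneCochain_apply])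
        (fun a a' h h' => by
          simp only [degOneCochain_apply] at h h' ⊢
          simp only [map_add, ← h, ← h']; ring)
        (fun r a h => by
          simp only [degOneCochain_apply] at h ⊢
          simp only [map_smul, smul_eq_mul, ← h]; ring) b
      change _ + degOneCochain α (fun _ => m.pont _ _ (one _ x)) + _ * eps _ _ (one _ x) =
        crossForm _ _ (one _ x)
      rw [crossForm_one_right, m.delta_inclR, eps_one, mul_one, degOneCochain_lof, m.pont_lof_one (ZMod 2),
        degOneCochain_lof, eps_lof _ one_ne_zero, zero_mul, zero_add, add_comm]
  · have h1 : eps (ZMod 2) X (lof2 p a) * degOneCochain α (fun _ => lof2 q b) = 0 := by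
      by_cases hp : p = 0
      · rw [degOneCochain_lof_of_ne α (by omega), mul_zero]
      · rw [eps_lof _ hp, zero_mul]
    have h2 : degOneCochain α (fun _ => lof2 p a) * eps (ZMod 2) X (lof2 q b) = 0 := by
      by_cases hp : q = 0
      · rw [degOneCochain_lof_of_ne α (by omega), zero_mul]
      · rw [eps_lof _ hp, mul_zero]
    rw [h1, h2, pont_lof, degOneCochain_lof_of_ne α hd, crossForm_eq_zero (Ne.symm hd)]
    simp

theorem crossCochain_add_delta_mem (α : H (ZMod 2) X 1 →ₗ[ZMod 2] ZMod 2) :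
    crossCochain (w + m.delta α) - crossCochain w ∈ m.hochB (ZMod 2) 2 1 := by
  refine ⟨degOneCochain α, ?_, funext fun r => ?_⟩
  · intro d r hd
    rw [Fin.sum_univ_one] at hd
    exact degOneCochain_lof_of_ne α hd (r 0)
  · refine (crossCochain_delta α r).trans ?_
    change _ = crossForm (w + m.delta α) (r 0) (r 1) - crossForm w (r 0) (r 1)
    have e : crossForm (w + m.delta α) = crossForm w + crossForm (m.delta α) := by
      ext p a q b
      simp only [LinearMap.comp_apply, LinearMap.add_apply, crossForm_lof]
    rw [e, LinearMap.add_apply, LinearMap.add_apply, add_sub_cancel_left]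
    rfl

end Cocycle

/-! ### Group completions and degree one classes -/

section Transfer

variable {X Y : Type u} [TopologicalSpace X] [TopologicalSpace Y] {mX : HSpaceStr X}
  {mY : HSpaceStr Y} {f : C(X, Y)} {w : H (ZMod 2) (Y × Y) 1 →ₗ[ZMod 2] ZMod 2}
  {g : H (ZMod 2) X 1 →ₗ[ZMod 2] ZMod 2}

theorem inclL_of_delta (hg : w ∘ₗ hmap (ZMod 2) 1 (f.prodMap f) = mX.delta g) (x : X)
    (r : H (ZMod 2) X 1) : w (hmap (ZMod 2) 1 (inclL (f x)) (hmap (ZMod 2) 1 f r)) =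
      g r + g (hmap (ZMod 2) 1 (mX.trans x) r) := by
  rw [← mX.delta_inclL, ← hg, LinearMap.comp_apply, hmap_comp, hmap_comp]
  rfl

theorem inclR_of_delta (hg : w ∘ₗ hmap (ZMod 2) 1 (f.prodMap f) = mX.delta g) (x : X)
    (r : H (ZMod 2) X 1) : w (hmap (ZMod 2) 1 (inclR (f x)) (hmap (ZMod 2) 1 f r)) =
      g r + g (hmap (ZMod 2) 1 (mX.trans x) r) := by
  rw [← mX.delta_inclR, ← hg, LinearMap.comp_apply, hmap_comp, hmap_comp]
  rfl

theorem hmap_inclL_congr {y y' : Y} (h : Joined y y') (z : H (ZMod 2) Y 1) :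
    hmap (ZMod 2) 1 (inclL y : C(Y, Y × Y)) z = hmap (ZMod 2) 1 (inclL y') z :=
  LinearMap.congr_fun (hmap_congr _ (inclL_homotopic h) 1) z

theorem hmap_inclR_congr {y y' : Y} (h : Joined y y') (z : H (ZMod 2) Y 1) :
    hmap (ZMod 2) 1 (inclR y : C(Y, Y × Y)) z = hmap (ZMod 2) 1 (inclR y') z :=
  LinearMap.congr_fun (hmap_congr _ (inclR_homotopic h) 1) z

/-- For a group completion `f`, a potential `g` of the pullback of `w` extends. -/
theorem IsGroupCompletion.exists_delta_eq (hf : IsGroupCompletion mX mY f) (hw : mY.IsAssoc w)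
    (hg : w ∘ₗ hmap (ZMod 2) 1 (f.prodMap f) = mX.delta g) :
    ∃ α, w = mY.delta α ∧ α ∘ₗ hmap (ZMod 2) 1 f = g := by
  have hgL := inclL_of_delta hg
  have hgR := inclR_of_delta hg
  have hD := hw.third
  have hS := fun x r => hf.isHMap.hmap_trans (ZMod 2) x 1 r
  have hcomm := fun y y' z => mY.hmap_trans_comm (ZMod 2) y y' 1 z
  have hmul := fun y y' z => mY.hmap_trans_mul (ZMod 2) y y' 1 z
  have hDc (y y' z) := congrArg w (hmap_inclL_congr (mY.joined_mul_comm y y') z)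
  have htot := hf.exists_hmap_eq (ZMod 2) 1
  -- Well-definedness of the extension: cross-translating `r` and `r'` gives classes with equal
  -- image in `Y`, which agree in `X` after one more translation. The slice identity then yields
  -- equal values of `g`, and commutativity of translations gives the rest.
  have hwd (z x r x' r') (h : hmap (ZMod 2) 1 (mY.trans (f x)) z = hmap (ZMod 2) 1 f r)
      (h' : hmap (ZMod 2) 1 (mY.trans (f x')) z = hmap (ZMod 2) 1 f r') :
      g r + w (hmap (ZMod 2) 1 (inclL (f x)) z) = g r' + w (hmap (ZMod 2) 1 (inclL (f x')) z) := by
    have h1 : hmap (ZMod 2) 1 f (hmap (ZMod 2) 1 (mX.trans x') r) =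
        hmap (ZMod 2) 1 f (hmap (ZMod 2) 1 (mX.trans x) r') := by
      rw [hS, hS, ← h, ← h', hcomm]
    obtain ⟨x'', h2⟩ := hf.exists_trans_eq_zero (ZMod 2) 1
      (hmap (ZMod 2) 1 (mX.trans x') r - hmap (ZMod 2) 1 (mX.trans x) r')
      (by rw [map_sub, h1, sub_self])
    rw [map_sub, sub_eq_zero] at h2
    have e1 := hgL x'' (hmap (ZMod 2) 1 (mX.trans x') r)
    have e2 := hgL x'' (hmap (ZMod 2) 1 (mX.trans x) r')
    rw [h1, e2, h2] at e1
    have e3 := add_right_cancel e1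
    have e4 := hgL x' r
    have e5 := hgL x r'
    rw [← h] at e4
    rw [← h'] at e5
    have e6 := hDc (f x) (f x') z
    rw [hD, hD] at e6
    rw [e3] at e5
    revert e4 e5 e6
    generalize w (hmap (ZMod 2) 1 (inclL (f x')) _) = a₁
    generalize w (hmap (ZMod 2) 1 (inclL (f x)) _) = a₂
    generalize w (hmap (ZMod 2) 1 (inclL (f x')) _) = a₃
    generalize w (hmap (ZMod 2) 1 (inclL (f x)) _) = a₄
    generalize g r = a₅
    generalize g r' = a₆
    generalize g _ = a₇
    revert a₁ a₂ a₃ a₄ a₅ a₆ a₇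
    decide
  choose x₀ r₀ hxr using htot
  -- The formula is forced: `w = δα` on the slice at `f(x)` says that `α z` is `α` of the translate
  -- plus a value of `w`, and `α` of the translate must be `g r`.
  let α₀ (z : H (ZMod 2) Y 1) : ZMod 2 := g (r₀ z) + w (hmap (ZMod 2) 1 (inclL (f (x₀ z))) z)
  have hα₀ (z x r) (h : hmap (ZMod 2) 1 (mY.trans (f x)) z = hmap (ZMod 2) 1 f r) :
      α₀ z = g r + w (hmap (ZMod 2) 1 (inclL (f x)) z) := hwd z _ _ _ _ (hxr z) h
  -- The product of the two chosen elements of `X` serves as a common denominator.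
  have hadd (z z') : α₀ (z + z') = α₀ z + α₀ z' := by
    have hT (y) : hmap (ZMod 2) 1 (mY.trans (f (mX.mul (x₀ z, x₀ z')))) y =
        hmap (ZMod 2) 1 (mY.trans (f (x₀ z))) (hmap (ZMod 2) 1 (mY.trans (f (x₀ z'))) y) := by
      rw [mY.hmap_trans_congr (ZMod 2) (hf.isHMap.joined _ _), hmul]
    have h1 : hmap (ZMod 2) 1 (mY.trans (f (mX.mul (x₀ z, x₀ z')))) z =
        hmap (ZMod 2) 1 f (hmap (ZMod 2) 1 (mX.trans (x₀ z')) (r₀ z)) := by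
      rw [hT, hcomm, hxr, hS]
    have h2 : hmap (ZMod 2) 1 (mY.trans (f (mX.mul (x₀ z, x₀ z')))) z' =
        hmap (ZMod 2) 1 f (hmap (ZMod 2) 1 (mX.trans (x₀ z)) (r₀ z')) := by
      rw [hT, hxr, hS]
    rw [hα₀ _ _ _ h1, hα₀ _ _ _ h2, hα₀ (z + z') _ _ (by rw [map_add, h1, h2, ← map_add])]
    simp only [map_add]
    ring
  let α : H (ZMod 2) Y 1 →ₗ[ZMod 2] ZMod 2 := (AddMonoidHom.mk' α₀ hadd).toZModLinearMap 2
  have hα (z x r) (h : hmap (ZMod 2) 1 (mY.trans (f x)) z = hmap (ZMod 2) 1 f r) :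
      α z = g r + w (hmap (ZMod 2) 1 (inclL (f x)) z) := hα₀ z x r h
  clear_value α
  have hφ (r) : α (hmap (ZMod 2) 1 f r) = g r := by
    rw [hα _ mX.e (hmap (ZMod 2) 1 (mX.trans mX.e) r) (hS _ _).symm, hgL, add_left_comm,
      zmod_two_add_self, add_zero]
  have hDf (x z) : w (hmap (ZMod 2) 1 (inclL (f x)) z) =
      α z + α (hmap (ZMod 2) 1 (mY.trans (f x)) z) := by
    have e1 := hα z _ _ (hxr z)
    have e2 := hα (hmap (ZMod 2) 1 (mY.trans (f x)) z) (x₀ z)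
      (hmap (ZMod 2) 1 (mX.trans x) (r₀ z)) (by rw [hcomm, hxr, hS])
    have e3 := hgL x (r₀ z)
    rw [← hxr] at e3
    have e4 := hDc (f (x₀ z)) (f x) z
    rw [hD, hD] at e4
    rw [e1, e2]
    revert e3 e4
    generalize w (hmap (ZMod 2) 1 (inclL (f x)) z) = a₁
    generalize w (hmap (ZMod 2) 1 (inclL (f (x₀ z))) z) = a₂
    generalize w _ = a₃
    generalize w _ = a₄
    generalize g _ = a₅
    generalize g _ = a₆
    revert a₁ a₂ a₃ a₄ a₅ a₆
    decide
  -- Multiplied by some `f(x₁)`, the point `y` lies in the path component of a point `f(x₂)`;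
  -- associativity in the third factor then reduces to `hDf`.
  have hDy (y z) : w (hmap (ZMod 2) 1 (inclL y) z) = α z + α (hmap (ZMod 2) 1 (mY.trans y) z) := by
    obtain ⟨x₁, x₂, hj⟩ := hf.exists_joined y
    have e1 := hDf x₁ (hmap (ZMod 2) 1 (mY.trans y) z)
    have e2 := hDf x₂ z
    have e3 := hD (f x₁) y z
    rw [← hmul, mY.hmap_trans_congr (ZMod 2) hj] at e1
    rw [hmap_inclL_congr hj] at e3
    revert e1 e2 e3
    generalize w _ = a₁
    generalize w _ = a₂
    generalize w _ = a₃
    generalize α _ = a₄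
    generalize α _ = a₅
    generalize α _ = a₆
    revert a₁ a₂ a₃ a₄ a₅ a₆
    decide
  -- The difference between the right and left slices is invariant under translation of the class;
  -- this is associativity in the second factor.
  have hinv (y y' z) : w (hmap (ZMod 2) 1 (inclR y') (hmap (ZMod 2) 1 (mY.trans y) z)) +
        w (hmap (ZMod 2) 1 (inclL y') (hmap (ZMod 2) 1 (mY.trans y) z)) =
      w (hmap (ZMod 2) 1 (inclR y') z) + w (hmap (ZMod 2) 1 (inclL y') z) := by
    have e1 := hw.second y y' z
    rw [hDy, hDy] at e1
    rw [hDy, hDy, hcomm]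
    revert e1
    generalize w _ = a₁
    generalize w _ = a₂
    generalize α _ = a₃
    generalize α _ = a₄
    generalize α _ = a₅
    generalize α _ = a₆
    revert a₁ a₂ a₃ a₄ a₅ a₆
    decide
  -- Translate `z` into the image of `f`, where both slices are given by `g` and hence coincide.
  have hEf (x z) : w (hmap (ZMod 2) 1 (inclR (f x)) z) = w (hmap (ZMod 2) 1 (inclL (f x)) z) := by
    have e1 := hinv (f (x₀ z)) (f x) z
    rw [hxr, hgR, hgL, zmod_two_add_self] at e1
    exact zmod_two_add_eq_zero.1 e1.symm
  have hEy (y z) : w (hmap (ZMod 2) 1 (inclR y) z) = w (hmap (ZMod 2) 1 (inclL y) z) := by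
    obtain ⟨x₁, x₂, hj⟩ := hf.exists_joined y
    have e1 := hw.first (f x₁) y z
    have e2 := hD y (f x₁) z
    rw [hmap_inclR_congr hj, hEf, hEf] at e1
    rw [hmap_inclL_congr ((mY.joined_mul_comm _ _).trans hj), e1] at e2
    have e3 := hinv (f x₁) y z
    rw [add_left_cancel e2, zmod_two_add_self] at e3
    exact zmod_two_add_eq_zero.1 e3.symm
  exact ⟨α, mY.eq_delta hDy fun y z => (hEy y z).trans (hDy y z), LinearMap.ext hφ⟩

/-- The condition makes `α` translation invariant, and each class is translated into the image of
`f`, on which `α` vanishes. -/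
theorem IsGroupCompletion.eq_zero_of_delta (hf : IsGroupCompletion mX mY f)
    {α : H (ZMod 2) Y 1 →ₗ[ZMod 2] ZMod 2} (hα : mY.delta α = 0)
    (h0 : α ∘ₗ hmap (ZMod 2) 1 f = 0) : α = 0 := by
  ext z
  obtain ⟨x, r, hr⟩ := hf.exists_hmap_eq (ZMod 2) 1 z
  have h1 := mY.delta_inclL α (f x) z
  have h2 : α (hmap (ZMod 2) 1 f r) = 0 := LinearMap.congr_fun h0 r
  rw [hα, hr, h2, add_zero] at h1
  exact h1.symm

end Transfer

/-! ### Compatible square roots and obstruction classes -/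

section Main

open FrameSys LineBundle

variable {X Y : Type u} [TopologicalSpace X] [TopologicalSpace Y] {mX : HSpaceStr X}
  {mY : HSpaceStr Y} {f : C(X, Y)} {LX : LineBundle.{u, v} (X × X)}
  {LY : LineBundle.{u, v} (Y × Y)} {φX : PhiIso mX LX} {φY : PhiIso mY LY}

theorem mapsTo_compatRoots (hX : HasLPCType X) (hY : HasLPCType Y) (D : MapData φX φY f) :
    Set.MapsTo (SqRoots.pull f (diagIso f D.lam)) (CompatRoots φY) (CompatRoots φX) := by
  intro s hs
  obtain ⟨r, rfl⟩ := exists_cls_eq s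
  obtain ⟨k⟩ : Nonempty (diagBundle LY).Ref := inferInstance
  obtain ⟨l⟩ : Nonempty LY.Ref := inferInstance
  obtain ⟨cY, hcY⟩ := exists_phiCoord φY k l
  obtain ⟨u, hu⟩ := r.exists_isNormal k
  obtain ⟨cX, hcX, hW⟩ := exists_phiCoord_map D hcY
  rw [cls_mem_compatRoots_iff hY hcY hu] at hs
  refine (cls_mem_compatRoots_iff hX hcX (hu.pull f (diagIso f D.lam))).2 ?_
  exact (congrArg (fun G => obsW mX G _ cX) (u.frames_pullback f)).trans
    ((hW _ hu.frames_mul).trans (by rw [hs, LinearMap.zero_comp]))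

/-- The twist by `α` changes the class of the cover by `δα = 0`, so it stays compatible. -/
theorem existsUnique_compat_isTwist (hX : HasCWType X) (φ : PhiIso mX LX)
    {α : H (ZMod 2) X 1 →ₗ[ZMod 2] ZMod 2} (hα : mX.delta α = 0) {s : SqRoots (diagBundle LX)}
    (hs : s ∈ CompatRoots φ) : ∃! s', s' ∈ CompatRoots φ ∧ IsTwist α s s' := by
  obtain ⟨s', hs', huniq⟩ := existsUnique_isTwist hX α s
  refine ⟨s', ⟨?_, hs'⟩, fun t ht => huniq t ht.2⟩
  obtain ⟨r, rfl⟩ := exists_cls_eq s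
  obtain ⟨r', rfl⟩ := exists_cls_eq s'
  obtain ⟨k⟩ : Nonempty (diagBundle LX).Ref := inferInstance
  obtain ⟨l⟩ : Nonempty LX.Ref := inferInstance
  obtain ⟨c, hc⟩ := exists_phiCoord φ k l
  obtain ⟨u, hu⟩ := r.exists_isNormal k
  obtain ⟨u', hu'⟩ := r'.exists_isNormal k
  rw [cls_mem_compatRoots_iff hX.hasLPCType hc hu] at hs
  rw [cls_mem_compatRoots_iff hX.hasLPCType hc hu',
    obsW_change hc.frames_eq hu.frames_mul hu'.frames_mul, hs, ← (isTwist_cls_iff hu hu').1 hs', hα,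
    add_zero]

theorem isObstructionClass_iff {φ : PhiIso mX LX} {o : mX.HP (ZMod 2) 2 1} :
    IsObstructionClass φ o ↔ ∃ (r : SquareRoot (diagBundle LX))
      (w : H (ZMod 2) (X × X) 1 →ₗ[ZMod 2] ZMod 2)
      (h : crossCochain w ∈ mX.hochZ (ZMod 2) 2 1),
      IsW1 (E := ((r.J.pullback .fst).tensor (r.J.pullback .snd)).tensor LX)
        (F := r.J.pullback mX.mul) (SquaresTo φ r) w ∧ o = Submodule.Quotient.mk ⟨_, h⟩ := by
  constructor
  · rintro ⟨r, w, ⟨c, hc⟩, hw, ho, h⟩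
    obtain rfl := eq_crossCochain h
    exact ⟨r, w, hc, hw, ho⟩
  · rintro ⟨r, w, h, hw, ho⟩
    exact ⟨r, w, ⟨_, h⟩, hw, ho, fun p q a b => crossForm_lof p q a b⟩

theorem HSpaceStr.HP_mk_eq {i j : ℕ} (c c' : mX.hochZ (ZMod 2) i j)
    (h : c.1 - c'.1 ∈ mX.hochB (ZMod 2) i j) :
    (Submodule.Quotient.mk c : mX.HP (ZMod 2) i j) = Submodule.Quotient.mk c' := by
  refine (Submodule.Quotient.eq _).2 (Submodule.mem_comap.2 ?_)
  rw [map_sub]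
  exact h

theorem crossCochain_mk_eq {w w' : H (ZMod 2) (X × X) 1 →ₗ[ZMod 2] ZMod 2}
    {α : H (ZMod 2) X 1 →ₗ[ZMod 2] ZMod 2} (e : w' = w + mX.delta α)
    (h : crossCochain w ∈ mX.hochZ (ZMod 2) 2 1) (h' : crossCochain w' ∈ mX.hochZ (ZMod 2) 2 1) :
    (Submodule.Quotient.mk ⟨_, h⟩ : mX.HP (ZMod 2) 2 1) = Submodule.Quotient.mk ⟨_, h'⟩ := by
  subst e
  exact (HSpaceStr.HP_mk_eq ⟨_, h'⟩ ⟨_, h⟩ (crossCochain_add_delta_mem α)).symm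

/-- Two roots give cochains that differ by the Hochschild coboundary of their difference class. -/
theorem isObstructionClass_unique {φ : PhiIso mX LX} {o o' : mX.HP (ZMod 2) 2 1}
    (h : IsObstructionClass φ o) (h' : IsObstructionClass φ o') : o = o' := by
  obtain ⟨r, w, hw, hr, rfl⟩ := isObstructionClass_iff.1 h
  obtain ⟨r', w', hw', hr', rfl⟩ := isObstructionClass_iff.1 h'
  obtain ⟨k⟩ : Nonempty (diagBundle LX).Ref := inferInstance
  obtain ⟨l⟩ : Nonempty LX.Ref := inferInstance
  obtain ⟨c, hc⟩ := exists_phiCoord φ k l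
  obtain ⟨u, hu⟩ := r.exists_isNormal k
  obtain ⟨u', hu'⟩ := r'.exists_isNormal k
  rw [isW1_squaresTo_iff hc hu] at hr
  rw [isW1_squaresTo_iff hc hu', obsW_change hc.frames_eq hu.frames_mul hu'.frames_mul, ← hr] at hr'
  exact crossCochain_mk_eq hr' hw hw'

theorem exists_isObstructionClass {φ : PhiIso mX LX} (D : AssocData φ)
    (r : SquareRoot (diagBundle LX)) : ∃ o, IsObstructionClass φ o := by
  obtain ⟨k⟩ : Nonempty (diagBundle LX).Ref := inferInstance
  obtain ⟨l⟩ : Nonempty LX.Ref := inferInstance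
  obtain ⟨c, hc⟩ := exists_phiCoord φ k l
  obtain ⟨u, hu⟩ := r.exists_isNormal k
  have h : mX.IsAssoc (obsW mX u.frames l.frames c) := D.obsW_assoc hc hu.frames_mul
  exact ⟨_, isObstructionClass_iff.2 ⟨r, _, h.crossCochain_mem, (isW1_squaresTo_iff hc hu).2 rfl, rfl⟩⟩

/-- The pulled-back root has the pulled-back class, and the cross product is natural. -/
theorem IsObstructionClass.map (hf : IsHMap mX mY f) (D : MapData φX φY f)
    {o : mY.HP (ZMod 2) 2 1} (h : IsObstructionClass φY o) :
    IsObstructionClass φX (HPmap (ZMod 2) hf 2 1 o) := by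
  obtain ⟨r, w, c, hw, rfl, hc⟩ := h
  obtain ⟨k⟩ : Nonempty (diagBundle LY).Ref := inferInstance
  obtain ⟨l⟩ : Nonempty LY.Ref := inferInstance
  obtain ⟨cY, hcY⟩ := exists_phiCoord φY k l
  obtain ⟨u, hu⟩ := r.exists_isNormal k
  obtain ⟨cX, hcX, hW⟩ := exists_phiCoord_map D hcY
  rw [isW1_squaresTo_iff hcY hu] at hw
  refine ⟨r.pull f (diagIso f D.lam), w ∘ₗ hmap (ZMod 2) 1 (f.prodMap f), _,
    (isW1_squaresTo_iff hcX (hu.pull f (diagIso f D.lam))).2 ?_, rfl, fun p q a b => ?_⟩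
  · rw [hw]
    exact ((congrArg (fun G => obsW mX G _ cX) (u.frames_pullback f)).trans
      (hW _ hu.frames_mul)).symm
  · refine Eq.trans (congrArg c.1 (funext fun i => ?_)) ((hc p q (hmap (ZMod 2) p f a)
      (hmap (ZMod 2) q f b)).trans ?_)
    · fin_cases i
      · exact hstar_lof (ZMod 2) (f := f) p a
      · exact hstar_lof (ZMod 2) (f := f) q b
    · rw [← hmap_cross]
      rfl

theorem exists_squareRoot (hX : HasCWType X) {K : LineBundle.{u, v} X} (h : IsMod2Chern K 0) :
    Nonempty (SquareRoot K) := by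
  obtain ⟨k⟩ : Nonempty K.Ref := inferInstance
  obtain ⟨G, hG⟩ := exists_root_of_isMod2Chern hX h k
  obtain ⟨r, -⟩ := exists_root k G hG
  exact ⟨r⟩

theorem isMod2Chern_of_squareRoot {K : LineBundle.{u, v} X} (r : SquareRoot K) :
    IsMod2Chern K 0 := by
  obtain ⟨k⟩ : Nonempty K.Ref := inferInstance
  obtain ⟨u, hu⟩ := r.exists_isNormal k
  exact isMod2Chern_of_root hu.frames_mul

/-- A root `G` over `Y` exists by the Chern class argument, but it need be neither compatible nor
pull back to the given root. Its defect pulls back to `δ` of the difference from the given root, and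
the extension `α` of that difference corrects both faults by one twist. -/
theorem exists_compat_pull_eq (hX : HasCWType X) (hY : HasCWType Y) (hf : IsGroupCompletion mX mY f)
    (D : MapData φX φY f) (A : AssocData φY) {s : SqRoots (diagBundle LX)}
    (hs : s ∈ CompatRoots φX) :
    ∃ s' ∈ CompatRoots φY, SqRoots.pull f (diagIso f D.lam) s' = s := by
  obtain ⟨r, rfl⟩ := exists_cls_eq s
  obtain ⟨k⟩ : Nonempty (diagBundle LY).Ref := inferInstance
  obtain ⟨l⟩ : Nonempty LY.Ref := inferInstance
  obtain ⟨cY, hcY⟩ := exists_phiCoord φY k l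
  obtain ⟨cX, hcX, hW⟩ := exists_phiCoord_map D hcY
  obtain ⟨u, hu⟩ := r.exists_isNormal ((k.pullback f).map (diagIso f D.lam))
  have hk : ((k.pullback f).map (diagIso f D.lam)).frames = k.frames.comap f :=
    (Ref.frames_map _ _).trans (Ref.frames_pullback _ _)
  have hu2 : u.frames * u.frames = k.frames.comap f := hu.frames_mul.trans hk
  obtain ⟨G, hG⟩ := hf.exists_root hY hcY.frames_eq ⟨u.frames, hu2⟩
  have hGf : G.comap f * G.comap f = k.frames.comap f := by rw [← comap_mul, hG]
  rw [cls_mem_compatRoots_iff hX.hasLPCType hcX hu, obsW_change hcX.frames_eq (hGf.trans hk.symm)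
    hu.frames_mul, hW G hG] at hs
  have hg : obsW mY G l.frames cY ∘ₗ hmap (ZMod 2) 1 (f.prodMap f) =
      mX.delta (rootW (G.comap f) u.frames) := by
    ext z
    have := LinearMap.congr_fun hs z
    exact zmod_two_add_eq_zero.1 this
  obtain ⟨α, hα, hαf⟩ := hf.exists_delta_eq (A.obsW_assoc hcY hG) hg
  obtain ⟨τ, hτ⟩ := SignTwist.exists_w1_eq hY α
  have hτG : G.twist τ * G.twist τ = k.frames := (twist_mul_self G τ).trans hG
  have hrw : rootW G (G.twist τ) = α := (rootW_twist G τ).trans hτ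
  obtain ⟨r', u', hu', e⟩ := exists_root k (G.twist τ) hτG
  refine ⟨r'.cls, (cls_mem_compatRoots_iff hY.hasLPCType hcY hu').2 ?_, ?_⟩
  · rw [e, obsW_change hcY.frames_eq hG hτG, hrw, hα]
    ext z
    exact zmod_two_add_self _
  · refine cls_eq_of_rootW hX.hasLPCType (hu'.pull f (diagIso f D.lam)) hu ?_
    have h1 : (G.twist τ).comap f * (G.twist τ).comap f = G.comap f * G.comap f := by
      rw [← comap_mul, hτG, hGf]
    have key : rootW ((G.twist τ).comap f) u.frames = 0 := by
      rw [rootW_add h1 (hGf.trans hu2.symm), rootW_swap h1.symm,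
        rootW_comap (hG.trans hτG.symm), hrw, hαf]
      ext z
      exact zmod_two_add_self _
    exact (congrArg (fun F => rootW F u.frames)
      ((u'.frames_pullback f).trans (congrArg (fun F => F.comap f) e))).trans key

/-- The difference class of two compatible roots is killed by `δ`, and by `f^*` when their pullbacks
agree; hence it is zero. -/
theorem injOn_pull (hY : HasCWType Y) (hf : IsGroupCompletion mX mY f)
    (D : MapData φX φY f) :
    Set.InjOn (SqRoots.pull f (diagIso f D.lam)) (CompatRoots φY) := by
  intro s hs s' hs' h
  obtain ⟨r, rfl⟩ := exists_cls_eq s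
  obtain ⟨r', rfl⟩ := exists_cls_eq s'
  obtain ⟨k⟩ : Nonempty (diagBundle LY).Ref := inferInstance
  obtain ⟨l⟩ : Nonempty LY.Ref := inferInstance
  obtain ⟨cY, hcY⟩ := exists_phiCoord φY k l
  obtain ⟨u, hu⟩ := r.exists_isNormal k
  obtain ⟨u', hu'⟩ := r'.exists_isNormal k
  rw [cls_mem_compatRoots_iff hY.hasLPCType hcY hu] at hs
  rw [cls_mem_compatRoots_iff hY.hasLPCType hcY hu',
    obsW_change hcY.frames_eq hu.frames_mul hu'.frames_mul, hs, zero_add] at hs'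
  refine cls_eq_of_rootW hY.hasLPCType hu hu' (hf.eq_zero_of_delta hs' ?_)
  rw [← rootW_comap (hu.frames_mul.trans hu'.frames_mul.symm), ← Ref.frames_pullback,
    ← Ref.frames_pullback]
  exact rootW_of_cls_eq (hu.pull f (diagIso f D.lam)) (hu'.pull f (diagIso f D.lam)) h

end Main

end HochPont

end

/-! ### Assembly of the four statements -/

theorem proposition5p11 {X Y : Type u} [TopologicalSpace X] [TopologicalSpace Y]
    (hX : HasCWType X) (hY : HasCWType Y) (f : C(X, Y)) :
    -- Pullback of square roots is equivariant for the actions of `H^1(Y, ℤ₂)` and `H^1(X, ℤ₂)`.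
    (∀ (KX : LineBundle.{u, v} X) (KY : LineBundle.{u, v} Y) (κ : (KY.pullback f).Iso KX),
      (∀ (α : H (ZMod 2) X 1 →ₗ[ZMod 2] ZMod 2) (s : SqRoots KX), ∃! s', IsTwist α s s') ∧
      (∀ (α : H (ZMod 2) Y 1 →ₗ[ZMod 2] ZMod 2) (s : SqRoots KY), ∃! s', IsTwist α s s') ∧
      ∀ (α : H (ZMod 2) Y 1 →ₗ[ZMod 2] ZMod 2) (s s' : SqRoots KY), IsTwist α s s' →
        IsTwist (α ∘ₗ hmap (ZMod 2) 1 f) (SqRoots.pull f κ s) (SqRoots.pull f κ s')) ∧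
    ∀ (mX : HSpaceStr X) (mY : HSpaceStr Y) (hf : IsHMap mX mY f)
      (LX : LineBundle.{u, v} (X × X)) (LY : LineBundle.{u, v} (Y × Y))
      (φX : PhiIso mX LX) (φY : PhiIso mY LY) (D : MapData φX φY f),
      -- It restricts to compatible square roots, equivariantly for the actions of `HP^{1,1}`.
      (Set.MapsTo (SqRoots.pull f (diagIso f D.lam)) (CompatRoots φY) (CompatRoots φX) ∧
        (∀ (a : mX.HP (ZMod 2) 1 1), ∀ s ∈ CompatRoots φX,
          ∃! s', s' ∈ CompatRoots φX ∧ IsTwist (mX.toH1 (ZMod 2) a) s s') ∧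
        (∀ (a : mY.HP (ZMod 2) 1 1), ∀ s ∈ CompatRoots φY,
          ∃! s', s' ∈ CompatRoots φY ∧ IsTwist (mY.toH1 (ZMod 2) a) s s') ∧
        ∀ (a : mY.HP (ZMod 2) 1 1), ∀ s ∈ CompatRoots φY, ∀ s' ∈ CompatRoots φY,
          IsTwist (mY.toH1 (ZMod 2) a) s s' →
            IsTwist (mX.toH1 (ZMod 2) (HPmap (ZMod 2) hf 1 1 a))
              (SqRoots.pull f (diagIso f D.lam) s) (SqRoots.pull f (diagIso f D.lam) s')) ∧
      -- The obstruction class of `Y` is mapped to that of `X`.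
      (Nonempty (AssocData φX) → Nonempty (AssocData φY) → IsMod2Chern (diagBundle LY) 0 →
        IsMod2Chern (diagBundle LX) 0 ∧ (∃! oX, IsObstructionClass φX oX) ∧
        (∃! oY, IsObstructionClass φY oY) ∧
        ∀ oX oY, IsObstructionClass φX oX → IsObstructionClass φY oY →
          HPmap (ZMod 2) hf 2 1 oY = oX) ∧
      -- For a group completion, pullback of compatible square roots is a bijection.
      (Nonempty (AssocData φX) → Nonempty (AssocData φY) → IsGroupCompletion mX mY f →
        ((CompatRoots φX).Nonempty ↔ (CompatRoots φY).Nonempty) ∧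
        Set.BijOn (SqRoots.pull f (diagIso f D.lam)) (CompatRoots φY) (CompatRoots φX)) := by
  refine ⟨fun KX KY κ => ⟨existsUnique_isTwist hX, existsUnique_isTwist hY, isTwist_pull f κ⟩,
    fun mX mY hf LX LY φX φY D => ⟨⟨mapsTo_compatRoots hX.hasLPCType hY.hasLPCType D,
      fun a s hs => existsUnique_compat_isTwist hX φX (mX.delta_toH1 a) hs,
      fun a s hs => existsUnique_compat_isTwist hY φY (mY.delta_toH1 a) hs,
      fun a s _ s' _ h => ?_⟩, ?_, ?_⟩⟩
  · rw [toH1_HPmap]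
    exact isTwist_pull f _ _ s s' h
  · rintro ⟨AX⟩ ⟨AY⟩ hK
    obtain ⟨r⟩ := exists_squareRoot hY hK
    obtain ⟨oX, hoX⟩ := exists_isObstructionClass AX (r.pull f (diagIso f D.lam))
    obtain ⟨oY, hoY⟩ := exists_isObstructionClass AY r
    exact ⟨isMod2Chern_of_squareRoot (r.pull f (diagIso f D.lam)),
      ⟨oX, hoX, fun _ h => isObstructionClass_unique h hoX⟩,
      ⟨oY, hoY, fun _ h => isObstructionClass_unique h hoY⟩,
      fun _ _ h h' => isObstructionClass_unique (h'.map hf D) h⟩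
  · rintro - ⟨AY⟩ hfc
    have hmaps := mapsTo_compatRoots hX.hasLPCType hY.hasLPCType D
    have hsurj : Set.SurjOn (SqRoots.pull f (diagIso f D.lam)) (CompatRoots φY) (CompatRoots φX) :=
      fun s hs => exists_compat_pull_eq hX hY hfc D AY hs
    exact ⟨⟨fun h => (h.mono hsurj).of_image, fun h => (h.image _).mono hmaps.image_subset⟩,
      hmaps, injOn_pull hY hfc D, hsurj⟩
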